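/- A planar polygon is a nonempty compact region $L\subset\mathbb{R}^2$ that is the closure of its interior and whose boundary is a union of finitely many pairwise disjoint simple closed polygonal curves; it is $n$-connected if it is connected and its boundary has $n$ components. Polygons are in general position: no two vertices have the same height $h(x,y)=y$. The Reeb graph of $L$ is the quotient of $L$ obtained by shrinking each fiber (connected component of a level set of $h$) to a point; its vertices are the images of the vertices of $L$, its edges are the components of the complement of the vertices, oriented by increasing height. A vertex of degree two is called left if the horizontal ray going to the right from the corresponding vertex of $L$ lies in $L$ near that vertex, and right otherwise. The Reeb graph of $L$ is optimal if no Reeb graph of a planar polygon in general position is homotopy equivalent to it and has fewer vertices. Theorem 3. The polygons in general position that are two-connected and have an optimal Reeb graph are exactly the triangles $ABC$ with one triangular hole $DEF$ (named by decreasing height). Up to isomorphism of oriented graphs there are exactly $4$ optimal Reeb graphs of two-connected polygons. Moreover, if left and right vertices of degree two are distinguished, and graphs are identified when they are isomorphic after possibly reversing all edges and/or exchanging left and right (reflections of the polygon in a horizontal or a vertical line), there are again exactly $4$ classes. These classes are given by the following cases: each class contains the marked graph of a triangle $ABC$ with hole $DEF$ such that $B$ is on the right of $AC$ and exactly $k\in\{2,3\}$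 of the vertices $D,E,F$ lie below $B$; each of the four combinations of $k\in\{2,3\}$ with $DEF$ left or right (that is, $E$ to the left or to the right of $DF$) occurs; and two such marked graphs are in the same class if and only if they have the same $k$ and $DEF$ is on the same side in both. -/

import Mathlib

open scoped Topology

/-! ### Oriented graphs -/

/-- A finite or infinite oriented graph (parallel edges allowed):
`Edge u v` is the type of edges going from `u` to `v`. -/
structure OrientedGraph where
  V : Type
  Edge : V → V → Type

namespace OrientedGraph

/-- Isomorphism of oriented graphs. -/
def Iso (G H : OrientedGraph) : Prop :=
  ∃ σ : G.V ≃ H.V, ∀ u v, Nonempty (G.Edge u v ≃ H.Edge (σ u) (σ v))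

theorem Iso.refl (G : OrientedGraph) : G.Iso G :=
  ⟨Equiv.refl _, fun _ _ => ⟨Equiv.refl _⟩⟩

theorem Iso.symm {G H : OrientedGraph} (h : G.Iso H) : H.Iso G := by
  obtain ⟨σ, hσ⟩ := h
  refine ⟨σ.symm, fun u v => ?_⟩
  obtain ⟨e⟩ := hσ (σ.symm u) (σ.symm v)
  rw [σ.apply_symm_apply, σ.apply_symm_apply] at e
  exact ⟨e.symm⟩

theorem Iso.trans {G H K : OrientedGraph} (h : G.Iso H) (h' : H.Iso K) : G.Iso K := by
  obtain ⟨σ, hσ⟩ := h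
  obtain ⟨τ, hτ⟩ := h'
  refine ⟨σ.trans τ, fun u v => ?_⟩
  obtain ⟨e⟩ := hσ u v
  obtain ⟨f⟩ := hτ (σ u) (σ v)
  exact ⟨e.trans f⟩

/-- Isomorphism as an equivalence relation. -/
def isoSetoid : Setoid OrientedGraph where
  r := Iso
  iseqv := ⟨Iso.refl, Iso.symm, Iso.trans⟩

/-- The number of edges, incoming and outgoing, at a vertex. -/
noncomputable def degree (G : OrientedGraph) (v : G.V) : ℕ :=
  Nat.card (Σ u, G.Edge u v) + Nat.card (Σ u, G.Edge v u)

theorem degree_eq {G H : OrientedGraph} (σ : G.V ≃ H.V)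
    (hσ : ∀ u v, Nonempty (G.Edge u v ≃ H.Edge (σ u) (σ v))) (v : G.V) :
    H.degree (σ v) = G.degree v := by
  have h1 : Nat.card (Σ u, G.Edge u v) = Nat.card (Σ u, H.Edge u (σ v)) :=
    Nat.card_congr (Equiv.sigmaCongr σ fun u => (hσ u v).some)
  have h2 : Nat.card (Σ u, G.Edge v u) = Nat.card (Σ u, H.Edge (σ v) u) :=
    Nat.card_congr (Equiv.sigmaCongr σ fun u => (hσ v u).some)
  simp only [degree, h1, h2]

end OrientedGraph

/-- An oriented graph whose vertices of degree two are divided into left and right ones.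
The value of `isLeft` at vertices of another degree plays no role. -/
structure MarkedGraph extends OrientedGraph where
  isLeft : V → Prop

namespace MarkedGraph

/-- Isomorphism of oriented graphs that respects the left and right marks. -/
def Iso (G H : MarkedGraph) : Prop :=
  ∃ σ : G.V ≃ H.V, (∀ u v, Nonempty (G.Edge u v ≃ H.Edge (σ u) (σ v))) ∧
    ∀ v, G.degree v = 2 → (G.isLeft v ↔ H.isLeft (σ v))

/-- Reverse all edges (the effect of reflecting a polygon in a horizontal line). -/
def reverse (G : MarkedGraph) : MarkedGraph where
  V := G.V
  Edge u v := G.Edge v u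
  isLeft := G.isLeft

/-- Exchange left and right (the effect of reflecting a polygon in a vertical line). -/
def mirror (G : MarkedGraph) : MarkedGraph where
  V := G.V
  Edge := G.Edge
  isLeft v := ¬ G.isLeft v

/-- Isomorphism of marked graphs up to the two reflections. -/
def Similar (G H : MarkedGraph) : Prop :=
  G.Iso H ∨ G.reverse.Iso H ∨ G.mirror.Iso H ∨ G.reverse.mirror.Iso H

theorem Iso.refl (G : MarkedGraph) : G.Iso G :=
  ⟨Equiv.refl _, fun _ _ => ⟨Equiv.refl _⟩, fun _ _ => Iff.rfl⟩

theorem Iso.symm {G H : MarkedGraph} (h : G.Iso H) : H.Iso G := by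
  obtain ⟨σ, hσ, hm⟩ := h
  refine ⟨σ.symm, fun u v => ?_, fun v hv => ?_⟩
  · obtain ⟨e⟩ := hσ (σ.symm u) (σ.symm v)
    rw [σ.apply_symm_apply, σ.apply_symm_apply] at e
    exact ⟨e.symm⟩
  · have h1 := OrientedGraph.degree_eq σ hσ (σ.symm v)
    rw [σ.apply_symm_apply] at h1
    have h2 := hm (σ.symm v) (h1 ▸ hv)
    rw [σ.apply_symm_apply] at h2
    exact h2.symm

theorem Iso.trans {G H K : MarkedGraph} (h : G.Iso H) (h' : H.Iso K) : G.Iso K := by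
  obtain ⟨σ, hσ, hm⟩ := h
  obtain ⟨τ, hτ, hm'⟩ := h'
  refine ⟨σ.trans τ, fun u v => ?_, fun v hv => ?_⟩
  · obtain ⟨e⟩ := hσ u v
    obtain ⟨f⟩ := hτ (σ u) (σ v)
    exact ⟨e.trans f⟩
  · exact (hm v hv).trans (hm' (σ v) ((OrientedGraph.degree_eq σ hσ v).trans hv))

theorem degree_reverse (G : MarkedGraph) (v : G.V) : G.reverse.degree v = G.degree v :=
  Nat.add_comm _ _

theorem Iso.reverse {G H : MarkedGraph} (h : G.Iso H) : G.reverse.Iso H.reverse := by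
  obtain ⟨σ, hσ, hm⟩ := h
  exact ⟨σ, fun u v => hσ v u, fun v hv => hm v ((degree_reverse G v).symm.trans hv)⟩

theorem Iso.mirror {G H : MarkedGraph} (h : G.Iso H) : G.mirror.Iso H.mirror := by
  obtain ⟨σ, hσ, hm⟩ := h
  exact ⟨σ, hσ, fun v hv => not_congr (hm v hv)⟩

theorem mirror_mirror (G : MarkedGraph) : G.mirror.mirror = G := by
  simp [MarkedGraph.mirror, not_not]

theorem reverse_reverse (G : MarkedGraph) : G.reverse.reverse = G := rfl

theorem reverse_mirror (G : MarkedGraph) : G.mirror.reverse = G.reverse.mirror := rfl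

theorem Similar.symm {G H : MarkedGraph} (h : G.Similar H) : H.Similar G := by
  rcases h with h | h | h | h
  · exact Or.inl h.symm
  · exact Or.inr (Or.inl h.reverse.symm)
  · refine Or.inr (Or.inr (Or.inl ?_))
    have := h.mirror.symm
    rwa [mirror_mirror] at this
  · refine Or.inr (Or.inr (Or.inr ?_))
    have := h.mirror.reverse.symm
    rwa [mirror_mirror, reverse_reverse, reverse_mirror] at this

theorem Similar.trans {G H K : MarkedGraph} (h : G.Similar H) (h' : H.Similar K) :
    G.Similar K := by
  rcases h' with h' | h' | h' | h'
  · rcases h with h | h | h | h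
    · exact Or.inl (h.trans h')
    · exact Or.inr (Or.inl (h.trans h'))
    · exact Or.inr (Or.inr (Or.inl (h.trans h')))
    · exact Or.inr (Or.inr (Or.inr (h.trans h')))
  · rcases h with h | h | h | h
    · exact Or.inr (Or.inl (h.reverse.trans h'))
    · exact Or.inl (h.reverse.trans h')
    · exact Or.inr (Or.inr (Or.inr (h.reverse.trans h')))
    · exact Or.inr (Or.inr (Or.inl (h.reverse.trans h')))
  · have key : ∀ {X : MarkedGraph}, X.Iso H → X.mirror.Iso K := fun hX => hX.mirror.trans h'
    rcases h with h | h | h | h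
    · exact Or.inr (Or.inr (Or.inl (key h)))
    · exact Or.inr (Or.inr (Or.inr (key h)))
    · have := key h
      rw [mirror_mirror] at this
      exact Or.inl this
    · have := key h
      rw [mirror_mirror] at this
      exact Or.inr (Or.inl this)
  · have key : ∀ {X : MarkedGraph}, X.Iso H → X.reverse.mirror.Iso K :=
      fun hX => hX.reverse.mirror.trans h'
    rcases h with h | h | h | h
    · exact Or.inr (Or.inr (Or.inr (key h)))
    · exact Or.inr (Or.inr (Or.inl (key h)))
    · have := key h
      rw [reverse_mirror, mirror_mirror] at this
      exact Or.inr (Or.inl this)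
    · have := key h
      rw [reverse_mirror, mirror_mirror] at this
      exact Or.inl this

/-- Similarity as an equivalence relation. -/
def similarSetoid : Setoid MarkedGraph where
  r := Similar
  iseqv := ⟨fun G => Or.inl (Iso.refl G), Similar.symm, Similar.trans⟩

end MarkedGraph

/-! ### Planar polygons and their Reeb graphs -/

/-- A planar polygon, possibly with holes, in general position with respect to the height
function `(x, y) ↦ y`: a nonempty compact region `carrier`, equal to the closure of its interior,
whose boundary is the union of finitely many pairwise disjoint simple closed polygonal curves.
The vertices of these curves form the set `vertices`; `next` sends a vertex to the
following one along its curve, so the boundary edges are the segments from `v` to `next v`, and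
the boundary curves are the cycles of `next`. -/
structure PlanarPolygon where
  carrier : Set (ℝ × ℝ)
  vertices : Finset (ℝ × ℝ)
  next : Equiv.Perm vertices
  nonempty : carrier.Nonempty
  isCompact : IsCompact carrier
  closure_interior : closure (interior carrier) = carrier
  frontier_eq : frontier carrier =
    ⋃ v : vertices, segment ℝ (v : ℝ × ℝ) (next v : ℝ × ℝ)
  next_ne : ∀ v, next v ≠ v
  /-- two different edges meet at most in a common end point -/
  edge_inter : ∀ v w : vertices, v ≠ w →
    segment ℝ (v : ℝ × ℝ) (next v : ℝ × ℝ) ∩ segment ℝ (w : ℝ × ℝ) (next w : ℝ × ℝ) ⊆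
      ({(v : ℝ × ℝ), (next v : ℝ × ℝ)} : Set (ℝ × ℝ)) ∩ {(w : ℝ × ℝ), (next w : ℝ × ℝ)}
  /-- general position: different vertices have different heights -/
  height_injOn : ∀ v ∈ vertices, ∀ w ∈ vertices, v.2 = w.2 → v = w

namespace PlanarPolygon

/-- The polygon is `n`-connected: it is connected and its boundary has `n` components. -/
def IsNConnected (P : PlanarPolygon) (n : ℕ) : Prop :=
  IsConnected P.carrier ∧ Nat.card (ConnectedComponents (frontier P.carrier)) = n

/-- The fiber through a point: its connected component in the level set of the height function. -/
def fiber (P : PlanarPolygon) (x : P.carrier) : Set (ℝ × ℝ) :=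
  connectedComponentIn {z | z ∈ P.carrier ∧ z.2 = x.1.2} x.1

theorem mem_fiber (P : PlanarPolygon) (x : P.carrier) : x.1 ∈ P.fiber x :=
  mem_connectedComponentIn ⟨x.2, rfl⟩

theorem height_eq_of_fiber_eq (P : PlanarPolygon) {x y : P.carrier}
    (h : P.fiber x = P.fiber y) : x.1.2 = y.1.2 := by
  have hx : x.1 ∈ P.fiber y := h ▸ P.mem_fiber x
  exact (connectedComponentIn_subset _ _ hx).2

/-- Two points are identified when they belong to one fiber. -/
def fiberSetoid (P : PlanarPolygon) : Setoid P.carrier := Setoid.ker P.fiber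

/-- The underlying space of the Reeb graph: the polygon with every fiber shrunk to a point. -/
def ReebSpace (P : PlanarPolygon) : Type := Quotient P.fiberSetoid

instance (P : PlanarPolygon) : TopologicalSpace P.ReebSpace :=
  inferInstanceAs (TopologicalSpace (Quotient P.fiberSetoid))

/-- The quotient map onto the Reeb graph. -/
def toReeb (P : PlanarPolygon) (x : P.carrier) : P.ReebSpace := Quotient.mk P.fiberSetoid x

/-- The height function on the Reeb graph. -/
def reebHeight (P : PlanarPolygon) : P.ReebSpace → ℝ :=
  Quotient.lift (fun x : P.carrier => x.1.2) fun _ _ h => P.height_eq_of_fiber_eq h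

/-- The vertices of the Reeb graph: the images of the vertices of the polygon. -/
def reebVertices (P : PlanarPolygon) : Set P.ReebSpace :=
  {q | ∃ x : P.carrier, x.1 ∈ P.vertices ∧ P.toReeb x = q}

/-- The (open) edges of the Reeb graph: the connected components of the complement of the
vertices. They correspond to the trapezoids of the trapezoidal map. -/
def IsReebEdge (P : PlanarPolygon) (e : Set P.ReebSpace) : Prop :=
  ∃ q ∈ (P.reebVertices)ᶜ, e = connectedComponentIn (P.reebVertices)ᶜ q

/-- The Reeb graph, oriented by increasing height: an edge goes from the end point below it
to the end point above it. -/
def reebGraph (P : PlanarPolygon) : OrientedGraph where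
  V := P.reebVertices
  Edge u v := {e : Set P.ReebSpace // P.IsReebEdge e ∧
    (u.1 ∈ closure e ∧ ∀ q ∈ e, P.reebHeight u.1 < P.reebHeight q) ∧
    (v.1 ∈ closure e ∧ ∀ q ∈ e, P.reebHeight q < P.reebHeight v.1)}

/-- The Reeb graph with its vertices of degree two divided into left and right ones: a vertex is
left if, near the vertex, the horizontal ray going to the right lies in the polygon. -/
def markedReebGraph (P : PlanarPolygon) : MarkedGraph where
  toOrientedGraph := P.reebGraph
  isLeft u := ∃ x : P.carrier, x.1 ∈ P.vertices ∧ P.toReeb x = u.1 ∧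
    ∀ᶠ t in 𝓝[>] (0 : ℝ), (x.1.1 + t, x.1.2) ∈ P.carrier

/-- The Reeb graph of `P` is optimal: no Reeb graph of a polygon that is homotopy equivalent
to it has fewer vertices. -/
def IsOptimal (P : PlanarPolygon) : Prop :=
  ¬ ∃ Q : PlanarPolygon, Nonempty (ContinuousMap.HomotopyEquiv P.ReebSpace Q.ReebSpace) ∧
    Nat.card Q.reebGraph.V < Nat.card P.reebGraph.V

/-- `P` is the triangle `ABC` with the triangular hole `DEF`, each triangle named
from its highest to its lowest vertex. -/
def IsTriangleWithHole (P : PlanarPolygon) (A B C D E F : ℝ × ℝ) : Prop :=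
  (P.vertices : Set (ℝ × ℝ)) = {A, B, C, D, E, F} ∧
  (B.2 < A.2 ∧ C.2 < B.2) ∧ (E.2 < D.2 ∧ F.2 < E.2) ∧
  convexHull ℝ {D, E, F} ⊆ interior (convexHull ℝ {A, B, C}) ∧
  P.carrier = convexHull ℝ {A, B, C} \ interior (convexHull ℝ {D, E, F})

end PlanarPolygon

/-- In a triangle with highest vertex `A`, middle vertex `B` and lowest vertex `C`, the middle
vertex lies to the right of the side `AC`, that is, the triangle is right. -/
def MiddleOnRight (A B C : ℝ × ℝ) : Prop :=
  (A.1 - C.1) * (B.2 - C.2) < (B.1 - C.1) * (A.2 - C.2)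

namespace PlanarPolygon

/-- `P` is a triangle with a triangular hole whose outer middle vertex is on the right, with
exactly `k` vertices of the inner triangle below the outer middle vertex, and with the inner
triangle right or left according as `right` is true or false. -/
def HasCase (P : PlanarPolygon) (k : ℕ) (right : Bool) : Prop :=
  ∃ A B C D E F : ℝ × ℝ, P.IsTriangleWithHole A B C D E F ∧ MiddleOnRight A B C ∧
    {X : ℝ × ℝ | X ∈ ({D, E, F} : Set (ℝ × ℝ)) ∧ X.2 < B.2}.ncard = k ∧
    (right = true ↔ MiddleOnRight D E F)

end PlanarPolygon

/-! The vertices of a polygon have different heights, so they correspond bijectively to the vertices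
of its Reeb graph, and optimality is a minimality statement about the number of vertices of the
polygon. The Reeb space of a connected polygon is contractible if there is one boundary curve
(`contractibleSpace_of_sameCycle`) and homotopy equivalent to a circle if there are two
(`homotopyEquiv_circle`). Since the circle is not contractible, a polygon whose Reeb space is
homotopy equivalent to that of a two-connected one has at least two boundary curves. Each curve has
at least three vertices, so six is a lower bound, and triangles with a triangular hole attain it.
Conversely, six vertices on two curves mean two triangles with disjoint boundaries; if they were not
nested, the polygon would fall apart (`isTriangleWithHole_of_card`).

The homotopy type is found by counting flows. Cut the Reeb space at all vertex heights. The pieces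
are arcs, one for every slab between consecutive vertex heights and every edge that bounds the
polygon on the left in this slab. In a connected graph the rational flows form a space of dimension
(arcs) - (nodes) + 1 (`finrank_flows`). Every flow has a potential, defined on the boundary edges:
the total flow through the arcs on the left of the edge. The conservation law makes the potential
constant along each boundary curve (`potential_next`), and the flow is the difference of the
potential across a trapezoid (`flow_eq_potential`). Hence with one curve there is no flow except
zero, and the graph is a tree; with two curves all flows are multiples of one flow, which is not
zero because the polygon is connected (`eq_of_facing`), and the graph has exactly one cycle.
Removing leaves then leaves a point or a circle.

For the classification, a region with one hole has a Reeb space made of four arcs parametrized by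
height: below, on the left, on the right of and above the hole. The six vertices lie on these arcs,
and two of them are joined by one edge for every arc on which they are consecutive
(`ArcSystem.nonempty_edgeEquiv`). So the marked graph depends only on the position `k` of the outer
middle vertex among the heights of the hole and on the sides `b`, `e` of the two middle vertices
(`IsTriangleWithHole.model_iso`). What remains concerns finitely many models: symmetries reduce them
to four in the oriented and in the marked setting, and simple invariants (an edge parallel to a path
of two edges, two such paths with common ends, a source next to a branching vertex, all marks on one
side) tell these apart. -/

section Development

open Set Filter

/-! ### Segments as graphs over the height -/

/-- The abscissa, at height `y`, of the line through `p` and `q`. -/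
noncomputable def lineX (p q : ℝ × ℝ) (y : ℝ) : ℝ :=
  p.1 + (y - p.2) * ((q.1 - p.1) / (q.2 - p.2))

theorem lineX_left (p q : ℝ × ℝ) : lineX p q p.2 = p.1 := by simp [lineX]

theorem lineX_right {p q : ℝ × ℝ} (h : p.2 ≠ q.2) : lineX p q q.2 = q.1 := by
  have : q.2 - p.2 ≠ 0 := sub_ne_zero.2 h.symm
  simp only [lineX]; field_simp; ring

theorem continuous_lineX (p q : ℝ × ℝ) : Continuous (lineX p q) := by
  unfold lineX; fun_prop

theorem lineX_convex (p q : ℝ × ℝ) {a b : ℝ} (hab : a + b = 1) (y z : ℝ) :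
    lineX p q (a * y + b * z) = a * lineX p q y + b * lineX p q z := by
  simp only [lineX]
  linear_combination (-p.1 + p.2 * ((q.1 - p.1) / (q.2 - p.2))) * hab

/-- In general position no boundary edge is horizontal, so every edge is the graph of an affine
function of the height. This description replaces segments from here on. -/
theorem mem_segment_iff_lineX {p q : ℝ × ℝ} (h : p.2 ≠ q.2) (z : ℝ × ℝ) :
    z ∈ segment ℝ p q ↔ (min p.2 q.2 ≤ z.2 ∧ z.2 ≤ max p.2 q.2) ∧ z.1 = lineX p q z.2 := by
  have h0 : q.2 - p.2 ≠ 0 := sub_ne_zero.2 h.symm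
  constructor
  · rintro ⟨a, b, ha, hb, hab, rfl⟩
    have hz : (a • p + b • q).2 = a * p.2 + b * q.2 := by simp
    have hz1 : (a • p + b • q).1 = a * p.1 + b * q.1 := by simp
    rw [hz, hz1, lineX_convex _ _ hab, lineX_left, lineX_right h]
    refine ⟨⟨?_, ?_⟩, rfl⟩
    · have h1 := mul_le_mul_of_nonneg_left (min_le_left p.2 q.2) ha
      have h2 := mul_le_mul_of_nonneg_left (min_le_right p.2 q.2) hb
      have h3 : a * min p.2 q.2 + b * min p.2 q.2 = min p.2 q.2 := by rw [← add_mul, hab, one_mul]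
      linarith
    · have h1 := mul_le_mul_of_nonneg_left (le_max_left p.2 q.2) ha
      have h2 := mul_le_mul_of_nonneg_left (le_max_right p.2 q.2) hb
      have h3 : a * max p.2 q.2 + b * max p.2 q.2 = max p.2 q.2 := by rw [← add_mul, hab, one_mul]
      linarith
  · rintro ⟨⟨h1, h2⟩, h3⟩
    rw [segment_eq_image]
    have ht : 0 ≤ (z.2 - p.2) / (q.2 - p.2) ∧ (z.2 - p.2) / (q.2 - p.2) ≤ 1 := by
      rcases lt_or_gt_of_ne h with hlt | hlt
      · rw [min_eq_left hlt.le] at h1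
        rw [max_eq_right hlt.le] at h2
        exact ⟨div_nonneg (by linarith) (by linarith), (div_le_one (by linarith)).2 (by linarith)⟩
      · rw [min_eq_right hlt.le] at h1
        rw [max_eq_left hlt.le] at h2
        exact ⟨div_nonneg_of_nonpos (by linarith) (by linarith),
          (div_le_one_of_neg (by linarith)).2 (by linarith)⟩
    refine ⟨_, ht, ?_⟩
    have h4 : (z.2 - p.2) / (q.2 - p.2) * (q.2 - p.2) = z.2 - p.2 := div_mul_cancel₀ _ h0
    ext
    · simp only [Prod.fst_add, Prod.smul_fst, smul_eq_mul, h3, lineX]; ring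
    · simp only [Prod.snd_add, Prod.smul_snd, smul_eq_mul]; linear_combination h4

theorem mem_segment_horizontal {p q : ℝ × ℝ} (h : p.2 = q.2) (hle : p.1 ≤ q.1) (z : ℝ × ℝ) :
    z ∈ segment ℝ p q ↔ z.2 = p.2 ∧ p.1 ≤ z.1 ∧ z.1 ≤ q.1 := by
  obtain ⟨a, b⟩ := p
  obtain ⟨c, d⟩ := q
  obtain ⟨x, y⟩ := z
  dsimp only at h hle ⊢
  subst h
  rw [← Prod.image_mk_segment_left, segment_eq_Icc hle]
  simp only [mem_image, mem_Icc, Prod.mk.injEq]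
  constructor
  · rintro ⟨w, hw, rfl, rfl⟩; exact ⟨rfl, hw⟩
  · rintro ⟨rfl, hw⟩; exact ⟨x, hw, rfl, rfl⟩

namespace PlanarPolygon

variable (P : PlanarPolygon)

/-! ### Boundary edges -/

/-- The boundary edge from `v` to the following vertex. -/
def edge (v : P.vertices) : Set (ℝ × ℝ) := segment ℝ (v : ℝ × ℝ) (P.next v : ℝ × ℝ)

/-- The smallest height of a boundary edge. -/
noncomputable def lo (v : P.vertices) : ℝ := min (v : ℝ × ℝ).2 (P.next v : ℝ × ℝ).2

/-- The largest height of a boundary edge. -/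
noncomputable def hi (v : P.vertices) : ℝ := max (v : ℝ × ℝ).2 (P.next v : ℝ × ℝ).2

/-- The abscissa of a boundary edge at a given height. -/
noncomputable def xAt (v : P.vertices) : ℝ → ℝ := lineX (v : ℝ × ℝ) (P.next v : ℝ × ℝ)

theorem vertex_ext {v w : P.vertices} (h : (v : ℝ × ℝ).2 = (w : ℝ × ℝ).2) : v = w :=
  Subtype.ext (P.height_injOn v v.2 w w.2 h)

theorem height_next_ne (v : P.vertices) : (v : ℝ × ℝ).2 ≠ (P.next v : ℝ × ℝ).2 :=
  fun h => P.next_ne v (P.vertex_ext h).symm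

theorem lo_lt_hi (v : P.vertices) : P.lo v < P.hi v := min_lt_max.2 (P.height_next_ne v)

theorem mem_edge {v : P.vertices} {z : ℝ × ℝ} :
    z ∈ P.edge v ↔ (P.lo v ≤ z.2 ∧ z.2 ≤ P.hi v) ∧ z.1 = P.xAt v z.2 :=
  mem_segment_iff_lineX (P.height_next_ne v) z

theorem xAt_mem_edge {v : P.vertices} {y : ℝ} (h1 : P.lo v ≤ y) (h2 : y ≤ P.hi v) :
    (P.xAt v y, y) ∈ P.edge v := P.mem_edge.2 ⟨⟨h1, h2⟩, rfl⟩

theorem continuous_xAt (v : P.vertices) : Continuous (P.xAt v) := continuous_lineX _ _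

theorem isClosed_edge (v : P.vertices) : IsClosed (P.edge v) := by
  have h : P.edge v = {z | P.lo v ≤ z.2} ∩ {z | z.2 ≤ P.hi v} ∩ {z | z.1 = P.xAt v z.2} := by
    ext z; exact P.mem_edge
  rw [h]
  have := P.continuous_xAt v
  exact ((isClosed_le continuous_const continuous_snd).inter
    (isClosed_le continuous_snd continuous_const)).inter
    (isClosed_eq continuous_fst (this.comp continuous_snd))

theorem frontier_eq_iUnion : frontier P.carrier = ⋃ v, P.edge v := P.frontier_eq

theorem mem_frontier {z : ℝ × ℝ} : z ∈ frontier P.carrier ↔ ∃ v, z ∈ P.edge v := by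
  rw [frontier_eq_iUnion]; exact mem_iUnion

theorem isClosed_carrier : IsClosed P.carrier := P.isCompact.isClosed

theorem frontier_subset : frontier P.carrier ⊆ P.carrier := P.isClosed_carrier.frontier_subset

theorem edge_subset_frontier (v : P.vertices) : P.edge v ⊆ frontier P.carrier :=
  fun _ h => P.mem_frontier.2 ⟨v, h⟩

theorem edge_subset (v : P.vertices) : P.edge v ⊆ P.carrier :=
  (P.edge_subset_frontier v).trans P.frontier_subset

theorem vertex_mem_edge (v : P.vertices) : (v : ℝ × ℝ) ∈ P.edge v := left_mem_segment _ _ _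

theorem next_mem_edge (v : P.vertices) : (P.next v : ℝ × ℝ) ∈ P.edge v := right_mem_segment _ _ _

theorem vertex_mem_carrier (v : P.vertices) : (v : ℝ × ℝ) ∈ P.carrier :=
  P.edge_subset v (P.vertex_mem_edge v)

theorem eq_or_of_vertex_mem_edge {u e : P.vertices} (h : (u : ℝ × ℝ) ∈ P.edge e) :
    u = e ∨ u = P.next e := by
  by_cases hue : e = u
  · exact Or.inl hue.symm
  · have := (P.edge_inter e u hue ⟨h, P.vertex_mem_edge u⟩).1
    rcases this with h | h
    exacts [Or.inl (Subtype.ext h), Or.inr (Subtype.ext h)]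

theorem exists_vertex_of_mem_edges {e f : P.vertices} (hef : e ≠ f) {z : ℝ × ℝ}
    (he : z ∈ P.edge e) (hf : z ∈ P.edge f) : ∃ u : P.vertices, z = u := by
  have := (P.edge_inter e f hef ⟨he, hf⟩).1
  rcases this with h | h
  · exact ⟨e, h⟩
  · exact ⟨_, h⟩

theorem height_of_vertex_mem_edge {u e : P.vertices} (h : (u : ℝ × ℝ) ∈ P.edge e) :
    (u : ℝ × ℝ).2 = P.lo e ∨ (u : ℝ × ℝ).2 = P.hi e := by
  have h1 : (e : ℝ × ℝ).2 = P.lo e ∨ (e : ℝ × ℝ).2 = P.hi e := by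
    unfold lo hi; grind
  have h2 : (P.next e : ℝ × ℝ).2 = P.lo e ∨ (P.next e : ℝ × ℝ).2 = P.hi e := by
    unfold lo hi; grind
  rcases P.eq_or_of_vertex_mem_edge h with rfl | rfl
  exacts [h1, h2]

theorem exists_lo (e : P.vertices) : ∃ u : P.vertices,
    (u : ℝ × ℝ) = (P.xAt e (P.lo e), P.lo e) := by
  rcases min_choice (e : ℝ × ℝ).2 (P.next e : ℝ × ℝ).2 with h | h
  · refine ⟨e, ?_⟩
    unfold xAt lo
    rw [h, lineX_left]
  · refine ⟨P.next e, ?_⟩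
    unfold xAt lo
    rw [h, lineX_right (P.height_next_ne e)]

theorem exists_hi (e : P.vertices) : ∃ u : P.vertices,
    (u : ℝ × ℝ) = (P.xAt e (P.hi e), P.hi e) := by
  rcases max_choice (e : ℝ × ℝ).2 (P.next e : ℝ × ℝ).2 with h | h
  · refine ⟨e, ?_⟩
    unfold xAt hi
    rw [h, lineX_left]
  · refine ⟨P.next e, ?_⟩
    unfold xAt hi
    rw [h, lineX_right (P.height_next_ne e)]

/-- Two different edges have different abscissas at a height where the first one has no end. -/
theorem xAt_ne {e f : P.vertices} (hef : e ≠ f) {y : ℝ} (he1 : P.lo e < y) (he2 : y < P.hi e)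
    (hf1 : P.lo f ≤ y) (hf2 : y ≤ P.hi f) : P.xAt e y ≠ P.xAt f y := by
  intro h
  have h1 := P.xAt_mem_edge he1.le he2.le
  have h2 := P.xAt_mem_edge hf1 hf2
  rw [← h] at h2
  obtain ⟨u, hu⟩ := P.exists_vertex_of_mem_edges hef h1 h2
  rw [hu] at h1
  have hy : y = (u : ℝ × ℝ).2 := congrArg Prod.snd hu
  rcases P.height_of_vertex_mem_edge h1 with h | h <;> linarith

theorem prev_ne (v : P.vertices) : P.next.symm v ≠ v := by
  intro h
  have := P.next_ne v
  rw [Equiv.symm_apply_eq] at h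
  exact this h.symm

theorem mem_edge_iff_vertex {u e : P.vertices} :
    (u : ℝ × ℝ) ∈ P.edge e ↔ e = u ∨ e = P.next.symm u := by
  constructor
  · intro h
    rcases P.eq_or_of_vertex_mem_edge h with h | h
    · exact Or.inl h.symm
    · right; rw [h, Equiv.symm_apply_apply]
  · rintro (rfl | rfl)
    · exact P.vertex_mem_edge _
    · have := P.next_mem_edge (P.next.symm u)
      rwa [Equiv.apply_symm_apply] at this

/-! ### Points of the polygon to the left and to the right of a boundary point -/

/-- Near `p`, the horizontal ray in direction `s` lies in the polygon. -/
def Germ (s : ℝ) (p : ℝ × ℝ) : Prop := ∀ᶠ t in 𝓝[>] (0 : ℝ), (p.1 + s * t, p.2) ∈ P.carrier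

/-- Off the frontier the polygon is both open and closed, so a connected set that avoids the
frontier cannot leave it. -/
theorem subset_or_disjoint {Ω : Set (ℝ × ℝ)} (h1 : IsPreconnected Ω)
    (h2 : Disjoint Ω (frontier P.carrier)) {z : ℝ × ℝ} (hz : z ∈ Ω) (hzK : z ∈ P.carrier) :
    Ω ⊆ interior P.carrier := by
  have hcov : Ω ⊆ interior P.carrier ∪ P.carrierᶜ := by
    intro w hw
    by_cases h : w ∈ P.carrier
    · left
      by_contra hi
      exact disjoint_left.1 h2 hw ⟨subset_closure h, hi⟩
    · exact Or.inr h
  intro w hw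
  rcases hcov hw with h | h
  · exact h
  · obtain ⟨x, -, hx1, hx2⟩ := h1 _ _ isOpen_interior P.isClosed_carrier.isOpen_compl hcov
      ⟨z, hz, (hcov hz).resolve_right fun h => h hzK⟩ ⟨w, hw, h⟩
    exact absurd (interior_subset hx1) hx2

/-- The basic tool for germs: a connected region free of boundary points carries the information
from the start of the ray to any test point of the region. -/
theorem germ_iff_mem {Ω : Set (ℝ × ℝ)} (h1 : IsPreconnected Ω)
    (h2 : Disjoint Ω (frontier P.carrier)) {z : ℝ × ℝ} (hz : z ∈ Ω) {s : ℝ} {p : ℝ × ℝ}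
    (hp : ∀ᶠ t in 𝓝[>] (0 : ℝ), (p.1 + s * t, p.2) ∈ Ω) : P.Germ s p ↔ z ∈ P.carrier := by
  constructor
  · intro h
    obtain ⟨t, ht1, ht2⟩ := (h.and hp).exists
    exact interior_subset (P.subset_or_disjoint h1 h2 ht2 ht1 hz)
  · intro h
    filter_upwards [hp] with t ht
    exact interior_subset (P.subset_or_disjoint h1 h2 hz h ht)

theorem germ_iff_germ {Ω : Set (ℝ × ℝ)} (h1 : IsPreconnected Ω)
    (h2 : Disjoint Ω (frontier P.carrier)) {s s' : ℝ} {p p' : ℝ × ℝ}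
    (hp : ∀ᶠ t in 𝓝[>] (0 : ℝ), (p.1 + s * t, p.2) ∈ Ω)
    (hp' : ∀ᶠ t in 𝓝[>] (0 : ℝ), (p'.1 + s' * t, p'.2) ∈ Ω) : P.Germ s p ↔ P.Germ s' p' := by
  obtain ⟨t, ht⟩ := hp.exists
  rw [P.germ_iff_mem h1 h2 ht hp, P.germ_iff_mem h1 h2 ht hp']

/-- The edges are finitely many closed sets, so those that miss `p` keep a positive distance from
it. -/
theorem exists_ball (p : ℝ × ℝ) :
    ∃ δ > 0, ∀ e, p ∉ P.edge e → Disjoint (Metric.ball p δ) (P.edge e) := by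
  have hc : IsClosed (⋃ e ∈ {e | p ∉ P.edge e}, P.edge e) :=
    (toFinite _).isClosed_biUnion fun e _ => P.isClosed_edge e
  have hp : p ∈ (⋃ e ∈ {e | p ∉ P.edge e}, P.edge e)ᶜ := by
    simp
  obtain ⟨δ, hδ, h⟩ := Metric.isOpen_iff.1 hc.isOpen_compl p hp
  refine ⟨δ, hδ, fun e he => ?_⟩
  rw [disjoint_left]
  intro z hz hze
  exact h hz (mem_biUnion (show e ∈ {e | p ∉ P.edge e} from he) hze)

theorem mem_ball_iff {p z : ℝ × ℝ} {δ : ℝ} :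
    z ∈ Metric.ball p δ ↔ |z.1 - p.1| < δ ∧ |z.2 - p.2| < δ := by
  rw [Metric.mem_ball, Prod.dist_eq, max_lt_iff, Real.dist_eq, Real.dist_eq]

theorem eventually_ray_mem {U : Set (ℝ × ℝ)} {p : ℝ × ℝ} (hU : U ∈ 𝓝 p) (s : ℝ) :
    ∀ᶠ t in 𝓝[>] (0 : ℝ), (p.1 + s * t, p.2) ∈ U := by
  have : Tendsto (fun t : ℝ => ((p.1 + s * t, p.2) : ℝ × ℝ)) (𝓝 0) (𝓝 p) := by
    have h : Continuous (fun t : ℝ => ((p.1 + s * t, p.2) : ℝ × ℝ)) := by fun_prop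
    have := h.tendsto 0
    simpa using this
  exact (this.mono_left nhdsWithin_le_nhds) hU

/-- The part of a small ball around a point of an edge lying between the heights of the edge and
beside it. -/
def sideRegion (e : P.vertices) (p : ℝ × ℝ) (δ s : ℝ) : Set (ℝ × ℝ) :=
  Metric.ball p δ ∩ {z | (P.lo e ≤ z.2 ∧ z.2 ≤ P.hi e) ∧ 0 < s * (z.1 - P.xAt e z.2)}

theorem convex_sideRegion (e : P.vertices) (p : ℝ × ℝ) (δ s : ℝ) :
    Convex ℝ (P.sideRegion e p δ s) := by
  refine (convex_ball p δ).inter ?_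
  intro x hx y hy a b ha hb hab
  obtain ⟨⟨h1, h2⟩, h3⟩ := hx
  obtain ⟨⟨k1, k2⟩, k3⟩ := hy
  have e1 : (a • x + b • y).1 = a * x.1 + b * y.1 := by simp
  have e2 : (a • x + b • y).2 = a * x.2 + b * y.2 := by simp
  have hb' : b = 1 - a := by linarith
  refine ⟨⟨?_, ?_⟩, ?_⟩
  · rw [e2]; subst hb'; nlinarith
  · rw [e2]; subst hb'; nlinarith
  · rw [e1, e2]
    have : s * (a * x.1 + b * y.1 - P.xAt e (a * x.2 + b * y.2)) =
        a * (s * (x.1 - P.xAt e x.2)) + b * (s * (y.1 - P.xAt e y.2)) := by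
      unfold xAt
      rw [lineX_convex _ _ hab]; ring
    rw [this]
    rcases ha.eq_or_lt with h | h
    · have : b = 1 := by linarith
      rw [← h, this]; linarith
    · have := mul_pos h h3
      have := mul_nonneg hb k3.le
      linarith

theorem eventually_mem_sideRegion {e : P.vertices} {p : ℝ × ℝ} {δ s : ℝ} (hs : s ≠ 0)
    {z : ℝ × ℝ} (hz : z ∈ P.edge e) (hzb : z ∈ Metric.ball p δ) :
    ∀ᶠ t in 𝓝[>] (0 : ℝ), (z.1 + s * t, z.2) ∈ P.sideRegion e p δ s := by
  filter_upwards [eventually_ray_mem (Metric.isOpen_ball.mem_nhds hzb) s,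
    self_mem_nhdsWithin] with t ht ht0
  rw [P.mem_edge] at hz
  refine ⟨ht, hz.1, ?_⟩
  dsimp only
  rw [hz.2]
  have : 0 < s * s := mul_self_pos.2 hs
  have : 0 < s * s * t := mul_pos this ht0
  linarith

/-- The germ is locally constant along an edge, at points where no other edge enters the region
beside the edge. -/
theorem germ_locally_const {e : P.vertices} {p : ℝ × ℝ} (hp : p ∈ P.edge e) {s : ℝ} (hs : s ≠ 0)
    (hother : ∀ f, f ≠ e → p ∈ P.edge f → ∀ z ∈ P.edge f, (P.lo e ≤ z.2 ∧ z.2 ≤ P.hi e) →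
      s * (z.1 - P.xAt e z.2) ≤ 0) :
    ∃ δ > 0, ∀ z ∈ P.edge e, z ∈ Metric.ball p δ → (P.Germ s z ↔ P.Germ s p) := by
  obtain ⟨δ, hδ, h⟩ := P.exists_ball p
  refine ⟨δ, hδ, fun z hz hzb => ?_⟩
  refine P.germ_iff_germ (P.convex_sideRegion e p δ s).isPreconnected ?_
    (P.eventually_mem_sideRegion hs hz hzb)
    (P.eventually_mem_sideRegion hs hp (Metric.mem_ball_self hδ))
  rw [disjoint_left]
  intro w hw hwF
  obtain ⟨f, hf⟩ := P.mem_frontier.1 hwF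
  by_cases hpf : p ∈ P.edge f
  · by_cases hfe : f = e
    · subst hfe
      have h1 := hw.2.2
      rw [(P.mem_edge.1 hf).2, sub_self, mul_zero] at h1
      exact lt_irrefl _ h1
    · exact absurd hw.2.2 (not_lt.2 (hother f hfe hpf w hf hw.2.1))
  · exact disjoint_left.1 (h f hpf) hw.1 hf

/-- The point of an edge at half its height. -/
noncomputable def mid (e : P.vertices) : ℝ × ℝ :=
  (P.xAt e ((P.lo e + P.hi e) / 2), (P.lo e + P.hi e) / 2)

/-- The polygon lies, near the edge, on the side of direction `s`. -/
def Side (s : ℝ) (e : P.vertices) : Prop := P.Germ s (P.mid e)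

theorem not_mem_other_edge {e f : P.vertices} (hfe : f ≠ e) {y : ℝ} (h1 : P.lo e < y)
    (h2 : y < P.hi e) : (P.xAt e y, y) ∉ P.edge f := by
  intro h
  have := P.mem_edge.1 h
  exact P.xAt_ne hfe.symm h1 h2 this.1.1 this.1.2 this.2

/-- No other edge meets the inside of an edge, so the germ is locally constant there, hence constant
on the connected interval of heights. This makes `Side`, which looks at the midpoint only,
independent of the chosen point. -/
theorem germ_iff_of_mem_Ioo {e : P.vertices} {s : ℝ} (hs : s ≠ 0) {y y' : ℝ}
    (hy : y ∈ Ioo (P.lo e) (P.hi e)) (hy' : y' ∈ Ioo (P.lo e) (P.hi e)) :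
    P.Germ s (P.xAt e y, y) ↔ P.Germ s (P.xAt e y', y') := by
  have key : ∀ y0 ∈ Ioo (P.lo e) (P.hi e), ∀ᶠ y in 𝓝 y0,
      (P.Germ s (P.xAt e y, y) ↔ P.Germ s (P.xAt e y0, y0)) := by
    intro y0 hy0
    obtain ⟨δ, hδ, h⟩ := P.germ_locally_const (P.xAt_mem_edge hy0.1.le hy0.2.le) hs
      (fun f hfe hf => absurd hf (P.not_mem_other_edge hfe hy0.1 hy0.2))
    have hc : Continuous fun y => ((P.xAt e y, y) : ℝ × ℝ) :=
      (P.continuous_xAt e).prodMk continuous_id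
    filter_upwards [hc.continuousAt.preimage_mem_nhds (Metric.ball_mem_nhds _ hδ),
      isOpen_Ioo.mem_nhds hy0] with y h1 h2
    exact h _ (P.xAt_mem_edge h2.1.le h2.2.le) h1
  have hpre : IsPreconnected (Ioo (P.lo e) (P.hi e)) := isPreconnected_Ioo
  have := hpre.induction₂ (fun y y' => (P.Germ s (P.xAt e y, y) ↔ P.Germ s (P.xAt e y', y')))
    (fun x hx => by
      filter_upwards [nhdsWithin_le_nhds (key x hx)] with y h using h.symm)
    (fun x y z _ _ _ h1 h2 => h1.trans h2) (fun x y _ _ h => h.symm) hy hy'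
  exact this

theorem mid_mem_Ioo (e : P.vertices) : (P.lo e + P.hi e) / 2 ∈ Ioo (P.lo e) (P.hi e) := by
  have := P.lo_lt_hi e
  constructor <;> linarith

theorem germ_iff_side {e : P.vertices} {s : ℝ} (hs : s ≠ 0) {y : ℝ} (h1 : P.lo e < y)
    (h2 : y < P.hi e) : P.Germ s (P.xAt e y, y) ↔ P.Side s e :=
  P.germ_iff_of_mem_Ioo hs ⟨h1, h2⟩ (P.mid_mem_Ioo e)

/-- A small ball around the midpoint consists of the edge and of one region on either side. If both
regions were in the polygon, the midpoint would be an interior point; if neither were, it would not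
be a limit of interior points. -/
theorem side_iff_not (e : P.vertices) : P.Side 1 e ↔ ¬ P.Side (-1) e := by
  set p := P.mid e with hp
  have hI := P.mid_mem_Ioo e
  have hpe : p ∈ P.edge e := P.xAt_mem_edge hI.1.le hI.2.le
  obtain ⟨δ₀, hδ₀, h⟩ := P.exists_ball p
  obtain ⟨δ, hδ, hδδ, hδ1, hδ2⟩ : ∃ δ > 0, δ ≤ δ₀ ∧ δ ≤ p.2 - P.lo e ∧ δ ≤ P.hi e - p.2 := by
    refine ⟨min δ₀ (min (p.2 - P.lo e) (P.hi e - p.2)), ?_, ?_, ?_, ?_⟩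
    · exact lt_min hδ₀ (lt_min (sub_pos.2 hI.1) (sub_pos.2 hI.2))
    · exact min_le_left _ _
    · exact (min_le_right _ _).trans (min_le_left _ _)
    · exact (min_le_right _ _).trans (min_le_right _ _)
  have hF : ∀ z ∈ Metric.ball p δ, ∀ f, z ∈ P.edge f → f = e := by
    intro z hz f hf
    by_contra hne
    exact disjoint_left.1 (h f (P.not_mem_other_edge hne hI.1 hI.2))
      (Metric.ball_subset_ball hδδ hz) hf
  have hrange : ∀ z ∈ Metric.ball p δ, P.lo e ≤ z.2 ∧ z.2 ≤ P.hi e := by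
    intro z hz
    have := abs_lt.1 (mem_ball_iff.1 hz).2
    constructor <;> linarith
  have hdisj : ∀ s : ℝ, Disjoint (P.sideRegion e p δ s) (frontier P.carrier) := by
    intro s
    rw [disjoint_left]
    intro w hw hwF
    obtain ⟨f, hf⟩ := P.mem_frontier.1 hwF
    obtain rfl := hF w hw.1 f hf
    have h1 := hw.2.2
    rw [(P.mem_edge.1 hf).2, sub_self, mul_zero] at h1
    exact lt_irrefl _ h1
  have hcases : ∀ z ∈ Metric.ball p δ, z ∈ P.sideRegion e p δ 1 ∨ z ∈ P.sideRegion e p δ (-1) ∨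
      z ∈ P.edge e := by
    intro z hz
    rcases lt_trichotomy z.1 (P.xAt e z.2) with h | h | h
    · right; left; exact ⟨hz, hrange z hz, by linarith⟩
    · right; right; exact P.mem_edge.2 ⟨hrange z hz, h⟩
    · left; exact ⟨hz, hrange z hz, by linarith⟩
  have hiff : ∀ s : ℝ, s ≠ 0 → ∀ z ∈ P.sideRegion e p δ s, (P.Side s e ↔ z ∈ P.carrier) := by
    intro s hs z hz
    exact P.germ_iff_mem (P.convex_sideRegion e p δ s).isPreconnected (hdisj s) hz
      (P.eventually_mem_sideRegion hs hpe (Metric.mem_ball_self hδ))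
  have hpF : p ∈ frontier P.carrier := P.edge_subset_frontier e hpe
  constructor
  · intro h1 h2
    have : Metric.ball p δ ⊆ P.carrier := by
      intro z hz
      rcases hcases z hz with h | h | h
      · exact (hiff 1 one_ne_zero z h).1 h1
      · exact (hiff (-1) (by norm_num) z h).1 h2
      · exact P.edge_subset e h
    exact hpF.2 (mem_interior.2 ⟨_, this, Metric.isOpen_ball, Metric.mem_ball_self hδ⟩)
  · intro h2
    by_contra h1
    have hpc : p ∈ closure (interior P.carrier) := by
      rw [P.closure_interior]; exact P.edge_subset e hpe
    obtain ⟨z, hz1, hz2⟩ := mem_closure_iff.1 hpc _ Metric.isOpen_ball (Metric.mem_ball_self hδ)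
    rcases hcases z hz1 with h | h | h
    · exact h1 ((hiff 1 one_ne_zero z h).2 (interior_subset hz2))
    · exact h2 ((hiff (-1) (by norm_num) z h).2 (interior_subset hz2))
    · exact (P.edge_subset_frontier e h).2 hz2

end PlanarPolygon

namespace PlanarPolygon

variable (P : PlanarPolygon)

/-! ### The germs at a vertex -/

/-- An end point of an edge is compared with points inside the edge close to it. This needs that no
other edge at the end point enters the region beside the edge. -/
theorem germ_iff_side_of_mem_edge {v : ℝ × ℝ} {e : P.vertices} (hv : v ∈ P.edge e) {s : ℝ}
    (hs : s ≠ 0) (hother : ∀ f, f ≠ e → v ∈ P.edge f → ∀ z ∈ P.edge f,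
      (P.lo e ≤ z.2 ∧ z.2 ≤ P.hi e) → s * (z.1 - P.xAt e z.2) ≤ 0) :
    P.Germ s v ↔ P.Side s e := by
  obtain ⟨δ, hδ, h⟩ := P.germ_locally_const hv hs hother
  have hv' := P.mem_edge.1 hv
  have hc : Continuous fun y => ((P.xAt e y, y) : ℝ × ℝ) :=
    (P.continuous_xAt e).prodMk continuous_id
  have hcl : v.2 ∈ closure (Ioo (P.lo e) (P.hi e)) := by
    rw [closure_Ioo (P.lo_lt_hi e).ne]; exact hv'.1
  have hveq : (P.xAt e v.2, v.2) = v := Prod.ext hv'.2.symm rfl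
  have hn : (fun y => ((P.xAt e y, y) : ℝ × ℝ)) ⁻¹' Metric.ball v δ ∈ 𝓝 v.2 := by
    apply hc.continuousAt.preimage_mem_nhds
    rw [hveq]
    exact Metric.ball_mem_nhds _ hδ
  obtain ⟨y, hy1, hy2⟩ := mem_closure_iff_nhds.1 hcl _ hn
  rw [← h _ (P.xAt_mem_edge hy2.1.le hy2.2.le) hy1]
  exact P.germ_iff_side hs hy2.1 hy2.2

theorem edges_at {v e f g : P.vertices} (hef : e ≠ f) (he : (v : ℝ × ℝ) ∈ P.edge e)
    (hf : (v : ℝ × ℝ) ∈ P.edge f) (hg : (v : ℝ × ℝ) ∈ P.edge g) : g = e ∨ g = f := by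
  rw [P.mem_edge_iff_vertex] at he hf hg
  grind

theorem xAt_of_mem {v : ℝ × ℝ} {e : P.vertices} (h : v ∈ P.edge e) : P.xAt e v.2 = v.1 :=
  (P.mem_edge.1 h).2.symm

/-- At a vertex with one edge going up and one going down. -/
theorem germ_iff_side_up_down {v e f : P.vertices} (hef : e ≠ f)
    (he : (v : ℝ × ℝ) ∈ P.edge e) (hf : (v : ℝ × ℝ) ∈ P.edge f) (hlo : P.lo e = (v : ℝ × ℝ).2)
    (hhi : P.hi f = (v : ℝ × ℝ).2) {s : ℝ} (hs : s ≠ 0) :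
    (P.Germ s v ↔ P.Side s e) ∧ (P.Germ s v ↔ P.Side s f) := by
  constructor
  · refine P.germ_iff_side_of_mem_edge he hs fun g hg hvg z hz hr => ?_
    obtain rfl := (P.edges_at hef he hf hvg).resolve_left hg
    have h1 := (P.mem_edge.1 hz)
    have h2 : z.2 = (v : ℝ × ℝ).2 := by linarith [h1.1.2, hr.1]
    rw [h1.2, h2, P.xAt_of_mem he, P.xAt_of_mem hf]; simp
  · refine P.germ_iff_side_of_mem_edge hf hs fun g hg hvg z hz hr => ?_
    obtain rfl := (P.edges_at hef he hf hvg).resolve_right hg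
    have h1 := (P.mem_edge.1 hz)
    have h2 : z.2 = (v : ℝ × ℝ).2 := by linarith [h1.1.1, hr.2]
    rw [h1.2, h2, P.xAt_of_mem he, P.xAt_of_mem hf]; simp

/-- An open half plane together with one open half of its boundary line. On the side of a vertex
away from both edges it is a convex region without boundary points near the vertex, and it contains
one of the two horizontal rays. -/
theorem convex_lexHalfPlane (v : ℝ × ℝ) (d s : ℝ) :
    Convex ℝ {z : ℝ × ℝ | 0 < d * (z.2 - v.2) ∨ (z.2 = v.2 ∧ 0 < s * (z.1 - v.1))} := by
  intro x hx y hy a b ha hb hab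
  have e1 : (a • x + b • y).1 = a * x.1 + b * y.1 := by simp
  have e2 : (a • x + b • y).2 = a * x.2 + b * y.2 := by simp
  have hd : d * ((a • x + b • y).2 - v.2) = a * (d * (x.2 - v.2)) + b * (d * (y.2 - v.2)) := by
    rw [e2]; linear_combination (d * v.2) * hab
  have hs : s * ((a • x + b • y).1 - v.1) = a * (s * (x.1 - v.1)) + b * (s * (y.1 - v.1)) := by
    rw [e1]; linear_combination (s * v.1) * hab
  rcases ha.eq_or_lt with h | ha'
  · have : b = 1 := by linarith
    subst this; subst h
    simpa using hy
  rcases hb.eq_or_lt with h | hb'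
  · have : a = 1 := by linarith
    subst this; subst h
    simpa using hx
  rw [mem_ofPred_eq, hd, hs]
  rcases hx with hx | ⟨hx1, hx2⟩ <;> rcases hy with hy | ⟨hy1, hy2⟩
  · left; positivity
  · left; rw [hy1, sub_self]; simpa using mul_pos ha' hx
  · left; rw [hx1, sub_self]; simpa using mul_pos hb' hy
  · right
    refine ⟨?_, by positivity⟩
    rw [e2, hx1, hy1, ← add_mul, hab, one_mul]

/-- At a vertex whose two edges go to the same side, the horizontal rays to the left and to the
right behave in the same way. -/
theorem germ_one_iff_germ_neg_one {v e f : P.vertices} (hef : e ≠ f)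
    (he : (v : ℝ × ℝ) ∈ P.edge e) (hf : (v : ℝ × ℝ) ∈ P.edge f) {d : ℝ} (hd : d ≠ 0)
    (hde : ∀ z ∈ P.edge e, 0 ≤ d * (z.2 - (v : ℝ × ℝ).2))
    (hdf : ∀ z ∈ P.edge f, 0 ≤ d * (z.2 - (v : ℝ × ℝ).2)) :
    P.Germ 1 v ↔ P.Germ (-1) v := by
  obtain ⟨δ, hδ, h⟩ := P.exists_ball v
  -- Both rays are decided by the same test point, at the distance `δ / 2` above or below the
  -- vertex, on the side where there are no edges.
  have key : ∀ s : ℝ, s ≠ 0 → (P.Germ s v ↔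
      ((v : ℝ × ℝ).1, (v : ℝ × ℝ).2 - d * (δ / (2 * |d|))) ∈ P.carrier) := by
    intro s hs
    refine P.germ_iff_mem (Ω := Metric.ball (v : ℝ × ℝ) δ ∩
      {z : ℝ × ℝ | 0 < (-d) * (z.2 - (v : ℝ × ℝ).2) ∨
        (z.2 = (v : ℝ × ℝ).2 ∧ 0 < s * (z.1 - (v : ℝ × ℝ).1))})
      ((convex_ball _ _).inter (convex_lexHalfPlane _ _ _)).isPreconnected ?_ ?_ ?_
    · rw [disjoint_left]
      rintro w ⟨hw1, hw2⟩ hwF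
      obtain ⟨g, hg⟩ := P.mem_frontier.1 hwF
      by_cases hvg : (v : ℝ × ℝ) ∈ P.edge g
      · have hw3 : 0 ≤ d * (w.2 - (v : ℝ × ℝ).2) := by
          rcases P.edges_at hef he hf hvg with rfl | rfl
          exacts [hde w hg, hdf w hg]
        rcases hw2 with hw2 | ⟨hw2, hw4⟩
        · linarith
        · rw [(P.mem_edge.1 hg).2, hw2, P.xAt_of_mem hvg] at hw4
          simp at hw4
      · exact disjoint_left.1 (h g hvg) hw1 hg
    · have hd' : 0 < |d| := abs_pos.2 hd
      refine ⟨mem_ball_iff.2 ⟨by simpa using hδ, ?_⟩, Or.inl ?_⟩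
      · have h1 : (v : ℝ × ℝ).2 - d * (δ / (2 * |d|)) - (v : ℝ × ℝ).2 = -(d * (δ / (2 * |d|))) := by
          ring
        dsimp only
        rw [h1, abs_neg, abs_mul, abs_of_pos (show 0 < δ / (2 * |d|) by positivity)]
        have h2 : |d| * (δ / (2 * |d|)) = δ / 2 := by field_simp
        rw [h2]; linarith
      · have h1 : (-d) * ((v : ℝ × ℝ).2 - d * (δ / (2 * |d|)) - (v : ℝ × ℝ).2)
            = (d * d) * (δ / (2 * |d|)) := by ring
        dsimp only
        rw [h1]
        have : 0 < d * d := mul_self_pos.2 hd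
        positivity
    · filter_upwards [eventually_ray_mem (Metric.ball_mem_nhds _ hδ) s,
        self_mem_nhdsWithin] with t ht ht0
      refine ⟨ht, Or.inr ⟨rfl, ?_⟩⟩
      dsimp only
      have : 0 < s * s := mul_self_pos.2 hs
      have : 0 < s * s * t := mul_pos this ht0
      linarith
  rw [key 1 one_ne_zero, key (-1) (by norm_num)]

/-- At a vertex whose two edges go to the same side, the first one being on the left. -/
theorem germ_iff_side_fork {v e f : P.vertices} (hef : e ≠ f)
    (he : (v : ℝ × ℝ) ∈ P.edge e) (hf : (v : ℝ × ℝ) ∈ P.edge f) {d : ℝ}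
    (hde : ∀ z ∈ P.edge e, 0 ≤ d * (z.2 - (v : ℝ × ℝ).2))
    (hdf : ∀ z ∈ P.edge f, 0 ≤ d * (z.2 - (v : ℝ × ℝ).2))
    (hlt : ∀ y, 0 ≤ d * (y - (v : ℝ × ℝ).2) → P.xAt e y ≤ P.xAt f y) :
    (P.Germ 1 v ↔ P.Side 1 f) ∧ (P.Germ (-1) v ↔ P.Side (-1) e) := by
  constructor
  · refine P.germ_iff_side_of_mem_edge hf one_ne_zero fun g hg hvg z hz hr => ?_
    obtain rfl := (P.edges_at hef he hf hvg).resolve_right hg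
    have h1 := (P.mem_edge.1 hz).2
    have := hlt z.2 (hde z hz)
    linarith
  · refine P.germ_iff_side_of_mem_edge he (by norm_num) fun g hg hvg z hz hr => ?_
    obtain rfl := (P.edges_at hef he hf hvg).resolve_left hg
    have h1 := (P.mem_edge.1 hz).2
    have := hlt z.2 (hdf z hz)
    linarith

/-- The slope of an edge as a function of the height. -/
noncomputable def slope (e : P.vertices) : ℝ :=
  ((P.next e : ℝ × ℝ).1 - (e : ℝ × ℝ).1) / ((P.next e : ℝ × ℝ).2 - (e : ℝ × ℝ).2)

theorem xAt_sub (e : P.vertices) (y y' : ℝ) : P.xAt e y - P.xAt e y' = (y - y') * P.slope e := by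
  unfold xAt lineX slope; ring

/-- Along two lines through one point the difference of abscissas is the height difference times the
difference of slopes, so it keeps its sign above the point, and likewise below. -/
theorem fork_total {v : ℝ × ℝ} {e f : P.vertices} (he : v ∈ P.edge e) (hf : v ∈ P.edge f) {d : ℝ}
    (hd : d ≠ 0) : (∀ y, 0 ≤ d * (y - v.2) → P.xAt e y ≤ P.xAt f y) ∨
      (∀ y, 0 ≤ d * (y - v.2) → P.xAt f y ≤ P.xAt e y) := by
  have key : ∀ y, d * d * (P.xAt f y - P.xAt e y) =
      d * (y - v.2) * (d * (P.slope f - P.slope e)) := by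
    intro y
    have h1 := P.xAt_sub e y v.2
    have h2 := P.xAt_sub f y v.2
    rw [P.xAt_of_mem he] at h1
    rw [P.xAt_of_mem hf] at h2
    linear_combination d * d * (h2 - h1)
  have hdd : 0 < d * d := mul_self_pos.2 hd
  rcases le_total 0 (d * (P.slope f - P.slope e)) with h | h
  · left
    intro y hy
    have h1 := mul_nonneg hy h
    rw [← key] at h1
    have := nonneg_of_mul_nonneg_right h1 hdd
    linarith
  · right
    intro y hy
    have h1 := mul_nonpos_of_nonneg_of_nonpos hy h
    rw [← key] at h1
    have := nonpos_of_mul_nonpos_right h1 hdd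
    linarith

/-! ### Horizontal segments in the polygon -/

theorem germ_of_mem_interior {p : ℝ × ℝ} (hp : p ∈ interior P.carrier) (s : ℝ) : P.Germ s p := by
  filter_upwards [eventually_ray_mem (isOpen_interior.mem_nhds hp) s] with t ht
  exact interior_subset ht

/-- Following a horizontal ray that starts in the polygon, one meets the boundary. -/
theorem exists_frontier_of_germ {p : ℝ × ℝ} {s : ℝ} (hs : s ≠ 0) (hp : P.Germ s p) :
    ∃ t > 0, (p.1 + s * t, p.2) ∈ frontier P.carrier ∧
      ∀ t' ∈ Ioo 0 t, (p.1 + s * t', p.2) ∈ interior P.carrier := by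
  have hcont : Continuous fun t : ℝ => ((p.1 + s * t, p.2) : ℝ × ℝ) := by fun_prop
  have hinj : Function.Injective fun t : ℝ => ((p.1 + s * t, p.2) : ℝ × ℝ) := by
    intro t t' h
    have := congrArg Prod.fst h
    simpa [hs] using this
  set T : Set ℝ := {t | 0 < t ∧ (p.1 + s * t, p.2) ∈ frontier P.carrier} with hT
  -- Every edge meets the horizontal line at most once, so among the boundary points on the ray
  -- there is a first one, if any.
  have hfin : T.Finite := by
    have : T ⊆ (fun t : ℝ => ((p.1 + s * t, p.2) : ℝ × ℝ)) ⁻¹'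
        (range fun e => (P.xAt e p.2, p.2)) := by
      rintro t ⟨-, ht⟩
      obtain ⟨e, he⟩ := P.mem_frontier.1 ht
      exact ⟨e, Prod.ext (P.mem_edge.1 he).2.symm rfl⟩
    exact ((finite_range _).preimage hinj.injOn).subset this
  have hsub : ∀ t, (∀ t' ∈ Ioo 0 t, t' ∉ T) →
      ∀ t' ∈ Ioo 0 t, (p.1 + s * t', p.2) ∈ interior P.carrier := by
    intro t h t' ht'
    have hpre : IsPreconnected ((fun t : ℝ => ((p.1 + s * t, p.2) : ℝ × ℝ)) '' Ioo 0 t) :=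
      isPreconnected_Ioo.image _ hcont.continuousOn
    have hev : ∀ᶠ t' in 𝓝[>] (0 : ℝ), t' ∈ Ioo 0 t :=
      Ioo_mem_nhdsGT (ht'.1.trans ht'.2)
    obtain ⟨t₁, h1, h2⟩ := (hp.and hev).exists
    refine P.subset_or_disjoint hpre ?_ (mem_image_of_mem _ h2) h1 (mem_image_of_mem _ ht')
    rw [disjoint_left]
    rintro _ ⟨t₂, ht₂, rfl⟩ h3
    exact h t₂ ht₂ ⟨ht₂.1, h3⟩
  by_cases hne : T.Nonempty
  · obtain ⟨t, ht, hmin⟩ := hfin.exists_minimalFor id T hne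
    refine ⟨t, ht.1, ht.2, hsub t fun t' ht' hT' => ?_⟩
    exact absurd (hmin hT' ht'.2.le) (not_le.2 ht'.2)
  · exfalso
    have hall : ∀ t > 0, (p.1 + s * t, p.2) ∈ P.carrier := by
      intro t ht
      refine interior_subset (hsub (t + 1) (fun t' _ h => hne ⟨t', h⟩) t ⟨ht, by linarith⟩)
    obtain ⟨R, hR⟩ := P.isCompact.isBounded.subset_ball (0 : ℝ × ℝ)
    have hs' : 0 < |s| := abs_pos.2 hs
    have h1 := (mem_ball_iff.1 (hR (hall ((|R| + |p.1| + 1) / |s|) (by positivity)))).1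
    have h2 : |s * ((|R| + |p.1| + 1) / |s|)| = |R| + |p.1| + 1 := by
      rw [abs_mul, abs_of_pos (show 0 < (|R| + |p.1| + 1) / |s| by positivity)]
      field_simp
    simp only [Prod.fst_zero, sub_zero] at h1
    have h3 := abs_sub_abs_le_abs_add (s * ((|R| + |p.1| + 1) / |s|)) p.1
    have h4 := le_abs_self R
    rw [add_comm _ p.1] at h3
    linarith

end PlanarPolygon

/-! ### Hausdorff quotients of compact spaces -/

/-- If the kernel is closed, the quotient map is closed, because the saturation of a closed set is
the projection of a compact set. Different points then have disjoint closed preimages, which are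
separated by open sets `U`, `V` in the normal space `X`; the points whose whole preimage lies in
`U`, respectively `V`, form the required neighbourhoods. -/
theorem t2Space_of_isClosed_ker {X Y : Type*} [TopologicalSpace X] [TopologicalSpace Y]
    [CompactSpace X] [T2Space X] {f : X → Y} (hf : Topology.IsQuotientMap f)
    (hker : IsClosed {z : X × X | f z.1 = f z.2}) : T2Space Y := by
  have hclosed : IsClosedMap f := by
    intro C hC
    rw [← hf.isClosed_preimage]
    have : f ⁻¹' (f '' C) = Prod.snd '' ({z : X × X | f z.1 = f z.2} ∩ Prod.fst ⁻¹' C) := by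
      ext y
      constructor
      · rintro ⟨x, hx, hxy⟩
        exact ⟨(x, y), ⟨hxy, hx⟩, rfl⟩
      · rintro ⟨⟨x, y'⟩, ⟨h1, h2⟩, rfl⟩
        exact ⟨x, h2, h1⟩
    rw [this]
    exact ((hker.inter (hC.preimage continuous_fst)).isCompact.image continuous_snd).isClosed
  have hpt : ∀ y, IsClosed (f ⁻¹' {y}) := by
    intro y
    obtain ⟨x, rfl⟩ := hf.surjective y
    have := hclosed {x} isClosed_singleton
    rw [image_singleton] at this
    exact this.preimage hf.continuous
  refine ⟨fun y y' hne => ?_⟩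
  have hdisj : Disjoint (f ⁻¹' {y}) (f ⁻¹' {y'}) := by
    rw [disjoint_left]
    intro x h1 h2
    exact hne (h1.symm.trans h2)
  obtain ⟨U, V, hU, hV, hyU, hyV, hUV⟩ := normal_separation (hpt y) (hpt y') hdisj
  refine ⟨(f '' Uᶜ)ᶜ, (f '' Vᶜ)ᶜ, (hclosed _ hU.isClosed_compl).isOpen_compl,
    (hclosed _ hV.isClosed_compl).isOpen_compl, ?_, ?_, ?_⟩
  · rintro ⟨x, hx, rfl⟩
    exact hx (hyU rfl)
  · rintro ⟨x, hx, rfl⟩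
    exact hx (hyV rfl)
  · rw [disjoint_left]
    intro z hz1 hz2
    obtain ⟨x, rfl⟩ := hf.surjective z
    have h1 : x ∈ U := by
      by_contra h
      exact hz1 ⟨x, h, rfl⟩
    have h2 : x ∈ V := by
      by_contra h
      exact hz2 ⟨x, h, rfl⟩
    exact disjoint_left.1 hUV h1 h2

namespace PlanarPolygon

variable (P : PlanarPolygon)

/-! ### The Reeb space -/

/-- A connected subset of a horizontal line contains the segment between any two of its points. This
replaces connected components of level sets by an elementary condition. -/
theorem fiber_eq_iff (x y : P.carrier) :
    P.fiber x = P.fiber y ↔ x.1.2 = y.1.2 ∧ segment ℝ x.1 y.1 ⊆ P.carrier := by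
  constructor
  · intro h
    have hh := P.height_eq_of_fiber_eq h
    refine ⟨hh, ?_⟩
    have hx : x.1 ∈ P.fiber x := P.mem_fiber x
    have hy : y.1 ∈ P.fiber x := by rw [h]; exact P.mem_fiber y
    have hpre : IsPreconnected (P.fiber x) := isPreconnected_connectedComponentIn
    have hsub : ∀ z ∈ P.fiber x, z ∈ P.carrier ∧ z.2 = x.1.2 :=
      fun z hz => connectedComponentIn_subset {z | z ∈ P.carrier ∧ z.2 = x.1.2} _ hz
    have himg := (hpre.image Prod.fst continuous_fst.continuousOn).ordConnected
    intro z hz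
    have hz2 : z.2 = x.1.2 ∧ z.1 ∈ uIcc x.1.1 y.1.1 := by
      rcases le_total x.1.1 y.1.1 with hle | hle
      · rw [mem_segment_horizontal hh hle] at hz
        exact ⟨hz.1, by rw [uIcc_of_le hle]; exact hz.2⟩
      · rw [segment_symm, mem_segment_horizontal hh.symm hle] at hz
        exact ⟨hz.1.trans hh.symm, by rw [uIcc_of_ge hle]; exact hz.2⟩
    obtain ⟨w, hw, hwz⟩ := himg.uIcc_subset (mem_image_of_mem _ hx) (mem_image_of_mem _ hy) hz2.2
    have : w = z := Prod.ext hwz ((hsub w hw).2.trans hz2.1.symm)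
    exact this ▸ (hsub w hw).1
  · rintro ⟨hh, hs⟩
    have hsub : segment ℝ x.1 y.1 ⊆ {z | z ∈ P.carrier ∧ z.2 = x.1.2} := by
      intro z hz
      refine ⟨hs hz, ?_⟩
      rcases le_total x.1.1 y.1.1 with hle | hle
      · exact ((mem_segment_horizontal hh hle z).1 hz).1
      · rw [segment_symm, mem_segment_horizontal hh.symm hle] at hz
        exact hz.1.trans hh.symm
    have hpre : IsPreconnected (segment ℝ x.1 y.1) := (convex_segment _ _).isPreconnected
    have h1 := hpre.subset_connectedComponentIn (left_mem_segment ℝ x.1 y.1) hsub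
      (right_mem_segment ℝ x.1 y.1)
    have h2 := connectedComponentIn_eq h1
    unfold fiber
    rw [h2, hh]

theorem toReeb_eq_iff (x y : P.carrier) :
    P.toReeb x = P.toReeb y ↔ x.1.2 = y.1.2 ∧ segment ℝ x.1 y.1 ⊆ P.carrier := by
  rw [← fiber_eq_iff]
  exact Quotient.eq (r := P.fiberSetoid)

theorem isQuotientMap_toReeb : Topology.IsQuotientMap P.toReeb := isQuotientMap_quotient_mk'

instance : CompactSpace P.carrier := isCompact_iff_compactSpace.1 P.isCompact

/-- Lying in one fiber is a closed condition on a pair: equal heights and, for every `t`, the point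
with parameter `t` on the segment belongs to the closed polygon. -/
instance : T2Space P.ReebSpace := by
  refine t2Space_of_isClosed_ker P.isQuotientMap_toReeb ?_
  have : {z : P.carrier × P.carrier | P.toReeb z.1 = P.toReeb z.2} =
      {z | z.1.1.2 = z.2.1.2} ∩ ⋂ t ∈ Icc (0 : ℝ) 1,
        (fun z : P.carrier × P.carrier => z.1.1 + t • (z.2.1 - z.1.1)) ⁻¹' P.carrier := by
    ext z
    simp only [mem_ofPred_eq, toReeb_eq_iff, segment_eq_image', subset_def, forall_mem_image,
      mem_inter_iff, mem_iInter, mem_preimage]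
  rw [this]
  refine (isClosed_eq (by fun_prop) (by fun_prop)).inter ?_
  exact isClosed_biInter fun t _ => P.isClosed_carrier.preimage (by fun_prop)

open Classical in
/-- The point of the Reeb space that is the image of a point of the polygon; a fixed point of the
Reeb space for points outside of the polygon. -/
noncomputable def reebMk (z : ℝ × ℝ) : P.ReebSpace :=
  if h : z ∈ P.carrier then P.toReeb ⟨z, h⟩ else P.toReeb ⟨_, P.nonempty.some_mem⟩

theorem reebMk_of_mem {z : ℝ × ℝ} (h : z ∈ P.carrier) : P.reebMk z = P.toReeb ⟨z, h⟩ :=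
  dif_pos h

theorem reebMk_eq_iff {z w : ℝ × ℝ} (hz : z ∈ P.carrier) (hw : w ∈ P.carrier) :
    P.reebMk z = P.reebMk w ↔ z.2 = w.2 ∧ segment ℝ z w ⊆ P.carrier := by
  rw [P.reebMk_of_mem hz, P.reebMk_of_mem hw, toReeb_eq_iff]

theorem reebHeight_reebMk {z : ℝ × ℝ} (h : z ∈ P.carrier) : P.reebHeight (P.reebMk z) = z.2 := by
  rw [P.reebMk_of_mem h]; rfl

theorem exists_reebMk (q : P.ReebSpace) : ∃ z ∈ P.carrier, P.reebMk z = q := by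
  obtain ⟨x, rfl⟩ := P.isQuotientMap_toReeb.surjective q
  exact ⟨x.1, x.2, P.reebMk_of_mem x.2⟩

theorem continuousOn_reebMk : ContinuousOn P.reebMk P.carrier := by
  rw [continuousOn_iff_continuous_domRestrict]
  have : P.carrier.domRestrict P.reebMk = P.toReeb := by
    funext x
    exact P.reebMk_of_mem x.2
  rw [this]
  exact P.isQuotientMap_toReeb.continuous

theorem reebMk_eq_of_horizontal {z w : ℝ × ℝ} (h : z.2 = w.2)
    (hs : ∀ x, z.1 ≤ x → x ≤ w.1 → (x, z.2) ∈ P.carrier) (hle : z.1 ≤ w.1) :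
    P.reebMk z = P.reebMk w := by
  have hz : z ∈ P.carrier := hs z.1 le_rfl hle
  have hw : w ∈ P.carrier := by
    have := hs w.1 hle le_rfl
    rwa [h] at this
  rw [P.reebMk_eq_iff hz hw]
  refine ⟨h, fun u hu => ?_⟩
  rw [mem_segment_horizontal h hle] at hu
  have := hs u.1 hu.2.1 hu.2.2
  rwa [← hu.1] at this

theorem mem_of_reebMk_eq {z w : ℝ × ℝ} (hz : z ∈ P.carrier) (hw : w ∈ P.carrier)
    (h : P.reebMk z = P.reebMk w) (x : ℝ) (h1 : z.1 ≤ x) (h2 : x ≤ w.1) :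
    (x, z.2) ∈ P.carrier := by
  obtain ⟨h3, h4⟩ := (P.reebMk_eq_iff hz hw).1 h
  exact h4 ((mem_segment_horizontal h3 (h1.trans h2) _).2 ⟨rfl, h1, h2⟩)

theorem mem_reebVertices_iff {q : P.ReebSpace} :
    q ∈ P.reebVertices ↔ ∃ v : P.vertices, P.reebMk v = q := by
  constructor
  · rintro ⟨x, hx, rfl⟩
    exact ⟨⟨x.1, hx⟩, P.reebMk_of_mem x.2⟩
  · rintro ⟨v, rfl⟩
    exact ⟨⟨v, P.vertex_mem_carrier v⟩, v.2, (P.reebMk_of_mem _).symm⟩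

theorem reebMk_vertex_injective : Function.Injective fun v : P.vertices => P.reebMk v := by
  intro v w h
  have := congrArg P.reebHeight h
  simp only [P.reebHeight_reebMk (P.vertex_mem_carrier _)] at this
  exact P.vertex_ext this

/-- The vertices of the Reeb graph correspond to the vertices of the polygon. -/
noncomputable def vertexEquiv : P.vertices ≃ P.reebGraph.V :=
  Equiv.ofBijective (fun v => ⟨P.reebMk v, P.mem_reebVertices_iff.2 ⟨v, rfl⟩⟩)
    ⟨fun _ _ h => P.reebMk_vertex_injective (congrArg Subtype.val h), fun q => by
      obtain ⟨v, hv⟩ := P.mem_reebVertices_iff.1 q.2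
      exact ⟨v, Subtype.ext hv⟩⟩

/-- Turns optimality into a statement about the number of vertices of the polygon. -/
theorem card_reebGraph : Nat.card P.reebGraph.V = P.vertices.card := by
  rw [← Nat.card_congr P.vertexEquiv, Nat.card_eq_fintype_card, Fintype.card_coe]

end PlanarPolygon

/-! ### Topological graphs -/

section TopologicalGraph

variable {X : Type*} [TopologicalSpace X]

/-- `S` is an arc from `a` to `b`. -/
def IsArc (S : Set X) (a b : X) : Prop :=
  ∃ φ : ℝ → X, ContinuousOn φ (Icc 0 1) ∧ InjOn φ (Icc 0 1) ∧ φ '' Icc 0 1 = S ∧ φ 0 = a ∧ φ 1 = b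

theorem isArc_image_Icc {φ : ℝ → X} {p q : ℝ} (hpq : p < q) (hc : ContinuousOn φ (Icc p q))
    (hi : InjOn φ (Icc p q)) : IsArc (φ '' Icc p q) (φ p) (φ q) := by
  have himg : (fun t => p + t * (q - p)) '' Icc 0 1 = Icc p q := by
    ext x
    constructor
    · rintro ⟨t, ⟨h1, h2⟩, rfl⟩
      constructor <;> dsimp only <;> nlinarith
    · rintro ⟨h1, h2⟩
      have : 0 < q - p := sub_pos.2 hpq
      refine ⟨(x - p) / (q - p), ⟨by apply div_nonneg <;> linarith, ?_⟩, ?_⟩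
      · rw [div_le_one this]; linarith
      · dsimp only; rw [div_mul_cancel₀ _ this.ne']; ring
  have hmaps : MapsTo (fun t => p + t * (q - p)) (Icc 0 1) (Icc p q) := by
    rw [← himg]; exact mapsTo_image _ _
  refine ⟨fun t => φ (p + t * (q - p)), hc.comp (by fun_prop) hmaps, ?_, ?_, ?_, ?_⟩
  · refine hi.comp (fun t _ t' _ h => ?_) hmaps
    have : q - p ≠ 0 := (sub_pos.2 hpq).ne'
    simpa [this] using h
  · rw [← himg, image_image]
  · simp
  · simp

theorem IsArc.symm {S : Set X} {a b : X} (h : IsArc S a b) : IsArc S b a := by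
  obtain ⟨φ, hc, hi, rfl, rfl, rfl⟩ := h
  have hmaps : MapsTo (fun t : ℝ => 1 - t) (Icc 0 1) (Icc 0 1) := by
    rintro t ⟨h1, h2⟩
    constructor <;> dsimp only <;> linarith
  refine ⟨fun t => φ (1 - t), hc.comp (by fun_prop) hmaps, ?_, ?_, ?_, ?_⟩
  · refine hi.comp (fun t _ t' _ h => ?_) hmaps
    simpa using h
  · ext x
    constructor
    · rintro ⟨t, ht, rfl⟩
      exact mem_image_of_mem _ (hmaps ht)
    · rintro ⟨t, ht, rfl⟩
      exact ⟨1 - t, hmaps ht, by simp⟩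
  · simp
  · simp

theorem IsArc.left_mem {S : Set X} {a b : X} (h : IsArc S a b) : a ∈ S := by
  obtain ⟨φ, hc, hi, rfl, rfl, rfl⟩ := h
  exact mem_image_of_mem _ ⟨le_rfl, zero_le_one⟩

theorem IsArc.right_mem {S : Set X} {a b : X} (h : IsArc S a b) : b ∈ S := h.symm.left_mem

theorem IsArc.ne {S : Set X} {a b : X} (h : IsArc S a b) : a ≠ b := by
  obtain ⟨φ, hc, hi, rfl, rfl, rfl⟩ := h
  intro h
  exact zero_ne_one (hi ⟨le_rfl, zero_le_one⟩ ⟨zero_le_one, le_rfl⟩ h)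

theorem IsArc.isCompact {S : Set X} {a b : X} (h : IsArc S a b) : IsCompact S := by
  obtain ⟨φ, hc, hi, rfl, rfl, rfl⟩ := h
  exact isCompact_Icc.image_of_continuousOn hc

/-- The concatenation of two arcs, as a function on `[0, 2]`. -/
theorem IsArc.exists_concat {S S' : Set X} {a b c : X} (h : IsArc S a b) (h' : IsArc S' b c) :
    ∃ f : ℝ → X, ContinuousOn f (Icc 0 2) ∧ f '' Icc 0 2 = S ∪ S' ∧ f 0 = a ∧ f 1 = b ∧ f 2 = c ∧
      InjOn f (Icc 0 1) ∧ InjOn f (Icc 1 2) ∧ f '' Icc 0 1 = S ∧ f '' Icc 1 2 = S' := by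
  obtain ⟨φ, hc, hi, rfl, rfl, hb⟩ := h
  obtain ⟨ψ, hc', hi', rfl, hb', rfl⟩ := h'
  set f : ℝ → X := fun t => if t ≤ 1 then φ t else ψ (t - 1) with hf
  have h1 : EqOn f φ (Icc 0 1) := fun t ht => if_pos ht.2
  have h2 : EqOn f (fun t => ψ (t - 1)) (Icc 1 2) := by
    intro t ht
    rcases ht.1.eq_or_lt with h | h
    · subst h
      simp only [hf, le_refl, if_true, sub_self, hb, hb']
    · exact if_neg (not_le.2 h)
  have hmaps : MapsTo (fun t : ℝ => t - 1) (Icc 1 2) (Icc 0 1) := by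
    rintro t ⟨h1, h2⟩
    constructor <;> dsimp only <;> linarith
  have hu : Icc (0 : ℝ) 2 = Icc 0 1 ∪ Icc 1 2 := by
    rw [Icc_union_Icc_eq_Icc] <;> norm_num
  have i1 : f '' Icc 0 1 = φ '' Icc 0 1 := h1.image_eq
  have i2 : f '' Icc 1 2 = ψ '' Icc 0 1 := by
    rw [h2.image_eq]
    ext x
    constructor
    · rintro ⟨t, ht, rfl⟩
      exact mem_image_of_mem _ (hmaps ht)
    · rintro ⟨t, ht, rfl⟩
      exact ⟨t + 1, ⟨by linarith [ht.1], by linarith [ht.2]⟩, by simp⟩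
  refine ⟨f, ?_, ?_, ?_, ?_, ?_, ?_, ?_, i1, i2⟩
  · rw [hu]
    refine ContinuousOn.union_of_isClosed (hc.congr h1) ?_ isClosed_Icc isClosed_Icc
    exact (hc'.comp (by fun_prop) hmaps).congr h2
  · rw [hu, image_union, i1, i2]
  · exact h1 ⟨le_rfl, zero_le_one⟩
  · rw [h1 ⟨zero_le_one, le_rfl⟩, hb]
  · rw [h2 ⟨by norm_num, le_rfl⟩]; norm_num
  · exact hi.congr h1.symm
  · refine InjOn.congr (hi'.comp (fun t _ t' _ h => ?_) hmaps) h2.symm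
    simpa using h

theorem IsArc.trans {S S' : Set X} {a b c : X} (h : IsArc S a b) (h' : IsArc S' b c)
    (hS : ∀ x ∈ S, x ∈ S' → x = b) : IsArc (S ∪ S') a c := by
  obtain ⟨f, hc, him, h0, h1, h2, hi1, hi2, im1, im2⟩ := h.exists_concat h'
  rw [← him, ← h0, ← h2]
  refine isArc_image_Icc (by norm_num) hc ?_
  have key : ∀ t ∈ Icc (0 : ℝ) 1, ∀ t' ∈ Icc (1 : ℝ) 2, f t = f t' → t = t' := by
    intro t ht t' ht' hft
    have hx : f t = b := hS _ (im1 ▸ mem_image_of_mem _ ht) (by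
      rw [hft, ← im2]; exact mem_image_of_mem _ ht')
    have e1 : t = 1 := hi1 ht ⟨zero_le_one, le_rfl⟩ (by rw [hx, h1])
    have e2 : t' = 1 := hi2 ht' ⟨le_rfl, by norm_num⟩ (by rw [← hft, hx, h1])
    rw [e1, e2]
  intro t ht t' ht' hft
  rcases le_total t 1 with l | l <;> rcases le_total t' 1 with l' | l'
  · exact hi1 ⟨ht.1, l⟩ ⟨ht'.1, l'⟩ hft
  · exact key t ⟨ht.1, l⟩ t' ⟨l', ht'.2⟩ hft
  · exact (key t' ⟨ht'.1, l'⟩ t ⟨l, ht.2⟩ hft.symm).symm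
  · exact hi2 ⟨l, ht.2⟩ ⟨l', ht'.2⟩ hft

/-- Running along one arc and back along the other gives a closed path on `[0, 2]`. It descends to a
continuous injection of the circle, which is an embedding because the circle is compact and `X` is
Hausdorff. -/
theorem IsArc.homeomorph_circle [T2Space X] {S S' : Set X} {a b : X} (h : IsArc S a b)
    (h' : IsArc S' a b) (hS : ∀ x ∈ S, x ∈ S' → x = a ∨ x = b) :
    Nonempty (↥(S ∪ S') ≃ₜ AddCircle (2 : ℝ)) := by
  have : Fact ((0 : ℝ) < 2) := ⟨by norm_num⟩
  obtain ⟨f, hc, him, h0, h1, h2, hi1, hi2, im1, im2⟩ := h.exists_concat h'.symm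
  have hcont : Continuous (AddCircle.liftIco (2 : ℝ) 0 f) :=
    AddCircle.liftIco_zero_continuous (h0.trans h2.symm) hc
  have hrep : ∀ x : AddCircle (2 : ℝ), ∃ t ∈ Ico (0 : ℝ) 2, (t : AddCircle (2 : ℝ)) = x ∧
      AddCircle.liftIco (2 : ℝ) 0 f x = f t := by
    intro x
    obtain ⟨t, ht, rfl⟩ := AddCircle.coe_image_Ico_eq (2 : ℝ) 0 ▸ mem_univ x
    rw [zero_add] at ht
    exact ⟨t, ht, rfl, AddCircle.liftIco_zero_coe_apply ht⟩
  have key : ∀ t ∈ Icc (0 : ℝ) 1, ∀ t' ∈ Ico (1 : ℝ) 2, f t = f t' → t = t' := by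
    intro t ht t' ht' hft
    have hx := hS (f t) (im1 ▸ mem_image_of_mem _ ht) (by
      rw [hft, ← im2]; exact mem_image_of_mem _ ⟨ht'.1, ht'.2.le⟩)
    rcases hx with hx | hx
    · have e2 : t' = 2 := hi2 ⟨ht'.1, ht'.2.le⟩ ⟨by norm_num, le_rfl⟩ (by rw [← hft, hx, h2])
      exact absurd ht'.2 (by rw [e2]; exact lt_irrefl _)
    · have e1 : t = 1 := hi1 ht ⟨zero_le_one, le_rfl⟩ (by rw [hx, h1])
      have e2 : t' = 1 := hi2 ⟨ht'.1, ht'.2.le⟩ ⟨le_rfl, by norm_num⟩ (by rw [← hft, hx, h1])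
      rw [e1, e2]
  have hinj : Function.Injective (AddCircle.liftIco (2 : ℝ) 0 f) := by
    intro x x' hx
    obtain ⟨t, ht, rfl, e⟩ := hrep x
    obtain ⟨t', ht', rfl, e'⟩ := hrep x'
    rw [e, e'] at hx
    congr 1
    rcases le_total t 1 with l | l <;> rcases le_total t' 1 with l' | l'
    · exact hi1 ⟨ht.1, l⟩ ⟨ht'.1, l'⟩ hx
    · exact key t ⟨ht.1, l⟩ t' ⟨l', ht'.2⟩ hx
    · exact (key t' ⟨ht'.1, l'⟩ t ⟨l, ht.2⟩ hx.symm).symm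
    · exact hi2 ⟨l, ht.2.le⟩ ⟨l', ht'.2.le⟩ hx
  have hrange : range (AddCircle.liftIco (2 : ℝ) 0 f) = S ∪ S' := by
    rw [← him]
    ext x
    constructor
    · rintro ⟨y, rfl⟩
      obtain ⟨t, ht, -, e⟩ := hrep y
      rw [e]
      exact mem_image_of_mem _ ⟨ht.1, ht.2.le⟩
    · rintro ⟨t, ht, rfl⟩
      rcases ht.2.eq_or_lt with h | h
      · refine ⟨((0 : ℝ) : AddCircle (2 : ℝ)), ?_⟩
        rw [AddCircle.liftIco_zero_coe_apply ⟨le_rfl, by norm_num⟩, h, h0, h2]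
      · exact ⟨(t : AddCircle (2 : ℝ)), AddCircle.liftIco_zero_coe_apply ⟨ht.1, h⟩⟩
  have hemb := (hcont.isClosedEmbedding hinj).isEmbedding
  exact ⟨(Homeomorph.setCongr hrange).symm.trans hemb.toHomeomorph.symm⟩

/-- Removing an arc that is attached at one end does not change the homotopy type. -/
theorem IsArc.homotopyEquiv_union [T2Space X] {S S' : Set X} {a b : X} (hS : IsClosed S)
    (h' : IsArc S' a b) (hb : b ∈ S) (hSS : ∀ x ∈ S, x ∈ S' → x = b) :
    Nonempty (ContinuousMap.HomotopyEquiv ↥(S ∪ S') ↥S) := by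
  classical
  have hS'c : IsClosed S' := h'.isCompact.isClosed
  have hbS' := h'.right_mem
  obtain ⟨φ, hc, hi, rfl, rfl, rfl⟩ := h'
  set θ : X → ℝ := Function.invFunOn φ (Icc 0 1) with hθ
  have hθmem : ∀ x ∈ φ '' Icc 0 1, θ x ∈ Icc (0 : ℝ) 1 := fun x hx => Function.invFunOn_mem hx
  have hφθ : ∀ x ∈ φ '' Icc 0 1, φ (θ x) = x := fun x hx => Function.invFunOn_eq hx
  have hθφ : ∀ t ∈ Icc (0 : ℝ) 1, θ (φ t) = t := fun t ht =>
    hi (hθmem _ (mem_image_of_mem _ ht)) ht (hφθ _ (mem_image_of_mem _ ht))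
  -- The inverse of the parametrization is continuous since closed subsets of the interval have
  -- compact, hence closed, images.
  have hθc : ContinuousOn θ (φ '' Icc 0 1) := by
    rw [continuousOn_iff_isClosed]
    intro C hC
    refine ⟨φ '' (Icc 0 1 ∩ C), ?_, ?_⟩
    · exact ((isCompact_Icc.inter_right hC).image_of_continuousOn
        (hc.mono inter_subset_left)).isClosed
    · ext x
      constructor
      · rintro ⟨h1, h2⟩
        exact ⟨⟨θ x, ⟨hθmem x h2, h1⟩, hφθ x h2⟩, h2⟩
      · rintro ⟨⟨t, ⟨h1, h2⟩, rfl⟩, h3⟩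
        refine ⟨?_, h3⟩
        rw [mem_preimage, hθφ t h1]
        exact h2
  -- The deformation fixes `S` and moves the parameter `θ` of a point of the arc linearly to `1`,
  -- that is, the point slides to the end where the arc is attached.
  set H : ℝ × X → X := fun z => if z.2 ∈ S then z.2 else φ (z.1 + (1 - z.1) * θ z.2) with hH
  have hmid : ∀ t ∈ Icc (0 : ℝ) 1, ∀ s ∈ Icc (0 : ℝ) 1, t + (1 - t) * s ∈ Icc (0 : ℝ) 1 := by
    rintro t ⟨h1, h2⟩ s ⟨h3, h4⟩
    constructor <;> nlinarith
  have hH1 : EqOn H Prod.snd (Icc (0 : ℝ) 1 ×ˢ S) := fun z hz => if_pos hz.2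
  have hH2 : EqOn H (fun z => φ (z.1 + (1 - z.1) * θ z.2)) (Icc (0 : ℝ) 1 ×ˢ (φ '' Icc 0 1)) := by
    intro z hz
    by_cases h : z.2 ∈ S
    · have h1 : z.2 = φ 1 := hSS _ h hz.2
      simp only [hH, if_pos h]
      rw [h1, hθφ 1 ⟨zero_le_one, le_rfl⟩]
      congr 1; ring
    · exact if_neg h
  have hHc : ContinuousOn H (Icc (0 : ℝ) 1 ×ˢ (S ∪ φ '' Icc 0 1)) := by
    rw [prod_union]
    refine ContinuousOn.union_of_isClosed (continuousOn_snd.congr hH1) ?_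
      (isClosed_Icc.prod hS) (isClosed_Icc.prod hS'c)
    refine ContinuousOn.congr ?_ hH2
    refine hc.comp ?_ (fun z hz => hmid _ hz.1 _ (hθmem _ hz.2))
    have : ContinuousOn (fun z : ℝ × X => θ z.2) (Icc (0 : ℝ) 1 ×ˢ (φ '' Icc 0 1)) :=
      hθc.comp continuousOn_snd (fun z hz => hz.2)
    exact continuousOn_fst.add ((continuousOn_const.sub continuousOn_fst).mul this)
  have hHmem : ∀ z ∈ Icc (0 : ℝ) 1 ×ˢ (S ∪ φ '' Icc 0 1), H z ∈ S ∪ φ '' Icc 0 1 := by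
    rintro z ⟨h1, h2⟩
    by_cases h : z.2 ∈ S
    · rw [hH1 ⟨h1, h⟩]; exact h2
    · have h3 := h2.resolve_left h
      rw [hH2 ⟨h1, h3⟩]
      exact Or.inr (mem_image_of_mem _ (hmid _ h1 _ (hθmem _ h3)))
  have hH1mem : ∀ x ∈ S ∪ φ '' Icc 0 1, H (1, x) ∈ S := by
    intro x hx
    by_cases h : x ∈ S
    · simp only [hH, if_pos h]; exact h
    · simp only [hH, if_neg h]
      rw [sub_self, zero_mul, add_zero]; exact hb
  have hH0 : ∀ x ∈ S ∪ φ '' Icc 0 1, H (0, x) = x := by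
    intro x hx
    by_cases h : x ∈ S
    · simp only [hH, if_pos h]
    · simp only [hH, if_neg h]
      rw [sub_zero, one_mul, zero_add]
      exact hφθ x (hx.resolve_left h)
  have hcr : Continuous fun x : ↥(S ∪ φ '' Icc 0 1) => (⟨H (1, x.1), hH1mem x.1 x.2⟩ : S) := by
    refine Continuous.subtype_mk ?_ _
    exact hHc.comp_continuous (by fun_prop) fun x => ⟨⟨zero_le_one, le_rfl⟩, x.2⟩
  let r : C(↥(S ∪ φ '' Icc 0 1), S) := ⟨_, hcr⟩
  let i : C(S, ↥(S ∪ φ '' Icc 0 1)) := ⟨fun x => ⟨x.1, Or.inl x.2⟩, by fun_prop⟩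
  have hri : r.comp i = ContinuousMap.id S := by
    ext x
    change H (1, x.1) = x.1
    exact if_pos x.2
  have hir : (ContinuousMap.id ↥(S ∪ φ '' Icc 0 1)).Homotopic (i.comp r) := by
    refine ⟨⟨⟨fun z => ⟨H (z.1.1, z.2.1), hHmem _ ⟨z.1.2, z.2.2⟩⟩, ?_⟩, ?_, ?_⟩⟩
    · refine Continuous.subtype_mk ?_ _
      exact hHc.comp_continuous
        (f := fun z : unitInterval × ↥(S ∪ φ '' Icc 0 1) => ((z.1 : ℝ), (z.2.1 : X)))
        ((continuous_subtype_val.comp continuous_fst).prodMk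
          (continuous_subtype_val.comp continuous_snd)) fun z => ⟨z.1.2, z.2.2⟩
    · intro x
      exact Subtype.ext (hH0 x.1 x.2)
    · intro x
      rfl
  exact ⟨⟨r, i, hir.symm, by rw [hri]⟩⟩

end TopologicalGraph

section TopologicalGraph

variable {X : Type*} [TopologicalSpace X] {ι : Type*}

/-- The arcs `arc e`, for `e` in `B`, meet each other and the node set `A` only in their ends. -/
structure IsTopGraph (A : Finset X) (B : Finset ι) (arc : ι → Set X) (src tgt : ι → X) : Prop where
  isArc : ∀ e ∈ B, IsArc (arc e) (src e) (tgt e)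
  src_mem : ∀ e ∈ B, src e ∈ A
  tgt_mem : ∀ e ∈ B, tgt e ∈ A
  arc_inter_nodes : ∀ e ∈ B, ∀ x ∈ arc e, x ∈ A → x = src e ∨ x = tgt e
  arc_inter : ∀ e ∈ B, ∀ e' ∈ B, e ≠ e' → ∀ x ∈ arc e, x ∈ arc e' → x ∈ A

/-- The union of the nodes and the arcs. -/
def graphBody (A : Finset X) (B : Finset ι) (arc : ι → Set X) : Set X := ↑A ∪ ⋃ e ∈ B, arc e

/-- Combinatorial connectedness: a property that passes along arcs holds everywhere or nowhere. -/
def IsLinked (A : Finset X) (B : Finset ι) (src tgt : ι → X) : Prop :=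
  ∀ f : X → Prop, (∀ e ∈ B, f (src e) ↔ f (tgt e)) → ∀ a ∈ A, ∀ b ∈ A, f a → f b

open Classical in
/-- The number of arcs at a node. -/
noncomputable def nodeDegree (B : Finset ι) (src tgt : ι → X) (a : X) : ℕ :=
  (B.filter fun e => src e = a ∨ tgt e = a).card

variable {A : Finset X} {B : Finset ι} {arc : ι → Set X} {src tgt : ι → X}

set_option linter.unusedSectionVars false in
theorem mem_graphBody {x : X} : x ∈ graphBody A B arc ↔ x ∈ A ∨ ∃ e ∈ B, x ∈ arc e := by
  simp [graphBody]

-- Incidences are counted twice; the two ends of an arc are different, so each is counted once. The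
-- weight `f` is needed for the parity argument in `isLinked_erase`.
open Classical in
theorem IsTopGraph.sum_filter_degree (h : IsTopGraph A B arc src tgt) (f : X → Prop) :
    ∑ a ∈ A.filter f, nodeDegree B src tgt a =
      ∑ e ∈ B, ((if f (src e) then 1 else 0) + (if f (tgt e) then 1 else 0)) := by
  have h1 := Finset.sum_card_bipartiteAbove_eq_sum_card_bipartiteBelow (s := A.filter f) (t := B)
    (fun a e => src e = a ∨ tgt e = a)
  unfold Finset.bipartiteAbove Finset.bipartiteBelow at h1
  unfold nodeDegree
  rw [h1]
  refine Finset.sum_congr rfl fun e he => ?_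
  have hne := (h.isArc e he).ne
  have hs := h.src_mem e he
  have ht := h.tgt_mem e he
  have : (A.filter f).filter (fun a => src e = a ∨ tgt e = a) =
      ({src e, tgt e} : Finset X).filter f := by
    ext a
    simp only [Finset.mem_filter, Finset.mem_insert, Finset.mem_singleton]
    constructor
    · rintro ⟨⟨-, h2⟩, h3⟩
      exact ⟨h3.imp Eq.symm Eq.symm, h2⟩
    · rintro ⟨rfl | rfl, h2⟩
      · exact ⟨⟨hs, h2⟩, Or.inl rfl⟩
      · exact ⟨⟨ht, h2⟩, Or.inr rfl⟩
  rw [this, Finset.filter_insert, Finset.filter_singleton]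
  split_ifs <;> simp [hne]

theorem IsTopGraph.sum_degree (h : IsTopGraph A B arc src tgt) :
    ∑ a ∈ A, nodeDegree B src tgt a = 2 * B.card := by
  classical
  have := h.sum_filter_degree (fun _ => True)
  rw [Finset.filter_true] at this
  rw [this]
  simp [mul_comm]

-- For an isolated node `a`, the property of being equal to `a` would pass along all arcs.
set_option linter.unusedSectionVars false in
theorem IsLinked.degree_pos (h : IsLinked A B src tgt) (hA : 2 ≤ A.card) {a : X} (ha : a ∈ A) :
    1 ≤ nodeDegree B src tgt a := by
  classical
  by_contra hcon
  have h0 : nodeDegree B src tgt a = 0 := by omega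
  unfold nodeDegree at h0
  rw [Finset.card_eq_zero, Finset.filter_eq_empty_iff] at h0
  obtain ⟨b, hb, hne⟩ := Finset.exists_mem_ne (show 1 < A.card by omega) a
  have := h (fun x => x = a) (fun e he => by
    have := h0 he
    push Not at this
    exact ⟨fun h => absurd h this.1, fun h => absurd h this.2⟩) a ha b hb rfl
  exact hne this

set_option linter.unusedSectionVars false in
open Classical in
/-- The unique arc at a node of degree one. -/
theorem exists_leaf_arc {a : X} (h : nodeDegree B src tgt a = 1) :
    ∃ e ∈ B, (src e = a ∨ tgt e = a) ∧ ∀ e' ∈ B.erase e, src e' ≠ a ∧ tgt e' ≠ a := by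
  unfold nodeDegree at h
  obtain ⟨e, he⟩ := Finset.card_eq_one.1 h
  have h1 : e ∈ B.filter fun e => src e = a ∨ tgt e = a := by rw [he]; simp
  rw [Finset.mem_filter] at h1
  refine ⟨e, h1.1, h1.2, fun e' he' => ?_⟩
  rw [Finset.mem_erase] at he'
  by_contra hcon
  have : e' ∈ B.filter fun e => src e = a ∨ tgt e = a := by
    rw [Finset.mem_filter]
    exact ⟨he'.2, by tauto⟩
  rw [he, Finset.mem_singleton] at this
  exact he'.1 this

open Classical in
/-- The structure of the graph at a leaf. -/
theorem IsTopGraph.exists_prune (h : IsTopGraph A B arc src tgt) (hl : IsLinked A B src tgt)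
    {a : X} (ha : a ∈ A) (hd : nodeDegree B src tgt a = 1) :
    ∃ e ∈ B, ∃ b ∈ A, b ≠ a ∧ ((src e = a ∧ tgt e = b) ∨ (src e = b ∧ tgt e = a)) ∧
      IsArc (arc e) a b ∧
      IsTopGraph (A.erase a) (B.erase e) arc src tgt ∧ IsLinked (A.erase a) (B.erase e) src tgt ∧
      graphBody A B arc = graphBody (A.erase a) (B.erase e) arc ∪ arc e ∧
      ∀ x ∈ graphBody (A.erase a) (B.erase e) arc, x ∈ arc e → x = b := by
  obtain ⟨e, he, hea, hother⟩ := exists_leaf_arc hd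
  have harc := h.isArc e he
  obtain ⟨b, hb, hba, hcase, harc'⟩ : ∃ b ∈ A, b ≠ a ∧
      ((src e = a ∧ tgt e = b) ∨ (src e = b ∧ tgt e = a)) ∧ IsArc (arc e) a b := by
    rcases hea with rfl | rfl
    · exact ⟨_, h.tgt_mem e he, harc.ne.symm, Or.inl ⟨rfl, rfl⟩, harc⟩
    · exact ⟨_, h.src_mem e he, harc.ne, Or.inr ⟨rfl, rfl⟩, harc.symm⟩
  have hends : ∀ x ∈ arc e, x ∈ A → x = a ∨ x = b := by
    intro x hx hxA
    have := h.arc_inter_nodes e he x hx hxA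
    rcases hcase with ⟨h1, h2⟩ | ⟨h1, h2⟩ <;> rw [h1, h2] at this
    · exact this
    · exact this.symm
  have hna : ∀ e' ∈ B.erase e, a ∉ arc e' := by
    intro e' he' hx
    rcases h.arc_inter_nodes e' (Finset.mem_of_mem_erase he') a hx ha with h1 | h1
    · exact (hother e' he').1 h1.symm
    · exact (hother e' he').2 h1.symm
  refine ⟨e, he, b, hb, hba, hcase, harc', ?_, ?_, ?_, ?_⟩
  · constructor
    · exact fun e' he' => h.isArc e' (Finset.mem_of_mem_erase he')
    · exact fun e' he' => Finset.mem_erase.2 ⟨(hother e' he').1,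
        h.src_mem e' (Finset.mem_of_mem_erase he')⟩
    · exact fun e' he' => Finset.mem_erase.2 ⟨(hother e' he').2,
        h.tgt_mem e' (Finset.mem_of_mem_erase he')⟩
    · exact fun e' he' x hx hxA => h.arc_inter_nodes e' (Finset.mem_of_mem_erase he') x hx
        (Finset.mem_of_mem_erase hxA)
    · intro e' he' e'' he'' hne x hx hx'
      refine Finset.mem_erase.2 ⟨?_, h.arc_inter e' (Finset.mem_of_mem_erase he') e''
        (Finset.mem_of_mem_erase he'') hne x hx hx'⟩
      rintro rfl
      exact hna e' he' hx
  · intro f hf c hc d hd' hfc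
    rw [Finset.mem_erase] at hc hd'
    -- A property of the nodes of the smaller graph is extended to the leaf by its value at the
    -- neighbour `b`, so that it passes along the removed arc too.
    have := hl (fun x => if x = a then f b else f x) (fun e' he' => by
      by_cases hee : e' = e
      · subst hee
        rcases hcase with ⟨h1, h2⟩ | ⟨h1, h2⟩ <;> rw [h1, h2] <;> simp [hba]
      · have hm : e' ∈ B.erase e := Finset.mem_erase.2 ⟨hee, he'⟩
        have := hother e' hm
        simp only [this.1, this.2, if_false]
        exact hf e' hm) c hc.2 d hd'.2 (by simpa [hc.1] using hfc)
    simpa [hd'.1] using this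
  · ext x
    simp only [mem_union, mem_graphBody, Finset.mem_erase]
    constructor
    · rintro (hx | ⟨e', he', hx⟩)
      · by_cases hxa : x = a
        · subst hxa; exact Or.inr harc'.left_mem
        · exact Or.inl (Or.inl ⟨hxa, hx⟩)
      · by_cases hee : e' = e
        · subst hee; exact Or.inr hx
        · exact Or.inl (Or.inr ⟨e', ⟨hee, he'⟩, hx⟩)
    · rintro ((hx | ⟨e', he', hx⟩) | hx)
      · exact Or.inl hx.2
      · exact Or.inr ⟨e', he'.2, hx⟩
      · exact Or.inr ⟨e, he, hx⟩
  · intro x hx hxe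
    rw [mem_graphBody] at hx
    rcases hx with hx | ⟨e', he', hx⟩
    · rw [Finset.mem_erase] at hx
      exact (hends x hxe hx.2).resolve_left hx.1
    · have he2 := Finset.mem_erase.1 he'
      have hxA := h.arc_inter e' he2.2 e he he2.1 x hx hxe
      refine (hends x hxe hxA).resolve_left ?_
      rintro rfl
      exact hna e' he' hx

theorem IsTopGraph.isClosed_graphBody [T2Space X] (h : IsTopGraph A B arc src tgt) :
    IsClosed (graphBody A B arc) := by
  refine A.finite_toSet.isClosed.union ?_
  exact B.finite_toSet.isClosed_biUnion fun e he => (h.isArc e he).isCompact.isClosed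

theorem IsTopGraph.prune_homotopyEquiv [T2Space X] {A' : Finset X} {B' : Finset ι}
    (h : IsTopGraph A' B' arc src tgt) {e : ι} {a b : X} (hb : b ∈ A') (harc : IsArc (arc e) a b)
    (hbody : graphBody A B arc = graphBody A' B' arc ∪ arc e)
    (hinter : ∀ x ∈ graphBody A' B' arc, x ∈ arc e → x = b) :
    Nonempty (ContinuousMap.HomotopyEquiv ↥(graphBody A B arc) ↥(graphBody A' B' arc)) := by
  rw [hbody]
  exact harc.homotopyEquiv_union h.isClosed_graphBody (mem_graphBody.2 (Or.inl hb)) hinter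

/-- A tree is contractible. -/
theorem IsTopGraph.contractibleSpace [T2Space X] (h : IsTopGraph A B arc src tgt)
    (hl : IsLinked A B src tgt) (hc : B.card + 1 = A.card) :
    ContractibleSpace ↥(graphBody A B arc) := by
  classical
  induction hn : A.card using Nat.strong_induction_on generalizing A B with
  | _ n ih =>
  by_cases h2 : 2 ≤ A.card
  · obtain ⟨a, ha, hlt⟩ : ∃ a ∈ A, nodeDegree B src tgt a < 2 := by
      by_contra hcon
      push Not at hcon
      have h3 := Finset.card_nsmul_le_sum A (nodeDegree B src tgt) 2 hcon
      rw [h.sum_degree, smul_eq_mul] at h3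
      omega
    have hd : nodeDegree B src tgt a = 1 := by
      have := hl.degree_pos h2 ha
      omega
    obtain ⟨e, he, b, hb, hba, -, harc, hg, hl', hbody, hinter⟩ := h.exists_prune hl ha hd
    have c1 := Finset.card_erase_of_mem ha
    have c2 := Finset.card_erase_of_mem he
    have c3 : 0 < B.card := Finset.card_pos.2 ⟨e, he⟩
    have := ih _ (by omega) hg hl' (by omega) rfl
    obtain ⟨E⟩ := hg.prune_homotopyEquiv (Finset.mem_erase.2 ⟨hba, hb⟩) harc hbody hinter
    exact E.contractibleSpace
  · have hA : A.card = 1 := by omega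
    have hB : B = ∅ := Finset.card_eq_zero.1 (by omega)
    obtain ⟨a, rfl⟩ := Finset.card_eq_one.1 hA
    have hbody : graphBody {a} B arc = {a} := by
      ext x
      rw [mem_graphBody]
      simp [hB]
    rw [hbody]
    infer_instance

/-- A tree without branching is an arc. -/
theorem IsTopGraph.exists_isArc [T2Space X] (h : IsTopGraph A B arc src tgt)
    (hl : IsLinked A B src tgt) (hc : B.card + 1 = A.card) (h2 : 2 ≤ A.card)
    (hdeg : ∀ a ∈ A, nodeDegree B src tgt a ≤ 2) {a : X} (ha : a ∈ A)
    (hd : nodeDegree B src tgt a = 1) :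
    ∃ c ∈ A, c ≠ a ∧ nodeDegree B src tgt c = 1 ∧ IsArc (graphBody A B arc) a c := by
  classical
  induction hn : A.card using Nat.strong_induction_on generalizing A B a with
  | _ n ih =>
  obtain ⟨e, he, b, hb, hba, hcase, harc, hg, hl', hbody, hinter⟩ := h.exists_prune hl ha hd
  have c1 := Finset.card_erase_of_mem ha
  have c2 := Finset.card_erase_of_mem he
  have c3 : 0 < B.card := Finset.card_pos.2 ⟨e, he⟩
  have hdeg' : ∀ c, nodeDegree B src tgt c =
      nodeDegree (B.erase e) src tgt c + if src e = c ∨ tgt e = c then 1 else 0 := by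
    intro c
    unfold nodeDegree
    conv_lhs => rw [← Finset.insert_erase he]
    rw [Finset.filter_insert]
    split_ifs
    · rw [Finset.card_insert_of_notMem (by simp)]
    · rfl
  have hbe : src e = b ∨ tgt e = b := by tauto
  have hb' : b ∈ A.erase a := Finset.mem_erase.2 ⟨hba, hb⟩
  by_cases h3 : A.card = 2
  · have hA' : A.erase a = {b} := by
      refine (Finset.eq_of_subset_of_card_le (by simpa using hb') ?_).symm
      rw [c1, h3]; simp
    have hB' : B.erase e = ∅ := Finset.card_eq_zero.1 (by omega)
    refine ⟨b, hb, hba, ?_, ?_⟩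
    · rw [hdeg' b, if_pos hbe, hB']; simp [nodeDegree]
    · have : graphBody A B arc = arc e := by
        rw [hbody, hA', hB', union_eq_right]
        intro x hx
        rw [mem_graphBody] at hx
        simp only [Finset.mem_singleton, Finset.notMem_empty, false_and, exists_false, or_false]
          at hx
        rw [hx]; exact harc.right_mem
      rw [this]; exact harc
  -- The neighbour `b` had at most two arcs and has lost one, so it is a leaf of the smaller graph;
  -- the arc that starts there by induction is prolonged to `a`.
  · have hbd := hdeg' b
    rw [if_pos hbe] at hbd
    have hbd2 := hl'.degree_pos (by omega) hb'
    have hbd3 := hdeg b hb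
    obtain ⟨c, hc', hcb, hcd, hcarc⟩ := ih _ (by omega) hg hl' (by omega) (by omega)
      (fun x hx => by
        have h4 := hdeg x (Finset.mem_of_mem_erase hx)
        have h5 := hdeg' x
        omega) hb' (by omega) rfl
    rw [Finset.mem_erase] at hc'
    refine ⟨c, hc'.2, hc'.1, ?_, ?_⟩
    · rw [hdeg' c, if_neg, hcd]
      rcases hcase with ⟨e1, e2⟩ | ⟨e1, e2⟩ <;> rw [e1, e2] <;> simp [hcb.symm, hc'.1.symm]
    · rw [hbody, union_comm]
      exact harc.trans hcarc fun x hx hx' => hinter x hx' hx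

open Classical in
/-- In a linked graph with all degrees equal to two, every arc may be removed. -/
theorem IsTopGraph.isLinked_erase (h : IsTopGraph A B arc src tgt) (hl : IsLinked A B src tgt)
    (hdeg : ∀ a ∈ A, nodeDegree B src tgt a = 2) {e : ι} (he : e ∈ B) :
    IsLinked A (B.erase e) src tgt := by
  intro f hf
  refine hl f fun e' he' => ?_
  by_cases hee : e' = e
  · subst hee
    -- Parity: the degrees of the nodes with property `f` have an even sum, and every arc except
    -- `e'` contributes zero or two to it. So `e'` has both of its ends or none among these nodes.
    have h1 := h.sum_filter_degree f
    rw [Finset.sum_congr rfl (fun a ha => hdeg a (Finset.mem_filter.1 ha).1), Finset.sum_const,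
      smul_eq_mul, ← Finset.add_sum_erase _ _ he'] at h1
    have h2 : ∑ x ∈ B.erase e', ((if f (src x) then 1 else 0) + (if f (tgt x) then 1 else 0)) =
        (∑ x ∈ B.erase e', if f (src x) then 1 else 0) * 2 := by
      rw [Finset.sum_mul]
      refine Finset.sum_congr rfl fun x hx => ?_
      rw [show (f (tgt x)) = f (src x) from (propext (hf x hx)).symm]
      ring
    rw [h2] at h1
    by_cases hs : f (src e') <;> by_cases ht : f (tgt e') <;> simp only [hs, ht, if_true, if_false]
      at h1 ⊢ <;> omega
  · exact hf e' (Finset.mem_erase.2 ⟨hee, he'⟩)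

/-- A linked graph with as many arcs as nodes is homotopy equivalent to the circle. -/
theorem IsTopGraph.homotopyEquiv_circle [T2Space X] (h : IsTopGraph A B arc src tgt)
    (hl : IsLinked A B src tgt) (hc : B.card = A.card) (hne : A.Nonempty) :
    Nonempty (ContinuousMap.HomotopyEquiv ↥(graphBody A B arc) (AddCircle (2 : ℝ))) := by
  classical
  induction hn : A.card using Nat.strong_induction_on generalizing A B with
  | _ n ih =>
  have hA := hne.card_pos
  obtain ⟨e₀, he₀⟩ : B.Nonempty := Finset.card_pos.1 (by omega)
  have h2 : 2 ≤ A.card := by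
    have : ({src e₀, tgt e₀} : Finset X) ⊆ A := by
      intro x hx
      rw [Finset.mem_insert, Finset.mem_singleton] at hx
      rcases hx with rfl | rfl
      exacts [h.src_mem _ he₀, h.tgt_mem _ he₀]
    have h3 := Finset.card_le_card this
    rwa [Finset.card_pair (h.isArc e₀ he₀).ne] at h3
  by_cases hleaf : ∃ a ∈ A, nodeDegree B src tgt a = 1
  · obtain ⟨a, ha, hd⟩ := hleaf
    obtain ⟨e, he, b, hb, hba, -, harc, hg, hl', hbody, hinter⟩ := h.exists_prune hl ha hd
    have c1 := Finset.card_erase_of_mem ha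
    have c2 := Finset.card_erase_of_mem he
    have hb' : b ∈ A.erase a := Finset.mem_erase.2 ⟨hba, hb⟩
    obtain ⟨E'⟩ := ih _ (by omega) hg hl' (by omega) ⟨b, hb'⟩ rfl
    obtain ⟨E⟩ := hg.prune_homotopyEquiv hb' harc hbody hinter
    exact ⟨E.trans E'⟩
  -- Without leaves all degrees are at least two, and two is their average, so all are equal to two.
  -- Removing one arc leaves an unbranched tree, which is an arc between the two ends of the removed
  -- one; putting this back closes the circle.
  · have hge : ∀ a ∈ A, 2 ≤ nodeDegree B src tgt a := by
      intro a ha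
      have h3 := hl.degree_pos h2 ha
      have h4 : nodeDegree B src tgt a ≠ 1 := fun h => hleaf ⟨a, ha, h⟩
      omega
    have hdeg : ∀ a ∈ A, nodeDegree B src tgt a = 2 := by
      have h3 : ∑ a ∈ A, 2 = ∑ a ∈ A, nodeDegree B src tgt a := by
        rw [h.sum_degree, Finset.sum_const, smul_eq_mul]; omega
      intro a ha
      exact ((Finset.sum_eq_sum_iff_of_le hge).1 h3 a ha).symm
    have hl' := h.isLinked_erase hl hdeg he₀
    have hg : IsTopGraph A (B.erase e₀) arc src tgt :=
      ⟨fun e he => h.isArc e (Finset.mem_of_mem_erase he),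
        fun e he => h.src_mem e (Finset.mem_of_mem_erase he),
        fun e he => h.tgt_mem e (Finset.mem_of_mem_erase he),
        fun e he => h.arc_inter_nodes e (Finset.mem_of_mem_erase he),
        fun e he e' he' => h.arc_inter e (Finset.mem_of_mem_erase he) e'
          (Finset.mem_of_mem_erase he')⟩
    have hdeg' : ∀ c ∈ A, nodeDegree (B.erase e₀) src tgt c +
        (if src e₀ = c ∨ tgt e₀ = c then 1 else 0) = 2 := by
      intro c hcA
      rw [← hdeg c hcA]
      unfold nodeDegree
      conv_rhs => rw [← Finset.insert_erase he₀]
      rw [Finset.filter_insert]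
      split_ifs
      · rw [Finset.card_insert_of_notMem (by simp)]
      · rfl
    have c2 := Finset.card_erase_of_mem he₀
    obtain ⟨c, hcA, hca, hcd, hcarc⟩ := hg.exists_isArc hl' (by omega) h2
      (fun a ha => by have := hdeg' a ha; omega) (h.src_mem e₀ he₀) (by
        have := hdeg' _ (h.src_mem e₀ he₀)
        simpa using this)
    have hct : c = tgt e₀ := by
      have := hdeg' c hcA
      by_contra hcon
      rw [if_neg, hcd] at this
      · omega
      · rintro (h5 | h5)
        exacts [hca h5.symm, hcon h5.symm]
    subst hct
    have hbody : graphBody A B arc = graphBody A (B.erase e₀) arc ∪ arc e₀ := by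
      ext x
      simp only [mem_union, mem_graphBody, Finset.mem_erase]
      constructor
      · rintro (hx | ⟨e', he', hx⟩)
        · exact Or.inl (Or.inl hx)
        · by_cases hee : e' = e₀
          · subst hee; exact Or.inr hx
          · exact Or.inl (Or.inr ⟨e', ⟨hee, he'⟩, hx⟩)
      · rintro ((hx | ⟨e', he', hx⟩) | hx)
        · exact Or.inl hx
        · exact Or.inr ⟨e', he'.2, hx⟩
        · exact Or.inr ⟨e₀, he₀, hx⟩
    rw [hbody]
    obtain ⟨E⟩ := hcarc.homeomorph_circle (h.isArc e₀ he₀) (fun x hx hxe => by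
      refine h.arc_inter_nodes e₀ he₀ x hxe ?_
      rw [mem_graphBody] at hx
      rcases hx with hx | ⟨e', he', hx⟩
      · exact hx
      · rw [Finset.mem_erase] at he'
        exact h.arc_inter e' he'.2 e₀ he₀ he'.1 x hx hxe)
    exact ⟨E.toHomotopyEquiv⟩

/-- A graph with connected body is linked. -/
theorem IsTopGraph.isLinked [T2Space X] (h : IsTopGraph A B arc src tgt)
    (hc : IsPreconnected (graphBody A B arc)) : IsLinked A B src tgt := by
  classical
  intro f hf a ha b hb hfa
  by_contra hfb
  -- The part of the graph where the property holds and the part where it fails are closed and cover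
  -- the body; they are disjoint because the property passes along arcs.
  let W : (X → Prop) → Set X := fun g => {x | x ∈ A ∧ g x} ∪ ⋃ e ∈ {e | e ∈ B ∧ g (src e)}, arc e
  have hcl : ∀ g : X → Prop, IsClosed (W g) := fun g =>
    (A.finite_toSet.subset fun x hx => hx.1).isClosed.union
      ((B.finite_toSet.subset fun x hx => hx.1).isClosed_biUnion
        fun e he => (h.isArc e he.1).isCompact.isClosed)
  have hmem : ∀ (g : X → Prop) (x : X), x ∈ W g ↔ (x ∈ A ∧ g x) ∨
      ∃ e ∈ B, g (src e) ∧ x ∈ arc e := by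
    intro g x
    simp [W, and_assoc]
  have hnode : ∀ (g : X → Prop), (∀ e ∈ B, g (src e) ↔ g (tgt e)) → ∀ e ∈ B, g (src e) →
      ∀ x ∈ arc e, x ∈ A → g x := by
    intro g hg e he hge x hx hxA
    rcases h.arc_inter_nodes e he x hx hxA with rfl | rfl
    exacts [hge, (hg e he).1 hge]
  have hcov : graphBody A B arc ⊆ W f ∪ W fun x => ¬ f x := by
    intro x hx
    rw [mem_union, hmem f, hmem fun x => ¬ f x]
    rw [mem_graphBody] at hx
    rcases hx with hx | ⟨e, he, hx⟩
    · by_cases hfx : f x <;> tauto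
    · by_cases hfx : f (src e)
      · exact Or.inl (Or.inr ⟨e, he, hfx, hx⟩)
      · exact Or.inr (Or.inr ⟨e, he, hfx, hx⟩)
  obtain ⟨x, -, hx1, hx2⟩ := isPreconnected_closed_iff.1 hc _ _ (hcl f) (hcl fun x => ¬ f x) hcov
    ⟨a, mem_graphBody.2 (Or.inl ha), (hmem f a).2 (Or.inl ⟨ha, hfa⟩)⟩
    ⟨b, mem_graphBody.2 (Or.inl hb), (hmem (fun x => ¬ f x) b).2 (Or.inl ⟨hb, hfb⟩)⟩
  rw [hmem f] at hx1
  rw [hmem fun x => ¬ f x] at hx2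
  have hf' : ∀ e ∈ B, (¬ f (src e)) ↔ (¬ f (tgt e)) := fun e he => not_congr (hf e he)
  rcases hx1 with ⟨h1, h2⟩ | ⟨e, he, h1, h2⟩ <;> rcases hx2 with ⟨h3, h4⟩ | ⟨e', he', h3, h4⟩
  · exact h4 h2
  · exact hnode (fun x => ¬ f x) hf' e' he' h3 x h4 h1 h2
  · exact h4 (hnode f hf e he h1 x h2 h3)
  · by_cases hee : e = e'
    · subst hee; exact h3 h1
    · have hxA := h.arc_inter e he e' he' hee x h2 h4
      exact hnode (fun x => ¬ f x) hf' e' he' h3 x h4 hxA (hnode f hf e he h1 x h2 hxA)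

end TopologicalGraph

/-! ### The circle is not contractible -/

/-- A homotopy from a constant map to the identity lifts to the covering by the line, and its end is
a continuous section. Pulled back to the line, the section `s` differs from the identity by
multiples of the period; this difference is continuous, hence constant. But `s` takes the same value
at `0` and `2`. -/
theorem not_contractibleSpace_addCircle : ¬ ContractibleSpace (AddCircle (2 : ℝ)) := by
  intro hcon
  obtain ⟨c, ⟨H⟩⟩ := id_nullhomotopic (AddCircle (2 : ℝ))
  have H' := H.symm
  obtain ⟨c', rfl⟩ := QuotientAddGroup.mk_surjective c
  have cov := AddCircle.isCoveringMap_coe (2 : ℝ)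
  have h0 : ∀ a, H'.toContinuousMap (0, a) =
      ((ContinuousMap.const (AddCircle (2 : ℝ)) c') a : ℝ) := by
    intro a
    exact H'.map_zero_left a
  set L := cov.liftHomotopy H'.toContinuousMap (ContinuousMap.const _ c') h0 with hL
  have hlift : ∀ z, ((L z : ℝ) : AddCircle (2 : ℝ)) = H' z := fun z =>
    congrFun (cov.liftHomotopy_lifts (H_0 := h0)) z
  let s : ℝ → ℝ := fun x => L (1, (x : AddCircle (2 : ℝ)))
  have hs : Continuous s := L.continuous.comp (by
    exact continuous_const.prodMk (AddCircle.continuous_mk' (2 : ℝ)))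
  have hsx : ∀ x, ((s x : ℝ) : AddCircle (2 : ℝ)) = x := by
    intro x
    have := hlift (1, (x : AddCircle (2 : ℝ)))
    rw [H'.apply_one] at this
    exact this
  have hint : ∀ x, ∃ n : ℤ, (s x - x) / 2 = n := by
    intro x
    have : ((s x - x : ℝ) : AddCircle (2 : ℝ)) = 0 := by
      rw [AddCircle.coe_sub, hsx, sub_self]
    obtain ⟨n, hn⟩ := (AddCircle.coe_eq_zero_iff (2 : ℝ)).1 this
    refine ⟨n, ?_⟩
    rw [← hn]; simp
  choose N hN using hint
  have hNc : Continuous fun x => (N x : ℝ) := by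
    have : (fun x => (N x : ℝ)) = fun x => (s x - x) / 2 := by
      funext x; exact (hN x).symm
    rw [this]; fun_prop
  have hNc' : Continuous N := Int.isClosedEmbedding_coe_real.isEmbedding.continuous_iff.2 hNc
  have heq : N 0 = N 2 := by
    have : IsLocallyConstant N := (IsLocallyConstant.iff_continuous N).2 hNc'
    exact this.apply_eq_of_isPreconnected isPreconnected_univ (mem_univ _) (mem_univ _)
  have hs2 : s 0 = s 2 := by
    change L (1, ((0 : ℝ) : AddCircle (2 : ℝ))) = L (1, ((2 : ℝ) : AddCircle (2 : ℝ)))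
    rw [AddCircle.coe_period, AddCircle.coe_zero]
  have h1 := hN 0
  have h2 := hN 2
  rw [← heq, ← hs2] at h2
  linarith

/-! ### Flows on graphs -/

section Flow

variable {X : Type*} {ι : Type*}

open Classical in
/-- The values `z e`, for arcs `e` in `B`, satisfy the conservation law at the nodes in `A`. -/
def IsFlow (A : Finset X) (B : Finset ι) (src tgt : ι → X) (z : ι → ℚ) : Prop :=
  ∀ a ∈ A, ∑ e ∈ B with tgt e = a, z e = ∑ e ∈ B with src e = a, z e

open Classical in
/-- The incidence matrix of an oriented graph. -/
noncomputable def incMatrix (A : Finset X) (B : Finset ι) (src tgt : ι → X) : Matrix B A ℚ :=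
  fun e a => (if tgt e = a then 1 else 0) - (if src e = a then 1 else 0)

variable {A : Finset X} {B : Finset ι} {src tgt : ι → X}

theorem incMatrix_mulVec (hs : ∀ e ∈ B, src e ∈ A) (ht : ∀ e ∈ B, tgt e ∈ A) (f : A → ℚ) (e : B) :
    (incMatrix A B src tgt).mulVec f e = f ⟨tgt e, ht e e.2⟩ - f ⟨src e, hs e e.2⟩ := by
  classical
  have key : ∀ (x : X) (hx : x ∈ A), ∑ a : A, (if x = (a : X) then (1 : ℚ) else 0) * f a =
      f ⟨x, hx⟩ := by
    intro x hx
    rw [Finset.sum_eq_single ⟨x, hx⟩]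
    · simp
    · intro b _ hb
      rw [if_neg, zero_mul]
      intro h
      exact hb (Subtype.ext h.symm)
    · simp
  unfold Matrix.mulVec dotProduct incMatrix
  simp only [sub_mul, Finset.sum_sub_distrib]
  rw [← key _ (ht e e.2), ← key _ (hs e e.2)]

theorem incMatrix_transpose_mulVec (z : ι → ℚ) (a : A) [DecidableEq X] :
    (incMatrix A B src tgt).transpose.mulVec (fun e => z e) a =
      ∑ e ∈ B with tgt e = a, z e - ∑ e ∈ B with src e = a, z e := by
  unfold Matrix.mulVec dotProduct incMatrix Matrix.transpose
  simp only [Matrix.of_apply, sub_mul, Finset.sum_sub_distrib, ite_mul, one_mul, zero_mul]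
  rw [Finset.sum_filter, Finset.sum_filter]
  congr 1
  · rw [← Finset.sum_coe_sort B fun e => if tgt e = (a : X) then z e else 0]
  · rw [← Finset.sum_coe_sort B fun e => if src e = (a : X) then z e else 0]

theorem isFlow_iff_mulVec (z : ι → ℚ) : IsFlow A B src tgt z ↔
    (incMatrix A B src tgt).transpose.mulVec (fun e => z e) = 0 := by
  classical
  constructor
  · intro h
    funext a
    rw [incMatrix_transpose_mulVec, Pi.zero_apply, sub_eq_zero]
    convert h a a.2
  · intro h a ha
    have := congrFun h ⟨a, ha⟩
    rw [incMatrix_transpose_mulVec, Pi.zero_apply, sub_eq_zero] at this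
    convert this

/-- Flows are the kernel of the transposed incidence matrix. The kernel of the matrix itself
consists of the functions with equal values at the two ends of every arc, which are constant because
the graph is linked. Row rank and column rank agree. -/
theorem finrank_flows (hs : ∀ e ∈ B, src e ∈ A) (ht : ∀ e ∈ B, tgt e ∈ A)
    (hl : IsLinked A B src tgt) (hA : A.Nonempty) :
    Module.finrank ℚ (LinearMap.ker (incMatrix A B src tgt).transpose.mulVecLin) + A.card =
      B.card + 1 := by
  classical
  set M := incMatrix A B src tgt
  have h1 := LinearMap.finrank_range_add_finrank_ker M.mulVecLin
  have h2 := LinearMap.finrank_range_add_finrank_ker M.transpose.mulVecLin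
  have h3 : Module.finrank ℚ (LinearMap.range M.transpose.mulVecLin) =
      Module.finrank ℚ (LinearMap.range M.mulVecLin) := M.rank_transpose
  rw [Module.finrank_fintype_fun_eq_card, Fintype.card_coe] at h1 h2
  obtain ⟨a₀, ha₀⟩ := hA
  have h4 : LinearMap.ker M.mulVecLin = Submodule.span ℚ {fun _ => 1} := by
    ext f
    rw [LinearMap.mem_ker, Submodule.mem_span_singleton, Matrix.mulVecLin_apply]
    constructor
    · intro hf
      refine ⟨f ⟨a₀, ha₀⟩, ?_⟩
      funext a
      obtain ⟨_, h⟩ := hl (fun x => ∃ h : x ∈ A, f ⟨x, h⟩ = f ⟨a₀, ha₀⟩) (fun e he => by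
        have h5 := congrFun hf ⟨e, he⟩
        rw [incMatrix_mulVec hs ht, Pi.zero_apply, sub_eq_zero] at h5
        constructor
        · rintro ⟨_, h⟩
          exact ⟨ht e he, by rw [h5, h]⟩
        · rintro ⟨_, h⟩
          exact ⟨hs e he, by rw [← h5, h]⟩) a₀ ha₀ a a.2 ⟨ha₀, rfl⟩
      simp [h]
    · rintro ⟨c, rfl⟩
      funext e
      rw [incMatrix_mulVec hs ht]
      simp
  have h5 : Module.finrank ℚ (LinearMap.ker M.mulVecLin) = 1 := by
    rw [h4]
    refine finrank_span_singleton fun h => ?_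
    exact one_ne_zero (congrFun h ⟨a₀, ha₀⟩)
  omega

/-- The space of flows has dimension zero, and the dimension formula becomes the Euler
characteristic of a tree. -/
theorem card_of_flow_eq_zero (hs : ∀ e ∈ B, src e ∈ A) (ht : ∀ e ∈ B, tgt e ∈ A)
    (hl : IsLinked A B src tgt) (hA : A.Nonempty)
    (h0 : ∀ z, IsFlow A B src tgt z → ∀ e ∈ B, z e = 0) : B.card + 1 = A.card := by
  classical
  have h1 := finrank_flows hs ht hl hA
  have h2 : LinearMap.ker (incMatrix A B src tgt).transpose.mulVecLin = ⊥ := by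
    rw [LinearMap.ker_eq_bot']
    intro z hz
    set z' : ι → ℚ := fun e => if h : e ∈ B then z ⟨e, h⟩ else 0 with hz'
    have h3 : (fun e : B => z' e) = z := by
      funext e; simp [hz']
    have h4 : IsFlow A B src tgt z' := by
      rw [isFlow_iff_mulVec, h3]; exact hz
    rw [← h3]
    funext e
    exact h0 z' h4 e e.2
  rw [h2, finrank_bot] at h1
  omega

theorem card_of_flow_eq_smul (hs : ∀ e ∈ B, src e ∈ A) (ht : ∀ e ∈ B, tgt e ∈ A)
    (hl : IsLinked A B src tgt) (hA : A.Nonempty) {z₀ : ι → ℚ} (hz₀ : IsFlow A B src tgt z₀)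
    (hne : ∃ e ∈ B, z₀ e ≠ 0)
    (h0 : ∀ z, IsFlow A B src tgt z → ∃ c : ℚ, ∀ e ∈ B, z e = c * z₀ e) : B.card = A.card := by
  classical
  have h1 := finrank_flows hs ht hl hA
  have h2 : LinearMap.ker (incMatrix A B src tgt).transpose.mulVecLin =
      Submodule.span ℚ {fun e : B => z₀ e} := by
    ext z
    rw [LinearMap.mem_ker, Submodule.mem_span_singleton, Matrix.mulVecLin_apply]
    set z' : ι → ℚ := fun e => if h : e ∈ B then z ⟨e, h⟩ else 0 with hz'
    have h3 : (fun e : B => z' e) = z := by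
      funext e; simp [hz']
    rw [← h3, ← isFlow_iff_mulVec]
    constructor
    · intro h
      obtain ⟨c, hc⟩ := h0 z' h
      refine ⟨c, ?_⟩
      funext e
      exact (hc e e.2).symm
    · rintro ⟨c, hc⟩
      have h4 : ∀ e ∈ B, z' e = c * z₀ e := fun e he => (congrFun hc ⟨e, he⟩).symm
      intro a ha
      have h5 := hz₀ a ha
      rw [Finset.sum_congr rfl fun e he => h4 e (Finset.mem_filter.1 he).1,
        Finset.sum_congr rfl fun e he => h4 e (Finset.mem_filter.1 he).1, ← Finset.mul_sum,
        ← Finset.mul_sum, h5]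
  have h3 : Module.finrank ℚ (Submodule.span ℚ {fun e : B => z₀ e}) = 1 := by
    refine finrank_span_singleton fun h => ?_
    obtain ⟨e, he, h4⟩ := hne
    exact h4 (congrFun h ⟨e, he⟩)
  rw [h2, h3] at h1
  omega

end Flow

/-- Above the finite set the sequence goes on with `c + i`, so that every index has a successor and
the slabs need no special case at the top. -/
theorem exists_strictMono_enumeration (s : Finset ℝ) :
    ∃ f : ℕ → ℝ, StrictMono f ∧ ∀ x, x ∈ s ↔ ∃ i < s.card, f i = x := by
  obtain ⟨c, hc⟩ : ∃ c : ℝ, ∀ x ∈ s, x < c := by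
    obtain ⟨b, hb⟩ := s.bddAbove
    exact ⟨b + 1, fun x hx => by linarith [hb hx]⟩
  refine ⟨fun i => if h : i < s.card then s.orderEmbOfFin rfl ⟨i, h⟩ else c + i, ?_, ?_⟩
  · intro i j hij
    dsimp only
    split_ifs with h1 h2 h2
    · exact (s.orderEmbOfFin rfl).strictMono hij
    · have := hc _ (s.orderEmbOfFin_mem rfl ⟨i, h1⟩)
      have h3 : (0 : ℝ) ≤ j := Nat.cast_nonneg j
      linarith
    · omega
    · have : (i : ℝ) < j := Nat.cast_lt.2 hij
      linarith
  · intro x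
    constructor
    · intro hx
      have : x ∈ Set.range (s.orderEmbOfFin rfl) := by
        rw [Finset.range_orderEmbOfFin]; exact hx
      obtain ⟨i, hi⟩ := this
      exact ⟨i, i.2, by dsimp only; rw [dif_pos i.2]; exact hi⟩
    · rintro ⟨i, hi, rfl⟩
      dsimp only
      rw [dif_pos hi]
      exact s.orderEmbOfFin_mem rfl _

namespace PlanarPolygon

variable (P : PlanarPolygon)

/-! ### The heights of the vertices -/

/-- The heights of the vertices in increasing order, followed by an arbitrary increasing
sequence. -/
noncomputable def ht : ℕ → ℝ := (exists_strictMono_enumeration (P.vertices.image Prod.snd)).choose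

theorem ht_strictMono : StrictMono P.ht :=
  (exists_strictMono_enumeration (P.vertices.image Prod.snd)).choose_spec.1

theorem exists_ht (v : P.vertices) : ∃ i < P.vertices.card, P.ht i = (v : ℝ × ℝ).2 := by
  have h := (exists_strictMono_enumeration (P.vertices.image Prod.snd)).choose_spec.2 (v : ℝ × ℝ).2
  obtain ⟨i, hi, hi'⟩ := h.1 (Finset.mem_image_of_mem _ v.2)
  exact ⟨i, hi.trans_le Finset.card_image_le, hi'⟩

theorem exists_ht_lo (e : P.vertices) : ∃ i, P.ht i = P.lo e := by
  obtain ⟨u, hu⟩ := P.exists_lo e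
  obtain ⟨i, -, hi⟩ := P.exists_ht u
  exact ⟨i, by rw [hi, hu]⟩

theorem exists_ht_hi (e : P.vertices) : ∃ i < P.vertices.card, P.ht i = P.hi e := by
  obtain ⟨u, hu⟩ := P.exists_hi e
  obtain ⟨i, hi, hi'⟩ := P.exists_ht u
  exact ⟨i, hi, by rw [hi', hu]⟩

/-- The edge crosses the slab between two consecutive vertex heights. -/
def Spans (i : ℕ) (e : P.vertices) : Prop := P.lo e ≤ P.ht i ∧ P.ht (i + 1) ≤ P.hi e

theorem ht_lt_succ (i : ℕ) : P.ht i < P.ht (i + 1) := P.ht_strictMono (Nat.lt_succ_self i)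

/-- An edge begins and ends at vertex heights, and none of these lies strictly inside a slab; an
edge that enters the slab therefore crosses it. -/
theorem spans_of_lt {i : ℕ} {e : P.vertices} (h1 : P.lo e < P.ht (i + 1)) (h2 : P.ht i < P.hi e) :
    P.Spans i e := by
  obtain ⟨a, ha⟩ := P.exists_ht_lo e
  obtain ⟨b, -, hb⟩ := P.exists_ht_hi e
  rw [← ha, P.ht_strictMono.lt_iff_lt] at h1
  rw [← hb, P.ht_strictMono.lt_iff_lt] at h2
  refine ⟨?_, ?_⟩
  · rw [← ha, P.ht_strictMono.le_iff_le]; omega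
  · rw [← hb, P.ht_strictMono.le_iff_le]; omega

theorem spans_iff_up {i : ℕ} {e : P.vertices} :
    P.Spans i e ↔ P.lo e ≤ P.ht i ∧ P.ht i < P.hi e :=
  ⟨fun h => ⟨h.1, (P.ht_lt_succ i).trans_le h.2⟩,
    fun h => P.spans_of_lt (h.1.trans_lt (P.ht_lt_succ i)) h.2⟩

theorem spans_iff_down {i : ℕ} {e : P.vertices} :
    P.Spans i e ↔ P.lo e < P.ht (i + 1) ∧ P.ht (i + 1) ≤ P.hi e :=
  ⟨fun h => ⟨h.1.trans_lt (P.ht_lt_succ i), h.2⟩,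
    fun h => P.spans_of_lt h.1 ((P.ht_lt_succ i).trans_le h.2)⟩

theorem Spans.lt_card {P : PlanarPolygon} {i : ℕ} {e : P.vertices} (h : P.Spans i e) :
    i + 1 < P.vertices.card := by
  obtain ⟨b, hb, hb'⟩ := P.exists_ht_hi e
  have := h.2
  rw [← hb', P.ht_strictMono.le_iff_le] at this
  omega

theorem Spans.mem_Icc {P : PlanarPolygon} {i : ℕ} {e : P.vertices} (h : P.Spans i e) {y : ℝ}
    (hy : y ∈ Icc (P.ht i) (P.ht (i + 1))) : P.lo e ≤ y ∧ y ≤ P.hi e :=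
  ⟨h.1.trans hy.1, hy.2.trans h.2⟩

theorem Spans.mem_Ioo {P : PlanarPolygon} {i : ℕ} {e : P.vertices} (h : P.Spans i e) {y : ℝ}
    (hy : y ∈ Ioo (P.ht i) (P.ht (i + 1))) : P.lo e < y ∧ y < P.hi e :=
  ⟨h.1.trans_lt hy.1, hy.2.trans_le h.2⟩

theorem Spans.mem_edge {P : PlanarPolygon} {i : ℕ} {e : P.vertices} (h : P.Spans i e) {y : ℝ}
    (hy : y ∈ Icc (P.ht i) (P.ht (i + 1))) : (P.xAt e y, y) ∈ P.edge e :=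
  P.xAt_mem_edge (h.mem_Icc hy).1 (h.mem_Icc hy).2

theorem spans_of_mem_edge {i : ℕ} {e : P.vertices} {z : ℝ × ℝ} (hz : z ∈ P.edge e)
    (hi : z.2 ∈ Ioo (P.ht i) (P.ht (i + 1))) : P.Spans i e := by
  have := (P.mem_edge.1 hz).1
  exact P.spans_of_lt (this.1.trans_lt hi.2) (hi.1.trans_le this.2)

/-- In a slab, different edges do not change their order. -/
theorem xAt_lt_of_lt {i : ℕ} {e f : P.vertices} (he : P.Spans i e) (hf : P.Spans i f) {y y' : ℝ}
    (hy : y ∈ Ioo (P.ht i) (P.ht (i + 1))) (hy' : y' ∈ Ioo (P.ht i) (P.ht (i + 1)))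
    (h : P.xAt e y < P.xAt f y) : P.xAt e y' < P.xAt f y' := by
  have hef : e ≠ f := by
    rintro rfl; exact lt_irrefl _ h
  by_contra hcon
  have hc : ContinuousOn (fun y => P.xAt f y - P.xAt e y) (Ioo (P.ht i) (P.ht (i + 1))) :=
    ((P.continuous_xAt f).sub (P.continuous_xAt e)).continuousOn
  have h0 : (0 : ℝ) ∈ Icc (P.xAt f y' - P.xAt e y') (P.xAt f y - P.xAt e y) :=
    ⟨by linarith, by linarith⟩
  obtain ⟨w, hw, hw'⟩ := isPreconnected_Ioo.intermediate_value hy' hy hc h0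
  have h1 := he.mem_Ioo hw
  have h2 := hf.mem_Icc (Ioo_subset_Icc_self hw)
  exact P.xAt_ne hef h1.1 h1.2 h2.1 h2.2 (by linarith [hw'])

theorem xAt_le_of_lt {i : ℕ} {e f : P.vertices} (he : P.Spans i e) (hf : P.Spans i f) {y y' : ℝ}
    (hy : y ∈ Ioo (P.ht i) (P.ht (i + 1))) (hy' : y' ∈ Icc (P.ht i) (P.ht (i + 1)))
    (h : P.xAt e y < P.xAt f y) : P.xAt e y' ≤ P.xAt f y' := by
  have hcl : IsClosed {w | P.xAt e w ≤ P.xAt f w} :=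
    isClosed_le (P.continuous_xAt e) (P.continuous_xAt f)
  have hsub : Ioo (P.ht i) (P.ht (i + 1)) ⊆ {w | P.xAt e w ≤ P.xAt f w} :=
    fun w hw => (P.xAt_lt_of_lt he hf hy hw h).le
  have := hcl.closure_subset_iff.2 hsub
  rw [closure_Ioo (P.ht_lt_succ i).ne] at this
  exact this hy'

/-- The height in the middle of a slab. -/
noncomputable def midHt (i : ℕ) : ℝ := (P.ht i + P.ht (i + 1)) / 2

theorem midHt_mem (i : ℕ) : P.midHt i ∈ Ioo (P.ht i) (P.ht (i + 1)) := by
  have := P.ht_lt_succ i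
  unfold midHt
  constructor <;> linarith

/-! ### The types of vertices -/

/-- The complete local picture at a vertex. If one edge goes up and the other down, the polygon is
on the same side of both, and exactly one horizontal ray belongs to it. If both go the same way,
with `e` on the left, the polygon is on opposite sides of them, and the two rays belong to it both
or neither, according as it lies outside or inside the wedge. -/
theorem vertex_cases (v : P.vertices) : ∃ e f : P.vertices, e ≠ f ∧ (v : ℝ × ℝ) ∈ P.edge e ∧
    (v : ℝ × ℝ) ∈ P.edge f ∧
    ((P.lo e = (v : ℝ × ℝ).2 ∧ P.hi f = (v : ℝ × ℝ).2 ∧ (P.Side 1 e ↔ P.Side 1 f) ∧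
        (P.Germ 1 v ↔ P.Side 1 e) ∧ (P.Germ (-1) v ↔ ¬ P.Side 1 e)) ∨
      ((P.lo e = (v : ℝ × ℝ).2 ∧ P.lo f = (v : ℝ × ℝ).2 ∧
          (∀ y, (v : ℝ × ℝ).2 ≤ y → P.xAt e y ≤ P.xAt f y) ∨
        P.hi e = (v : ℝ × ℝ).2 ∧ P.hi f = (v : ℝ × ℝ).2 ∧
          (∀ y, y ≤ (v : ℝ × ℝ).2 → P.xAt e y ≤ P.xAt f y)) ∧
        (P.Side 1 e ↔ ¬ P.Side 1 f) ∧ (P.Germ 1 v ↔ P.Side 1 f) ∧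
          (P.Germ (-1) v ↔ P.Side 1 f))) := by
  obtain ⟨e, w, hne, hv1, hv2⟩ : ∃ e w : P.vertices, e ≠ w ∧ (v : ℝ × ℝ) ∈ P.edge e ∧
      (v : ℝ × ℝ) ∈ P.edge w :=
    ⟨v, P.next.symm v, (P.prev_ne v).symm, P.vertex_mem_edge v,
      P.mem_edge_iff_vertex.2 (Or.inr rfl)⟩
  have hn1 : (-1 : ℝ) ≠ 0 := by norm_num
  have updown : ∀ e f : P.vertices, e ≠ f → (v : ℝ × ℝ) ∈ P.edge e → (v : ℝ × ℝ) ∈ P.edge f →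
      P.lo e = (v : ℝ × ℝ).2 → P.hi f = (v : ℝ × ℝ).2 →
      (P.Side 1 e ↔ P.Side 1 f) ∧ (P.Germ 1 v ↔ P.Side 1 e) ∧ (P.Germ (-1) v ↔ ¬ P.Side 1 e) := by
    intro e f hef he hf hlo hhi
    have h1 := P.germ_iff_side_up_down hef he hf hlo hhi one_ne_zero
    have h2 := P.germ_iff_side_up_down hef he hf hlo hhi hn1
    have h3 := P.side_iff_not e
    tauto
  have fork : ∀ e f : P.vertices, e ≠ f → (v : ℝ × ℝ) ∈ P.edge e → (v : ℝ × ℝ) ∈ P.edge f →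
      ∀ d : ℝ, d ≠ 0 → (∀ z ∈ P.edge e, 0 ≤ d * (z.2 - (v : ℝ × ℝ).2)) →
      (∀ z ∈ P.edge f, 0 ≤ d * (z.2 - (v : ℝ × ℝ).2)) →
      (∀ y, 0 ≤ d * (y - (v : ℝ × ℝ).2) → P.xAt e y ≤ P.xAt f y) →
      (P.Side 1 e ↔ ¬ P.Side 1 f) ∧ (P.Germ 1 v ↔ P.Side 1 f) ∧ (P.Germ (-1) v ↔ P.Side 1 f) := by
    intro e f hef he hf d hd hde hdf hlt
    have h1 := P.germ_one_iff_germ_neg_one hef he hf hd hde hdf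
    have h2 := P.germ_iff_side_fork hef he hf hde hdf hlt
    have h3 := P.side_iff_not e
    tauto
  have up : ∀ e, P.lo e = (v : ℝ × ℝ).2 → ∀ z ∈ P.edge e, 0 ≤ (1 : ℝ) * (z.2 - (v : ℝ × ℝ).2) := by
    intro e he z hz
    have := (P.mem_edge.1 hz).1.1
    linarith
  have down : ∀ e, P.hi e = (v : ℝ × ℝ).2 →
      ∀ z ∈ P.edge e, 0 ≤ (-1 : ℝ) * (z.2 - (v : ℝ × ℝ).2) := by
    intro e he z hz
    have := (P.mem_edge.1 hz).1.2
    linarith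
  rcases P.height_of_vertex_mem_edge hv1 with h1 | h1 <;>
    rcases P.height_of_vertex_mem_edge hv2 with h2 | h2
  · rcases P.fork_total hv1 hv2 one_ne_zero with h | h
    · refine ⟨e, w, hne, hv1, hv2, Or.inr ⟨Or.inl ⟨h1.symm, h2.symm, fun y hy => h y (by linarith)⟩,
        fork e w hne hv1 hv2 1 one_ne_zero (up e h1.symm) (up w h2.symm) h⟩⟩
    · refine ⟨w, e, hne.symm, hv2, hv1, Or.inr ⟨Or.inl ⟨h2.symm, h1.symm,
        fun y hy => h y (by linarith)⟩,
        fork w e hne.symm hv2 hv1 1 one_ne_zero (up w h2.symm) (up e h1.symm) h⟩⟩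
  · exact ⟨e, w, hne, hv1, hv2, Or.inl ⟨h1.symm, h2.symm,
      updown e w hne hv1 hv2 h1.symm h2.symm⟩⟩
  · exact ⟨w, e, hne.symm, hv2, hv1, Or.inl ⟨h2.symm, h1.symm,
      updown w e hne.symm hv2 hv1 h2.symm h1.symm⟩⟩
  · rcases P.fork_total hv1 hv2 hn1 with h | h
    · refine ⟨e, w, hne, hv1, hv2, Or.inr ⟨Or.inr ⟨h1.symm, h2.symm, fun y hy => h y (by linarith)⟩,
        fork e w hne hv1 hv2 (-1) hn1 (down e h1.symm) (down w h2.symm) h⟩⟩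
    · refine ⟨w, e, hne.symm, hv2, hv1, Or.inr ⟨Or.inr ⟨h2.symm, h1.symm,
        fun y hy => h y (by linarith)⟩,
        fork w e hne.symm hv2 hv1 (-1) hn1 (down w h2.symm) (down e h1.symm) h⟩⟩

theorem mem_interior_or_frontier {p : ℝ × ℝ} (hp : p ∈ P.carrier) :
    p ∈ interior P.carrier ∨ p ∈ frontier P.carrier := by
  by_cases h : p ∈ interior P.carrier
  · exact Or.inl h
  · exact Or.inr ⟨subset_closure hp, h⟩

/-- A boundary point is a vertex or lies inside an edge. -/
theorem vertex_or_mem_Ioo {p : ℝ × ℝ} {e : P.vertices} (hp : p ∈ P.edge e) :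
    (∃ v : P.vertices, p = v) ∨ (P.lo e < p.2 ∧ p.2 < P.hi e) := by
  have h := P.mem_edge.1 hp
  rcases h.1.1.eq_or_lt with h1 | h1
  · obtain ⟨u, hu⟩ := P.exists_lo e
    exact Or.inl ⟨u, by rw [hu, h1]; exact Prod.ext h.2 rfl⟩
  rcases h.1.2.eq_or_lt with h2 | h2
  · obtain ⟨u, hu⟩ := P.exists_hi e
    exact Or.inl ⟨u, by rw [hu, ← h2]; exact Prod.ext h.2 rfl⟩
  exact Or.inr ⟨h1, h2⟩

theorem germ_iff_side_of_Ioo {p : ℝ × ℝ} {e : P.vertices} (hp : p ∈ P.edge e)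
    (h1 : P.lo e < p.2) (h2 : p.2 < P.hi e) {s : ℝ} (hs : s ≠ 0) : P.Germ s p ↔ P.Side s e := by
  rw [← P.germ_iff_side hs h1 h2]
  have : (P.xAt e p.2, p.2) = p := Prod.ext (P.mem_edge.1 hp).2.symm rfl
  rw [this]

/-- A boundary point with the polygon not on its left lies on a left edge. -/
theorem exists_side_of_not_germ {p : ℝ × ℝ} (hp : p ∈ frontier P.carrier)
    (hg : ¬ P.Germ (-1) p) : ∃ e, p ∈ P.edge e ∧ P.Side 1 e := by
  obtain ⟨g, hgp⟩ := P.mem_frontier.1 hp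
  rcases P.vertex_or_mem_Ioo hgp with ⟨v, rfl⟩ | ⟨h1, h2⟩
  · obtain ⟨e, f, -, he, hf, h⟩ := P.vertex_cases v
    refine ⟨e, he, ?_⟩
    tauto
  · refine ⟨g, hgp, ?_⟩
    rw [P.side_iff_not, ← P.germ_iff_side_of_Ioo hgp h1 h2 (by norm_num)]
    exact hg

/-- The left end of a fiber. -/
theorem exists_left_end {p : ℝ × ℝ} (hp : p ∈ P.carrier) :
    ∃ x ≤ p.1, (∀ x', x ≤ x' → x' ≤ p.1 → (x', p.2) ∈ P.carrier) ∧ ¬ P.Germ (-1) (x, p.2) := by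
  by_cases hg : P.Germ (-1) p
  -- The boundary points that can be reached from `p` by going left in the polygon. They are
  -- finitely many, and from a point with the polygon still on its left one reaches a further one;
  -- so the leftmost is the end.
  · set D : Set ℝ := {x | x ≤ p.1 ∧ (∀ x', x ≤ x' → x' ≤ p.1 → (x', p.2) ∈ P.carrier) ∧
      (x, p.2) ∈ frontier P.carrier} with hD
    have hfin : D.Finite := by
      refine (finite_range fun e => P.xAt e p.2).subset ?_
      rintro x ⟨-, -, hx⟩
      obtain ⟨e, he⟩ := P.mem_frontier.1 hx
      exact ⟨e, (P.mem_edge.1 he).2.symm⟩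
    have step : ∀ x ≤ p.1, (∀ x', x ≤ x' → x' ≤ p.1 → (x', p.2) ∈ P.carrier) →
        P.Germ (-1) (x, p.2) → ∃ x₁ ∈ D, x₁ < x := by
      intro x hx hx' hgx
      obtain ⟨t, ht, h1, h2⟩ := P.exists_frontier_of_germ (by norm_num) hgx
      refine ⟨x + -1 * t, ⟨by linarith, fun x' h3 h4 => ?_, h1⟩, by linarith⟩
      rcases le_or_gt x x' with h | h
      · exact hx' x' h h4
      rcases h3.eq_or_lt with h5 | h5
      · rw [← h5]; exact P.frontier_subset h1
      · have h6 := h2 (x - x') ⟨by linarith, by linarith⟩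
        have : x + -1 * (x - x') = x' := by ring
        dsimp only at h6
        rw [this] at h6
        exact interior_subset h6
    obtain ⟨x₁, hx₁, -⟩ := step p.1 le_rfl (fun x' h1 h2 => by
      rw [le_antisymm h2 h1]; exact hp) hg
    obtain ⟨x₂, hx₂, hmin⟩ := hfin.exists_minimalFor id D ⟨x₁, hx₁⟩
    refine ⟨x₂, hx₂.1, hx₂.2.1, fun hg₂ => ?_⟩
    obtain ⟨x₃, hx₃, hlt⟩ := step x₂ hx₂.1 hx₂.2.1 hg₂
    exact absurd (hmin hx₃ hlt.le) (not_le.2 hlt)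
  · exact ⟨p.1, le_rfl, fun x' h1 h2 => by rw [le_antisymm h2 h1]; exact hp, hg⟩

/-- Every fiber meets a left edge. -/
theorem exists_left_edge {p : ℝ × ℝ} (hp : p ∈ P.carrier) :
    ∃ l, P.Side 1 l ∧ (P.lo l ≤ p.2 ∧ p.2 ≤ P.hi l) ∧ P.reebMk (P.xAt l p.2, p.2) = P.reebMk p := by
  obtain ⟨x, hx, hK, hg⟩ := P.exists_left_end hp
  have hxK := hK x le_rfl hx
  have hxF : (x, p.2) ∈ frontier P.carrier := by
    refine (P.mem_interior_or_frontier hxK).resolve_left fun h => ?_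
    exact hg (P.germ_of_mem_interior h _)
  obtain ⟨l, hl, hs⟩ := P.exists_side_of_not_germ hxF hg
  have h1 := P.mem_edge.1 hl
  refine ⟨l, hs, h1.1, ?_⟩
  rw [← h1.2]
  exact P.reebMk_eq_of_horizontal rfl hK hx

/-! ### The Reeb space as a topological graph -/

open Classical in
/-- The arcs of the Reeb space cut at all vertex heights are given by the slabs and the left edges
crossing them. -/
noncomputable def slabArcs : Finset (ℕ × P.vertices) :=
  (Finset.range P.vertices.card ×ˢ Finset.univ).filter fun a => P.Spans a.1 a.2 ∧ P.Side 1 a.2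

theorem mem_slabArcs {a : ℕ × P.vertices} : a ∈ P.slabArcs ↔ P.Spans a.1 a.2 ∧ P.Side 1 a.2 := by
  classical
  unfold slabArcs
  rw [Finset.mem_filter, Finset.mem_product, Finset.mem_range]
  constructor
  · exact fun h => h.2
  · intro h
    have := h.1.lt_card
    exact ⟨⟨by omega, Finset.mem_univ _⟩, h⟩

/-- The fiber through the point of an edge at a given height. -/
noncomputable def edgeFiber (e : P.vertices) (y : ℝ) : P.ReebSpace := P.reebMk (P.xAt e y, y)

/-- The closed arc of the Reeb space given by a left edge in a slab. -/
def slabArc (a : ℕ × P.vertices) : Set P.ReebSpace :=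
  P.edgeFiber a.2 '' Icc (P.ht a.1) (P.ht (a.1 + 1))

/-- The lower end of an arc. -/
noncomputable def slabSrc (a : ℕ × P.vertices) : P.ReebSpace := P.edgeFiber a.2 (P.ht a.1)

/-- The upper end of an arc. -/
noncomputable def slabTgt (a : ℕ × P.vertices) : P.ReebSpace := P.edgeFiber a.2 (P.ht (a.1 + 1))

open Classical in
/-- The ends of the arcs. -/
noncomputable def slabNodes : Finset P.ReebSpace :=
  P.slabArcs.image P.slabSrc ∪ P.slabArcs.image P.slabTgt

theorem reebHeight_edgeFiber {e : P.vertices} {y : ℝ} (h1 : P.lo e ≤ y) (h2 : y ≤ P.hi e) :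
    P.reebHeight (P.edgeFiber e y) = y :=
  P.reebHeight_reebMk (P.edge_subset e (P.xAt_mem_edge h1 h2))

theorem continuousOn_edgeFiber (e : P.vertices) :
    ContinuousOn (P.edgeFiber e) (Icc (P.lo e) (P.hi e)) := by
  refine P.continuousOn_reebMk.comp
    ((P.continuous_xAt e).prodMk continuous_id).continuousOn fun y hy => ?_
  exact P.edge_subset e (P.xAt_mem_edge hy.1 hy.2)

theorem Spans.Icc_subset {P : PlanarPolygon} {i : ℕ} {e : P.vertices} (h : P.Spans i e) :
    Icc (P.ht i) (P.ht (i + 1)) ⊆ Icc (P.lo e) (P.hi e) := fun _ hy => h.mem_Icc hy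

theorem ht_mem_Icc_left (i : ℕ) : P.ht i ∈ Icc (P.ht i) (P.ht (i + 1)) :=
  ⟨le_rfl, (P.ht_lt_succ i).le⟩

theorem ht_mem_Icc_right (i : ℕ) : P.ht (i + 1) ∈ Icc (P.ht i) (P.ht (i + 1)) :=
  ⟨(P.ht_lt_succ i).le, le_rfl⟩

theorem ht_notMem_Ioo (i j : ℕ) : P.ht j ∉ Ioo (P.ht i) (P.ht (i + 1)) := by
  rintro ⟨h1, h2⟩
  rw [P.ht_strictMono.lt_iff_lt] at h1 h2
  omega

theorem exists_height_of_mem_slabNodes {q : P.ReebSpace} (hq : q ∈ P.slabNodes) :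
    ∃ j, P.reebHeight q = P.ht j := by
  classical
  unfold slabNodes at hq
  rw [Finset.mem_union, Finset.mem_image, Finset.mem_image] at hq
  rcases hq with ⟨a, ha, rfl⟩ | ⟨a, ha, rfl⟩
  · have h := (P.mem_slabArcs.1 ha).1.mem_Icc (P.ht_mem_Icc_left a.1)
    exact ⟨_, P.reebHeight_edgeFiber h.1 h.2⟩
  · have h := (P.mem_slabArcs.1 ha).1.mem_Icc (P.ht_mem_Icc_right a.1)
    exact ⟨_, P.reebHeight_edgeFiber h.1 h.2⟩

theorem slabSrc_mem {a : ℕ × P.vertices} (ha : a ∈ P.slabArcs) : P.slabSrc a ∈ P.slabNodes := by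
  classical
  exact Finset.mem_union_left _ (Finset.mem_image_of_mem _ ha)

theorem slabTgt_mem {a : ℕ × P.vertices} (ha : a ∈ P.slabArcs) : P.slabTgt a ∈ P.slabNodes := by
  classical
  exact Finset.mem_union_right _ (Finset.mem_image_of_mem _ ha)

/-- A point strictly inside the polygon in its fiber: the polygon is on the left of it. -/
theorem germ_neg_of_reebMk_eq {z w : ℝ × ℝ} (hz : z ∈ P.carrier) (hw : w ∈ P.carrier)
    (h : P.reebMk z = P.reebMk w) {x : ℝ} (h1 : z.1 < x) (h2 : x ≤ w.1) :
    P.Germ (-1) (x, z.2) := by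
  have : ∀ᶠ t in 𝓝[>] (0 : ℝ), t ∈ Ioo 0 (x - z.1) := Ioo_mem_nhdsGT (by linarith)
  filter_upwards [this] with t ht
  exact P.mem_of_reebMk_eq hz hw h _ (by linarith [ht.2]) (by linarith [ht.1])

theorem germ_pos_of_reebMk_eq {z w : ℝ × ℝ} (hz : z ∈ P.carrier) (hw : w ∈ P.carrier)
    (h : P.reebMk z = P.reebMk w) {x : ℝ} (h1 : z.1 ≤ x) (h2 : x < w.1) :
    P.Germ 1 (x, z.2) := by
  have : ∀ᶠ t in 𝓝[>] (0 : ℝ), t ∈ Ioo 0 (w.1 - x) := Ioo_mem_nhdsGT (by linarith)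
  filter_upwards [this] with t ht
  exact P.mem_of_reebMk_eq hz hw h _ (by linarith [ht.1]) (by linarith [ht.2])

/-- A common fiber would contain the points just on the left of `l'`, where the polygon is not. -/
theorem edgeFiber_ne {l l' : P.vertices} (hs' : P.Side 1 l') {y : ℝ}
    (h1 : P.lo l ≤ y) (h2 : y ≤ P.hi l) (h1' : P.lo l' < y) (h2' : y < P.hi l')
    (hlt : P.xAt l y < P.xAt l' y) : P.edgeFiber l y ≠ P.edgeFiber l' y := by
  intro h
  have hm := P.edge_subset l (P.xAt_mem_edge h1 h2)
  have hm' := P.edge_subset l' (P.xAt_mem_edge h1'.le h2'.le)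
  have hg := P.germ_neg_of_reebMk_eq hm hm' h (x := P.xAt l' y) hlt le_rfl
  rw [P.germ_iff_side (by norm_num) h1' h2'] at hg
  exact (P.side_iff_not l').1 hs' hg

theorem edgeFiber_injOn {l l' : P.vertices} (hs : P.Side 1 l) (hs' : P.Side 1 l') {y : ℝ}
    (h1 : P.lo l < y) (h2 : y < P.hi l) (h1' : P.lo l' < y) (h2' : y < P.hi l')
    (h : P.edgeFiber l y = P.edgeFiber l' y) : l = l' := by
  by_contra hne
  rcases (P.xAt_ne hne h1 h2 h1'.le h2'.le).lt_or_gt with hlt | hlt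
  · exact P.edgeFiber_ne hs' h1.le h2.le h1' h2' hlt h
  · exact P.edgeFiber_ne hs h1'.le h2'.le h1 h2 hlt h.symm

/-- The height is a coordinate on every arc, and all nodes lie at vertex heights. Two arcs with a
common point at any other height are in one slab, and there a fiber has only one left edge. -/
theorem isTopGraph_slab :
    IsTopGraph P.slabNodes P.slabArcs P.slabArc P.slabSrc P.slabTgt := by
  have hheight : ∀ a ∈ P.slabArcs, ∀ y ∈ Icc (P.ht a.1) (P.ht (a.1 + 1)),
      P.reebHeight (P.edgeFiber a.2 y) = y := by
    intro a ha y hy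
    have h := (P.mem_slabArcs.1 ha).1.mem_Icc hy
    exact P.reebHeight_edgeFiber h.1 h.2
  have hends : ∀ a ∈ P.slabArcs, ∀ y ∈ Icc (P.ht a.1) (P.ht (a.1 + 1)),
      y ∈ Ioo (P.ht a.1) (P.ht (a.1 + 1)) ∨ P.edgeFiber a.2 y = P.slabSrc a ∨
        P.edgeFiber a.2 y = P.slabTgt a := by
    intro a ha y hy
    rcases hy.1.eq_or_lt with h | h
    · exact Or.inr (Or.inl (by rw [← h]; rfl))
    rcases hy.2.eq_or_lt with h' | h'
    · exact Or.inr (Or.inr (by rw [h']; rfl))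
    exact Or.inl ⟨h, h'⟩
  constructor
  · intro a ha
    have hsp := (P.mem_slabArcs.1 ha).1
    refine isArc_image_Icc (P.ht_lt_succ _) ((P.continuousOn_edgeFiber a.2).mono hsp.Icc_subset) ?_
    intro y hy y' hy' h
    rw [← hheight a ha y hy, h, hheight a ha y' hy']
  · exact fun a ha => P.slabSrc_mem ha
  · exact fun a ha => P.slabTgt_mem ha
  · rintro a ha _ ⟨y, hy, rfl⟩ hq
    obtain ⟨j, hj⟩ := P.exists_height_of_mem_slabNodes hq
    rw [hheight a ha y hy] at hj
    rcases hends a ha y hy with h | h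
    · rw [hj] at h
      exact absurd h (P.ht_notMem_Ioo _ _)
    · exact h
  · rintro a ha b hb hab _ ⟨y, hy, rfl⟩ ⟨y', hy', hyy⟩
    have h1 := hheight b hb y' hy'
    rw [hyy, hheight a ha y hy] at h1
    subst h1
    rcases hends a ha y hy with h | h | h
    · rcases hends b hb y hy' with h' | h' | h'
      · exfalso
        have hab1 : a.1 = b.1 := by
          have e1 := P.ht_strictMono.lt_iff_lt.1 (h.1.trans h'.2)
          have e2 := P.ht_strictMono.lt_iff_lt.1 (h'.1.trans h.2)
          omega
        have hab2 : a.2 = b.2 := by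
          obtain ⟨p1, p2⟩ := P.mem_slabArcs.1 ha
          obtain ⟨q1, q2⟩ := P.mem_slabArcs.1 hb
          exact P.edgeFiber_injOn p2 q2 (p1.mem_Ioo h).1 (p1.mem_Ioo h).2 (q1.mem_Ioo h').1
            (q1.mem_Ioo h').2 hyy.symm
        exact hab (Prod.ext hab1 hab2)
      · rw [← hyy, h']; exact P.slabSrc_mem hb
      · rw [← hyy, h']; exact P.slabTgt_mem hb
    · rw [h]; exact P.slabSrc_mem ha
    · rw [h]; exact P.slabTgt_mem ha

/-- A height of an edge lies in a slab spanned by the edge. -/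
theorem exists_spans {e : P.vertices} {y : ℝ} (h1 : P.lo e ≤ y) (h2 : y ≤ P.hi e) :
    ∃ i, P.Spans i e ∧ y ∈ Icc (P.ht i) (P.ht (i + 1)) := by
  classical
  obtain ⟨a, ha⟩ := P.exists_ht_lo e
  obtain ⟨b, -, hb⟩ := P.exists_ht_hi e
  have hab : a < b := by
    rw [← P.ht_strictMono.lt_iff_lt, ha, hb]; exact P.lo_lt_hi e
  have hex : ∃ n, y ≤ P.ht (a + n + 1) := by
    refine ⟨b - a, h2.trans ?_⟩
    rw [← hb, P.ht_strictMono.le_iff_le]; omega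
  have hfind := Nat.find_spec hex
  refine ⟨a + Nat.find hex, ⟨?_, ?_⟩, ?_, hfind⟩
  · rw [← ha, P.ht_strictMono.le_iff_le]; omega
  · rw [← hb, P.ht_strictMono.le_iff_le]
    have : Nat.find hex ≤ b - a - 1 := by
      refine Nat.find_min' hex (h2.trans ?_)
      rw [← hb, P.ht_strictMono.le_iff_le]; omega
    omega
  · by_cases h0 : Nat.find hex = 0
    · rw [h0, add_zero, ha]; exact h1
    · have := Nat.find_min hex (show Nat.find hex - 1 < Nat.find hex by omega)
      rw [not_le] at this
      have h3 : a + (Nat.find hex - 1) + 1 = a + Nat.find hex := by omega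
      rw [h3] at this
      exact this.le

theorem graphBody_slab : graphBody P.slabNodes P.slabArcs P.slabArc = univ := by
  refine eq_univ_of_forall fun q => ?_
  obtain ⟨p, hp, rfl⟩ := P.exists_reebMk q
  obtain ⟨l, hs, hl, h⟩ := P.exists_left_edge hp
  obtain ⟨i, hi, hy⟩ := P.exists_spans hl.1 hl.2
  rw [mem_graphBody]
  exact Or.inr ⟨(i, l), P.mem_slabArcs.2 ⟨hi, hs⟩, p.2, hy, h⟩

theorem slabArcs_nonempty : P.slabArcs.Nonempty := by
  obtain ⟨p, hp⟩ := P.nonempty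
  obtain ⟨l, hs, hl, h⟩ := P.exists_left_edge hp
  obtain ⟨i, hi, hy⟩ := P.exists_spans hl.1 hl.2
  exact ⟨(i, l), P.mem_slabArcs.2 ⟨hi, hs⟩⟩

theorem isLinked_slab [ConnectedSpace P.ReebSpace] :
    IsLinked P.slabNodes P.slabArcs P.slabSrc P.slabTgt := by
  refine P.isTopGraph_slab.isLinked ?_
  rw [graphBody_slab]
  exact isPreconnected_univ

end PlanarPolygon

namespace PlanarPolygon

variable (P : PlanarPolygon)

/-! ### Facing edges -/

/-- In the slab, `l` is a left edge and `r` is the next edge on the right of it. -/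
structure Facing (i : ℕ) (l r : P.vertices) : Prop where
  left : P.Spans i l
  right : P.Spans i r
  side : P.Side 1 l
  side' : ¬ P.Side 1 r
  lt : P.xAt l (P.midHt i) < P.xAt r (P.midHt i)
  between : ∀ g, P.Spans i g → P.xAt g (P.midHt i) ≤ P.xAt l (P.midHt i) ∨
    P.xAt r (P.midHt i) ≤ P.xAt g (P.midHt i)

theorem xAt_le_iff_of_mem_Ioo {i : ℕ} {e f : P.vertices} (he : P.Spans i e) (hf : P.Spans i f)
    {y y' : ℝ} (hy : y ∈ Ioo (P.ht i) (P.ht (i + 1))) (hy' : y' ∈ Ioo (P.ht i) (P.ht (i + 1))) :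
    P.xAt e y ≤ P.xAt f y ↔ P.xAt e y' ≤ P.xAt f y' := by
  rw [← not_lt, ← not_lt]
  exact not_congr ⟨P.xAt_lt_of_lt hf he hy hy', P.xAt_lt_of_lt hf he hy' hy⟩

theorem eq_of_xAt_eq {i : ℕ} {e f : P.vertices} (he : P.Spans i e) (hf : P.Spans i f)
    {y : ℝ} (hy : y ∈ Ioo (P.ht i) (P.ht (i + 1))) (h : P.xAt e y = P.xAt f y) : e = f := by
  by_contra hef
  have h1 := he.mem_Ioo hy
  have h2 := hf.mem_Ioo hy
  exact P.xAt_ne hef h1.1 h1.2 h2.1.le h2.2.le h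

/-- One horizontal segment in the interior, at any height inside the slab, determines a pair of
facing edges for the whole slab, since the edges keep their order there. -/
theorem facing_of_interior {i : ℕ} {y x₁ x₂ : ℝ} (hy : y ∈ Ioo (P.ht i) (P.ht (i + 1)))
    (h₁ : (x₁, y) ∈ frontier P.carrier) (h₂ : (x₂, y) ∈ frontier P.carrier) (hlt : x₁ < x₂)
    (hint : ∀ x ∈ Ioo x₁ x₂, (x, y) ∈ interior P.carrier) :
    ∃ l r, P.Facing i l r ∧ P.xAt l y = x₁ ∧ P.xAt r y = x₂ := by
  obtain ⟨l, hl⟩ := P.mem_frontier.1 h₁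
  obtain ⟨r, hr⟩ := P.mem_frontier.1 h₂
  have hsl : P.Spans i l := P.spans_of_mem_edge hl hy
  have hsr : P.Spans i r := P.spans_of_mem_edge hr hy
  have hxl : P.xAt l y = x₁ := P.xAt_of_mem hl
  have hxr : P.xAt r y = x₂ := P.xAt_of_mem hr
  refine ⟨l, r, ⟨hsl, hsr, ?_, ?_, ?_, ?_⟩, hxl, hxr⟩
  · have h := P.germ_iff_side (e := l) (s := 1) (by norm_num) (hsl.mem_Ioo hy).1 (hsl.mem_Ioo hy).2
    rw [← h, hxl]
    have : ∀ᶠ t in 𝓝[>] (0 : ℝ), t ∈ Ioo 0 (x₂ - x₁) := Ioo_mem_nhdsGT (by linarith)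
    filter_upwards [this] with t ht
    exact interior_subset (hint _ ⟨by linarith [ht.1], by linarith [ht.2]⟩)
  · have h := P.germ_iff_side (e := r) (s := -1) (by norm_num) (hsr.mem_Ioo hy).1 (hsr.mem_Ioo hy).2
    rw [P.side_iff_not, not_not, ← h, hxr]
    have : ∀ᶠ t in 𝓝[>] (0 : ℝ), t ∈ Ioo 0 (x₂ - x₁) := Ioo_mem_nhdsGT (by linarith)
    filter_upwards [this] with t ht
    exact interior_subset (hint _ ⟨by linarith [ht.2], by linarith [ht.1]⟩)
  · exact P.xAt_lt_of_lt hsl hsr hy (P.midHt_mem i) (by rw [hxl, hxr]; exact hlt)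
  · intro g hg
    rw [← P.xAt_le_iff_of_mem_Ioo hg hsl hy (P.midHt_mem i),
      ← P.xAt_le_iff_of_mem_Ioo hsr hg hy (P.midHt_mem i), hxl, hxr]
    by_contra! hcon
    have h1 := hint _ ⟨hcon.1, hcon.2⟩
    have h2 := P.edge_subset_frontier g (hg.mem_edge (Ioo_subset_Icc_self hy))
    exact h2.2 h1

theorem exists_facing_right {i : ℕ} {l : P.vertices} (hl : P.Spans i l) (hs : P.Side 1 l) :
    ∃ r, P.Facing i l r := by
  have hy := P.midHt_mem i
  have hg := (P.germ_iff_side (e := l) (s := 1) (by norm_num) (hl.mem_Ioo hy).1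
    (hl.mem_Ioo hy).2).2 hs
  obtain ⟨t, ht, h1, h2⟩ := P.exists_frontier_of_germ (by norm_num) hg
  obtain ⟨l', r, hf, hl', -⟩ := P.facing_of_interior hy
    (P.edge_subset_frontier l (hl.mem_edge (Ioo_subset_Icc_self hy))) h1 (by simpa using ht)
    (fun x hx => by
      have := h2 (x - P.xAt l (P.midHt i))
        ⟨by linarith [hx.1], by dsimp only at hx; linarith [hx.2]⟩
      simpa using this)
  have : l' = l := P.eq_of_xAt_eq hf.left hl hy hl'
  subst this
  exact ⟨r, hf⟩

theorem exists_facing_left {i : ℕ} {r : P.vertices} (hr : P.Spans i r) (hs : ¬ P.Side 1 r) :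
    ∃ l, P.Facing i l r := by
  have hy := P.midHt_mem i
  rw [P.side_iff_not, not_not] at hs
  have hg := (P.germ_iff_side (e := r) (s := -1) (by norm_num) (hr.mem_Ioo hy).1
    (hr.mem_Ioo hy).2).2 hs
  obtain ⟨t, ht, h1, h2⟩ := P.exists_frontier_of_germ (by norm_num) hg
  obtain ⟨l, r', hf, -, hr'⟩ := P.facing_of_interior hy h1
    (P.edge_subset_frontier r (hr.mem_edge (Ioo_subset_Icc_self hy))) (by simpa using ht)
    (fun x hx => by
      have := h2 (P.xAt r (P.midHt i) - x)
        ⟨by linarith [hx.2], by dsimp only at hx; linarith [hx.1]⟩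
      simpa using this)
  have : r' = r := P.eq_of_xAt_eq hf.right hr hy hr'
  subst this
  exact ⟨l, hf⟩

variable {P}

theorem Facing.right_unique {i : ℕ} {l r r' : P.vertices} (h : P.Facing i l r)
    (h' : P.Facing i l r') : r = r' := by
  refine P.eq_of_xAt_eq h.right h'.right (P.midHt_mem i) (le_antisymm ?_ ?_)
  · exact (h.between r' h'.right).resolve_left (not_le.2 h'.lt)
  · exact (h'.between r h.right).resolve_left (not_le.2 h.lt)

theorem Facing.left_unique {i : ℕ} {l l' r : P.vertices} (h : P.Facing i l r)
    (h' : P.Facing i l' r) : l = l' := by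
  refine P.eq_of_xAt_eq h.left h'.left (P.midHt_mem i) (le_antisymm ?_ ?_)
  · exact (h'.between l h.left).resolve_right (not_le.2 h.lt)
  · exact (h.between l' h'.left).resolve_right (not_le.2 h'.lt)

/-- Inside the slab, the ray from `l` to the first boundary point cannot stop before `r`, as no edge
runs between them. The two end heights follow by continuity in the Hausdorff Reeb space. -/
theorem Facing.edgeFiber_eq {i : ℕ} {l r : P.vertices} (h : P.Facing i l r) {y : ℝ}
    (hy : y ∈ Icc (P.ht i) (P.ht (i + 1))) : P.edgeFiber l y = P.edgeFiber r y := by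
  have key : ∀ y ∈ Ioo (P.ht i) (P.ht (i + 1)), P.edgeFiber l y = P.edgeFiber r y := by
    intro y hy
    have hg := (P.germ_iff_side (e := l) (s := 1) (by norm_num) (h.left.mem_Ioo hy).1
      (h.left.mem_Ioo hy).2).2 h.side
    obtain ⟨t, ht, h1, h2⟩ := P.exists_frontier_of_germ (by norm_num) hg
    have hlt := P.xAt_lt_of_lt h.left h.right (P.midHt_mem i) hy h.lt
    have hrF := P.edge_subset_frontier r (h.right.mem_edge (Ioo_subset_Icc_self hy))
    obtain ⟨g, hg⟩ := P.mem_frontier.1 h1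
    have hsg := P.spans_of_mem_edge hg hy
    have hxg : P.xAt g y = _ := P.xAt_of_mem hg
    dsimp only at hxg
    have hle : P.xAt r y ≤ P.xAt g y := by
      rw [P.xAt_le_iff_of_mem_Ioo h.right hsg hy (P.midHt_mem i)]
      refine (h.between g hsg).resolve_left ?_
      rw [← P.xAt_le_iff_of_mem_Ioo hsg h.left hy (P.midHt_mem i), hxg]
      linarith
    refine P.reebMk_eq_of_horizontal rfl (fun x hx1 hx2 => ?_) hlt.le
    dsimp only at hx1 hx2 ⊢
    rcases hx1.eq_or_lt with h3 | h3
    · rw [← h3]; exact P.edge_subset l (h.left.mem_edge (Ioo_subset_Icc_self hy))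
    rcases (hx2.trans hle).eq_or_lt with h4 | h4
    · rw [h4, hxg]; exact P.frontier_subset h1
    · have := h2 (x - P.xAt l y) ⟨by linarith, by linarith⟩
      simpa using interior_subset this
  have hcl : closure (Ioo (P.ht i) (P.ht (i + 1))) = Icc (P.ht i) (P.ht (i + 1)) :=
    closure_Ioo (P.ht_lt_succ i).ne
  exact (Set.EqOn.of_subset_closure (s := Ioo (P.ht i) (P.ht (i + 1))) key
    ((P.continuousOn_edgeFiber l).mono h.left.Icc_subset)
    ((P.continuousOn_edgeFiber r).mono h.right.Icc_subset) Ioo_subset_Icc_self hcl.ge) hy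

variable (P)

open Classical in
/-- The edge facing a left edge in a slab. -/
noncomputable def facing (a : ℕ × P.vertices) : P.vertices :=
  if h : ∃ r, P.Facing a.1 a.2 r then h.choose else a.2

theorem facing_spec {a : ℕ × P.vertices} (ha : a ∈ P.slabArcs) :
    P.Facing a.1 a.2 (P.facing a) := by
  rw [mem_slabArcs] at ha
  have h := P.exists_facing_right ha.1 ha.2
  rw [facing, dif_pos h]
  exact h.choose_spec

variable {P}

theorem facing_eq {i : ℕ} {l r : P.vertices} (h : P.Facing i l r) : P.facing (i, l) = r :=
  (P.facing_spec (a := (i, l)) (P.mem_slabArcs.2 ⟨h.left, h.side⟩)).right_unique h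

theorem Facing.mem {i : ℕ} {l r : P.vertices} (h : P.Facing i l r) : (i, l) ∈ P.slabArcs :=
  P.mem_slabArcs.2 ⟨h.left, h.side⟩

variable (P)

/-! ### Flows from potentials -/

open Classical in
/-- Sum over the edges with a fiber `q` that start or cross below it, of a function counted
negatively on left edges. -/
theorem sum_slab_eq {i : ℕ} {y : ℝ} (hy : y ∈ Icc (P.ht i) (P.ht (i + 1))) (q : P.ReebSpace)
    (a : P.vertices → ℚ) :
    ∑ l with P.Spans i l ∧ P.Side 1 l ∧ P.edgeFiber l y = q, (a (P.facing (i, l)) - a l) =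
      ∑ e with P.Spans i e ∧ P.edgeFiber e y = q, (if P.Side 1 e then -a e else a e) := by
  rw [Finset.sum_sub_distrib]
  have h1 : ∑ e with P.Spans i e ∧ P.edgeFiber e y = q, (if P.Side 1 e then -a e else a e) =
      ∑ e with P.Spans i e ∧ ¬ P.Side 1 e ∧ P.edgeFiber e y = q, a e -
      ∑ e with P.Spans i e ∧ P.Side 1 e ∧ P.edgeFiber e y = q, a e := by
    rw [Finset.sum_ite, Finset.filter_filter, Finset.filter_filter, Finset.sum_neg_distrib,
      neg_add_eq_sub]
    congr 1
    · refine Finset.sum_congr (Finset.filter_congr fun e _ => ?_) fun _ _ => rfl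
      tauto
    · refine Finset.sum_congr (Finset.filter_congr fun e _ => ?_) fun _ _ => rfl
      tauto
  rw [h1]
  congr 1
  -- Facing is a bijection between the left and the right edges of the slab, and facing edges have
  -- the same fibers.
  refine Finset.sum_bij (fun l _ => P.facing (i, l)) ?_ ?_ ?_ ?_
  · intro l hl
    simp only [Finset.mem_filter, Finset.mem_univ, true_and] at hl ⊢
    have hf := P.facing_spec (a := (i, l)) (P.mem_slabArcs.2 ⟨hl.1, hl.2.1⟩)
    exact ⟨hf.right, hf.side', by rw [← hf.edgeFiber_eq hy]; exact hl.2.2⟩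
  · intro l hl l' hl' h
    simp only [Finset.mem_filter, Finset.mem_univ, true_and] at hl hl'
    have hf := P.facing_spec (a := (i, l)) (P.mem_slabArcs.2 ⟨hl.1, hl.2.1⟩)
    have hf' := P.facing_spec (a := (i, l')) (P.mem_slabArcs.2 ⟨hl'.1, hl'.2.1⟩)
    rw [← h] at hf'
    exact hf.left_unique hf'
  · intro r hr
    simp only [Finset.mem_filter, Finset.mem_univ, true_and] at hr
    obtain ⟨l, hf⟩ := P.exists_facing_left hr.1 hr.2.1
    refine ⟨l, ?_, facing_eq hf⟩
    simp only [Finset.mem_filter, Finset.mem_univ, true_and]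
    exact ⟨hf.left, hf.side, by rw [hf.edgeFiber_eq hy]; exact hr.2.2⟩
  · intros; rfl

end PlanarPolygon

namespace PlanarPolygon

variable (P : PlanarPolygon)

theorem reebHeight_slabSrc {a : ℕ × P.vertices} (ha : a ∈ P.slabArcs) :
    P.reebHeight (P.slabSrc a) = P.ht a.1 := by
  have h := (P.mem_slabArcs.1 ha).1.mem_Icc (P.ht_mem_Icc_left a.1)
  exact P.reebHeight_edgeFiber h.1 h.2

theorem reebHeight_slabTgt {a : ℕ × P.vertices} (ha : a ∈ P.slabArcs) :
    P.reebHeight (P.slabTgt a) = P.ht (a.1 + 1) := by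
  have h := (P.mem_slabArcs.1 ha).1.mem_Icc (P.ht_mem_Icc_right a.1)
  exact P.reebHeight_edgeFiber h.1 h.2

open Classical in
theorem sum_slabSrc {j : ℕ} {q : P.ReebSpace} (hq : P.reebHeight q = P.ht j)
    (z : ℕ × P.vertices → ℚ) : ∑ a ∈ P.slabArcs with P.slabSrc a = q, z a =
      ∑ l with P.Spans j l ∧ P.Side 1 l ∧ P.edgeFiber l (P.ht j) = q, z (j, l) := by
  refine Finset.sum_bij (fun a _ => a.2) ?_ ?_ ?_ ?_
  · intro a ha
    rw [Finset.mem_filter] at ha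
    have h1 : a.1 = j := by
      apply P.ht_strictMono.injective
      rw [← hq, ← ha.2, P.reebHeight_slabSrc ha.1]
    subst h1
    have h2 := P.mem_slabArcs.1 ha.1
    simpa using ⟨h2.1, h2.2, ha.2⟩
  · intro a ha b hb hab
    rw [Finset.mem_filter] at ha hb
    refine Prod.ext (P.ht_strictMono.injective ?_) hab
    rw [← P.reebHeight_slabSrc ha.1, ← P.reebHeight_slabSrc hb.1, ha.2, hb.2]
  · intro l hl
    simp only [Finset.mem_filter, Finset.mem_univ, true_and] at hl
    exact ⟨(j, l), Finset.mem_filter.2 ⟨P.mem_slabArcs.2 ⟨hl.1, hl.2.1⟩, hl.2.2⟩, rfl⟩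
  · intro a ha
    rw [Finset.mem_filter] at ha
    have h1 : a.1 = j := by
      apply P.ht_strictMono.injective
      rw [← hq, ← ha.2, P.reebHeight_slabSrc ha.1]
    subst h1
    rfl

open Classical in
theorem sum_slabTgt {i : ℕ} {q : P.ReebSpace} (hq : P.reebHeight q = P.ht (i + 1))
    (z : ℕ × P.vertices → ℚ) : ∑ a ∈ P.slabArcs with P.slabTgt a = q, z a =
      ∑ l with P.Spans i l ∧ P.Side 1 l ∧ P.edgeFiber l (P.ht (i + 1)) = q, z (i, l) := by
  have key : ∀ a ∈ P.slabArcs, P.slabTgt a = q → a.1 = i := by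
    intro a ha ha'
    have : P.ht (a.1 + 1) = P.ht (i + 1) := by rw [← hq, ← ha', P.reebHeight_slabTgt ha]
    have := P.ht_strictMono.injective this
    omega
  refine Finset.sum_bij (fun a _ => a.2) ?_ ?_ ?_ ?_
  · intro a ha
    rw [Finset.mem_filter] at ha
    have h1 := key a ha.1 ha.2
    subst h1
    have h2 := P.mem_slabArcs.1 ha.1
    simpa using ⟨h2.1, h2.2, ha.2⟩
  · intro a ha b hb hab
    rw [Finset.mem_filter] at ha hb
    exact Prod.ext ((key a ha.1 ha.2).trans (key b hb.1 hb.2).symm) hab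
  · intro l hl
    simp only [Finset.mem_filter, Finset.mem_univ, true_and] at hl
    exact ⟨(i, l), Finset.mem_filter.2 ⟨P.mem_slabArcs.2 ⟨hl.1, hl.2.1⟩, hl.2.2⟩, rfl⟩
  · intro a ha
    rw [Finset.mem_filter] at ha
    have h1 := key a ha.1 ha.2
    subst h1
    rfl

theorem sum_slabTgt_zero {q : P.ReebSpace} (hq : P.reebHeight q = P.ht 0)
    (z : ℕ × P.vertices → ℚ) [DecidablePred fun a => P.slabTgt a = q] :
    ∑ a ∈ P.slabArcs with P.slabTgt a = q, z a = 0 := by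
  refine Finset.sum_eq_zero fun a ha => ?_
  rw [Finset.mem_filter] at ha
  have : P.ht (a.1 + 1) = P.ht 0 := by rw [← hq, ← ha.2, P.reebHeight_slabTgt ha.1]
  have := P.ht_strictMono.injective this
  omega

theorem eq_of_next_eq {α : Type*} {a : P.vertices → α} (ha : ∀ v, a (P.next v) = a v)
    {e f v : P.vertices} (he : (v : ℝ × ℝ) ∈ P.edge e) (hf : (v : ℝ × ℝ) ∈ P.edge f) :
    a e = a f := by
  have key : ∀ g, (v : ℝ × ℝ) ∈ P.edge g → a g = a v := by
    intro g hg
    rcases P.mem_edge_iff_vertex.1 hg with rfl | rfl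
    · rfl
    · rw [← ha (P.next.symm v), Equiv.apply_symm_apply]
  rw [key e he, key f hf]

-- The conservation law at the fiber `q`. Only the two edges at a vertex of height `h` are treated
-- differently by the two sums. If one goes up and one down, they carry the same sign and replace
-- each other; if both go the same way, they carry opposite signs and cancel.
open Classical in
theorem sum_up_eq_sum_down {a : P.vertices → ℚ} (ha : ∀ v, a (P.next v) = a v) (h : ℝ)
    (q : P.ReebSpace) :
    ∑ e with (P.lo e ≤ h ∧ h < P.hi e) ∧ P.edgeFiber e h = q, (if P.Side 1 e then -a e else a e) =
      ∑ e with (P.lo e < h ∧ h ≤ P.hi e) ∧ P.edgeFiber e h = q,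
        (if P.Side 1 e then -a e else a e) := by
  rw [← sub_eq_zero, Finset.sum_filter, Finset.sum_filter, ← Finset.sum_sub_distrib]
  by_cases hv : ∃ v : P.vertices, (v : ℝ × ℝ).2 = h
  · obtain ⟨v, rfl⟩ := hv
    obtain ⟨e, f, hef, he, hf, hcases⟩ := P.vertex_cases v
    have hout : ∀ g, g ≠ e ∧ g ≠ f → P.lo g ≠ (v : ℝ × ℝ).2 ∧ P.hi g ≠ (v : ℝ × ℝ).2 := by
      intro g hg
      have hno : (v : ℝ × ℝ) ∉ P.edge g := fun hvg => by
        rcases P.edges_at hef he hf hvg with h | h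
        · exact hg.1 h
        · exact hg.2 h
      have key : ∀ u : P.vertices, (u : ℝ × ℝ) = (P.xAt g (u : ℝ × ℝ).2, (u : ℝ × ℝ).2) →
          P.lo g ≤ (u : ℝ × ℝ).2 → (u : ℝ × ℝ).2 ≤ P.hi g →
          (u : ℝ × ℝ).2 ≠ (v : ℝ × ℝ).2 := by
        intro u hu h1 h2 h3
        have : u = v := P.vertex_ext h3
        subst this
        exact hno (by rw [hu]; exact P.xAt_mem_edge h1 h2)
      have hlh := P.lo_lt_hi g
      constructor
      · obtain ⟨u, hu⟩ := P.exists_lo g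
        have h3 : (u : ℝ × ℝ).2 = P.lo g := by rw [hu]
        rw [← h3]
        refine key u ?_ (by linarith) (by linarith)
        rw [h3]; exact hu
      · obtain ⟨u, hu⟩ := P.exists_hi g
        have h3 : (u : ℝ × ℝ).2 = P.hi g := by rw [hu]
        rw [← h3]
        refine key u ?_ (by linarith) (by linarith)
        rw [h3]; exact hu
    rw [← Finset.sum_subset (Finset.subset_univ ({e, f} : Finset P.vertices)), Finset.sum_pair hef]
    · have h1 : P.edgeFiber e (v : ℝ × ℝ).2 = P.reebMk v := by
        unfold edgeFiber; rw [P.xAt_of_mem he]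
      have h2 : P.edgeFiber f (v : ℝ × ℝ).2 = P.reebMk v := by
        unfold edgeFiber; rw [P.xAt_of_mem hf]
      rw [h1, h2, P.eq_of_next_eq ha he hf]
      have l1 := P.lo_lt_hi e
      have l2 := P.lo_lt_hi f
      by_cases hq : P.reebMk v = q
      · rcases hcases with ⟨c1, c2, c3, -⟩ | ⟨⟨c1, c2, -⟩ | ⟨c1, c2, -⟩, c3, -⟩
        · by_cases hs : P.Side 1 f
          · rw [c1] at l1; rw [c2] at l2; simp [c1, c2, c3, hq, hs, l1, l2, l1.le, l2.le]
          · rw [c1] at l1; rw [c2] at l2; simp [c1, c2, c3, hq, hs, l1, l2, l1.le, l2.le]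
        · rw [c1] at l1; rw [c2] at l2
          by_cases hs : P.Side 1 f <;> simp [c1, c2, c3, hq, hs, l1, l2]
        · rw [c1] at l1; rw [c2] at l2
          by_cases hs : P.Side 1 f <;> simp [c1, c2, c3, hq, hs, l1, l2]
      · simp [hq]
    · intro g _ hg
      rw [Finset.mem_insert, Finset.mem_singleton, not_or] at hg
      obtain ⟨h1, h2⟩ := hout g hg
      have : ((P.lo g ≤ (v : ℝ × ℝ).2 ∧ (v : ℝ × ℝ).2 < P.hi g) ∧
          P.edgeFiber g (v : ℝ × ℝ).2 = q) ↔ ((P.lo g < (v : ℝ × ℝ).2 ∧ (v : ℝ × ℝ).2 ≤ P.hi g) ∧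
          P.edgeFiber g (v : ℝ × ℝ).2 = q) := by
        rw [lt_iff_le_and_ne, lt_iff_le_and_ne]
        have := h2.symm
        tauto
      simp only [this, sub_self]
  · push Not at hv
    refine Finset.sum_eq_zero fun g _ => ?_
    have h1 : P.lo g ≠ h := by
      obtain ⟨u, hu⟩ := P.exists_lo g
      have h3 : (u : ℝ × ℝ).2 = P.lo g := by rw [hu]
      rw [← h3]; exact hv u
    have h2 : P.hi g ≠ h := by
      obtain ⟨u, hu⟩ := P.exists_hi g
      have h3 : (u : ℝ × ℝ).2 = P.hi g := by rw [hu]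
      rw [← h3]; exact hv u
    have : ((P.lo g ≤ h ∧ h < P.hi g) ∧ P.edgeFiber g h = q) ↔
        ((P.lo g < h ∧ h ≤ P.hi g) ∧ P.edgeFiber g h = q) := by
      rw [lt_iff_le_and_ne, lt_iff_le_and_ne]
      have := h2.symm
      tauto
    simp only [this, sub_self]

/-- A function of the boundary cycles gives a flow. -/
theorem isFlow_of_next_eq {a : P.vertices → ℚ} (ha : ∀ v, a (P.next v) = a v) :
    IsFlow P.slabNodes P.slabArcs P.slabSrc P.slabTgt fun b => a (P.facing b) - a b.2 := by
  classical
  intro q hq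
  obtain ⟨j, hj⟩ := P.exists_height_of_mem_slabNodes hq
  have h1 := P.sum_slabSrc hj fun b => a (P.facing b) - a b.2
  have h2 := P.sum_slab_eq (P.ht_mem_Icc_left j) q a
  have h3 := P.sum_up_eq_sum_down ha (P.ht j) q
  simp only [← P.spans_iff_up] at h3
  have e1 : ∑ b ∈ P.slabArcs with P.slabSrc b = q, (a (P.facing b) - a b.2) = _ :=
    (h1.trans h2).trans h3
  have e2 : ∑ b ∈ P.slabArcs with P.slabTgt b = q, (a (P.facing b) - a b.2) =
      ∑ b ∈ P.slabArcs with P.slabSrc b = q, (a (P.facing b) - a b.2) := by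
    rw [e1]
    rcases j with _ | i
    · rw [P.sum_slabTgt_zero hj]
      symm
      refine Finset.sum_eq_zero fun g hg => ?_
      rw [Finset.mem_filter] at hg
      exfalso
      obtain ⟨k, hk⟩ := P.exists_ht_lo g
      have := hg.2.1.1
      rw [← hk, P.ht_strictMono.lt_iff_lt] at this
      omega
    · rw [P.sum_slabTgt hj, P.sum_slab_eq (P.ht_mem_Icc_right i) q a]
      simp only [P.spans_iff_down]
  convert e2

end PlanarPolygon

namespace PlanarPolygon

variable (P : PlanarPolygon)

/-! ### Functions of the boundary cycles that agree on facing edges -/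

theorem eq_of_mem_edges {α : Type*} {a : P.vertices → α} (ha : ∀ v, a (P.next v) = a v)
    {e f : P.vertices} {p : ℝ × ℝ} (he : p ∈ P.edge e) (hf : p ∈ P.edge f) : a e = a f := by
  by_cases hef : e = f
  · rw [hef]
  · obtain ⟨u, rfl⟩ := P.exists_vertex_of_mem_edges hef he hf
    exact P.eq_of_next_eq ha he hf

theorem xAt_lt_of_lt_Icc {i : ℕ} {e f : P.vertices} (he : P.Spans i e) (hf : P.Spans i f) {y y' : ℝ}
    (hy : y ∈ Icc (P.ht i) (P.ht (i + 1))) (hy' : y' ∈ Ioo (P.ht i) (P.ht (i + 1)))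
    (h : P.xAt e y < P.xAt f y) : P.xAt e y' < P.xAt f y' := by
  by_contra hcon
  rcases (not_lt.1 hcon).eq_or_lt with h1 | h1
  · have := P.eq_of_xAt_eq hf he hy' h1
    rw [this] at h
    exact lt_irrefl _ h
  · exact absurd (P.xAt_le_of_lt hf he hy' hy h1) (not_le.2 h)

/-- By general position at most one of the two points is a vertex. A slab is chosen for the edge at
this point, and the other edge passes through the height `h`, so it crosses the slab as well. -/
theorem exists_spans_of_consecutive {e₁ e₂ : P.vertices} {h x₁ x₂ : ℝ} (h₁ : (x₁, h) ∈ P.edge e₁)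
    (h₂ : (x₂, h) ∈ P.edge e₂) (hlt : x₁ < x₂) :
    ∃ i, P.Spans i e₁ ∧ P.Spans i e₂ ∧ h ∈ Icc (P.ht i) (P.ht (i + 1)) := by
  have b₁ := (P.mem_edge.1 h₁).1
  have b₂ := (P.mem_edge.1 h₂).1
  dsimp only at b₁ b₂
  rcases P.vertex_or_mem_Ioo h₂ with ⟨v, hv⟩ | ⟨h3, h4⟩
  · rcases P.vertex_or_mem_Ioo h₁ with ⟨w, hw⟩ | ⟨h3, h4⟩
    · have : v = w := P.vertex_ext (by rw [← hv, ← hw])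
      rw [← this, ← hv] at hw
      exact absurd (congrArg Prod.fst hw) hlt.ne
    · obtain ⟨i, hi, hy⟩ := P.exists_spans b₂.1 b₂.2
      exact ⟨i, P.spans_of_lt (h3.trans_le hy.2) (hy.1.trans_lt h4), hi, hy⟩
  · obtain ⟨i, hi, hy⟩ := P.exists_spans b₁.1 b₁.2
    exact ⟨i, hi, P.spans_of_lt (h3.trans_le hy.2) (hy.1.trans_lt h4), hy⟩

/-- Facing edges are defined through heights inside a slab, but `h` may be a vertex height. At a
height `y` in the slab close to `h`, the maximal horizontal segment through `(m, y)` ends on two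
facing edges. Back at the height `h` these pass through the two given points, for otherwise one of
`e₁`, `e₂` would cross the segment. Edges through a common point have equal values. -/
theorem eq_of_consecutive {α : Type*} {a : P.vertices → α} (ha : ∀ v, a (P.next v) = a v)
    (hf : ∀ i l r, P.Facing i l r → a l = a r) {e₁ e₂ : P.vertices} {h x₁ x₂ : ℝ}
    (h₁ : (x₁, h) ∈ P.edge e₁) (h₂ : (x₂, h) ∈ P.edge e₂) (hlt : x₁ < x₂)
    (hint : ∀ x ∈ Ioo x₁ x₂, (x, h) ∈ interior P.carrier) : a e₁ = a e₂ := by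
  obtain ⟨i, hs₁, hs₂, hh⟩ := P.exists_spans_of_consecutive h₁ h₂ hlt
  have hx₁ : P.xAt e₁ h = x₁ := P.xAt_of_mem h₁
  have hx₂ : P.xAt e₂ h = x₂ := P.xAt_of_mem h₂
  obtain ⟨m, hm₁, hm₂⟩ := exists_between hlt
  have hmi := hint m ⟨hm₁, hm₂⟩
  have hne : (𝓝[Ioo (P.ht i) (P.ht (i + 1))] h).NeBot := by
    rw [← mem_closure_iff_nhdsWithin_neBot, closure_Ioo (P.ht_lt_succ i).ne]
    exact hh
  have ev1 : ∀ᶠ y in 𝓝 h, (m, y) ∈ interior P.carrier := by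
    have hc : Continuous fun y : ℝ => ((m, y) : ℝ × ℝ) := by fun_prop
    exact hc.continuousAt (isOpen_interior.mem_nhds hmi)
  have ev2 : ∀ᶠ y in 𝓝 h, ∀ g, P.xAt g h < m → P.xAt g y < m := by
    rw [eventually_all]
    intro g
    by_cases hg : P.xAt g h < m
    · filter_upwards [(P.continuous_xAt g).continuousAt.eventually_lt continuousAt_const hg]
        with y hy _ using hy
    · exact Eventually.of_forall fun _ h => absurd h hg
  have ev3 : ∀ᶠ y in 𝓝 h, ∀ g, m < P.xAt g h → m < P.xAt g y := by
    rw [eventually_all]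
    intro g
    by_cases hg : m < P.xAt g h
    · filter_upwards [continuousAt_const.eventually_lt (P.continuous_xAt g).continuousAt hg]
        with y hy _ using hy
    · exact Eventually.of_forall fun _ h => absurd h hg
  obtain ⟨y, ⟨⟨hy1, hy2⟩, hy3⟩, hy⟩ := (((ev1.and ev2).and ev3).filter_mono
    nhdsWithin_le_nhds |>.and (eventually_mem_nhdsWithin (s := Ioo (P.ht i) (P.ht (i + 1))))).exists
  obtain ⟨t₁, ht₁, hF₁, hI₁⟩ := P.exists_frontier_of_germ (p := (m, y)) (s := -1) (by norm_num)
    (P.germ_of_mem_interior hy1 _)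
  obtain ⟨t₂, ht₂, hF₂, hI₂⟩ := P.exists_frontier_of_germ (p := (m, y)) (s := 1) (by norm_num)
    (P.germ_of_mem_interior hy1 _)
  dsimp only at hF₁ hF₂ hI₁ hI₂
  have hI : ∀ x ∈ Ioo (m + -1 * t₁) (m + 1 * t₂), (x, y) ∈ interior P.carrier := by
    intro x hx
    rcases lt_trichotomy x m with h3 | h3 | h3
    · have := hI₁ (m - x) ⟨by linarith, by linarith [hx.1]⟩
      rwa [show m + -1 * (m - x) = x by ring] at this
    · rw [h3]; exact hy1
    · have := hI₂ (x - m) ⟨by linarith, by linarith [hx.2]⟩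
      rwa [show m + 1 * (x - m) = x by ring] at this
  obtain ⟨l, r, hlr, hl, hr⟩ := P.facing_of_interior hy hF₁ hF₂ (by linarith) hI
  have hlF := P.edge_subset_frontier l (hlr.left.mem_edge hh)
  have hrF := P.edge_subset_frontier r (hlr.right.mem_edge hh)
  have hnotI : ∀ g, P.Spans i g → ¬ (m + -1 * t₁ < P.xAt g y ∧ P.xAt g y < m + 1 * t₂) :=
    fun g hg hcon => (P.edge_subset_frontier g (hg.mem_edge (Ioo_subset_Icc_self hy))).2
      (hI _ hcon)
  have hl1 : P.xAt l h = x₁ := by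
    have h3 : ¬ m < P.xAt l h := fun hcon => by
      have := hy3 l hcon
      linarith
    have h4 : P.xAt l h ≤ x₁ := by
      by_contra! hcon
      exact hlF.2 (hint _ ⟨hcon, by linarith⟩)
    refine h4.eq_of_not_lt fun h5 => ?_
    rw [← hx₁] at h5
    have h6 := P.xAt_lt_of_lt_Icc hlr.left hs₁ hh hy h5
    refine hnotI e₁ hs₁ ⟨by linarith, ?_⟩
    have := hy2 e₁ (by rw [hx₁]; exact hm₁)
    linarith
  have hr1 : P.xAt r h = x₂ := by
    have h3 : ¬ P.xAt r h < m := fun hcon => by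
      have := hy2 r hcon
      linarith
    have h4 : x₂ ≤ P.xAt r h := by
      by_contra! hcon
      exact hrF.2 (hint _ ⟨by linarith, hcon⟩)
    refine (h4.eq_of_not_lt fun h5 => ?_).symm
    rw [← hx₂] at h5
    have h6 := P.xAt_lt_of_lt_Icc hs₂ hlr.right hh hy h5
    refine hnotI e₂ hs₂ ⟨?_, by linarith⟩
    have := hy3 e₂ (by rw [hx₂]; exact hm₂)
    linarith
  have hle := hlr.left.mem_edge hh
  have hre := hlr.right.mem_edge hh
  rw [hl1] at hle
  rw [hr1] at hre
  rw [P.eq_of_mem_edges ha h₁ hle, hf i l r hlr, P.eq_of_mem_edges ha hre h₂]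

/-- A fiber may touch the boundary between its ends. One walks along it from one boundary point to
the next, and the value of `a` does not change in any step. -/
theorem eq_of_edgeFiber_eq {α : Type*} {a : P.vertices → α} (ha : ∀ v, a (P.next v) = a v)
    (hf : ∀ i l r, P.Facing i l r → a l = a r) {e f : P.vertices} {y : ℝ}
    (he : P.lo e ≤ y ∧ y ≤ P.hi e) (hf' : P.lo f ≤ y ∧ y ≤ P.hi f)
    (h : P.edgeFiber e y = P.edgeFiber f y) : a e = a f := by
  wlog hle : P.xAt e y ≤ P.xAt f y generalizing e f
  · exact (this hf' he h.symm (le_of_not_ge hle)).symm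
  have hme := P.xAt_mem_edge he.1 he.2
  have hmf := P.xAt_mem_edge hf'.1 hf'.2
  -- The boundary points of the fiber to which the value of `e` is known to extend; the rightmost of
  -- them must be the point of `f`.
  set D : Set ℝ := {x | (P.xAt e y ≤ x ∧ x ≤ P.xAt f y) ∧ ∃ g, (x, y) ∈ P.edge g ∧ a g = a e}
  have hfin : D.Finite := by
    refine (finite_range fun g => P.xAt g y).subset ?_
    rintro x ⟨-, g, hg, -⟩
    exact ⟨g, P.xAt_of_mem hg⟩
  obtain ⟨x₁, ⟨⟨h1, h2⟩, g, hg, hga⟩, hmax⟩ :=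
    hfin.exists_maximalFor id D ⟨P.xAt e y, ⟨le_rfl, hle⟩, e, hme, rfl⟩
  rcases h2.eq_or_lt with h2 | h2
  · rw [← hga]
    rw [h2] at hg
    exact P.eq_of_mem_edges ha hg hmf
  exfalso
  have hgerm := P.germ_pos_of_reebMk_eq (P.edge_subset e hme) (P.edge_subset f hmf) h h1 h2
  obtain ⟨t, ht, hF, hI⟩ := P.exists_frontier_of_germ (by norm_num) hgerm
  dsimp only at hF hI
  obtain ⟨g', hg'⟩ := P.mem_frontier.1 hF
  have hle' : x₁ + 1 * t ≤ P.xAt f y := by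
    by_contra! hcon
    have h3 := hI (P.xAt f y - x₁) ⟨by linarith, by linarith⟩
    rw [show x₁ + 1 * (P.xAt f y - x₁) = P.xAt f y by ring] at h3
    exact (P.edge_subset_frontier f hmf).2 h3
  have h3 : a g = a g' := by
    refine P.eq_of_consecutive ha hf hg hg' (by linarith) fun x hx => ?_
    have := hI (x - x₁) ⟨by linarith [hx.1], by linarith [hx.2]⟩
    rwa [show x₁ + 1 * (x - x₁) = x by ring] at this
  have h4 : x₁ + 1 * t ∈ D := ⟨⟨by linarith, hle'⟩, g', hg', by rw [← h3, hga]⟩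
  have : x₁ + 1 * t ≤ x₁ := hmax h4 (by simp; linarith)
  linarith

/-- Every fiber meets an edge. The fibers that meet edges with the value `a v` and those that meet
edges with another value form closed sets covering the Reeb space; if both were nonempty they would
share a fiber. This shows later that the flow of a nonconstant function is not zero. -/
theorem eq_of_facing [ConnectedSpace P.ReebSpace] {α : Type*} {a : P.vertices → α}
    (ha : ∀ v, a (P.next v) = a v) (hf : ∀ i l r, P.Facing i l r → a l = a r) (v w : P.vertices) :
    a v = a w := by
  by_contra hvw
  have hclosed : ∀ s : Set P.vertices,
      IsClosed (⋃ e ∈ s, P.edgeFiber e '' Icc (P.lo e) (P.hi e)) := fun s =>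
    s.toFinite.isClosed_biUnion fun e _ =>
      (isCompact_Icc.image_of_continuousOn (P.continuousOn_edgeFiber e)).isClosed
  have hmem : ∀ (s : Set P.vertices) (e : P.vertices), e ∈ s → ∀ y, P.lo e ≤ y → y ≤ P.hi e →
      P.edgeFiber e y ∈ ⋃ e ∈ s, P.edgeFiber e '' Icc (P.lo e) (P.hi e) := fun s e he y h1 h2 =>
    mem_biUnion he ⟨y, ⟨h1, h2⟩, rfl⟩
  have hpre := isPreconnected_closed_iff.1 (isPreconnected_univ (α := P.ReebSpace)) _ _
    (hclosed {e | a e = a v}) (hclosed {e | a e ≠ a v}) ?_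
    ⟨_, mem_univ _, hmem {e | a e = a v} v rfl _ le_rfl (P.lo_lt_hi v).le⟩
    ⟨_, mem_univ _, hmem {e | a e ≠ a v} w (Ne.symm hvw) _ le_rfl (P.lo_lt_hi w).le⟩
  · obtain ⟨q, -, h1, h2⟩ := hpre
    rw [mem_iUnion₂] at h1 h2
    obtain ⟨e, he, y, hy, rfl⟩ := h1
    obtain ⟨f, hf', y', hy', h3⟩ := h2
    have h4 := congrArg P.reebHeight h3
    rw [P.reebHeight_edgeFiber hy.1 hy.2, P.reebHeight_edgeFiber hy'.1 hy'.2] at h4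
    subst h4
    exact hf' ((P.eq_of_edgeFiber_eq ha hf hy' hy h3).trans he)
  · intro q _
    obtain ⟨p, hp, rfl⟩ := P.exists_reebMk q
    obtain ⟨l, -, hl, h⟩ := P.exists_left_edge hp
    rw [← h]
    by_cases hlv : a l = a v
    · exact Or.inl (hmem _ l hlv _ hl.1 hl.2)
    · exact Or.inr (hmem _ l hlv _ hl.1 hl.2)

end PlanarPolygon

theorem IsFlow.sum_filter_eq {X ι : Type*} {A : Finset X} {B : Finset ι} {src tgt : ι → X}
    {z : ι → ℚ} (hz : IsFlow A B src tgt z) (hs : ∀ e ∈ B, src e ∈ A) (ht : ∀ e ∈ B, tgt e ∈ A)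
    (N : X → Prop) [DecidablePred fun e => N (src e)] [DecidablePred fun e => N (tgt e)] :
    ∑ e ∈ B with N (src e), z e = ∑ e ∈ B with N (tgt e), z e := by
  classical
  have key : ∀ (f : ι → X) (hf : ∀ e ∈ B, f e ∈ A) [DecidablePred fun e => N (f e)],
      ∑ e ∈ B with N (f e), z e = ∑ a ∈ A with N a, ∑ e ∈ B with f e = a, z e := by
    intro f hf _
    rw [← Finset.sum_fiberwise_of_maps_to (s := B.filter fun e => N (f e))
      (t := A.filter fun a => N a) (g := f)]
    · refine Finset.sum_congr rfl fun a ha => ?_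
      rw [Finset.filter_filter]
      refine Finset.sum_congr (Finset.filter_congr fun e _ => ?_) fun _ _ => rfl
      constructor
      · exact fun h => h.2
      · rintro rfl
        exact ⟨(Finset.mem_filter.1 ha).2, rfl⟩
    · intro e he
      rw [Finset.mem_filter] at he ⊢
      exact ⟨hf e he.1, he.2⟩
  rw [key src hs, key tgt ht]
  refine Finset.sum_congr rfl fun a ha => ?_
  have := (hz a (Finset.mem_filter.1 ha).1).symm
  convert this

namespace PlanarPolygon

variable (P : PlanarPolygon)

/-! ### Potentials of flows -/

open Classical in
/-- The sum of a function over the arcs in a slab whose abscissa at the height `y` is in `R`. -/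
noncomputable def slabSum (z : ℕ × P.vertices → ℚ) (i : ℕ) (y : ℝ) (R : Set ℝ) : ℚ :=
  ∑ a ∈ P.slabArcs with a.1 = i ∧ P.xAt a.2 y ∈ R, z a

open Classical in
/-- The sum of a function over the arcs ending at the level `j` with abscissa in `R`. -/
noncomputable def downSum (z : ℕ × P.vertices → ℚ) (j : ℕ) (R : Set ℝ) : ℚ :=
  ∑ a ∈ P.slabArcs with a.1 + 1 = j ∧ P.xAt a.2 (P.ht j) ∈ R, z a

theorem downSum_succ (z : ℕ × P.vertices → ℚ) (i : ℕ) (R : Set ℝ) :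
    P.downSum z (i + 1) R = P.slabSum z i (P.ht (i + 1)) R := by
  classical
  unfold downSum slabSum
  refine Finset.sum_congr (Finset.filter_congr fun a _ => ?_) fun _ _ => rfl
  rw [Nat.add_right_cancel_iff]

/-- A set of abscissas containing with a point of a fiber at height `h` the whole fiber. -/
def IsFull (h : ℝ) (R : Set ℝ) : Prop :=
  ∀ x x', (x, h) ∈ P.carrier → (x', h) ∈ P.carrier → P.reebMk (x, h) = P.reebMk (x', h) →
    x ∈ R → x' ∈ R

/-- A fiber with points on both sides of the bound would contain points just on the left of `x₀`. -/
theorem isFull_Iio {h x₀ : ℝ} (hg : ¬ P.Germ (-1) (x₀, h)) : P.IsFull h (Iio x₀) := by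
  intro x x' hx hx' heq hxR
  by_contra hcon
  exact hg (P.germ_neg_of_reebMk_eq hx hx' heq (x := x₀) hxR (not_lt.1 hcon))

theorem isFull_Iic {h x₀ : ℝ} (hg : ¬ P.Germ 1 (x₀, h)) : P.IsFull h (Iic x₀) := by
  intro x x' hx hx' heq hxR
  by_contra hcon
  exact hg (P.germ_pos_of_reebMk_eq hx hx' heq (x := x₀) hxR (not_le.1 hcon))

/-- A full set of abscissas selects complete nodes at the level `j`, so the conservation law may be
summed over them: what starts upwards in `R` is what arrives from below in `R`. -/
theorem slabSum_eq_downSum {z : ℕ × P.vertices → ℚ}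
    (hz : IsFlow P.slabNodes P.slabArcs P.slabSrc P.slabTgt z) {j : ℕ} {R : Set ℝ}
    (hR : P.IsFull (P.ht j) R) : P.slabSum z j (P.ht j) R = P.downSum z j R := by
  classical
  set N : P.ReebSpace → Prop := fun q =>
    ∃ x ∈ R, (x, P.ht j) ∈ P.carrier ∧ P.reebMk (x, P.ht j) = q with hN
  have h := hz.sum_filter_eq (fun a ha => P.slabSrc_mem ha) (fun a ha => P.slabTgt_mem ha) N
  have hNiff : ∀ l, P.lo l ≤ P.ht j → P.ht j ≤ P.hi l →
      (N (P.edgeFiber l (P.ht j)) ↔ P.xAt l (P.ht j) ∈ R) := by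
    intro l h1 h2
    have hm := P.edge_subset l (P.xAt_mem_edge h1 h2)
    constructor
    · rintro ⟨x, hx, hxK, hxq⟩
      exact hR x _ hxK hm hxq hx
    · exact fun hx => ⟨_, hx, hm, rfl⟩
  have hht : ∀ q, N q → P.reebHeight q = P.ht j := by
    rintro _ ⟨x, -, hx, rfl⟩
    exact P.reebHeight_reebMk hx
  have h1 : P.slabSum z j (P.ht j) R = ∑ a ∈ P.slabArcs with N (P.slabSrc a), z a := by
    unfold slabSum
    refine Finset.sum_congr (Finset.filter_congr fun a ha => ?_) fun _ _ => rfl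
    have hsp := (P.mem_slabArcs.1 ha).1
    constructor
    · rintro ⟨rfl, h2⟩
      exact (hNiff a.2 (hsp.mem_Icc (P.ht_mem_Icc_left _)).1
        (hsp.mem_Icc (P.ht_mem_Icc_left _)).2).2 h2
    · intro h2
      have h3 : a.1 = j := by
        apply P.ht_strictMono.injective
        rw [← P.reebHeight_slabSrc ha, hht _ h2]
      subst h3
      exact ⟨rfl, (hNiff a.2 (hsp.mem_Icc (P.ht_mem_Icc_left _)).1
        (hsp.mem_Icc (P.ht_mem_Icc_left _)).2).1 h2⟩
  have h2 : P.downSum z j R = ∑ a ∈ P.slabArcs with N (P.slabTgt a), z a := by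
    unfold downSum
    refine Finset.sum_congr (Finset.filter_congr fun a ha => ?_) fun _ _ => rfl
    have hsp := (P.mem_slabArcs.1 ha).1
    constructor
    · rintro ⟨rfl, h2⟩
      exact (hNiff a.2 (hsp.mem_Icc (P.ht_mem_Icc_right _)).1
        (hsp.mem_Icc (P.ht_mem_Icc_right _)).2).2 h2
    · intro h2
      have h3 : a.1 + 1 = j := by
        apply P.ht_strictMono.injective
        rw [← P.reebHeight_slabTgt ha, hht _ h2]
      subst h3
      exact ⟨rfl, (hNiff a.2 (hsp.mem_Icc (P.ht_mem_Icc_right _)).1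
        (hsp.mem_Icc (P.ht_mem_Icc_right _)).2).1 h2⟩
  rw [h1, h2, h]

/-- The sum of a function over the arcs on the left of an edge in a slab. -/
noncomputable def leftSum (z : ℕ × P.vertices → ℚ) (i : ℕ) (e : P.vertices) : ℚ :=
  P.slabSum z i (P.midHt i) (Iio (P.xAt e (P.midHt i)))

variable {P}

/-- An edge that is alone at a point of a closed slab. -/
theorem leftSum_eq_slabSum {z : ℕ × P.vertices → ℚ} {i : ℕ} {e : P.vertices} (he : P.Spans i e)
    {y : ℝ} (hy : y ∈ Icc (P.ht i) (P.ht (i + 1)))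
    (hu : ∀ g, P.Spans i g → P.xAt g y = P.xAt e y →
      P.xAt e (P.midHt i) ≤ P.xAt g (P.midHt i)) :
    P.leftSum z i e = P.slabSum z i y (Iio (P.xAt e y)) := by
  classical
  unfold leftSum slabSum
  refine Finset.sum_congr (Finset.filter_congr fun a ha => ?_) fun _ _ => rfl
  have hsp := (P.mem_slabArcs.1 ha).1
  refine and_congr_right ?_
  rintro rfl
  rw [mem_Iio, mem_Iio]
  constructor
  · intro h
    refine lt_of_le_of_ne (P.xAt_le_of_lt hsp he (P.midHt_mem _) hy h) fun h' => ?_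
    exact absurd (hu _ hsp h') (not_le.2 h)
  · exact fun h => P.xAt_lt_of_lt_Icc hsp he hy (P.midHt_mem _) h

theorem slabSum_Iio_eq_Iic {z : ℕ × P.vertices → ℚ} {i : ℕ} {y x₀ : ℝ}
    (hu : ∀ g, P.Spans i g → P.Side 1 g → P.xAt g y ≠ x₀) :
    P.slabSum z i y (Iio x₀) = P.slabSum z i y (Iic x₀) := by
  classical
  unfold slabSum
  refine Finset.sum_congr (Finset.filter_congr fun a ha => ?_) fun _ _ => rfl
  have hsp := P.mem_slabArcs.1 ha
  refine and_congr_right ?_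
  rintro rfl
  exact ⟨fun h => mem_Iic.2 (mem_Iio.1 h).le,
    fun h => lt_of_le_of_ne (mem_Iic.1 h) (hu _ hsp.1 hsp.2)⟩

theorem downSum_Iio_eq_Iic {z : ℕ × P.vertices → ℚ} {j : ℕ} {x₀ : ℝ}
    (hu : ∀ i g, i + 1 = j → P.Spans i g → P.Side 1 g → P.xAt g (P.ht j) ≠ x₀) :
    P.downSum z j (Iio x₀) = P.downSum z j (Iic x₀) := by
  rcases j with _ | i
  · unfold downSum
    simp
  · rw [downSum_succ, downSum_succ]
    exact slabSum_Iio_eq_Iic fun g hg hs => hu i g rfl hg hs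

/-- Following a boundary curve through a level. At a left edge the open half line on the left of
`x₀` is full, at a right edge the closed one is. In the second case the two half lines give equal
sums, because no left edge passes through the point. -/
theorem leftSum_eq_of_updown {z : ℕ × P.vertices → ℚ}
    (hz : IsFlow P.slabNodes P.slabArcs P.slabSrc P.slabTgt z) {i : ℕ} {e f : P.vertices} {x₀ : ℝ}
    (he : P.Spans (i + 1) e) (hf : P.Spans i f) (hxe : P.xAt e (P.ht (i + 1)) = x₀)
    (hxf : P.xAt f (P.ht (i + 1)) = x₀)
    (hue : ∀ g, P.Spans (i + 1) g → P.xAt g (P.ht (i + 1)) = x₀ → g = e)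
    (huf : ∀ g, P.Spans i g → P.xAt g (P.ht (i + 1)) = x₀ → g = f)
    (hside : P.Side 1 e ↔ P.Side 1 f) (h1 : P.Germ 1 (x₀, P.ht (i + 1)) ↔ P.Side 1 e)
    (h2 : P.Germ (-1) (x₀, P.ht (i + 1)) ↔ ¬ P.Side 1 e) :
    P.leftSum z (i + 1) e = P.leftSum z i f := by
  rw [leftSum_eq_slabSum he (P.ht_mem_Icc_left _) (fun g hg h => by rw [hue g hg (h.trans hxe)]),
    leftSum_eq_slabSum hf (P.ht_mem_Icc_right _) (fun g hg h => by rw [huf g hg (h.trans hxf)]),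
    hxe, hxf, ← downSum_succ]
  by_cases hs : P.Side 1 e
  · exact P.slabSum_eq_downSum hz (P.isFull_Iio (by tauto))
  · have h3 := P.slabSum_eq_downSum hz (P.isFull_Iic (h := P.ht (i + 1)) (x₀ := x₀) (by tauto))
    rw [← slabSum_Iio_eq_Iic, ← downSum_Iio_eq_Iic] at h3
    · exact h3
    · rintro k g hk hg hsg hx
      obtain rfl : k = i := by omega
      have := huf g hg hx
      subst this
      tauto
    · intro g hg hsg hx
      have := hue g hg hx
      subst this
      exact hs hsg

/-- No edge of the slab runs between the two edges of the fork, so the sums can differ only by the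
arc of `e`. If `e` is a right edge there is no such arc. If it is a left edge, `hS` says that this
arc, which ends at the tip, carries no flow. -/
theorem leftSum_eq_of_fork {z : ℕ × P.vertices → ℚ} {i : ℕ} {e f : P.vertices}
    {x₀ y : ℝ} (hef : e ≠ f) (he : P.Spans i e) (hf : P.Spans i f)
    (hy : y ∈ Icc (P.ht i) (P.ht (i + 1)))
    (hxe : P.xAt e y = x₀) (hxf : P.xAt f y = x₀)
    (hle : P.xAt e (P.midHt i) ≤ P.xAt f (P.midHt i))
    (hu : ∀ g, P.Spans i g → P.xAt g y = x₀ → g = e ∨ g = f)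
    (hside : P.Side 1 e ↔ ¬ P.Side 1 f)
    (hS : P.Side 1 e → P.slabSum z i y (Iio x₀) = P.slabSum z i y (Iic x₀)) :
    P.leftSum z i e = P.leftSum z i f := by
  classical
  have hlt : P.xAt e (P.midHt i) < P.xAt f (P.midHt i) :=
    lt_of_le_of_ne hle fun h => hef (P.eq_of_xAt_eq he hf (P.midHt_mem i) h)
  rw [leftSum_eq_slabSum he hy, hxe]
  · by_cases hs : P.Side 1 e
    · rw [hS hs]
      unfold leftSum slabSum
      refine Finset.sum_congr (Finset.filter_congr fun a ha => ?_) fun _ _ => rfl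
      have hsp := P.mem_slabArcs.1 ha
      refine and_congr_right ?_
      rintro rfl
      rw [mem_Iio, mem_Iic]
      constructor
      · intro h
        rcases h.eq_or_lt with h' | h'
        · rcases hu _ hsp.1 h' with h3 | h3
          · rw [h3]; exact hlt
          · rw [h3] at hsp; tauto
        · rw [← hxf] at h'
          exact P.xAt_lt_of_lt_Icc hsp.1 hf hy (P.midHt_mem _) h'
      · intro h
        rw [← hxf]
        exact P.xAt_le_of_lt hsp.1 hf (P.midHt_mem _) hy h
    · unfold leftSum slabSum
      refine Finset.sum_congr (Finset.filter_congr fun a ha => ?_) fun _ _ => rfl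
      have hsp := P.mem_slabArcs.1 ha
      refine and_congr_right ?_
      rintro rfl
      rw [mem_Iio, mem_Iio]
      constructor
      · intro h
        rw [← hxf] at h
        exact P.xAt_lt_of_lt_Icc hsp.1 hf hy (P.midHt_mem _) h
      · intro h
        have h4 := P.xAt_le_of_lt hsp.1 hf (P.midHt_mem _) hy h
        rw [hxf] at h4
        refine lt_of_le_of_ne h4 fun h' => ?_
        rcases hu _ hsp.1 h' with h3 | h3
        · rw [h3] at hsp; exact hs hsp.2
        · rw [h3] at h; exact lt_irrefl _ h
  · intro g hg hgx
    rcases hu g hg (hgx.trans hxe) with h3 | h3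
    · rw [h3]
    · rw [h3]; exact hle

variable (P)

theorem leftSum_succ {z : ℕ × P.vertices → ℚ}
    (hz : IsFlow P.slabNodes P.slabArcs P.slabSrc P.slabTgt z) {i : ℕ} {e : P.vertices}
    (h : P.Spans i e) (h' : P.Spans (i + 1) e) : P.leftSum z (i + 1) e = P.leftSum z i e := by
  have hlo : P.lo e < P.ht (i + 1) := h.1.trans_lt (P.ht_lt_succ i)
  have hhi : P.ht (i + 1) < P.hi e := (P.ht_lt_succ _).trans_le h'.2
  have hu : ∀ g, P.lo g ≤ P.ht (i + 1) → P.ht (i + 1) ≤ P.hi g →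
      P.xAt g (P.ht (i + 1)) = P.xAt e (P.ht (i + 1)) → g = e := by
    intro g h1 h2 h3
    by_contra hg
    exact P.xAt_ne (Ne.symm hg) hlo hhi h1 h2 h3.symm
  have g1 := P.germ_iff_side (e := e) (s := 1) (by norm_num) hlo hhi
  have g2 := P.germ_iff_side (e := e) (s := -1) (by norm_num) hlo hhi
  have g3 := P.side_iff_not e
  refine leftSum_eq_of_updown hz h' h rfl rfl (fun g hg => ?_) (fun g hg => ?_) Iff.rfl g1
    (by tauto)
  · exact hu g (hg.mem_Icc (P.ht_mem_Icc_left _)).1 (hg.mem_Icc (P.ht_mem_Icc_left _)).2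
  · exact hu g (hg.mem_Icc (P.ht_mem_Icc_right _)).1 (hg.mem_Icc (P.ht_mem_Icc_right _)).2

theorem leftSum_eq {z : ℕ × P.vertices → ℚ}
    (hz : IsFlow P.slabNodes P.slabArcs P.slabSrc P.slabTgt z) {i k : ℕ} {e : P.vertices}
    (h : P.Spans i e) (h' : P.Spans k e) : P.leftSum z i e = P.leftSum z k e := by
  wlog hik : i ≤ k generalizing i k
  · exact (this h' h (by omega)).symm
  obtain ⟨n, rfl⟩ := Nat.exists_eq_add_of_le hik
  clear hik
  induction n with
  | zero => rfl
  | succ n ih =>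
    have h1 : P.Spans (i + n) e := by
      refine ⟨h.1.trans (P.ht_strictMono.monotone (by omega)), le_trans ?_ h'.2⟩
      exact P.ht_strictMono.monotone (by omega)
    rw [ih h1]
    exact (P.leftSum_succ hz h1 h').symm

open Classical in
/-- The potential of a flow. -/
noncomputable def potential (z : ℕ × P.vertices → ℚ) (e : P.vertices) : ℚ :=
  P.leftSum z (P.exists_spans (e := e) le_rfl (P.lo_lt_hi e).le).choose e

theorem potential_eq {z : ℕ × P.vertices → ℚ}
    (hz : IsFlow P.slabNodes P.slabArcs P.slabSrc P.slabTgt z) {i : ℕ} {e : P.vertices}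
    (h : P.Spans i e) : P.potential z e = P.leftSum z i e :=
  P.leftSum_eq hz (P.exists_spans (e := e) le_rfl (P.lo_lt_hi e).le).choose_spec.1 h

/-- The left edges on the left of the facing edge are those on the left of `a.2` and `a.2` itself.
-/
theorem flow_eq_potential {z : ℕ × P.vertices → ℚ}
    (hz : IsFlow P.slabNodes P.slabArcs P.slabSrc P.slabTgt z) {a : ℕ × P.vertices}
    (ha : a ∈ P.slabArcs) : z a = P.potential z (P.facing a) - P.potential z a.2 := by
  classical
  obtain ⟨i, l⟩ := a
  have hf := P.facing_spec ha
  dsimp only at hf ⊢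
  rw [P.potential_eq hz hf.left, P.potential_eq hz hf.right, eq_sub_iff_add_eq]
  unfold leftSum slabSum
  rw [← Finset.sum_insert (s := Finset.filter _ _) (a := (i, l)) (f := z)]
  · refine Finset.sum_congr ?_ fun _ _ => rfl
    ext b
    rw [Finset.mem_insert, Finset.mem_filter, Finset.mem_filter]
    constructor
    · rintro (rfl | ⟨h1, rfl, h3⟩)
      · exact ⟨ha, rfl, hf.lt⟩
      · exact ⟨h1, rfl, lt_trans (mem_Iio.1 h3) hf.lt⟩
    · rintro ⟨h1, rfl, h3⟩
      have hb := P.mem_slabArcs.1 h1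
      have h4 := (hf.between b.2 hb.1).resolve_right (not_le.2 h3)
      rcases h4.eq_or_lt with h5 | h5
      · exact Or.inl (Prod.ext rfl (P.eq_of_xAt_eq hb.1 hf.left (P.midHt_mem _) h5))
      · exact Or.inr ⟨h1, rfl, h5⟩
  · rw [Finset.mem_filter]
    rintro ⟨-, -, h⟩
    exact lt_irrefl _ (mem_Iio.1 h)

end PlanarPolygon

namespace PlanarPolygon

variable (P : PlanarPolygon)

theorem spans_of_lo_eq {j : ℕ} {e : P.vertices} (h : P.lo e = P.ht j) : P.Spans j e :=
  P.spans_of_lt (by rw [h]; exact P.ht_lt_succ j) (by rw [← h]; exact P.lo_lt_hi e)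

theorem spans_of_hi_eq {i : ℕ} {e : P.vertices} (h : P.hi e = P.ht (i + 1)) : P.Spans i e :=
  P.spans_of_lt (by rw [← h]; exact P.lo_lt_hi e) (by rw [h]; exact P.ht_lt_succ i)

theorem potential_eq_of_cases {z : ℕ × P.vertices → ℚ}
    (hz : IsFlow P.slabNodes P.slabArcs P.slabSrc P.slabTgt z) (v : P.vertices) :
    ∃ e f : P.vertices, e ≠ f ∧ (v : ℝ × ℝ) ∈ P.edge e ∧ (v : ℝ × ℝ) ∈ P.edge f ∧
      P.potential z e = P.potential z f := by
  obtain ⟨e, f, hef, he, hf, hcases⟩ := P.vertex_cases v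
  refine ⟨e, f, hef, he, hf, ?_⟩
  obtain ⟨j, -, hj⟩ := P.exists_ht v
  have hxe := P.xAt_of_mem he
  have hxf := P.xAt_of_mem hf
  have hthru : ∀ g, P.lo g ≤ P.ht j → P.ht j ≤ P.hi g → P.xAt g (P.ht j) = (v : ℝ × ℝ).1 →
      g = e ∨ g = f := by
    intro g h1 h2 h3
    refine P.edges_at hef he hf ?_
    have := P.xAt_mem_edge h1 h2
    rwa [h3, hj] at this
  have hup : ∀ g, P.Spans j g → P.xAt g (P.ht j) = (v : ℝ × ℝ).1 → g = e ∨ g = f := fun g hg =>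
    hthru g (hg.mem_Icc (P.ht_mem_Icc_left _)).1 (hg.mem_Icc (P.ht_mem_Icc_left _)).2
  rw [← hj] at hcases hxe hxf
  have hp : (v : ℝ × ℝ) = ((v : ℝ × ℝ).1, P.ht j) := Prod.ext rfl hj.symm
  rw [hp] at hcases
  rcases hcases with ⟨c1, c2, c3, c4, c5⟩ | ⟨⟨c1, c2, c6⟩ | ⟨c1, c2, c6⟩, c3, c4, c5⟩
  · obtain ⟨i, rfl⟩ : ∃ i, j = i + 1 := by
      refine Nat.exists_eq_succ_of_ne_zero ?_
      rintro rfl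
      obtain ⟨k, hk⟩ := P.exists_ht_lo f
      have := P.lo_lt_hi f
      rw [c2, ← hk, P.ht_strictMono.lt_iff_lt] at this
      omega
    have hse := P.spans_of_lo_eq c1
    have hsf := P.spans_of_hi_eq c2
    rw [P.potential_eq hz hse, P.potential_eq hz hsf]
    refine leftSum_eq_of_updown hz hse hsf hxe hxf (fun g hg hx => ?_) (fun g hg hx => ?_)
      c3 c4 c5
    · refine (hup g hg hx).resolve_right ?_
      rintro rfl
      have := P.spans_iff_up.1 hg
      linarith
    · refine (hthru g (hg.mem_Icc (P.ht_mem_Icc_right _)).1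
        (hg.mem_Icc (P.ht_mem_Icc_right _)).2 hx).resolve_left ?_
      rintro rfl
      have := P.spans_iff_down.1 hg
      linarith
  · have hse := P.spans_of_lo_eq c1
    have hsf := P.spans_of_lo_eq c2
    rw [P.potential_eq hz hse, P.potential_eq hz hsf]
    refine leftSum_eq_of_fork hef hse hsf (P.ht_mem_Icc_left j) hxe hxf
      (c6 _ (P.midHt_mem j).1.le) hup c3 fun hs => ?_
    -- The polygon lies inside the wedge, so neither horizontal ray at the tip belongs to it and
    -- both half lines are full. Below this level no edge ends at the tip, so the two sums agree
    -- there, and hence also above.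
    have h1 := P.slabSum_eq_downSum hz
      (P.isFull_Iio (h := P.ht j) (x₀ := (v : ℝ × ℝ).1) (by tauto))
    have h2 := P.slabSum_eq_downSum hz
      (P.isFull_Iic (h := P.ht j) (x₀ := (v : ℝ × ℝ).1) (by tauto))
    rw [h1, h2]
    refine downSum_Iio_eq_Iic ?_
    rintro i g rfl hg - hx
    have h3 := P.spans_iff_down.1 hg
    rcases hthru g h3.1.le h3.2 hx with rfl | rfl <;> linarith
  · obtain ⟨i, rfl⟩ : ∃ i, j = i + 1 := by
      refine Nat.exists_eq_succ_of_ne_zero ?_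
      rintro rfl
      obtain ⟨k, hk⟩ := P.exists_ht_lo f
      have := P.lo_lt_hi f
      rw [c2, ← hk, P.ht_strictMono.lt_iff_lt] at this
      omega
    have hse := P.spans_of_hi_eq c1
    have hsf := P.spans_of_hi_eq c2
    rw [P.potential_eq hz hse, P.potential_eq hz hsf]
    refine leftSum_eq_of_fork hef hse hsf (P.ht_mem_Icc_right i) hxe hxf
      (c6 _ (P.midHt_mem i).2.le) (fun g hg => hthru g
        (hg.mem_Icc (P.ht_mem_Icc_right _)).1 (hg.mem_Icc (P.ht_mem_Icc_right _)).2) c3 fun hs => ?_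
    have h1 := P.slabSum_eq_downSum hz
      (P.isFull_Iio (h := P.ht (i + 1)) (x₀ := (v : ℝ × ℝ).1) (by tauto))
    have h2 := P.slabSum_eq_downSum hz
      (P.isFull_Iic (h := P.ht (i + 1)) (x₀ := (v : ℝ × ℝ).1) (by tauto))
    rw [← downSum_succ, ← downSum_succ, ← h1, ← h2]
    refine slabSum_Iio_eq_Iic ?_
    rintro g hg - hx
    have h3 := P.spans_iff_up.1 hg
    rcases hthru g h3.1 h3.2.le hx with rfl | rfl <;> linarith

/-- The potential of a flow is constant on the boundary cycles. -/
theorem potential_next {z : ℕ × P.vertices → ℚ}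
    (hz : IsFlow P.slabNodes P.slabArcs P.slabSrc P.slabTgt z) (v : P.vertices) :
    P.potential z (P.next v) = P.potential z v := by
  obtain ⟨e, f, hef, he, hf, h⟩ := P.potential_eq_of_cases hz (P.next v)
  have h1 := P.edges_at hef he hf (P.vertex_mem_edge _)
  have h2 := P.edges_at hef he hf (P.next_mem_edge v)
  rcases h1 with h1 | h1 <;> rcases h2 with h2 | h2 <;> rw [h1, h2]
  · exact h
  · exact h.symm

/-! ### Homotopy type of the Reeb graph with one or two boundary curves -/

theorem apply_eq_of_sameCycle {α β : Type*} {f : Equiv.Perm α} {a : α → β}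
    (ha : ∀ v, a (f v) = a v) {v w : α} (h : f.SameCycle v w) : a v = a w := by
  obtain ⟨n, rfl⟩ := h
  induction n using Int.induction_on with
  | zero => rfl
  | succ n ih => rw [ih, add_comm, zpow_one_add, Equiv.Perm.mul_apply, ha]
  | pred n ih =>
    rw [ih, ← ha ((f ^ (-(n : ℤ) - 1)) v), ← Equiv.Perm.mul_apply, ← zpow_one_add,
      add_sub_cancel]

theorem slabNodes_nonempty : P.slabNodes.Nonempty := by
  obtain ⟨a, ha⟩ := P.slabArcs_nonempty
  exact ⟨_, P.slabSrc_mem ha⟩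

/-- The Reeb graph of a polygon with only one boundary curve is contractible. -/
theorem contractibleSpace_of_sameCycle [ConnectedSpace P.ReebSpace]
    (h : ∀ v w, P.next.SameCycle v w) : ContractibleSpace P.ReebSpace := by
  have hc := card_of_flow_eq_zero (fun a ha => P.slabSrc_mem ha) (fun a ha => P.slabTgt_mem ha)
    P.isLinked_slab P.slabNodes_nonempty fun z hz a ha => by
      rw [P.flow_eq_potential hz ha, sub_eq_zero]
      exact apply_eq_of_sameCycle (P.potential_next hz) (h _ _)
  have := P.isTopGraph_slab.contractibleSpace P.isLinked_slab hc
  rw [graphBody_slab] at this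
  exact (Homeomorph.Set.univ P.ReebSpace).symm.contractibleSpace

/-- The Reeb graph of a polygon with two boundary curves is homotopy equivalent to the circle. -/
theorem homotopyEquiv_circle [ConnectedSpace P.ReebSpace] {v w : P.vertices}
    (hvw : ¬ P.next.SameCycle v w) (h : ∀ u, P.next.SameCycle v u ∨ P.next.SameCycle w u) :
    Nonempty (ContinuousMap.HomotopyEquiv P.ReebSpace (AddCircle (2 : ℝ))) := by
  classical
  set a : P.vertices → ℚ := fun u => if P.next.SameCycle v u then 1 else 0 with ha
  have hnext : ∀ u, a (P.next u) = a u := fun u => by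
    simp only [ha, Equiv.Perm.sameCycle_apply_right]
  -- With two cycles, a function that is constant on cycles is an affine function of the indicator
  -- `a` of one of them. Hence every flow is a multiple of the flow of `a`.
  have hval : ∀ p : P.vertices → ℚ, (∀ u, p (P.next u) = p u) →
      ∀ u, p u = p w + (p v - p w) * a u := by
    intro p hp u
    by_cases hu : P.next.SameCycle v u
    · rw [← apply_eq_of_sameCycle hp hu]
      simp only [ha, hu, if_true]; ring
    · rw [← apply_eq_of_sameCycle hp ((h u).resolve_left hu)]
      simp only [ha, hu, if_false]; ring
  have hc := card_of_flow_eq_smul (fun a ha => P.slabSrc_mem ha) (fun a ha => P.slabTgt_mem ha)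
    P.isLinked_slab P.slabNodes_nonempty (P.isFlow_of_next_eq hnext) ?_ fun z hz =>
      ⟨P.potential z v - P.potential z w, fun b hb => by
        rw [P.flow_eq_potential hz hb, hval _ (P.potential_next hz) (P.facing b),
          hval _ (P.potential_next hz) b.2]
        ring⟩
  · have := P.isTopGraph_slab.homotopyEquiv_circle P.isLinked_slab hc P.slabNodes_nonempty
    rw [graphBody_slab] at this
    exact ⟨(Homeomorph.Set.univ P.ReebSpace).symm.toHomotopyEquiv.trans this.some⟩
  -- If the flow of `a` vanished, `a` would agree on facing edges and be constant, but it separates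
  -- the two cycles.
  · by_contra! hcon
    have := P.eq_of_facing hnext (fun i l r hf => by
      have := hcon (i, l) hf.mem
      rw [facing_eq hf] at this
      linarith) v w
    simp only [ha, hvw, if_false, Equiv.Perm.SameCycle.refl, if_true] at this
    exact one_ne_zero this

/-! ### Boundary curves and connected components of the boundary -/

/-- The connected component of a vertex in the boundary. -/
def comp (v : P.vertices) : ConnectedComponents (frontier P.carrier) :=
  ConnectedComponents.mk ⟨v, P.edge_subset_frontier v (P.vertex_mem_edge v)⟩

theorem comp_eq_of_mem_edge {v : P.vertices} {z : ℝ × ℝ} (hz : z ∈ P.edge v) :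
    ConnectedComponents.mk ⟨z, P.edge_subset_frontier v hz⟩ = P.comp v := by
  rw [comp, ConnectedComponents.coe_eq_coe']
  have hpre : IsPreconnected (Subtype.val ⁻¹' P.edge v : Set (frontier P.carrier)) := by
    rw [← Topology.IsInducing.subtypeVal.isPreconnected_image, Subtype.image_preimage_coe,
      inter_eq_right.2 (P.edge_subset_frontier v)]
    exact (convex_segment _ _).isPreconnected
  exact hpre.subset_connectedComponent (P.vertex_mem_edge v) hz

theorem comp_next (v : P.vertices) : P.comp (P.next v) = P.comp v :=
  P.comp_eq_of_mem_edge (P.next_mem_edge v)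

theorem comp_surjective : Function.Surjective P.comp := by
  intro c
  obtain ⟨⟨z, hz⟩, rfl⟩ := ConnectedComponents.surjective_coe c
  obtain ⟨v, hv⟩ := P.mem_frontier.1 hz
  exact ⟨v, (P.comp_eq_of_mem_edge hv).symm⟩

theorem sameCycle_of_mem_edges {e f : P.vertices} {z : ℝ × ℝ} (he : z ∈ P.edge e)
    (hf : z ∈ P.edge f) : P.next.SameCycle e f := by
  by_cases hef : e = f
  · rw [hef]
  · obtain ⟨u, rfl⟩ := P.exists_vertex_of_mem_edges hef he hf
    have key : ∀ g, (u : ℝ × ℝ) ∈ P.edge g → P.next.SameCycle g u := by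
      intro g hg
      rcases P.mem_edge_iff_vertex.1 hg with rfl | rfl
      · exact Equiv.Perm.SameCycle.refl _ _
      · rw [← Equiv.Perm.sameCycle_apply_left, Equiv.apply_symm_apply]
    exact (key e he).trans (key f hf).symm

/-- The union of the edges of one cycle is closed, and so is the union of all others; edges from
different cycles do not meet. So each cycle is a clopen part of the boundary. -/
theorem comp_eq_iff {v w : P.vertices} : P.comp v = P.comp w ↔ P.next.SameCycle v w := by
  constructor
  · intro h
    set S : Set P.vertices → Set (frontier P.carrier) := fun s =>
      Subtype.val ⁻¹' ⋃ u ∈ s, P.edge u with hS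
    have hcl : ∀ s, IsClosed (S s) := fun s =>
      (s.toFinite.isClosed_biUnion fun u _ => P.isClosed_edge u).preimage continuous_subtype_val
    have hcompl : S {u | ¬ P.next.SameCycle v u} = (S {u | P.next.SameCycle v u})ᶜ := by
      ext ⟨z, hz⟩
      simp only [hS, mem_preimage, mem_iUnion₂, mem_compl_iff, mem_ofPred_eq]
      constructor
      · rintro ⟨u, hu, hzu⟩ ⟨u', hu', hzu'⟩
        exact hu (hu'.trans (P.sameCycle_of_mem_edges hzu' hzu))
      · intro hno
        obtain ⟨u, hu⟩ := P.mem_frontier.1 hz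
        exact ⟨u, fun hvu => hno ⟨u, hvu, hu⟩, hu⟩
    have hclopen : IsClopen (S {u | P.next.SameCycle v u}) :=
      ⟨hcl _, by rw [← isClosed_compl_iff, ← hcompl]; exact hcl _⟩
    have hmem := hclopen.connectedComponent_subset
      (mem_iUnion₂.2 ⟨v, Equiv.Perm.SameCycle.refl _ _, P.vertex_mem_edge v⟩)
      (ConnectedComponents.coe_eq_coe'.1 h.symm)
    obtain ⟨u, hu, hwu⟩ := mem_iUnion₂.1 hmem
    exact Equiv.Perm.SameCycle.trans hu (P.sameCycle_of_mem_edges hwu (P.vertex_mem_edge w))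
  · intro h
    exact apply_eq_of_sameCycle P.comp_next h

/-- The two edges of a cycle of length two would be the same segment, but different edges share end
points only. So every boundary curve has at least three vertices. -/
theorem next_next_ne (v : P.vertices) : P.next (P.next v) ≠ v := by
  intro h
  have hsub : P.edge v ∩ P.edge (P.next v) = P.edge v := by
    unfold edge
    rw [h, segment_symm ℝ (P.next v : ℝ × ℝ) v, inter_self]
  have hmid : P.mid v ∈ P.edge v := by
    have := P.lo_lt_hi v
    exact P.xAt_mem_edge (by linarith) (by linarith)
  have hmid' := hmid
  rw [← hsub] at hmid'
  obtain ⟨u, hu⟩ := P.exists_vertex_of_mem_edges (P.next_ne v).symm hmid'.1 hmid'.2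
  have h1 := P.height_of_vertex_mem_edge (hu ▸ hmid)
  have h2 := P.lo_lt_hi v
  have h3 : (P.mid v).2 = (P.lo v + P.hi v) / 2 := rfl
  rw [← hu, h3] at h1
  rcases h1 with h1 | h1 <;> linarith

theorem six_of_not_sameCycle {v w : P.vertices} (h : ¬ P.next.SameCycle v w) :
    ([v, P.next v, P.next (P.next v), w, P.next w, P.next (P.next w)] : List P.vertices).Nodup := by
  have hv : ∀ u, P.next.SameCycle v u → u ≠ w ∧ u ≠ P.next w ∧ u ≠ P.next (P.next w) := by
    refine fun u hu => ⟨?_, ?_, ?_⟩ <;> rintro rfl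
    · exact h hu
    · exact h (Equiv.Perm.sameCycle_apply_right.1 hu)
    · exact h (Equiv.Perm.sameCycle_apply_right.1 (Equiv.Perm.sameCycle_apply_right.1 hu))
  have h0 := hv v (Equiv.Perm.SameCycle.refl _ _)
  have h1 := hv (P.next v) (Equiv.Perm.sameCycle_apply_right.2 (Equiv.Perm.SameCycle.refl _ _))
  have h2 := hv (P.next (P.next v)) (Equiv.Perm.sameCycle_apply_right.2
    (Equiv.Perm.sameCycle_apply_right.2 (Equiv.Perm.SameCycle.refl _ _)))
  have a1 := P.next_ne v
  have a2 := P.next_ne (P.next v)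
  have a3 := P.next_next_ne v
  have b1 := P.next_ne w
  have b2 := P.next_ne (P.next w)
  have b3 := P.next_next_ne w
  simp only [List.nodup_cons, List.mem_cons, List.not_mem_nil, or_false, not_or, not_false_eq_true,
    List.nodup_nil, and_true]
  refine ⟨⟨a1.symm, a3.symm, h0⟩, ⟨a2.symm, h1⟩, h2, ⟨b1.symm, b3.symm⟩, b2.symm⟩

theorem six_le_card {v w : P.vertices} (h : ¬ P.next.SameCycle v w) : 6 ≤ P.vertices.card := by
  have := List.toFinset_card_of_nodup (P.six_of_not_sameCycle h)
  rw [← Fintype.card_coe]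
  exact this.symm.le.trans (Finset.card_le_univ _)

/-- Two boundary curves with together six vertices are triangles. -/
theorem exists_of_card_eq_six {v w : P.vertices} (h : ¬ P.next.SameCycle v w)
    (h6 : P.vertices.card ≤ 6) :
    (∀ u, u = v ∨ u = P.next v ∨ u = P.next (P.next v) ∨ u = w ∨ u = P.next w ∨
      u = P.next (P.next w)) ∧ P.next (P.next (P.next v)) = v ∧
      P.next (P.next (P.next w)) = w := by
  have hnd := P.six_of_not_sameCycle h
  have hall : ∀ u, u = v ∨ u = P.next v ∨ u = P.next (P.next v) ∨ u = w ∨ u = P.next w ∨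
      u = P.next (P.next w) := by
    intro u
    have h1 : ([v, P.next v, P.next (P.next v), w, P.next w, P.next (P.next w)] :
        List P.vertices).toFinset = Finset.univ := by
      rw [← Finset.card_eq_iff_eq_univ, List.toFinset_card_of_nodup hnd, Fintype.card_coe]
      exact le_antisymm (P.six_le_card h) h6
    have h2 := Finset.mem_univ u
    rw [← h1] at h2
    simpa using h2
  have hcyc : ∀ u : P.vertices, P.next.SameCycle u (P.next (P.next (P.next u))) := fun u => by
    simp only [Equiv.Perm.sameCycle_apply_right]
    exact Equiv.Perm.SameCycle.refl _ _
  refine ⟨hall, ?_, ?_⟩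
  · have h3 := hcyc v
    rcases hall (P.next (P.next (P.next v))) with h1 | h1 | h1 | h1 | h1 | h1
    · exact h1
    · exact absurd (P.next.injective h1) (P.next_next_ne v)
    · exact absurd h1 (P.next_ne _)
    all_goals
      rw [h1] at h3
      try simp only [Equiv.Perm.sameCycle_apply_right] at h3
      exact absurd h3 h
  · have h3 := hcyc w
    rcases hall (P.next (P.next (P.next w))) with h1 | h1 | h1 | h1 | h1 | h1
    · rw [h1] at h3; exact absurd h3.symm h
    · rw [h1] at h3
      simp only [Equiv.Perm.sameCycle_apply_right] at h3
      exact absurd h3.symm h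
    · rw [h1] at h3
      simp only [Equiv.Perm.sameCycle_apply_right] at h3
      exact absurd h3.symm h
    · exact h1
    · exact absurd (P.next.injective h1) (P.next_next_ne w)
    · exact absurd h1 (P.next_ne _)

end PlanarPolygon

/-! ### Regions between two graphs -/

/-- The set `S` is the region between the graphs of `l` and `r` over the interval `[a, b]` of
heights; the graphs meet over the ends of the interval only. -/
structure IsLens (S : Set (ℝ × ℝ)) (a b : ℝ) (l r : ℝ → ℝ) : Prop where
  lt : a < b
  continuous_left : Continuous l
  continuous_right : Continuous r
  bot : l a = r a
  top : l b = r b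
  left_lt_right : ∀ y ∈ Ioo a b, l y < r y
  mem_iff : ∀ z, z ∈ S ↔ (a ≤ z.2 ∧ z.2 ≤ b) ∧ l z.2 ≤ z.1 ∧ z.1 ≤ r z.2

namespace IsLens

variable {S : Set (ℝ × ℝ)} {a b : ℝ} {l r : ℝ → ℝ}

theorem le (h : IsLens S a b l r) {y : ℝ} (h1 : a ≤ y) (h2 : y ≤ b) : l y ≤ r y := by
  rcases h1.eq_or_lt with rfl | h1
  · exact h.bot.le
  rcases h2.eq_or_lt with rfl | h2
  · exact h.top.le
  exact (h.left_lt_right y ⟨h1, h2⟩).le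

theorem isClosed (h : IsLens S a b l r) : IsClosed S := by
  have : S = ({z | a ≤ z.2} ∩ {z | z.2 ≤ b}) ∩ ({z | l z.2 ≤ z.1} ∩ {z | z.1 ≤ r z.2}) := by
    ext z
    exact h.mem_iff z
  rw [this]
  exact ((isClosed_le continuous_const continuous_snd).inter
    (isClosed_le continuous_snd continuous_const)).inter
    ((isClosed_le (h.continuous_left.comp continuous_snd) continuous_fst).inter
    (isClosed_le continuous_fst (h.continuous_right.comp continuous_snd)))

theorem mem_interior_iff (h : IsLens S a b l r) (z : ℝ × ℝ) :
    z ∈ interior S ↔ (a < z.2 ∧ z.2 < b) ∧ l z.2 < z.1 ∧ z.1 < r z.2 := by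
  constructor
  · intro hz
    have hS := (h.mem_iff z).1 (interior_subset hz)
    have hray : ∀ s : ℝ, ∃ t > 0, (z.1 + s * t, z.2) ∈ S := by
      intro s
      have h1 := PlanarPolygon.eventually_ray_mem (isOpen_interior.mem_nhds hz) s
      obtain ⟨t, ht, ht'⟩ := (h1.and (eventually_mem_nhdsWithin (s := Ioi (0 : ℝ)))).exists
      exact ⟨t, ht', interior_subset ht⟩
    obtain ⟨t, ht, ht'⟩ := hray 1
    obtain ⟨u, hu, hu'⟩ := hray (-1)
    have h1 := ((h.mem_iff _).1 ht').2
    have h2 := ((h.mem_iff _).1 hu').2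
    dsimp only at h1 h2
    refine ⟨⟨lt_of_le_of_ne hS.1.1 ?_, lt_of_le_of_ne hS.1.2 ?_⟩, by linarith, by linarith⟩
    · intro heq
      have := h.bot
      rw [heq] at this
      linarith
    · intro heq
      have := h.top
      rw [← heq] at this
      linarith
  · intro hz
    have hopen : IsOpen (({z : ℝ × ℝ | a < z.2} ∩ {z | z.2 < b}) ∩
        ({z | l z.2 < z.1} ∩ {z | z.1 < r z.2})) :=
      ((isOpen_lt continuous_const continuous_snd).inter
        (isOpen_lt continuous_snd continuous_const)).inter
        ((isOpen_lt (h.continuous_left.comp continuous_snd) continuous_fst).inter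
        (isOpen_lt continuous_fst (h.continuous_right.comp continuous_snd)))
    refine interior_maximal ?_ hopen hz
    rintro w ⟨⟨h1, h2⟩, h3, h4⟩
    exact (h.mem_iff w).2 ⟨⟨le_of_lt h1, le_of_lt h2⟩, le_of_lt h3, le_of_lt h4⟩

theorem mem_frontier_iff (h : IsLens S a b l r) (z : ℝ × ℝ) :
    z ∈ frontier S ↔ (a ≤ z.2 ∧ z.2 ≤ b) ∧ (z.1 = l z.2 ∨ z.1 = r z.2) := by
  rw [h.isClosed.frontier_eq, Set.mem_sdiff, h.mem_interior_iff, h.mem_iff]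
  constructor
  · rintro ⟨⟨h1, h2, h3⟩, h4⟩
    refine ⟨h1, ?_⟩
    by_contra! hcon
    have h5 := lt_of_le_of_ne h2 hcon.1.symm
    have h6 := lt_of_le_of_ne h3 hcon.2
    refine h4 ⟨⟨lt_of_le_of_ne h1.1 ?_, lt_of_le_of_ne h1.2 ?_⟩, h5, h6⟩
    · intro heq
      have := h.bot
      rw [heq] at this
      linarith
    · intro heq
      have := h.top
      rw [← heq] at this
      linarith
  · rintro ⟨h1, h2⟩
    have := h.le h1.1 h1.2
    refine ⟨⟨h1, ?_⟩, ?_⟩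
    · rcases h2 with h2 | h2 <;> rw [h2] <;> simp [this]
    · rintro ⟨-, h3, h4⟩
      rcases h2 with h2 | h2 <;> linarith

theorem nonempty_interior (h : IsLens S a b l r) : (interior S).Nonempty := by
  obtain ⟨y, hy⟩ := exists_between h.lt
  obtain ⟨x, hx⟩ := exists_between (h.left_lt_right y hy)
  exact ⟨(x, y), (h.mem_interior_iff _).2 ⟨hy, hx⟩⟩

end IsLens

/-! ### Triangles -/

theorem mem_convexHull_triple {A B C z : ℝ × ℝ} : z ∈ convexHull ℝ {A, B, C} ↔
    ∃ a b c : ℝ, 0 ≤ a ∧ 0 ≤ b ∧ 0 ≤ c ∧ a + b + c = 1 ∧ a • A + b • B + c • C = z := by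
  constructor
  · intro hz
    refine convexHull_min (t := {z | ∃ a b c : ℝ, 0 ≤ a ∧ 0 ≤ b ∧ 0 ≤ c ∧ a + b + c = 1 ∧
      a • A + b • B + c • C = z}) ?_ ?_ hz
    · rintro w (rfl | rfl | rfl)
      · exact ⟨1, 0, 0, by simp⟩
      · exact ⟨0, 1, 0, by simp⟩
      · exact ⟨0, 0, 1, by simp⟩
    · rintro _ ⟨a, b, c, ha, hb, hc, h, rfl⟩ _ ⟨a', b', c', ha', hb', hc', h', rfl⟩ s t hs ht hst
      refine ⟨s * a + t * a', s * b + t * b', s * c + t * c', by positivity, by positivity,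
        by positivity, ?_, ?_⟩
      · linear_combination s * h + t * h' + hst
      · module
  · rintro ⟨a, b, c, ha, hb, hc, h, rfl⟩
    have hcv := convex_convexHull ℝ ({A, B, C} : Set (ℝ × ℝ))
    have hA : A ∈ convexHull ℝ ({A, B, C} : Set (ℝ × ℝ)) := subset_convexHull ℝ _ (by simp)
    have hB : B ∈ convexHull ℝ ({A, B, C} : Set (ℝ × ℝ)) := subset_convexHull ℝ _ (by simp)
    have hC : C ∈ convexHull ℝ ({A, B, C} : Set (ℝ × ℝ)) := subset_convexHull ℝ _ (by simp)
    have := hcv.sum_mem (t := Finset.univ) (w := ![a, b, c]) (z := ![A, B, C])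
      (by intro i _; fin_cases i <;> simpa) (by simp [Fin.sum_univ_three, h])
      (by intro i _; fin_cases i <;> simpa)
    simpa [Fin.sum_univ_three] using this

/-- The horizontal offset of the middle vertex of a triangle from the long side. -/
noncomputable def triOffset (A B C : ℝ × ℝ) : ℝ := B.1 - lineX A C B.2

/-- The relative width of a triangle at a given height. -/
noncomputable def triTent (A B C : ℝ × ℝ) (y : ℝ) : ℝ :=
  min ((y - C.2) / (B.2 - C.2)) ((A.2 - y) / (A.2 - B.2))

/-- The abscissa of the union of the two short sides of a triangle. -/
noncomputable def triBroken (A B C : ℝ × ℝ) (y : ℝ) : ℝ :=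
  lineX A C y + triOffset A B C * triTent A B C y

/-- The left end of the section of a triangle at a given height. -/
noncomputable def triLeft (A B C : ℝ × ℝ) (y : ℝ) : ℝ := min (lineX A C y) (triBroken A B C y)

/-- The right end of the section of a triangle at a given height. -/
noncomputable def triRight (A B C : ℝ × ℝ) (y : ℝ) : ℝ := max (lineX A C y) (triBroken A B C y)

section Triangle

variable {A B C : ℝ × ℝ}

/-- Up to the positive factor `A.2 - C.2`, the offset is the difference of the two products in the
definition. -/
theorem middleOnRight_iff (h : C.2 < A.2) : MiddleOnRight A B C ↔ 0 < triOffset A B C := by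
  have h0 : 0 < A.2 - C.2 := sub_pos.2 h
  have h1 : C.2 - A.2 ≠ 0 := by linarith
  have : triOffset A B C * (A.2 - C.2) =
      (B.1 - C.1) * (A.2 - C.2) - (A.1 - C.1) * (B.2 - C.2) := by
    unfold triOffset lineX
    field_simp
    ring
  unfold MiddleOnRight
  rw [← sub_pos, ← this, mul_pos_iff_of_pos_right h0]

/-- Only the barycentric coordinate `b` of the middle vertex is kept. The height determines the
other two, and their nonnegativity is the bound by `triTent`. -/
theorem mem_triangle_iff (hAB : B.2 < A.2) (hBC : C.2 < B.2) (z : ℝ × ℝ) :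
    z ∈ convexHull ℝ {A, B, C} ↔ ∃ b, 0 ≤ b ∧ b ≤ triTent A B C z.2 ∧
      z.1 = lineX A C z.2 + b * triOffset A B C := by
  have h1 : 0 < B.2 - C.2 := sub_pos.2 hBC
  have h2 : 0 < A.2 - B.2 := sub_pos.2 hAB
  have h3 : 0 < A.2 - C.2 := by linarith
  have h4 : C.2 - A.2 ≠ 0 := by linarith
  rw [mem_convexHull_triple]
  constructor
  · rintro ⟨a, b, c, ha, hb, hc, h, rfl⟩
    obtain rfl : a = 1 - b - c := by linarith
    refine ⟨b, hb, le_min ?_ ?_, ?_⟩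
    · rw [le_div_iff₀ h1]
      simp only [Prod.snd_add, Prod.smul_snd, smul_eq_mul]
      nlinarith [mul_nonneg ha h3.le]
    · rw [le_div_iff₀ h2]
      simp only [Prod.snd_add, Prod.smul_snd, smul_eq_mul]
      nlinarith [mul_nonneg hc h3.le]
    · unfold triOffset lineX
      simp only [Prod.snd_add, Prod.smul_snd, smul_eq_mul, Prod.fst_add, Prod.smul_fst]
      field_simp
      ring
  · rintro ⟨b, hb, hb', hz⟩
    obtain ⟨h5, h6⟩ := le_min_iff.1 hb'
    rw [le_div_iff₀ h1] at h5
    rw [le_div_iff₀ h2] at h6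
    refine ⟨((z.2 - C.2) - b * (B.2 - C.2)) / (A.2 - C.2), b,
      ((A.2 - z.2) - b * (A.2 - B.2)) / (A.2 - C.2), div_nonneg (by linarith) h3.le, hb,
      div_nonneg (by linarith) h3.le, ?_, ?_⟩
    · field_simp; ring
    · ext
      · simp only [smul_eq_mul, Prod.fst_add, Prod.smul_fst]
        rw [hz]
        unfold triOffset lineX
        field_simp
        ring
      · simp only [Prod.snd_add, Prod.smul_snd, smul_eq_mul]
        field_simp
        ring

theorem triTent_nonneg_iff (hAB : B.2 < A.2) (hBC : C.2 < B.2) {y : ℝ} :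
    0 ≤ triTent A B C y ↔ C.2 ≤ y ∧ y ≤ A.2 := by
  have h1 : 0 < B.2 - C.2 := sub_pos.2 hBC
  have h2 : 0 < A.2 - B.2 := sub_pos.2 hAB
  rw [triTent, le_min_iff, le_div_iff₀ h1, le_div_iff₀ h2, zero_mul, zero_mul, sub_nonneg,
    sub_nonneg]

theorem triTent_pos_iff (hAB : B.2 < A.2) (hBC : C.2 < B.2) {y : ℝ} :
    0 < triTent A B C y ↔ C.2 < y ∧ y < A.2 := by
  have h1 : 0 < B.2 - C.2 := sub_pos.2 hBC
  have h2 : 0 < A.2 - B.2 := sub_pos.2 hAB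
  rw [triTent, lt_min_iff, lt_div_iff₀ h1, lt_div_iff₀ h2, zero_mul, zero_mul, sub_pos, sub_pos]

theorem continuous_triBroken : Continuous (triBroken A B C) := by
  unfold triBroken triTent
  have := continuous_lineX A C
  fun_prop

theorem triBroken_of_le (hAB : B.2 < A.2) (hBC : C.2 < B.2) {y : ℝ} (hy : y ≤ B.2) :
    triBroken A B C y = lineX B C y := by
  have h1 : 0 < B.2 - C.2 := sub_pos.2 hBC
  have h2 : 0 < A.2 - B.2 := sub_pos.2 hAB
  have h4 : C.2 - A.2 ≠ 0 := by linarith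
  have h5 : C.2 - B.2 ≠ 0 := by linarith
  have : triTent A B C y = (y - C.2) / (B.2 - C.2) := by
    refine min_eq_left ?_
    rw [div_le_div_iff₀ h1 h2]
    nlinarith
  rw [triBroken, this]
  unfold triOffset lineX
  field_simp
  ring

theorem triBroken_of_ge (hAB : B.2 < A.2) (hBC : C.2 < B.2) {y : ℝ} (hy : B.2 ≤ y) :
    triBroken A B C y = lineX A B y := by
  have h1 : 0 < B.2 - C.2 := sub_pos.2 hBC
  have h2 : 0 < A.2 - B.2 := sub_pos.2 hAB
  have h4 : C.2 - A.2 ≠ 0 := by linarith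
  have h5 : B.2 - A.2 ≠ 0 := by linarith
  have : triTent A B C y = (A.2 - y) / (A.2 - B.2) := by
    refine min_eq_right ?_
    rw [div_le_div_iff₀ h2 h1]
    nlinarith
  rw [triBroken, this]
  unfold triOffset lineX
  field_simp
  ring

theorem triBroken_middle (hAB : B.2 < A.2) (hBC : C.2 < B.2) : triBroken A B C B.2 = B.1 := by
  rw [triBroken_of_le hAB hBC le_rfl, lineX_left]

/-- The section of the triangle at any height runs between the long side and the broken line of the
two short sides; the sign of the offset decides which is on the left. -/
theorem isLens_triangle (hAB : B.2 < A.2) (hBC : C.2 < B.2) (h0 : triOffset A B C ≠ 0) :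
    IsLens (convexHull ℝ {A, B, C}) C.2 A.2 (triLeft A B C) (triRight A B C) := by
  have hzero : ∀ y, triTent A B C y = 0 → triLeft A B C y = triRight A B C y := by
    intro y hy
    simp [triLeft, triRight, triBroken, hy]
  refine ⟨hBC.trans hAB, (continuous_lineX A C).min continuous_triBroken,
    (continuous_lineX A C).max continuous_triBroken, hzero _ ?_, hzero _ ?_, ?_, ?_⟩
  · have h1 := (triTent_nonneg_iff hAB hBC (y := C.2)).2 ⟨le_rfl, (hBC.trans hAB).le⟩
    refine le_antisymm (not_lt.1 fun h => ?_) h1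
    exact absurd ((triTent_pos_iff hAB hBC).1 h).1 (lt_irrefl _)
  · have h1 := (triTent_nonneg_iff hAB hBC (y := A.2)).2 ⟨(hBC.trans hAB).le, le_rfl⟩
    refine le_antisymm (not_lt.1 fun h => ?_) h1
    exact absurd ((triTent_pos_iff hAB hBC).1 h).2 (lt_irrefl _)
  · intro y hy
    have ht := (triTent_pos_iff hAB hBC).2 hy
    refine min_lt_max.2 fun h => ?_
    have : triOffset A B C * triTent A B C y = 0 := by
      unfold triBroken at h; linarith
    exact (mul_ne_zero h0 ht.ne') this
  · intro z
    rw [mem_triangle_iff hAB hBC, ← triTent_nonneg_iff hAB hBC]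
    unfold triLeft triRight triBroken
    constructor
    · rintro ⟨b, hb, hb', hz⟩
      refine ⟨hb.trans hb', ?_⟩
      rw [hz, min_le_iff, le_max_iff]
      rcases le_total 0 (triOffset A B C) with h | h
      · exact ⟨Or.inl (by nlinarith), Or.inr (by nlinarith)⟩
      · exact ⟨Or.inr (by nlinarith), Or.inl (by nlinarith)⟩
    · rintro ⟨ht, hz⟩
      rw [min_le_iff, le_max_iff] at hz
      refine ⟨(z.1 - lineX A C z.2) / triOffset A B C, ?_, ?_, by field_simp; ring⟩
      · rcases h0.lt_or_gt with h | h
        · refine div_nonneg_of_nonpos ?_ h.le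
          rcases hz.2 with h1 | h1 <;> nlinarith
        · refine div_nonneg ?_ h.le
          rcases hz.1 with h1 | h1 <;> nlinarith
      · rcases h0.lt_or_gt with h | h
        · rw [div_le_iff_of_neg h]
          rcases hz.1 with h1 | h1 <;> nlinarith
        · rw [div_le_iff₀ h]
          rcases hz.2 with h1 | h1 <;> nlinarith

theorem mem_long_side_iff (h : C.2 < A.2) (z : ℝ × ℝ) :
    z ∈ segment ℝ A C ↔ (C.2 ≤ z.2 ∧ z.2 ≤ A.2) ∧ z.1 = lineX A C z.2 := by
  rw [mem_segment_iff_lineX h.ne', min_eq_right h.le, max_eq_left h.le]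

theorem mem_short_sides_iff (hAB : B.2 < A.2) (hBC : C.2 < B.2) (z : ℝ × ℝ) :
    z ∈ segment ℝ A B ∪ segment ℝ B C ↔
      (C.2 ≤ z.2 ∧ z.2 ≤ A.2) ∧ z.1 = triBroken A B C z.2 := by
  rw [mem_union, mem_long_side_iff hAB, mem_long_side_iff hBC]
  constructor
  · rintro (⟨h1, h2⟩ | ⟨h1, h2⟩)
    · exact ⟨⟨by linarith, h1.2⟩, by rw [triBroken_of_ge hAB hBC h1.1, h2]⟩
    · exact ⟨⟨h1.1, by linarith⟩, by rw [triBroken_of_le hAB hBC h1.2, h2]⟩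
  · rintro ⟨h1, h2⟩
    rcases le_total z.2 B.2 with h | h
    · exact Or.inr ⟨⟨h1.1, h⟩, by rw [h2, triBroken_of_le hAB hBC h]⟩
    · exact Or.inl ⟨⟨h, h1.2⟩, by rw [h2, triBroken_of_ge hAB hBC h]⟩

theorem frontier_triangle (hAB : B.2 < A.2) (hBC : C.2 < B.2) (h0 : triOffset A B C ≠ 0) :
    frontier (convexHull ℝ {A, B, C}) = segment ℝ A B ∪ segment ℝ B C ∪ segment ℝ A C := by
  ext z
  rw [(isLens_triangle hAB hBC h0).mem_frontier_iff, mem_union, mem_short_sides_iff hAB hBC,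
    mem_long_side_iff (hBC.trans hAB), ← and_or_left]
  refine and_congr_right fun _ => ?_
  unfold triLeft triRight
  rcases le_total (lineX A C z.2) (triBroken A B C z.2) with h | h
  · rw [min_eq_left h, max_eq_right h]; tauto
  · rw [min_eq_right h, max_eq_left h]

/-- A triangle without interior is degenerate. -/
theorem interior_triangle_eq_empty (hAB : B.2 < A.2) (hBC : C.2 < B.2)
    (h0 : triOffset A B C = 0) : interior (convexHull ℝ {A, B, C}) = ∅ := by
  rw [eq_empty_iff_forall_notMem]
  intro z hz
  have h1 := PlanarPolygon.eventually_ray_mem (isOpen_interior.mem_nhds hz) 1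
  obtain ⟨t, ht, ht'⟩ := (h1.and (eventually_mem_nhdsWithin (s := Ioi (0 : ℝ)))).exists
  obtain ⟨b, -, -, hb⟩ := (mem_triangle_iff hAB hBC _).1 (interior_subset ht)
  obtain ⟨b', -, -, hb'⟩ := (mem_triangle_iff hAB hBC _).1 (interior_subset hz)
  have : 0 < t := ht'
  dsimp only at hb
  rw [h0] at hb hb'
  linarith

theorem isPreconnected_frontier_triangle (hAB : B.2 < A.2) (hBC : C.2 < B.2)
    (h0 : triOffset A B C ≠ 0) : IsPreconnected (frontier (convexHull ℝ {A, B, C})) := by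
  rw [frontier_triangle hAB hBC h0]
  have h : ∀ p q : ℝ × ℝ, IsPreconnected (segment ℝ p q) := fun p q =>
    (convex_segment p q).isPreconnected
  refine ((h A B).union B (right_mem_segment ℝ _ _) (left_mem_segment ℝ _ _) (h B C)).union A
    (Or.inl (left_mem_segment ℝ _ _)) (left_mem_segment ℝ _ _) (h A C)

theorem vertices_mem_frontier_triangle (hAB : B.2 < A.2) (hBC : C.2 < B.2)
    (h0 : triOffset A B C ≠ 0) : ({A, B, C} : Set (ℝ × ℝ)) ⊆ frontier (convexHull ℝ {A, B, C}) := by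
  rw [frontier_triangle hAB hBC h0]
  rintro z (rfl | rfl | rfl)
  · exact Or.inl (Or.inl (left_mem_segment ℝ _ _))
  · exact Or.inl (Or.inl (right_mem_segment ℝ _ _))
  · exact Or.inl (Or.inr (right_mem_segment ℝ _ _))

end Triangle

theorem IsPreconnected.subset_interior {X : Type*} [TopologicalSpace X] {t S : Set X}
    (ht : IsPreconnected t) (hd : Disjoint t (frontier S)) (hne : (t ∩ S).Nonempty) :
    t ⊆ interior S := by
  have hcov : t ⊆ interior S ∪ (closure S)ᶜ := by
    intro w hw
    by_contra hcon
    rw [mem_union, not_or, mem_compl_iff, not_not] at hcon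
    exact disjoint_left.1 hd hw ⟨hcon.2, hcon.1⟩
  obtain ⟨z, hz, hzS⟩ := hne
  refine ht.subset_left_of_subset_union isOpen_interior isClosed_closure.isOpen_compl ?_ hcov
    ⟨z, hz, (hcov hz).resolve_right fun h => h (subset_closure hzS)⟩
  exact disjoint_compl_right.mono_left (interior_subset.trans subset_closure)

/-- If two opposite rays from `z` both met the convex set, `z` would lie between two of its points.
-/
theorem Convex.ray_disjoint {T : Set (ℝ × ℝ)} (hT : Convex ℝ T) {z : ℝ × ℝ} (hz : z ∉ T)
    (d : ℝ × ℝ) : (∀ t : ℝ, 0 ≤ t → z + t • d ∉ T) ∨ (∀ t : ℝ, 0 ≤ t → z + t • (-d) ∉ T) := by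
  by_contra! hcon
  obtain ⟨⟨t, ht, h1⟩, s, hs, h2⟩ := hcon
  rcases (add_nonneg hs ht).eq_or_lt with h | h
  · have : t = 0 := by linarith
    rw [this, zero_smul, add_zero] at h1
    exact hz h1
  · refine hz ?_
    have := hT h1 h2 (a := s / (s + t)) (b := t / (s + t)) (by positivity) (by positivity)
      (by field_simp)
    convert this using 1
    have h3 : s / (s + t) + t / (s + t) = 1 := by field_simp
    have h4 : s / (s + t) * t - t / (s + t) * s = 0 := by ring
    calc z = (s / (s + t) + t / (s + t)) • z + (s / (s + t) * t - t / (s + t) * s) • d := by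
          rw [h3, h4]; simp
      _ = _ := by module

/-! ### A region between two graphs with a hole of the same kind -/

section Annulus

variable {S T : Set (ℝ × ℝ)} {a b c d : ℝ} {l r l' r' : ℝ → ℝ}

theorem IsLens.left_mem (h : IsLens S a b l r) {y : ℝ} (hy : a ≤ y ∧ y ≤ b) :
    (l y, y) ∈ frontier S := (h.mem_frontier_iff _).2 ⟨hy, Or.inl rfl⟩

theorem IsLens.right_mem (h : IsLens S a b l r) {y : ℝ} (hy : a ≤ y ∧ y ≤ b) :
    (r y, y) ∈ frontier S := (h.mem_frontier_iff _).2 ⟨hy, Or.inr rfl⟩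

theorem IsLens.closure_interior (h : IsLens S a b l r) (hS : Convex ℝ S) :
    closure (interior S) = S := by
  rw [hS.closure_interior_eq_closure_of_nonempty_interior h.nonempty_interior,
    h.isClosed.closure_eq]

theorem IsLens.hole_bounds (h : IsLens S a b l r) (h' : IsLens T c d l' r')
    (hsub : T ⊆ interior S) {y : ℝ} (hy : c ≤ y ∧ y ≤ d) :
    (a < y ∧ y < b) ∧ l y < l' y ∧ r' y < r y := by
  have h1 := (h.mem_interior_iff _).1 (hsub (h'.isClosed.frontier_subset (h'.left_mem hy)))
  have h2 := (h.mem_interior_iff _).1 (hsub (h'.isClosed.frontier_subset (h'.right_mem hy)))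
  exact ⟨h1.1, h1.2.1, h2.2.2⟩

theorem IsLens.annulus_isClosed (h : IsLens S a b l r) : IsClosed (S \ interior T) :=
  h.isClosed.sdiff isOpen_interior

theorem IsLens.annulus_interior (h' : IsLens T c d l' r')
    (hT : Convex ℝ T) : interior (S \ interior T) = interior S \ T := by
  rw [sdiff_eq, interior_inter, interior_compl, h'.closure_interior hT, sdiff_eq]

theorem IsLens.annulus_frontier (h : IsLens S a b l r) (h' : IsLens T c d l' r')
    (hT : Convex ℝ T) (hsub : T ⊆ interior S) :
    frontier (S \ interior T) = frontier S ∪ frontier T := by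
  rw [h.annulus_isClosed.frontier_eq, h'.annulus_interior hT, h.isClosed.frontier_eq,
    h'.isClosed.frontier_eq]
  ext z
  have h1 := @hsub z
  have h2 := @interior_subset _ _ S z
  have h3 := @interior_subset _ _ T z
  simp only [mem_union, Set.mem_sdiff]
  tauto

theorem IsLens.annulus_closure_interior (h : IsLens S a b l r) (h' : IsLens T c d l' r')
    (hS : Convex ℝ S) (hT : Convex ℝ T) (hsub : T ⊆ interior S) :
    closure (interior (S \ interior T)) = S \ interior T := by
  refine Subset.antisymm (closure_minimal interior_subset h.annulus_isClosed) ?_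
  rw [h'.annulus_interior hT]
  rintro z ⟨hzS, hzT⟩
  by_cases hz : z ∈ T
  · have h1 : z ∈ closure Tᶜ := by
      rw [closure_compl]; exact hzT
    exact isOpen_interior.inter_closure ⟨hsub hz, h1⟩
  · have h1 : z ∈ closure (interior S) := by
      rw [h.closure_interior hS]; exact hzS
    have := h'.isClosed.isOpen_compl.inter_closure ⟨hz, h1⟩
    rw [inter_comm] at this
    exact this

theorem isPreconnected_horizontal {s : Set ℝ} (hs : IsPreconnected s) (y : ℝ) :
    IsPreconnected ((fun x => ((x, y) : ℝ × ℝ)) '' s) :=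
  hs.image _ (by fun_prop)

/-- Every point can be joined by a horizontal segment that avoids the hole to the left or to the
right outer graph, and these two graphs meet in the lowest point. -/
theorem IsLens.annulus_isConnected (h : IsLens S a b l r) (h' : IsLens T c d l' r')
    (hsub : T ⊆ interior S) : IsConnected (S \ interior T) := by
  have hST : Disjoint (frontier S) T := by
    rw [disjoint_left]
    exact fun z hz hzT => hz.2 (hsub hzT)
  have hgraph : ∀ f : ℝ → ℝ, Continuous f → (∀ y, a ≤ y ∧ y ≤ b → (f y, y) ∈ frontier S) →
      IsPreconnected ((fun y => (f y, y)) '' Icc a b) ∧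
        (fun y => (f y, y)) '' Icc a b ⊆ S \ interior T := by
    intro f hf hm
    refine ⟨isPreconnected_Icc.image _ (hf.prodMk continuous_id).continuousOn, ?_⟩
    rintro _ ⟨y, hy, rfl⟩
    exact ⟨h.isClosed.frontier_subset (hm y hy), fun hT =>
      disjoint_left.1 hST (hm y hy) (interior_subset hT)⟩
  obtain ⟨hL, hL'⟩ := hgraph l h.continuous_left fun y hy => h.left_mem hy
  obtain ⟨hR, hR'⟩ := hgraph r h.continuous_right fun y hy => h.right_mem hy
  have hab := h.lt.le
  have hA : ((l a, a) : ℝ × ℝ) ∈ S \ interior T := hL' ⟨a, ⟨le_rfl, hab⟩, rfl⟩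
  refine ⟨⟨_, hA⟩, isPreconnected_of_forall (l a, a) ?_⟩
  rintro z ⟨hzS, hzT⟩
  have hz := (h.mem_iff z).1 hzS
  by_cases hcase : c < z.2 ∧ z.2 < d ∧ l' z.2 < z.1
  · have hzr : r' z.2 ≤ z.1 := by
      by_contra! hcon
      exact hzT ((h'.mem_interior_iff z).2 ⟨⟨hcase.1, hcase.2.1⟩, hcase.2.2, hcon⟩)
    refine ⟨(fun x => ((x, z.2) : ℝ × ℝ)) '' Icc z.1 (r z.2) ∪ (fun y => (r y, y)) '' Icc a b,
      union_subset ?_ hR', Or.inr ⟨a, ⟨le_rfl, hab⟩, by simp [h.bot]⟩,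
      Or.inl ⟨z.1, ⟨le_rfl, hz.2.2⟩, rfl⟩,
      (isPreconnected_horizontal isPreconnected_Icc _).union (r z.2, z.2)
        ⟨r z.2, ⟨hz.2.2, le_rfl⟩, rfl⟩ ⟨z.2, hz.1, rfl⟩ hR⟩
    rintro _ ⟨x, hx, rfl⟩
    refine ⟨(h.mem_iff _).2 ⟨hz.1, hz.2.1.trans hx.1, hx.2⟩, fun hxT => ?_⟩
    have := (h'.mem_interior_iff _).1 hxT
    dsimp only at this
    linarith [hx.1, this.2.2]
  · refine ⟨(fun x => ((x, z.2) : ℝ × ℝ)) '' Icc (l z.2) z.1 ∪ (fun y => (l y, y)) '' Icc a b,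
      union_subset ?_ hL', Or.inr ⟨a, ⟨le_rfl, hab⟩, rfl⟩,
      Or.inl ⟨z.1, ⟨hz.2.1, le_rfl⟩, rfl⟩,
      (isPreconnected_horizontal isPreconnected_Icc _).union (l z.2, z.2)
        ⟨l z.2, ⟨le_rfl, hz.2.1⟩, rfl⟩ ⟨z.2, hz.1, rfl⟩ hL⟩
    rintro _ ⟨x, hx, rfl⟩
    refine ⟨(h.mem_iff _).2 ⟨hz.1, hx.1, hx.2.trans hz.2.2⟩, fun hxT => ?_⟩
    have := (h'.mem_interior_iff _).1 hxT
    dsimp only at this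
    exact hcase ⟨this.1.1, this.1.2, by linarith [hx.2, this.2.1]⟩

end Annulus

/-! ### Recovering a polygon from its boundary -/

namespace PlanarPolygon

variable (P : PlanarPolygon)

/-- A point of the polygon cannot escape to infinity without crossing the boundary. -/
theorem exists_ray_mem_frontier {z d : ℝ × ℝ} (hz : z ∈ P.carrier) (hd : d ≠ 0) :
    ∃ t : ℝ, 0 ≤ t ∧ z + t • d ∈ frontier P.carrier := by
  by_contra! hcon
  have hpre : IsPreconnected ((fun t : ℝ => z + t • d) '' Ici 0) :=
    isPreconnected_Ici.image _ (by fun_prop)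
  have hdis : Disjoint ((fun t : ℝ => z + t • d) '' Ici 0) (frontier P.carrier) := by
    rw [disjoint_left]
    rintro _ ⟨t, ht, rfl⟩
    exact hcon t ht
  have hsub := P.subset_or_disjoint hpre hdis (z := z) ⟨0, by simp, by simp⟩ hz
  obtain ⟨R, hR⟩ := P.isCompact.isBounded.exists_norm_le
  have hd' : 0 < ‖d‖ := norm_pos_iff.2 hd
  have hR0 : 0 ≤ R := (norm_nonneg _).trans (hR z hz)
  set t := (R + ‖z‖ + 1) / ‖d‖ with ht
  have ht0 : 0 ≤ t := by positivity
  have h1 := hR _ (interior_subset (hsub ⟨t, ht0, rfl⟩))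
  have h2 : ‖t • d‖ = R + ‖z‖ + 1 := by
    rw [norm_smul, Real.norm_of_nonneg ht0, ht]; field_simp
  have h3 : ‖t • d‖ ≤ ‖z + t • d‖ + ‖z‖ := by
    calc ‖t • d‖ = ‖(z + t • d) - z‖ := by rw [add_sub_cancel_left]
      _ ≤ _ := norm_sub_le _ _
  dsimp only at h1
  linarith

theorem germ_iff_not_germ {p : ℝ × ℝ} (hp : p ∈ frontier P.carrier)
    (hv : ∀ v ∈ P.vertices, v.2 ≠ p.2) : P.Germ 1 p ↔ ¬ P.Germ (-1) p := by
  obtain ⟨e, he⟩ := P.mem_frontier.1 hp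
  rcases P.vertex_or_mem_Ioo he with ⟨v, rfl⟩ | ⟨h1, h2⟩
  · exact absurd rfl (hv v v.2)
  · rw [P.germ_iff_side_of_Ioo he h1 h2 one_ne_zero,
      P.germ_iff_side_of_Ioo he h1 h2 (by norm_num), P.side_iff_not]

/-- Points arbitrarily close to a given one avoid the heights of the vertices. -/
theorem exists_height_ne {U : Set (ℝ × ℝ)} (hU : IsOpen U) {z : ℝ × ℝ} (hz : z ∈ U) :
    ∃ w ∈ U, ∀ v ∈ P.vertices, v.2 ≠ w.2 := by
  have hc : Continuous fun t : ℝ => ((z.1, z.2 + t) : ℝ × ℝ) := by fun_prop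
  have h1 : ∀ᶠ t in 𝓝[>] (0 : ℝ), (z.1, z.2 + t) ∈ U := by
    have := hc.tendsto 0
    simp only [add_zero] at this
    exact (this.mono_left nhdsWithin_le_nhds) (hU.mem_nhds hz)
  have h2 : ∀ᶠ t in 𝓝[>] (0 : ℝ), ∀ v ∈ P.vertices, v.2 ≠ z.2 + t := by
    rw [Finset.eventually_all]
    intro v _
    rcases le_or_gt (v.2 - z.2) 0 with h | h
    · filter_upwards [self_mem_nhdsWithin] with t ht heq
      have : 0 < t := ht
      linarith
    · filter_upwards [Ioo_mem_nhdsGT h] with t ht heq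
      linarith [ht.2]
  obtain ⟨t, ht1, ht2⟩ := (h1.and h2).exists
  exact ⟨_, ht1, ht2⟩

/-- The polygon is closed, and the points that avoid all vertex heights are dense in an open set. -/
theorem subset_carrier_of_isOpen {U : Set (ℝ × ℝ)} (hU : IsOpen U)
    (h : ∀ z ∈ U, (∀ v ∈ P.vertices, v.2 ≠ z.2) → z ∈ P.carrier) : U ⊆ P.carrier := by
  intro z hz
  by_contra hcon
  obtain ⟨w, ⟨hw, hw'⟩, hv⟩ :=
    P.exists_height_ne (hU.inter P.isClosed_carrier.isOpen_compl) ⟨hz, hcon⟩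
  exact hw' (h w hw hv)

/-- A horizontal open segment free of boundary points, next to a germ of the polygon. -/
theorem mem_of_germ {s : ℝ} {I : Set ℝ} (hI : IsPreconnected I) {x x₀ y : ℝ}
    (hdis : ∀ x ∈ I, (x, y) ∉ frontier P.carrier) (hx : x ∈ I)
    (hev : ∀ᶠ t in 𝓝[>] (0 : ℝ), x₀ + s * t ∈ I) : P.Germ s (x₀, y) ↔ (x, y) ∈ P.carrier := by
  refine P.germ_iff_mem (isPreconnected_horizontal hI y) ?_ ⟨x, hx, rfl⟩ ?_
  · rw [disjoint_left]
    rintro _ ⟨x, hx, rfl⟩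
    exact hdis x hx
  · filter_upwards [hev] with t ht
    exact ⟨_, ht, rfl⟩

end PlanarPolygon

/-- Sorting the vertices of a triangle by height. -/
theorem exists_sorted {x y z : ℝ × ℝ} (h12 : x.2 ≠ y.2) (h23 : y.2 ≠ z.2) (h13 : x.2 ≠ z.2)
    (s1 : x ∉ segment ℝ y z) (s2 : y ∉ segment ℝ x z) (s3 : z ∉ segment ℝ x y) :
    ∃ A B C : ℝ × ℝ, B.2 < A.2 ∧ C.2 < B.2 ∧ triOffset A B C ≠ 0 ∧
      ({A, B, C} : Set (ℝ × ℝ)) = {x, y, z} ∧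
      segment ℝ A B ∪ segment ℝ B C ∪ segment ℝ A C =
        segment ℝ x y ∪ segment ℝ y z ∪ segment ℝ x z := by
  have off : ∀ {A B C : ℝ × ℝ}, B.2 < A.2 → C.2 < B.2 → B ∉ segment ℝ A C →
      triOffset A B C ≠ 0 := by
    intro A B C h1 h2 h3 h4
    refine h3 ((mem_long_side_iff (h2.trans h1) _).2 ⟨⟨h2.le, h1.le⟩, ?_⟩)
    unfold triOffset at h4
    linarith
  have e1 := segment_symm ℝ y x
  have e2 := segment_symm ℝ z y
  have e3 := segment_symm ℝ z x
  rcases h12.lt_or_gt with h | h <;> rcases h23.lt_or_gt with h' | h' <;>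
    rcases h13.lt_or_gt with h'' | h''
  · exact ⟨z, y, x, h', h, off h' h (by rwa [e3]), by ext; simp; tauto,
      by rw [e1, e2, e3]; ext; simp only [mem_union]; tauto⟩
  · linarith
  · exact ⟨y, z, x, h', h'', off h' h'' (by rwa [e1]), by ext; simp; tauto,
      by rw [e1, e3]; ext; simp only [mem_union]; tauto⟩
  · exact ⟨y, x, z, h, h'', off h h'' s1, by ext; simp; tauto,
      by rw [e1]; ext; simp only [mem_union]; tauto⟩
  · exact ⟨z, x, y, h'', h, off h'' h (by rwa [e2]), by ext; simp; tauto,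
      by rw [e2, e3]; ext; simp only [mem_union]; tauto⟩
  · exact ⟨x, z, y, h'', h', off h'' h' s3, by ext; simp; tauto,
      by rw [e2]; ext; simp only [mem_union]; tauto⟩
  · linarith
  · exact ⟨x, y, z, h, h', off h h' s2, rfl, rfl⟩

namespace PlanarPolygon

variable (P : PlanarPolygon)

/-- A polygon bounded by the frontiers of two convex regions, one inside the other. -/
theorem carrier_eq_of_nested {S T : Set (ℝ × ℝ)} {a b c d : ℝ} {l r l' r' : ℝ → ℝ}
    (hS : IsLens S a b l r) (hT : IsLens T c d l' r') (hSc : Convex ℝ S) (hsub : T ⊆ interior S)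
    (hF : frontier P.carrier = frontier S ∪ frontier T) : P.carrier = S \ interior T := by
  have hFS : ∀ z ∈ frontier P.carrier, z ∈ S := by
    intro z hz
    rw [hF] at hz
    rcases hz with hz | hz
    · exact hS.isClosed.frontier_subset hz
    · exact interior_subset (hsub (hT.isClosed.frontier_subset hz))
  -- From a point outside of the convex set one of the two horizontal rays misses it, but every ray
  -- from a point of the polygon meets the boundary, which lies in `S`.
  have hKS : P.carrier ⊆ S := by
    intro z hz
    by_contra hzS
    rcases hSc.ray_disjoint hzS (1, 0) with h | h
    · obtain ⟨t, ht, h1⟩ := P.exists_ray_mem_frontier hz (d := (1, 0)) (by simp)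
      exact h t ht (hFS _ h1)
    · obtain ⟨t, ht, h1⟩ := P.exists_ray_mem_frontier hz (d := -(1, 0)) (by simp)
      exact h t ht (hFS _ h1)
  have hFl : ∀ y, a ≤ y ∧ y ≤ b → (l y, y) ∈ frontier P.carrier := fun y hy => by
    rw [hF]; exact Or.inl (hS.left_mem hy)
  have hFr : ∀ y, a ≤ y ∧ y ≤ b → (r y, y) ∈ frontier P.carrier := fun y hy => by
    rw [hF]; exact Or.inl (hS.right_mem hy)
  -- germs at the outer boundary
  have hgl : ∀ y, a ≤ y ∧ y ≤ b → (∀ v ∈ P.vertices, v.2 ≠ y) → P.Germ 1 (l y, y) := by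
    intro y hy hv
    rw [P.germ_iff_not_germ (hFl y hy) hv]
    intro hg
    obtain ⟨t, h1, h2⟩ := (hg.and (self_mem_nhdsWithin (s := Ioi (0 : ℝ)))).exists
    have h3 := ((hS.mem_iff _).1 (hKS h1)).2.1
    have : 0 < t := h2
    dsimp only at h3
    linarith
  have hgr : ∀ y, a ≤ y ∧ y ≤ b → (∀ v ∈ P.vertices, v.2 ≠ y) → P.Germ (-1) (r y, y) := by
    intro y hy hv
    by_contra hg
    rw [← P.germ_iff_not_germ (hFr y hy) hv] at hg
    obtain ⟨t, h1, h2⟩ := (hg.and (self_mem_nhdsWithin (s := Ioi (0 : ℝ)))).exists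
    have h3 := ((hS.mem_iff _).1 (hKS h1)).2.2
    have : 0 < t := h2
    dsimp only at h3
    linarith
  -- At a height without vertices, the point is joined horizontally to the outer boundary on its own
  -- side of the hole. No boundary point lies in between, and the germ at the outer boundary points
  -- inwards.
  have hint : interior S \ T ⊆ P.carrier := by
    refine P.subset_carrier_of_isOpen (isOpen_interior.sdiff hT.isClosed) ?_
    rintro z ⟨hzS, hzT⟩ hv
    have hz := (hS.mem_interior_iff z).1 hzS
    have hz' : a ≤ z.2 ∧ z.2 ≤ b := ⟨hz.1.1.le, hz.1.2.le⟩
    by_cases hcase : c ≤ z.2 ∧ z.2 ≤ d ∧ l' z.2 ≤ z.1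
    · have hzr : r' z.2 < z.1 := by
        by_contra! hcon
        exact hzT ((hT.mem_iff z).2 ⟨⟨hcase.1, hcase.2.1⟩, hcase.2.2, hcon⟩)
      refine (P.mem_of_germ (s := -1) (I := Ioo (r' z.2) (r z.2)) isPreconnected_Ioo
        (x₀ := r z.2) (fun x hx hxF => ?_) ⟨hzr, hz.2.2⟩ ?_).1 (hgr z.2 hz' hv)
      · rw [hF, mem_union, hS.mem_frontier_iff, hT.mem_frontier_iff] at hxF
        have h1 := hT.le hcase.1 hcase.2.1
        have h2 := hS.hole_bounds hT hsub ⟨hcase.1, hcase.2.1⟩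
        rcases hxF with ⟨-, h | h⟩ | ⟨-, h | h⟩ <;> dsimp only at h <;> linarith [hx.1, hx.2]
      · have h0 : 0 < r z.2 - r' z.2 := by linarith [hz.2.2]
        filter_upwards [Ioo_mem_nhdsGT h0] with t ht
        exact ⟨by linarith [ht.2], by linarith [ht.1]⟩
    · refine (P.mem_of_germ (s := 1) (I := Ioc (l z.2) z.1) isPreconnected_Ioc
        (x₀ := l z.2) (fun x hx hxF => ?_) ⟨hz.2.1, le_rfl⟩ ?_).1 (hgl z.2 hz' hv)
      · rw [hF, mem_union, hS.mem_frontier_iff, hT.mem_frontier_iff] at hxF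
        rcases hxF with ⟨-, h | h⟩ | ⟨h3, h⟩
        · dsimp only at h; linarith [hx.1]
        · dsimp only at h; linarith [hx.2, hz.2.2]
        · dsimp only at h3 h
          have h4 := hT.le h3.1 h3.2
          exact hcase ⟨h3.1, h3.2, by rcases h with h | h <;> linarith [hx.2]⟩
      · have h0 : 0 < z.1 - l z.2 := by linarith [hz.2.1]
        filter_upwards [Ioo_mem_nhdsGT h0] with t ht
        exact ⟨by linarith [ht.1], by linarith [ht.2]⟩
  -- If the polygon entered the hole, then at some height without vertices the left boundary point
  -- of the hole would have the polygon on both sides, whereas such a point has it on exactly one.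
  refine Subset.antisymm (fun z hz => ⟨hKS hz, fun hzT => ?_⟩) ?_
  · rw [← P.closure_interior] at hz
    have h1 := isOpen_interior.inter_closure ⟨hzT, hz⟩
    obtain ⟨w₀, hw₀⟩ := closure_nonempty_iff.1 ⟨z, h1⟩
    obtain ⟨w, ⟨hwT, hwK⟩, hv⟩ :=
      P.exists_height_ne (isOpen_interior.inter isOpen_interior) hw₀
    have hw := (hT.mem_interior_iff w).1 hwT
    have hw' : c ≤ w.2 ∧ w.2 ≤ d := ⟨hw.1.1.le, hw.1.2.le⟩
    have hb := hS.hole_bounds hT hsub hw'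
    have hpF : (l' w.2, w.2) ∈ frontier P.carrier := by
      rw [hF]; exact Or.inr (hT.left_mem hw')
    have hg1 : P.Germ 1 (l' w.2, w.2) := by
      refine (P.mem_of_germ (s := 1) (I := Ioo (l' w.2) (r' w.2)) isPreconnected_Ioo
        (x₀ := l' w.2) (x := w.1) (fun x hx hxF => ?_) ⟨hw.2.1, hw.2.2⟩ ?_).2 (interior_subset hwK)
      · rw [hF, mem_union, hS.mem_frontier_iff, hT.mem_frontier_iff] at hxF
        rcases hxF with ⟨-, h | h⟩ | ⟨-, h | h⟩ <;> dsimp only at h <;> linarith [hx.1, hx.2]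
      · have h0 : 0 < r' w.2 - l' w.2 := by linarith
        filter_upwards [Ioo_mem_nhdsGT h0] with t ht
        exact ⟨by linarith [ht.1], by linarith [ht.2]⟩
    refine (P.germ_iff_not_germ hpF hv).1 hg1 ?_
    have h0 : 0 < l' w.2 - l w.2 := by linarith
    filter_upwards [Ioo_mem_nhdsGT h0] with t ht
    refine hint ⟨(hS.mem_interior_iff _).2 ⟨hb.1, ?_, ?_⟩, fun hmT => ?_⟩
    · dsimp only; linarith [ht.2]
    · dsimp only; linarith [ht.1]
    · have := ((hT.mem_iff _).1 hmT).2.1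
      dsimp only at this
      linarith [ht.1]
  · rintro z ⟨hzS, hzT⟩
    by_cases h1 : z ∈ interior S
    · by_cases h2 : z ∈ T
      · refine P.frontier_subset ?_
        rw [hF]
        exact Or.inr ⟨subset_closure h2, hzT⟩
      · exact hint ⟨h1, h2⟩
    · refine P.frontier_subset ?_
      rw [hF]
      exact Or.inl ⟨subset_closure hzS, h1⟩

/-- A polygon bounded by the frontiers of two disjoint convex regions is not connected. -/
theorem not_isPreconnected_of_separate {S T : Set (ℝ × ℝ)} (hSK : IsCompact S) (hTK : IsCompact T)
    (hSc : Convex ℝ S) (hTc : Convex ℝ T) (hdis : Disjoint S T)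
    (hS0 : (frontier S).Nonempty) (hT0 : (frontier T).Nonempty)
    (hF : frontier P.carrier = frontier S ∪ frontier T) : ¬ IsPreconnected P.carrier := by
  obtain ⟨f, u, v, hfS, huv, hfT⟩ :=
    geometric_hahn_banach_compact_closed hSc hSK hTc hTK.isClosed hdis
  -- The direction of the separating line: moving along `d` does not change `f`.
  set d : ℝ × ℝ := (f (0, 1), -f (1, 0)) with hd
  have hf : ∀ z : ℝ × ℝ, f z = z.1 * f (1, 0) + z.2 * f (0, 1) := by
    intro z
    have : z = z.1 • ((1, 0) : ℝ × ℝ) + z.2 • ((0, 1) : ℝ × ℝ) := by ext <;> simp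
    conv_lhs => rw [this]
    rw [map_add, map_smul, map_smul, smul_eq_mul, smul_eq_mul]
  have hfd : f d = 0 := by rw [hf, hd]; ring
  have hS1 : (frontier S) ⊆ S := hSK.isClosed.frontier_subset
  have hT1 : (frontier T) ⊆ T := hTK.isClosed.frontier_subset
  have hd0 : d ≠ 0 := by
    intro h0
    have h1 : f (0, 1) = 0 := congrArg Prod.fst h0
    have h2 : f (1, 0) = 0 := neg_eq_zero.1 (congrArg Prod.snd h0)
    obtain ⟨s, hs⟩ := hS0
    obtain ⟨t, ht⟩ := hT0
    have h3 := hfS s (hS1 hs)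
    have h4 := hfT t (hT1 ht)
    rw [hf, h1, h2] at h3 h4
    linarith
  have hfray : ∀ (z : ℝ × ℝ) (t : ℝ), f (z + t • d) = f z := by
    intro z t
    rw [map_add, map_smul, hfd, smul_zero, add_zero]
  -- A line in direction `d` through a point outside of both sets stays away from the set beyond the
  -- separating line, and one of its two halves misses the other set by convexity. This ray never
  -- meets the boundary.
  have hcov : P.carrier ⊆ S ∪ T := by
    intro z hz
    by_contra hcon
    rw [mem_union, not_or] at hcon
    have key : ∀ e : ℝ × ℝ, e ≠ 0 → (∀ t : ℝ, 0 ≤ t → z + t • e ∉ S) →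
        (∀ t : ℝ, 0 ≤ t → z + t • e ∉ T) → False := by
      intro e he h1 h2
      obtain ⟨t, ht, h3⟩ := P.exists_ray_mem_frontier hz he
      rw [hF] at h3
      rcases h3 with h3 | h3
      · exact h1 t ht (hS1 h3)
      · exact h2 t ht (hT1 h3)
    have hneg : ∀ t : ℝ, f (z + t • (-d)) = f z := fun t => by
      rw [smul_neg, ← neg_smul]; exact hfray z _
    by_cases hz1 : f z < v
    · have hnT : ∀ t : ℝ, z + t • d ∉ T ∧ z + t • (-d) ∉ T := fun t =>
        ⟨fun h => by have := hfT _ h; rw [hfray] at this; linarith,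
          fun h => by have := hfT _ h; rw [hneg] at this; linarith⟩
      rcases hSc.ray_disjoint hcon.1 d with h | h
      · exact key d hd0 h fun t _ => (hnT t).1
      · exact key (-d) (neg_ne_zero.2 hd0) h fun t _ => (hnT t).2
    · have hnS : ∀ t : ℝ, z + t • d ∉ S ∧ z + t • (-d) ∉ S := fun t =>
        ⟨fun h => by have := hfS _ h; rw [hfray] at this; linarith,
          fun h => by have := hfS _ h; rw [hneg] at this; linarith⟩
      rcases hTc.ray_disjoint hcon.2 d with h | h
      · exact key d hd0 (fun t _ => (hnS t).1) h
      · exact key (-d) (neg_ne_zero.2 hd0) (fun t _ => (hnS t).2) h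
  intro hpre
  obtain ⟨s, hs⟩ := hS0
  obtain ⟨t, ht⟩ := hT0
  have hsF : s ∈ P.carrier := P.frontier_subset (by rw [hF]; exact Or.inl hs)
  have htF : t ∈ P.carrier := P.frontier_subset (by rw [hF]; exact Or.inr ht)
  obtain ⟨x, -, hxS, hxT⟩ := isPreconnected_closed_iff.1 hpre S T hSK.isClosed hTK.isClosed hcov
    ⟨s, hsF, hS1 hs⟩ ⟨t, htF, hT1 ht⟩
  exact disjoint_left.1 hdis hxS hxT

/-- The triangle bounded by a boundary curve with three vertices. -/
theorem exists_sorted_triangle {v : P.vertices} (h : P.next (P.next (P.next v)) = v) :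
    ∃ A B C : ℝ × ℝ, B.2 < A.2 ∧ C.2 < B.2 ∧ triOffset A B C ≠ 0 ∧
      ({A, B, C} : Set (ℝ × ℝ)) =
        {(v : ℝ × ℝ), (P.next v : ℝ × ℝ), (P.next (P.next v) : ℝ × ℝ)} ∧
      segment ℝ A B ∪ segment ℝ B C ∪ segment ℝ A C =
        P.edge v ∪ P.edge (P.next v) ∪ P.edge (P.next (P.next v)) := by
  have hne1 : (v : ℝ × ℝ).2 ≠ (P.next v : ℝ × ℝ).2 := fun h => P.next_ne v (P.vertex_ext h).symm
  have hne2 : (P.next v : ℝ × ℝ).2 ≠ (P.next (P.next v) : ℝ × ℝ).2 :=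
    fun h => P.next_ne _ (P.vertex_ext h).symm
  have hne3 : (v : ℝ × ℝ).2 ≠ (P.next (P.next v) : ℝ × ℝ).2 :=
    fun h => P.next_next_ne v (P.vertex_ext h).symm
  have hE : P.edge v ∪ P.edge (P.next v) ∪ P.edge (P.next (P.next v)) =
      segment ℝ (v : ℝ × ℝ) (P.next v) ∪ segment ℝ (P.next v : ℝ × ℝ) (P.next (P.next v)) ∪
      segment ℝ (v : ℝ × ℝ) (P.next (P.next v)) := by
    unfold edge
    rw [h, segment_symm ℝ (P.next (P.next v) : ℝ × ℝ)]
  have hnot : ∀ x y z : P.vertices, x ≠ y → y ≠ z → x ≠ z → ∀ e : P.vertices,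
      segment ℝ (x : ℝ × ℝ) z = P.edge e → (e = x ∨ e = z) → (P.next e = x ∨ P.next e = z) →
      (y : ℝ × ℝ) ∉ segment ℝ (x : ℝ × ℝ) z := by
    intro x y z hxy hyz hxz e he h1 h2 hy
    rw [he] at hy
    rcases P.mem_edge_iff_vertex.1 hy with h3 | h3
    · subst h3; rcases h1 with h1 | h1
      · exact hxy h1.symm
      · exact hyz h1
    · have : P.next e = y := by rw [h3, Equiv.apply_symm_apply]
      rcases h2 with h2 | h2
      · exact hxy (h2.symm.trans this)
      · exact hyz (this.symm.trans h2)
  have n1 := P.next_ne v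
  have n2 := P.next_ne (P.next v)
  have n3 := P.next_next_ne v
  have s1 : (v : ℝ × ℝ) ∉ segment ℝ (P.next v : ℝ × ℝ) (P.next (P.next v)) :=
    hnot _ _ _ n1 n3.symm n2.symm (P.next v) rfl (Or.inl rfl) (Or.inr rfl)
  have s2 : (P.next v : ℝ × ℝ) ∉ segment ℝ (v : ℝ × ℝ) (P.next (P.next v)) :=
    hnot _ _ _ n1.symm n2.symm n3.symm (P.next (P.next v))
      (by unfold edge; rw [h, segment_symm]) (Or.inr rfl) (Or.inl h)
  have s3 : (P.next (P.next v) : ℝ × ℝ) ∉ segment ℝ (v : ℝ × ℝ) (P.next v) :=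
    hnot _ _ _ n3.symm n2 n1.symm v rfl (Or.inl rfl) (Or.inr rfl)
  rw [hE]
  exact exists_sorted hne1 hne2 hne3 s1 s2 s3

/-- A two-connected polygon with at most six vertices is a triangle with a triangular hole. -/
theorem isTriangleWithHole_of_card (hconn : IsConnected P.carrier) {v w : P.vertices}
    (hvw : ¬ P.next.SameCycle v w) (h6 : P.vertices.card ≤ 6) :
    ∃ A B C D E F : ℝ × ℝ, P.IsTriangleWithHole A B C D E F := by
  obtain ⟨hall, hv, hw⟩ := P.exists_of_card_eq_six hvw h6
  obtain ⟨A, B, C, hAB, hBC, h0, hset, hseg⟩ := P.exists_sorted_triangle hv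
  obtain ⟨D, E, F, hDE, hEF, h0', hset', hseg'⟩ := P.exists_sorted_triangle hw
  rw [← frontier_triangle hAB hBC h0] at hseg
  rw [← frontier_triangle hDE hEF h0'] at hseg'
  have hS := isLens_triangle hAB hBC h0
  have hT := isLens_triangle hDE hEF h0'
  have hSc := convex_convexHull ℝ ({A, B, C} : Set (ℝ × ℝ))
  have hTc := convex_convexHull ℝ ({D, E, F} : Set (ℝ × ℝ))
  have hF : frontier P.carrier =
      frontier (convexHull ℝ {A, B, C}) ∪ frontier (convexHull ℝ {D, E, F}) := by
    rw [hseg, hseg']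
    ext z
    rw [P.mem_frontier]
    constructor
    · rintro ⟨e, he⟩
      rcases hall e with rfl | rfl | rfl | rfl | rfl | rfl
      · exact Or.inl (Or.inl (Or.inl he))
      · exact Or.inl (Or.inl (Or.inr he))
      · exact Or.inl (Or.inr he)
      · exact Or.inr (Or.inl (Or.inl he))
      · exact Or.inr (Or.inl (Or.inr he))
      · exact Or.inr (Or.inr he)
    · rintro (((h | h) | h) | ((h | h) | h)) <;> exact ⟨_, h⟩
  have hdisj :
      Disjoint (frontier (convexHull ℝ {A, B, C})) (frontier (convexHull ℝ {D, E, F})) := by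
    rw [hseg, hseg', disjoint_left]
    have hcyc : ∀ u, P.next.SameCycle u (P.next u) ∧ P.next.SameCycle u (P.next (P.next u)) :=
      fun u => by
        simp only [Equiv.Perm.sameCycle_apply_right]
        exact ⟨Equiv.Perm.SameCycle.refl _ _, Equiv.Perm.SameCycle.refl _ _⟩
    have key : ∀ u z, z ∈ P.edge u ∪ P.edge (P.next u) ∪ P.edge (P.next (P.next u)) →
        ∃ e, z ∈ P.edge e ∧ P.next.SameCycle u e := by
      rintro u z ((h | h) | h)
      · exact ⟨_, h, Equiv.Perm.SameCycle.refl _ _⟩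
      · exact ⟨_, h, (hcyc u).1⟩
      · exact ⟨_, h, (hcyc u).2⟩
    intro z hz hz'
    obtain ⟨e, he, hve⟩ := key v z hz
    obtain ⟨f, hf, hwf⟩ := key w z hz'
    exact hvw ((hve.trans (P.sameCycle_of_mem_edges he hf)).trans hwf.symm)
  have hVerts : (P.vertices : Set (ℝ × ℝ)) = {A, B, C} ∪ {D, E, F} := by
    rw [hset, hset']
    ext z
    constructor
    · intro hz
      have := hall ⟨z, hz⟩
      simp only [Subtype.ext_iff] at this
      simp only [mem_union, mem_insert_iff, mem_singleton_iff]
      tauto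
    · rintro ((rfl | rfl | rfl) | (rfl | rfl | rfl)) <;> exact Subtype.prop _
  have hpS := isPreconnected_frontier_triangle hAB hBC h0
  have hpT := isPreconnected_frontier_triangle hDE hEF h0'
  have hvS := vertices_mem_frontier_triangle hAB hBC h0
  have hvT := vertices_mem_frontier_triangle hDE hEF h0'
  -- The two frontiers are connected and disjoint, so a frontier that meets the other triangle lies
  -- in its interior, and the triangles are nested.
  by_cases c1 : (frontier (convexHull ℝ {D, E, F}) ∩ convexHull ℝ {A, B, C}).Nonempty
  · have h1 := hpT.subset_interior hdisj.symm c1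
    have h2 : convexHull ℝ {D, E, F} ⊆ interior (convexHull ℝ {A, B, C}) :=
      convexHull_min (hvT.trans h1) hSc.interior
    refine ⟨A, B, C, D, E, F, ?_, ⟨hAB, hBC⟩, ⟨hDE, hEF⟩, h2,
      P.carrier_eq_of_nested hS hT hSc h2 hF⟩
    rw [hVerts]
    ext z
    simp only [mem_union, mem_insert_iff, mem_singleton_iff]
    tauto
  by_cases c2 : (frontier (convexHull ℝ {A, B, C}) ∩ convexHull ℝ {D, E, F}).Nonempty
  · have h1 := hpS.subset_interior hdisj c2
    have h2 : convexHull ℝ {A, B, C} ⊆ interior (convexHull ℝ {D, E, F}) :=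
      convexHull_min (hvS.trans h1) hTc.interior
    refine ⟨D, E, F, A, B, C, ?_, ⟨hDE, hEF⟩, ⟨hAB, hBC⟩, h2,
      P.carrier_eq_of_nested hT hS hTc h2 (by rw [hF, union_comm])⟩
    rw [hVerts]
    ext z
    simp only [mem_union, mem_insert_iff, mem_singleton_iff]
    tauto
  -- Now neither frontier meets the other triangle, so the triangles are disjoint: a common point
  -- would put one of them in the interior of the other.
  exfalso
  have hcomp : ∀ X Y Z : ℝ × ℝ, IsCompact (convexHull ℝ ({X, Y, Z} : Set (ℝ × ℝ))) := fun X Y Z =>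
    (toFinite _).isCompact_convexHull (𝕜 := ℝ)
  refine P.not_isPreconnected_of_separate (hcomp A B C) (hcomp D E F) hSc hTc ?_
    ⟨A, hvS (by simp)⟩ ⟨D, hvT (by simp)⟩ hF hconn.isPreconnected
  by_contra hnd
  rw [not_disjoint_iff_nonempty_inter] at hnd
  have h1 : Disjoint (convexHull ℝ {A, B, C}) (frontier (convexHull ℝ {D, E, F})) := by
    rw [disjoint_left]
    exact fun z h1 h2 => c1 ⟨z, h2, h1⟩
  have h2 := hSc.isPreconnected.subset_interior h1 hnd
  exact c2 ⟨A, hvS (by simp), interior_subset (h2 (subset_convexHull ℝ _ (by simp)))⟩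

end PlanarPolygon

/-! ### Components of a boundary and connectedness under homotopy equivalence -/

theorem card_connectedComponents_eq_two {X : Type*} [TopologicalSpace X] {F S T : Set X}
    (hF : F = S ∪ T) (hS : IsClosed S) (hT : IsClosed T) (hSp : IsPreconnected S)
    (hTp : IsPreconnected T) (hdis : Disjoint S T) (hS0 : S.Nonempty) (hT0 : T.Nonempty) :
    Nat.card (ConnectedComponents F) = 2 := by
  subst hF
  obtain ⟨s, hs⟩ := hS0
  obtain ⟨t, ht⟩ := hT0
  have hpre : ∀ U : Set X, U ⊆ S ∪ T → IsPreconnected U →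
      IsPreconnected (Subtype.val ⁻¹' U : Set ↥(S ∪ T)) := by
    intro U hU h
    rw [← Topology.IsInducing.subtypeVal.isPreconnected_image, Subtype.image_preimage_coe,
      inter_eq_right.2 hU]
    exact h
  rw [Nat.card_eq_two_iff]
  refine ⟨ConnectedComponents.mk ⟨s, Or.inl hs⟩, ConnectedComponents.mk ⟨t, Or.inr ht⟩, ?_, ?_⟩
  · intro h
    have hcompl : (Subtype.val ⁻¹' S : Set ↥(S ∪ T)) = (Subtype.val ⁻¹' T)ᶜ := by
      ext ⟨x, hx⟩
      constructor
      · exact fun h1 h2 => disjoint_left.1 hdis h1 h2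
      · exact fun h1 => hx.resolve_right h1
    have hclopen : IsClopen (Subtype.val ⁻¹' S : Set ↥(S ∪ T)) :=
      ⟨hS.preimage continuous_subtype_val,
        by rw [hcompl]; exact (hT.preimage continuous_subtype_val).isOpen_compl⟩
    have := hclopen.connectedComponent_subset (x := ⟨s, Or.inl hs⟩) hs
      (ConnectedComponents.coe_eq_coe'.1 h.symm)
    exact disjoint_left.1 hdis this ht
  · refine eq_univ_of_forall fun c => ?_
    obtain ⟨⟨z, hz⟩, rfl⟩ := ConnectedComponents.surjective_coe c
    rcases hz with hz | hz
    · exact Or.inl (ConnectedComponents.coe_eq_coe'.2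
        ((hpre S subset_union_left hSp).subset_connectedComponent hs hz))
    · exact Or.inr (ConnectedComponents.coe_eq_coe'.2
        ((hpre T subset_union_right hTp).subset_connectedComponent ht hz))

/-- The homotopy joins every point of `Y` by a path to the image of `X`, which is connected. -/
theorem ContinuousMap.HomotopyEquiv.preconnectedSpace {X Y : Type*} [TopologicalSpace X]
    [TopologicalSpace Y] [PreconnectedSpace X] (e : ContinuousMap.HomotopyEquiv X Y) :
    PreconnectedSpace Y := by
  obtain ⟨H⟩ := e.right_inv
  refine ⟨?_⟩
  have hmain : ∀ y : Y, ∃ U : Set Y, IsPreconnected U ∧ y ∈ U ∧ range e.toFun ⊆ U := by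
    intro y
    refine ⟨range e.toFun ∪ range (fun t : unitInterval => H (t, y)), ?_, ?_, subset_union_left⟩
    · refine (isPreconnected_range e.toFun.continuous).union (e.toFun (e.invFun y))
        ⟨_, rfl⟩ ⟨0, ?_⟩ (isPreconnected_range (by fun_prop))
      simp
    · exact Or.inr ⟨1, by simp⟩
  by_cases hX : Nonempty X
  · obtain ⟨x⟩ := hX
    refine isPreconnected_of_forall (e.toFun x) fun y _ => ?_
    obtain ⟨U, hU, hy, hr⟩ := hmain y
    exact ⟨U, subset_univ _, hr ⟨x, rfl⟩, hy, hU⟩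
  · have : IsEmpty Y := ⟨fun y => hX ⟨e.invFun y⟩⟩
    rw [univ_eq_empty_iff.2 this]
    exact isPreconnected_empty

namespace PlanarPolygon

variable {P : PlanarPolygon}

theorem connectedSpace_reebSpace (h : IsConnected P.carrier) : ConnectedSpace P.ReebSpace := by
  have := isConnected_iff_connectedSpace.1 h
  exact Quotient.mk_surjective.connectedSpace P.isQuotientMap_toReeb.continuous

/-! ### Triangles with a hole -/

section Hole

variable {A B C D E F : ℝ × ℝ}

theorem IsTriangleWithHole.offset_ne (h : P.IsTriangleWithHole A B C D E F) :
    triOffset A B C ≠ 0 := by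
  obtain ⟨-, ⟨hAB, hBC⟩, -, hsub, -⟩ := h
  intro h0
  have h1 := hsub (subset_convexHull ℝ _ (mem_insert D _))
  rw [interior_triangle_eq_empty hAB hBC h0] at h1
  exact h1

theorem vertex_mem_frontier {z : ℝ × ℝ} (hz : z ∈ P.vertices) : z ∈ frontier P.carrier :=
  P.edge_subset_frontier ⟨z, hz⟩ (P.vertex_mem_edge ⟨z, hz⟩)

/-- A degenerate hole has no interior, so nothing would be removed and `D` would be an interior
point of the polygon; but vertices lie on the frontier. -/
theorem IsTriangleWithHole.offset_ne' (h : P.IsTriangleWithHole A B C D E F) :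
    triOffset D E F ≠ 0 := by
  obtain ⟨hV, ⟨hAB, hBC⟩, ⟨hDE, hEF⟩, hsub, hK⟩ := h
  intro h0
  rw [interior_triangle_eq_empty hDE hEF h0, sdiff_empty] at hK
  have h1 := hsub (subset_convexHull ℝ _ (mem_insert D _))
  have h2 : D ∈ (P.vertices : Set (ℝ × ℝ)) := by rw [hV]; simp
  have h3 := vertex_mem_frontier (P := P) h2
  rw [hK] at h3
  exact h3.2 h1

theorem IsTriangleWithHole.outer (h : P.IsTriangleWithHole A B C D E F) :
    IsLens (convexHull ℝ {A, B, C}) C.2 A.2 (triLeft A B C) (triRight A B C) :=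
  isLens_triangle h.2.1.1 h.2.1.2 h.offset_ne

theorem IsTriangleWithHole.inner (h : P.IsTriangleWithHole A B C D E F) :
    IsLens (convexHull ℝ {D, E, F}) F.2 D.2 (triLeft D E F) (triRight D E F) :=
  isLens_triangle h.2.2.1.1 h.2.2.1.2 h.offset_ne'

theorem IsTriangleWithHole.isNConnected (h : P.IsTriangleWithHole A B C D E F) :
    P.IsNConnected 2 := by
  have hS := h.outer
  have hT := h.inner
  have h0 := h.offset_ne
  have h0' := h.offset_ne'
  obtain ⟨hV, ⟨hAB, hBC⟩, ⟨hDE, hEF⟩, hsub, hK⟩ := h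
  refine ⟨?_, card_connectedComponents_eq_two (S := frontier (convexHull ℝ {A, B, C}))
    (T := frontier (convexHull ℝ {D, E, F})) ?_ isClosed_frontier isClosed_frontier
    (isPreconnected_frontier_triangle hAB hBC h0) (isPreconnected_frontier_triangle hDE hEF h0') ?_
    ⟨A, vertices_mem_frontier_triangle hAB hBC h0 (by simp)⟩
    ⟨D, vertices_mem_frontier_triangle hDE hEF h0' (by simp)⟩⟩
  · rw [hK]
    exact hS.annulus_isConnected hT hsub
  · rw [hK]
    exact hS.annulus_frontier hT (convex_convexHull ℝ _) hsub
  · rw [disjoint_left]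
    exact fun z hz hz' => hz.2 (hsub (hT.isClosed.frontier_subset hz'))

theorem IsTriangleWithHole.card_le (h : P.IsTriangleWithHole A B C D E F) :
    P.vertices.card ≤ 6 := by
  classical
  have : P.vertices = {A, B, C, D, E, F} := by
    apply Finset.coe_injective
    rw [h.1]
    simp
  rw [this]
  exact Finset.card_le_six

end Hole

/-! ### Optimality means six vertices -/

theorem IsNConnected.exists_cycles (h : P.IsNConnected 2) : ∃ v w : P.vertices,
    ¬ P.next.SameCycle v w ∧ ∀ u, P.next.SameCycle v u ∨ P.next.SameCycle w u := by
  obtain ⟨x, y, hxy, huniv⟩ := Nat.card_eq_two_iff.1 h.2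
  obtain ⟨v, rfl⟩ := P.comp_surjective x
  obtain ⟨w, rfl⟩ := P.comp_surjective y
  refine ⟨v, w, fun hvw => hxy (P.comp_eq_iff.2 hvw), fun u => ?_⟩
  have hu : P.comp u ∈ ({P.comp v, P.comp w} : Set _) := by rw [huniv]; exact mem_univ _
  rcases hu with hu | hu
  · exact Or.inl (P.comp_eq_iff.1 hu.symm)
  · exact Or.inr (P.comp_eq_iff.1 (Eq.symm hu))

theorem IsNConnected.homotopyEquiv_circle (h : P.IsNConnected 2) :
    Nonempty (ContinuousMap.HomotopyEquiv P.ReebSpace (AddCircle (2 : ℝ))) := by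
  have := connectedSpace_reebSpace h.1
  obtain ⟨v, w, hvw, hu⟩ := h.exists_cycles
  exact P.homotopyEquiv_circle hvw hu

/-- A competitor with fewer than six vertices has a single boundary curve, hence a contractible Reeb
space, whereas the Reeb space of `P` is a circle up to homotopy. -/
theorem isOptimal_of_card_le (h : P.IsNConnected 2) (h6 : P.vertices.card ≤ 6) : P.IsOptimal := by
  rintro ⟨Q, ⟨e⟩, hcard⟩
  rw [Q.card_reebGraph, P.card_reebGraph] at hcard
  have hP := connectedSpace_reebSpace h.1
  have hQ : ConnectedSpace Q.ReebSpace :=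
    { toPreconnectedSpace := e.preconnectedSpace
      toNonempty := ⟨e.toFun (Classical.arbitrary _)⟩ }
  have hcyc : ∀ v w, Q.next.SameCycle v w := by
    by_contra! hcon
    obtain ⟨v, w, hvw⟩ := hcon
    have := Q.six_le_card hvw
    omega
  have hc := Q.contractibleSpace_of_sameCycle hcyc
  obtain ⟨e'⟩ := h.homotopyEquiv_circle
  have : ContractibleSpace (AddCircle (2 : ℝ)) := (e'.symm.trans e).contractibleSpace
  exact not_contractibleSpace_addCircle this

theorem IsTriangleWithHole.isOptimal {A B C D E F : ℝ × ℝ}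
    (h : P.IsTriangleWithHole A B C D E F) : P.IsOptimal :=
  isOptimal_of_card_le h.isNConnected h.card_le

/-- All two-connected polygons have homotopy equivalent Reeb spaces, so `Q` is a competitor and
forces `P` to have at most six vertices. -/
theorem IsNConnected.exists_isTriangleWithHole (h : P.IsNConnected 2) (hopt : P.IsOptimal)
    {Q : PlanarPolygon} (hQ : Q.IsNConnected 2) (h6 : Q.vertices.card ≤ 6) :
    ∃ A B C D E F : ℝ × ℝ, P.IsTriangleWithHole A B C D E F := by
  obtain ⟨v, w, hvw, -⟩ := h.exists_cycles
  refine P.isTriangleWithHole_of_card h.1 hvw ?_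
  by_contra hcon
  obtain ⟨e⟩ := h.homotopyEquiv_circle
  obtain ⟨e'⟩ := hQ.homotopyEquiv_circle
  refine hopt ⟨Q, ⟨e.trans e'.symm⟩, ?_⟩
  rw [Q.card_reebGraph, P.card_reebGraph]
  omega

end PlanarPolygon

/-! ### Construction of triangles with a hole -/

section Construction

theorem sides_inter {A B C : ℝ × ℝ} (hAB : B.2 < A.2) (hBC : C.2 < B.2)
    (h0 : triOffset A B C ≠ 0) :
    segment ℝ A B ∩ segment ℝ B C ⊆ {B} ∧ segment ℝ B C ∩ segment ℝ A C ⊆ {C} ∧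
      segment ℝ A B ∩ segment ℝ A C ⊆ {A} := by
  have hAC := hBC.trans hAB
  have key : ∀ z ∈ segment ℝ A B ∪ segment ℝ B C, z ∈ segment ℝ A C → z.2 = C.2 ∨ z.2 = A.2 := by
    intro z h1 h2
    rw [mem_short_sides_iff hAB hBC] at h1
    rw [mem_long_side_iff hAC] at h2
    by_contra! hcon
    have ht := (triTent_pos_iff hAB hBC).2 ⟨lt_of_le_of_ne h1.1.1 hcon.1.symm,
      lt_of_le_of_ne h1.1.2 hcon.2⟩
    have h3 := h1.2
    rw [h2.2, triBroken] at h3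
    exact mul_ne_zero h0 ht.ne' (by linarith)
  refine ⟨?_, ?_, ?_⟩
  · rintro z ⟨h1, h2⟩
    rw [mem_long_side_iff hAB] at h1
    rw [mem_long_side_iff hBC] at h2
    have h3 : z.2 = B.2 := le_antisymm h2.1.2 h1.1.1
    exact Prod.ext (by rw [h2.2, h3, lineX_left]) h3
  · rintro z ⟨h1, h2⟩
    have h3 := key z (Or.inr h1) h2
    rw [mem_long_side_iff hBC] at h1
    rw [mem_long_side_iff hAC] at h2
    have h4 : z.2 = C.2 := h3.resolve_right fun h => by linarith [h1.1.2]
    exact Prod.ext (by rw [h2.2, h4, lineX_right hAC.ne']) h4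
  · rintro z ⟨h1, h2⟩
    have h3 := key z (Or.inl h1) h2
    rw [mem_long_side_iff hAB] at h1
    rw [mem_long_side_iff hAC] at h2
    have h4 : z.2 = A.2 := h3.resolve_left fun h => by linarith [h1.1.1]
    exact Prod.ext (by rw [h2.2, h4, lineX_left]) h4

theorem sides_inter_cyclic {A B C : ℝ × ℝ} (hAB : B.2 < A.2) (hBC : C.2 < B.2)
    (h0 : triOffset A B C ≠ 0) (i j : Fin 3) (hij : i ≠ j) :
    segment ℝ (![A, B, C] i) (![A, B, C] (i + 1)) ∩
      segment ℝ (![A, B, C] j) (![A, B, C] (j + 1)) ⊆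
      {![A, B, C] i, ![A, B, C] (i + 1)} ∩ {![A, B, C] j, ![A, B, C] (j + 1)} := by
  obtain ⟨h1, h2, h3⟩ := sides_inter hAB hBC h0
  have e := segment_symm ℝ C A
  intro z hz
  fin_cases i <;> fin_cases j <;>
    simp [e] at hij hz ⊢
  · exact ⟨Or.inr (h1 hz), Or.inl (h1 hz)⟩
  · exact ⟨Or.inl (h3 hz), Or.inr (h3 hz)⟩
  · exact ⟨Or.inl (h1 hz.symm), Or.inr (h1 hz.symm)⟩
  · exact ⟨Or.inr (h2 hz), Or.inl (h2 hz)⟩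
  · exact ⟨Or.inr (h3 hz.symm), Or.inl (h3 hz.symm)⟩
  · exact ⟨Or.inl (h2 hz.symm), Or.inr (h2 hz.symm)⟩

variable (A B C D E F : ℝ × ℝ)

/-- The vertices of two triangles. -/
def twoTriangles (i : Fin 2 × Fin 3) : ℝ × ℝ :=
  if i.1 = 0 then ![A, B, C] i.2 else ![D, E, F] i.2

/-- The cyclic order of the vertices of two triangles. -/
def twoTrianglesSucc : Equiv.Perm (Fin 2 × Fin 3) :=
  Equiv.prodCongr (Equiv.refl _) (Equiv.addRight 1)

variable {A B C D E F}

theorem sides_eq (A B C : ℝ × ℝ) : (⋃ i : Fin 3, segment ℝ (![A, B, C] i) (![A, B, C] (i + 1))) =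
    segment ℝ A B ∪ segment ℝ B C ∪ segment ℝ A C := by
  ext z
  rw [mem_iUnion, Fin.exists_fin_succ, Fin.exists_fin_two, segment_symm ℝ A C, mem_union, mem_union,
    or_assoc]
  rfl

theorem twoTriangles_sides : (⋃ i, segment ℝ (twoTriangles A B C D E F i)
    (twoTriangles A B C D E F (twoTrianglesSucc i))) =
    (segment ℝ A B ∪ segment ℝ B C ∪ segment ℝ A C) ∪
      (segment ℝ D E ∪ segment ℝ E F ∪ segment ℝ D F) := by
  rw [← sides_eq A B C, ← sides_eq D E F]
  ext z
  rw [mem_iUnion, Prod.exists, Fin.exists_fin_two, mem_union, mem_iUnion, mem_iUnion]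
  rfl

theorem exists_isTriangleWithHole (hAB : B.2 < A.2) (hBC : C.2 < B.2) (hDE : E.2 < D.2)
    (hEF : F.2 < E.2) (h0 : triOffset A B C ≠ 0) (h0' : triOffset D E F ≠ 0)
    (hsub : ({D, E, F} : Set (ℝ × ℝ)) ⊆ interior (convexHull ℝ {A, B, C}))
    (hB : B.2 ≠ D.2 ∧ B.2 ≠ E.2 ∧ B.2 ≠ F.2) :
    ∃ P : PlanarPolygon, P.IsTriangleWithHole A B C D E F := by
  classical
  have hS := isLens_triangle hAB hBC h0
  have hT := isLens_triangle hDE hEF h0'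
  have hSc := convex_convexHull ℝ ({A, B, C} : Set (ℝ × ℝ))
  have hTc := convex_convexHull ℝ ({D, E, F} : Set (ℝ × ℝ))
  have hsub' : convexHull ℝ {D, E, F} ⊆ interior (convexHull ℝ {A, B, C}) :=
    convexHull_min hsub hSc.interior
  set p := twoTriangles A B C D E F with hp
  -- The hole lies strictly between the heights of `A` and `C`, so only `B` could have the height of
  -- a vertex of the hole; `hB` excludes this.
  have hheight : Function.Injective fun i => (p i).2 := by
    have hD := ((hS.mem_interior_iff D).1 (hsub (by simp))).1
    have hF := ((hS.mem_interior_iff F).1 (hsub (by simp))).1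
    obtain ⟨b1, b2, b3⟩ := hB
    rintro ⟨i, j⟩ ⟨i', j'⟩ h
    fin_cases i <;> fin_cases j <;> fin_cases i' <;> fin_cases j' <;>
      first
        | rfl
        | (exfalso
           simp [hp, twoTriangles] at h
           first
             | linarith
             | exact b1 h
             | exact b2 h
             | exact b3 h
             | exact b1 h.symm
             | exact b2 h.symm
             | exact b3 h.symm)
  have hinj : Function.Injective p := fun i j h => hheight (congrArg Prod.snd h)
  set V : Finset (ℝ × ℝ) := Finset.univ.image p with hV
  set e : Fin 2 × Fin 3 ≃ V := Equiv.ofBijective (fun i => ⟨p i, Finset.mem_image_of_mem p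
    (Finset.mem_univ i)⟩) ⟨fun i j h => hinj (congrArg Subtype.val h), fun ⟨v, hv⟩ => by
      obtain ⟨i, -, hi⟩ := Finset.mem_image.1 hv
      exact ⟨i, Subtype.ext hi⟩⟩ with he
  have hval : ∀ i, (e i : ℝ × ℝ) = p i := fun i => rfl
  have hnext : ∀ i, e.permCongr twoTrianglesSucc (e i) = e (twoTrianglesSucc i) := fun i => by simp
  have hfr : frontier (convexHull ℝ {A, B, C} \ interior (convexHull ℝ {D, E, F})) =
      ⋃ i, segment ℝ (p i) (p (twoTrianglesSucc i)) := by
    rw [hS.annulus_frontier hT hTc hsub', frontier_triangle hAB hBC h0,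
      frontier_triangle hDE hEF h0', twoTriangles_sides]
  have hside : ∀ i, (i.1 = 0 → segment ℝ (p i) (p (twoTrianglesSucc i)) ⊆
      frontier (convexHull ℝ {A, B, C})) ∧ (i.1 ≠ 0 → segment ℝ (p i) (p (twoTrianglesSucc i)) ⊆
      frontier (convexHull ℝ {D, E, F})) := by
    rintro ⟨i, j⟩
    rw [frontier_triangle hAB hBC h0, frontier_triangle hDE hEF h0', ← sides_eq A B C,
      ← sides_eq D E F]
    constructor
    · rintro rfl
      exact subset_iUnion (fun i : Fin 3 => segment ℝ (![A, B, C] i) (![A, B, C] (i + 1))) j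
    · intro hi
      have : p (i, j) = ![D, E, F] j ∧ p (twoTrianglesSucc (i, j)) = ![D, E, F] (j + 1) :=
        ⟨if_neg hi, if_neg hi⟩
      rw [this.1, this.2]
      exact subset_iUnion (fun i : Fin 3 => segment ℝ (![D, E, F] i) (![D, E, F] (i + 1))) j
  have hdis : ∀ z, z ∈ frontier (convexHull ℝ {A, B, C}) →
      z ∉ frontier (convexHull ℝ {D, E, F}) := fun z h1 h2 =>
    h1.2 (hsub' (hT.isClosed.frontier_subset h2))
  have hinter : ∀ i j, i ≠ j → segment ℝ (p i) (p (twoTrianglesSucc i)) ∩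
      segment ℝ (p j) (p (twoTrianglesSucc j)) ⊆
      {p i, p (twoTrianglesSucc i)} ∩ {p j, p (twoTrianglesSucc j)} := by
    rintro ⟨i, j⟩ ⟨i', j'⟩ hij z hz
    by_cases h1 : i = 0 <;> by_cases h2 : i' = 0
    · subst h1 h2
      exact sides_inter_cyclic hAB hBC h0 j j' (fun h => hij (by rw [h])) hz
    · exact absurd ((hside _).2 h2 hz.2) (hdis z ((hside _).1 h1 hz.1))
    · exact absurd ((hside _).2 h1 hz.1) (hdis z ((hside _).1 h2 hz.2))
    · have h3 : i = 1 := by omega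
      have h4 : i' = 1 := by omega
      subst h3 h4
      exact sides_inter_cyclic hDE hEF h0' j j' (fun h => hij (by rw [h])) hz
  refine ⟨{ carrier := convexHull ℝ {A, B, C} \ interior (convexHull ℝ {D, E, F})
            vertices := V
            next := e.permCongr twoTrianglesSucc
            nonempty := (hS.annulus_isConnected hT hsub').nonempty
            isCompact := IsCompact.diff ((toFinite _).isCompact_convexHull (𝕜 := ℝ)) isOpen_interior
            closure_interior := hS.annulus_closure_interior hT hSc hTc hsub'
            frontier_eq := ?_
            next_ne := ?_
            edge_inter := ?_
            height_injOn := ?_ }, ?_, ⟨hAB, hBC⟩, ⟨hDE, hEF⟩, hsub', rfl⟩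
  · rw [hfr, ← e.surjective.iUnion_comp]
    simp only [hnext, hval]
  · intro v
    obtain ⟨⟨i, j⟩, rfl⟩ := e.surjective v
    rw [hnext]
    intro h
    have := congrArg Prod.snd (e.injective h)
    have h2 : j + 1 = j := this
    omega
  · intro v w hvw
    obtain ⟨i, rfl⟩ := e.surjective v
    obtain ⟨j, rfl⟩ := e.surjective w
    rw [hnext, hnext, hval, hval, hval, hval]
    exact hinter i j fun h => hvw (by rw [h])
  · intro v hv w hw h
    obtain ⟨i, -, rfl⟩ := Finset.mem_image.1 hv
    obtain ⟨j, -, rfl⟩ := Finset.mem_image.1 hw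
    rw [hheight h]
  · ext z
    simp only [hV, Finset.coe_image, Finset.coe_univ, image_univ, mem_range, Prod.exists,
      Fin.exists_fin_succ, hp, twoTriangles]
    simp [eq_comm, or_assoc]

/-- A family of triangles with a hole. -/
theorem exists_example {b x : ℝ} (hb : -5 < b ∧ b < 5) (hb' : b ≠ 3 ∧ b ≠ 0 ∧ b ≠ -3)
    (hx : 0 < x ∧ x < 20) (hx' : x ≠ 10) : ∃ P : PlanarPolygon,
      P.IsTriangleWithHole (0, 100) (100, b) (0, -100) (10, 3) (x, 0) (10, -3) := by
  have o1 : triOffset (0, 100) (100, b) (0, -100) = 100 := by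
    simp [triOffset, lineX]
  have o2 : triOffset (10, 3) (x, 0) (10, -3) = x - 10 := by
    simp [triOffset, lineX]
  have h0 : triOffset (0, 100) (100, b) (0, -100) ≠ 0 := by rw [o1]; norm_num
  have hAB : ((100 : ℝ), b).2 < ((0 : ℝ), (100 : ℝ)).2 := by dsimp only; linarith
  have hBC : ((0 : ℝ), (-100 : ℝ)).2 < ((100 : ℝ), b).2 := by dsimp only; linarith
  refine exists_isTriangleWithHole hAB hBC (by norm_num) (by norm_num) h0
    (by rw [o2]; exact sub_ne_zero.2 hx') ?_ ⟨hb'.1, hb'.2.1, hb'.2.2⟩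
  -- The hole lies in a small rectangle that belongs to all outer triangles of the family. This
  -- leaves `b` free to choose the position of `B` among the heights of the hole and `x` free to
  -- choose the side of `E`.
  have key : ∀ u v : ℝ, 0 < u → u < 20 → -5 < v → v < 5 →
      ((u, v) : ℝ × ℝ) ∈ interior (convexHull ℝ {((0, 100) : ℝ × ℝ), (100, b), (0, -100)}) := by
    intro u v h1 h2 h3 h4
    rw [(isLens_triangle hAB hBC h0).mem_interior_iff]
    refine ⟨⟨by dsimp only; linarith, by dsimp only; linarith⟩, ?_, ?_⟩
    · refine (min_le_left _ _).trans_lt ?_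
      simpa [lineX] using h1
    · refine lt_of_lt_of_le ?_ (le_max_right _ _)
      unfold triBroken
      rw [o1]
      -- At these heights the relative width exceeds `95 / 105`, while `u / 100` is less than `1 /
      -- 5`.
      have : u / 100 < triTent (0, 100) (100, b) (0, -100) v := by
        have p1 : 0 < b - -100 := by linarith
        have p2 : 0 < 100 - b := by linarith
        refine lt_min ?_ ?_
        · rw [div_lt_div_iff₀ (by norm_num) p1]; nlinarith
        · rw [div_lt_div_iff₀ (by norm_num) p2]; nlinarith
      have hl : lineX (0, 100) (0, -100) v = 0 := by simp [lineX]
      dsimp only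
      rw [hl]
      linarith
  rintro z (rfl | rfl | rfl)
  · exact key _ _ (by norm_num) (by norm_num) (by norm_num) (by norm_num)
  · exact key _ _ hx.1 hx.2 (by norm_num) (by norm_num)
  · exact key _ _ (by norm_num) (by norm_num) (by norm_num) (by norm_num)

end Construction

/-! ### Spaces covered by arcs that are monotone for a height function -/

/-- A space with a height function covered by arcs parametrized by the height, whose interiors
are disjoint from the other arcs. -/
structure ArcSystem {X : Type*} [TopologicalSpace X] {ι : Type*} (h : X → ℝ) (γ : ι → ℝ → X)
    (lo hi : ι → ℝ) : Prop where
  lt : ∀ j, lo j < hi j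
  cont : ∀ j, ContinuousOn (γ j) (Icc (lo j) (hi j))
  height : ∀ j, ∀ y ∈ Icc (lo j) (hi j), h (γ j y) = y
  cover : ∀ q, ∃ j, ∃ y ∈ Icc (lo j) (hi j), γ j y = q
  disj : ∀ j k, j ≠ k → ∀ y ∈ Ioo (lo j) (hi j), y ∈ Icc (lo k) (hi k) → γ j y ≠ γ k y

namespace ArcSystem

variable {X : Type*} [TopologicalSpace X] [T2Space X] {ι : Type*} [Finite ι] {h : X → ℝ}
  {γ : ι → ℝ → X} {lo hi : ι → ℝ}

set_option linter.unusedSectionVars false in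
theorem height_eq (H : ArcSystem h γ lo hi) {j k : ι} {y y' : ℝ} (hy : y ∈ Icc (lo j) (hi j))
    (hy' : y' ∈ Icc (lo k) (hi k)) (heq : γ j y = γ k y') : y = y' := by
  rw [← H.height j y hy, heq, H.height k y' hy']

/-- The complement is a finite union of compact sets: the other arcs, which miss the inside of the
arc `j`, and the rest of the arc `j`. -/
theorem isOpen_image (H : ArcSystem h γ lo hi) {j : ι} {u v : ℝ} (hu : lo j ≤ u) (hv : v ≤ hi j) :
    IsOpen (γ j '' Ioo u v) := by
  classical
  have hsubI : ∀ y ∈ Ioo u v, y ∈ Ioo (lo j) (hi j) := fun y hy =>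
    ⟨hu.trans_lt hy.1, hy.2.trans_le hv⟩
  have hcompl : (γ j '' Ioo u v)ᶜ = (⋃ k ∈ {k | k ≠ j}, γ k '' Icc (lo k) (hi k)) ∪
      γ j '' (Icc (lo j) (hi j) ∩ (Iic u ∪ Ici v)) := by
    ext q
    constructor
    · intro hq
      obtain ⟨k, y, hy, rfl⟩ := H.cover q
      by_cases hk : k = j
      · subst hk
        refine Or.inr ⟨y, ⟨hy, ?_⟩, rfl⟩
        by_contra hcon
        rw [mem_union, not_or, mem_Iic, mem_Ici, not_le, not_le] at hcon
        exact hq ⟨y, hcon, rfl⟩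
      · exact Or.inl (mem_biUnion (show k ∈ {k | k ≠ j} from hk) ⟨y, hy, rfl⟩)
    · rintro hq ⟨y, hy, rfl⟩
      have hyI := Ioo_subset_Icc_self (hsubI y hy)
      rcases hq with hq | ⟨y', ⟨hy', hy''⟩, heq⟩
      · rw [mem_iUnion₂] at hq
        obtain ⟨k, hk, y', hy', heq⟩ := hq
        have := H.height_eq hy' hyI heq
        subst this
        exact H.disj j k (Ne.symm hk) y' (hsubI y' hy) hy' heq.symm
      · have := H.height_eq hy' hyI heq
        subst this
        rcases hy'' with h1 | h1
        · exact absurd hy.1 (not_lt.2 h1)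
        · exact absurd hy.2 (not_lt.2 h1)
  rw [← isClosed_compl_iff, hcompl]
  refine IsClosed.union ((toFinite _).isClosed_biUnion fun k _ =>
    (isCompact_Icc.image_of_continuousOn (H.cont k)).isClosed) ?_
  refine IsCompact.isClosed (IsCompact.image_of_continuousOn ?_ ((H.cont j).mono inter_subset_left))
  exact isCompact_Icc.inter_right (isClosed_Iic.union isClosed_Ici)

set_option linter.unusedSectionVars false in
theorem closure_image_subset (H : ArcSystem h γ lo hi) {j : ι} {u v : ℝ} (hu : lo j ≤ u)
    (hv : v ≤ hi j) : closure (γ j '' Ioo u v) ⊆ γ j '' Icc u v :=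
  closure_minimal (image_mono Ioo_subset_Icc_self)
    (isCompact_Icc.image_of_continuousOn ((H.cont j).mono (Icc_subset_Icc hu hv))).isClosed

set_option linter.unusedSectionVars false in
theorem mem_closure_image (H : ArcSystem h γ lo hi) {j : ι} {u v y : ℝ} (hu : lo j ≤ u)
    (hv : v ≤ hi j) (huv : u < v) (hy : y ∈ Icc u v) : γ j y ∈ closure (γ j '' Ioo u v) := by
  have h1 : ContinuousWithinAt (γ j) (Ioo u v) y :=
    ((H.cont j) y (Icc_subset_Icc hu hv hy)).mono
      (Ioo_subset_Icc_self.trans (Icc_subset_Icc hu hv))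
  refine h1.mem_closure_image ?_
  rw [closure_Ioo huv.ne]
  exact hy

/-- The piece is connected and open. Its closure adds only its two ends, which are vertices, so the
piece is also closed in the complement of the vertices. -/
theorem component_eq (H : ArcSystem h γ lo hi) {V : Set X} {j : ι} {u v : ℝ} (hu : lo j ≤ u)
    (hv : v ≤ hi j) (hVu : γ j u ∈ V) (hVv : γ j v ∈ V) (hV : ∀ y ∈ Ioo u v, γ j y ∉ V) {q : X}
    (hq : q ∈ γ j '' Ioo u v) : connectedComponentIn Vᶜ q = γ j '' Ioo u v := by
  have hsub : γ j '' Ioo u v ⊆ Vᶜ := by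
    rintro _ ⟨y, hy, rfl⟩
    exact hV y hy
  have hpre : IsPreconnected (γ j '' Ioo u v) :=
    isPreconnected_Ioo.image _ ((H.cont j).mono
      (Ioo_subset_Icc_self.trans (Icc_subset_Icc hu hv)))
  refine Subset.antisymm ?_ (hpre.subset_connectedComponentIn hq hsub)
  have hcl : closure (γ j '' Ioo u v) ∩ Vᶜ ⊆ γ j '' Ioo u v := by
    rintro x ⟨hx, hxV⟩
    obtain ⟨y, hy, rfl⟩ := H.closure_image_subset hu hv hx
    refine ⟨y, ⟨lt_of_le_of_ne hy.1 ?_, lt_of_le_of_ne hy.2 ?_⟩, rfl⟩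
    · rintro rfl; exact hxV hVu
    · rintro rfl; exact hxV hVv
  refine isPreconnected_connectedComponentIn.subset_left_of_subset_union (H.isOpen_image hu hv)
    isClosed_closure.isOpen_compl (disjoint_compl_right.mono_left subset_closure) (fun x hx => ?_)
    ⟨q, mem_connectedComponentIn (hsub hq), hq⟩
  by_cases hxc : x ∈ closure (γ j '' Ioo u v)
  · exact Or.inl (hcl ⟨hxc, connectedComponentIn_subset _ _ hx⟩)
  · exact Or.inr hxc

/-- The point `q` lies on the arc `j`. -/
def On (h : X → ℝ) (γ : ι → ℝ → X) (lo hi : ι → ℝ) (j : ι) (q : X) : Prop :=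
  h q ∈ Icc (lo j) (hi j) ∧ γ j (h q) = q

/-- On an arc through `q` one takes the last vertex below `q` and the first one above it; both exist
because the ends of the arc are vertices. -/
theorem exists_component (H : ArcSystem h γ lo hi) {V : Set X} (hVf : V.Finite)
    (hlo : ∀ j, γ j (lo j) ∈ V) (hhi : ∀ j, γ j (hi j) ∈ V) {q : X} (hq : q ∉ V) :
    ∃ j u v, lo j ≤ u ∧ v ≤ hi j ∧ u < v ∧ γ j u ∈ V ∧ γ j v ∈ V ∧ (∀ y ∈ Ioo u v, γ j y ∉ V) ∧
      connectedComponentIn Vᶜ q = γ j '' Ioo u v := by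
  obtain ⟨j, y, hy, rfl⟩ := H.cover q
  have hpre : {y | y ∈ Icc (lo j) (hi j) ∧ γ j y ∈ V}.Finite := by
    refine (hVf.image h).subset ?_
    rintro y ⟨hy, hyV⟩
    exact ⟨_, hyV, H.height j y hy⟩
  obtain ⟨u, ⟨⟨hu, huV⟩, huy⟩, humax⟩ :=
    (hpre.inter_of_left (Iic y)).exists_maximalFor id _
      ⟨lo j, ⟨⟨le_rfl, (H.lt j).le⟩, hlo j⟩, hy.1⟩
  obtain ⟨v, ⟨⟨hv, hvV⟩, hvy⟩, hvmin⟩ :=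
    (hpre.inter_of_left (Ici y)).exists_minimalFor id _
      ⟨hi j, ⟨⟨(H.lt j).le, le_rfl⟩, hhi j⟩, hy.2⟩
  have huy' : u < y := lt_of_le_of_ne huy (by rintro rfl; exact hq huV)
  have hvy' : y < v := lt_of_le_of_ne hvy (by rintro rfl; exact hq hvV)
  have hV : ∀ y' ∈ Ioo u v, γ j y' ∉ V := by
    intro y' hy' hyV
    have hI : y' ∈ Icc (lo j) (hi j) := ⟨hu.1.trans hy'.1.le, hy'.2.le.trans hv.2⟩
    rcases le_total y' y with h1 | h1
    · have : y' ≤ u := humax ⟨⟨hI, hyV⟩, h1⟩ hy'.1.le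
      exact absurd hy'.1 (not_lt.2 this)
    · have : v ≤ y' := hvmin ⟨⟨hI, hyV⟩, h1⟩ hy'.2.le
      exact absurd hy'.2 (not_lt.2 this)
  exact ⟨j, u, v, hu.1, hv.2, huy'.trans hvy', huV, hvV, hV,
    H.component_eq hu.1 hv.2 huV hvV hV ⟨y, ⟨huy', hvy'⟩, rfl⟩⟩

/-- The edges between two vertices correspond to the arcs on which the vertices are consecutive. -/
theorem nonempty_edgeEquiv (H : ArcSystem h γ lo hi) {V : Set X} (hVf : V.Finite)
    (hlo : ∀ j, γ j (lo j) ∈ V) (hhi : ∀ j, γ j (hi j) ∈ V) {p q : X} (hp : p ∈ V) (hq : q ∈ V) :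
    Nonempty ({e : Set X // (∃ x ∈ Vᶜ, e = connectedComponentIn Vᶜ x) ∧
      (p ∈ closure e ∧ ∀ x ∈ e, h p < h x) ∧ (q ∈ closure e ∧ ∀ x ∈ e, h x < h q)} ≃
      {j : ι // On h γ lo hi j p ∧ On h γ lo hi j q ∧ h p < h q ∧
        ∀ w ∈ V, On h γ lo hi j w → h p < h w → h q ≤ h w}) := by
  refine Nonempty.map Equiv.symm ?_
  have hno : ∀ j, On h γ lo hi j p → On h γ lo hi j q →
      (∀ w ∈ V, On h γ lo hi j w → h p < h w → h q ≤ h w) → ∀ y ∈ Ioo (h p) (h q), γ j y ∉ V := by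
    intro j hjp hjq hw y hy hyV
    have hI : y ∈ Icc (lo j) (hi j) := ⟨hjp.1.1.trans hy.1.le, hy.2.le.trans hjq.1.2⟩
    have h1 := hw _ hyV (by unfold On; rw [H.height j y hI]; exact ⟨hI, rfl⟩)
    rw [H.height j y hI] at h1
    exact absurd hy.2 (not_lt.2 (h1 hy.1))
  have hhgt : ∀ j, On h γ lo hi j p → On h γ lo hi j q → ∀ x ∈ γ j '' Ioo (h p) (h q),
      h p < h x ∧ h x < h q := by
    rintro j hjp hjq _ ⟨y, hy, rfl⟩
    rw [H.height j y ⟨hjp.1.1.trans hy.1.le, hy.2.le.trans hjq.1.2⟩]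
    exact hy
  -- An arc on which `p` and `q` are consecutive is sent to its open piece between them; different
  -- arcs have disjoint open pieces.
  refine ⟨Equiv.ofBijective (fun j => ⟨γ j.1 '' Ioo (h p) (h q), ?_, ⟨?_, ?_⟩, ?_, ?_⟩) ⟨?_, ?_⟩⟩
  · obtain ⟨j, hjp, hjq, hlt, hw⟩ := j
    obtain ⟨y, hy⟩ := exists_between hlt
    have hV := hno j hjp hjq hw
    exact ⟨γ j y, hV y hy, (H.component_eq hjp.1.1 hjq.1.2 (by rw [hjp.2]; exact hp)
      (by rw [hjq.2]; exact hq) hV ⟨y, hy, rfl⟩).symm⟩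
  · obtain ⟨j, hjp, hjq, hlt, hw⟩ := j
    have := H.mem_closure_image hjp.1.1 hjq.1.2 hlt (left_mem_Icc.2 hlt.le)
    rwa [hjp.2] at this
  · exact fun x hx => (hhgt j.1 j.2.1 j.2.2.1 x hx).1
  · obtain ⟨j, hjp, hjq, hlt, hw⟩ := j
    have := H.mem_closure_image hjp.1.1 hjq.1.2 hlt (right_mem_Icc.2 hlt.le)
    rwa [hjq.2] at this
  · exact fun x hx => (hhgt j.1 j.2.1 j.2.2.1 x hx).2
  · rintro ⟨j, hjp, hjq, hlt, hw⟩ ⟨k, hkp, hkq, _, _⟩ hjk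
    have hjk' : γ j '' Ioo (h p) (h q) = γ k '' Ioo (h p) (h q) := congrArg Subtype.val hjk
    apply Subtype.ext
    by_contra hne
    obtain ⟨y, hy⟩ := exists_between hlt
    have hyj : y ∈ Ioo (lo j) (hi j) := ⟨hjp.1.1.trans_lt hy.1, hy.2.trans_le hjq.1.2⟩
    have hmem : γ j y ∈ γ k '' Ioo (h p) (h q) := by
      rw [← hjk']; exact ⟨y, hy, rfl⟩
    obtain ⟨y', hy', heq⟩ := hmem
    have hyk : y' ∈ Icc (lo k) (hi k) := ⟨hkp.1.1.trans hy'.1.le, hy'.2.le.trans hkq.1.2⟩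
    have := H.height_eq hyk (Ioo_subset_Icc_self hyj) heq
    subst this
    exact H.disj j k hne y' hyj hyk heq.symm
  -- Conversely a component is an open piece of some arc. Since `p` and `q` lie in its closure,
  -- below and above all of its points, they are its ends.
  · rintro ⟨e, ⟨x, hx, rfl⟩, ⟨hpc, hpl⟩, hqc, hql⟩
    obtain ⟨j, u, v, hu, hv, huv, huV, hvV, hV, heq⟩ := H.exists_component hVf hlo hhi hx
    rw [heq] at hpc hpl hqc hql
    obtain ⟨y, hy, hyp⟩ := H.closure_image_subset hu hv hpc
    obtain ⟨y', hy', hyq⟩ := H.closure_image_subset hu hv hqc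
    have hyI : ∀ z ∈ Icc u v, z ∈ Icc (lo j) (hi j) := fun z hz => Icc_subset_Icc hu hv hz
    have hhp : h p = u := by
      rw [← hyp, H.height j y (hyI y hy)]
      refine le_antisymm (not_lt.1 fun hlt => ?_) hy.1
      obtain ⟨z, hz1, hz2⟩ := exists_between hlt
      have := hpl (γ j z) ⟨z, ⟨hz1, hz2.trans_le hy.2⟩, rfl⟩
      rw [← hyp, H.height j y (hyI y hy), H.height j z (hyI z ⟨hz1.le, hz2.le.trans hy.2⟩)] at this
      linarith
    have hhq : h q = v := by
      rw [← hyq, H.height j y' (hyI y' hy')]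
      refine le_antisymm hy'.2 (not_lt.1 fun hlt => ?_)
      obtain ⟨z, hz1, hz2⟩ := exists_between hlt
      have := hql (γ j z) ⟨z, ⟨hy'.1.trans_lt hz1, hz2⟩, rfl⟩
      rw [← hyq, H.height j y' (hyI y' hy'), H.height j z (hyI z ⟨hy'.1.trans hz1.le, hz2.le⟩)]
        at this
      linarith
    have hyu : y = u := by rw [← hhp, ← hyp, H.height j y (hyI y hy)]
    have hyv : y' = v := by rw [← hhq, ← hyq, H.height j y' (hyI y' hy')]
    refine ⟨⟨j, ⟨?_, ?_⟩, ⟨?_, ?_⟩, ?_, ?_⟩, ?_⟩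
    · rw [hhp]; exact hyI u ⟨le_rfl, huv.le⟩
    · rw [hhp, ← hyu, hyp]
    · rw [hhq]; exact hyI v ⟨huv.le, le_rfl⟩
    · rw [hhq, ← hyv, hyq]
    · rw [hhp, hhq]; exact huv
    · intro w hw hwj hlt
      rw [hhq]
      by_contra! hcon
      refine hV (h w) ⟨by rw [← hhp]; exact hlt, hcon⟩ ?_
      rw [hwj.2]; exact hw
    · apply Subtype.ext
      dsimp only
      rw [hhp, hhq, heq]

end ArcSystem

/-! ### The Reeb graph of a region with a hole -/

/-- The lower ends of the four arcs: below, left of, right of and above the hole. -/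
def arcLo (a c d : ℝ) : Fin 4 → ℝ := ![a, c, c, d]

/-- The upper ends of the four arcs. -/
def arcHi (b c d : ℝ) : Fin 4 → ℝ := ![c, d, d, b]

/-- The abscissas of the outer boundary points by which the four arcs are described. -/
def arcX (l r : ℝ → ℝ) : Fin 4 → ℝ → ℝ := ![l, l, r, l]

namespace PlanarPolygon

/-- The four arcs of the Reeb graph of a region with a hole. -/
noncomputable def holeArc (P : PlanarPolygon) (l r : ℝ → ℝ) (j : Fin 4) (y : ℝ) : P.ReebSpace :=
  P.reebMk (arcX l r j y, y)

/-- The polygon is a region between two graphs with a hole of the same kind. -/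
structure IsHoled (P : PlanarPolygon) (S T : Set (ℝ × ℝ)) (a b c d : ℝ) (l r l' r' : ℝ → ℝ) :
    Prop where
  outer : IsLens S a b l r
  inner : IsLens T c d l' r'
  sub : T ⊆ interior S
  carrier_eq : P.carrier = S \ interior T

section

variable {P : PlanarPolygon} {S T : Set (ℝ × ℝ)} {a b c d : ℝ} {l r l' r' : ℝ → ℝ}

theorem mem_carrier_iff_of_hole (H : P.IsHoled S T a b c d l r l' r')
    {x y : ℝ} : (x, y) ∈ P.carrier ↔
    ((a ≤ y ∧ y ≤ b) ∧ l y ≤ x ∧ x ≤ r y) ∧ (c < y → y < d → x ≤ l' y ∨ r' y ≤ x) := by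
  rw [H.carrier_eq, Set.mem_sdiff, H.outer.mem_iff, H.inner.mem_interior_iff]
  dsimp only
  refine and_congr_right fun _ => ?_
  constructor
  · intro h h1 h2
    by_contra! hcon
    exact h ⟨⟨h1, h2⟩, hcon⟩
  · rintro h ⟨⟨h1, h2⟩, h3, h4⟩
    rcases h h1 h2 with h5 | h5 <;> linarith

theorem reebMk_left_eq (H : P.IsHoled S T a b c d l r l' r')
    {x y : ℝ} (hp : (x, y) ∈ P.carrier) (h : c < y → y < d → x ≤ l' y) :
    P.reebMk (l y, y) = P.reebMk (x, y) := by
  have hp' := (mem_carrier_iff_of_hole H).1 hp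
  refine P.reebMk_eq_of_horizontal rfl (fun x' h1 h2 => ?_) hp'.1.2.1
  dsimp only at h1 h2 ⊢
  rw [mem_carrier_iff_of_hole H]
  exact ⟨⟨hp'.1.1, h1, h2.trans hp'.1.2.2⟩, fun h3 h4 => Or.inl (h2.trans (h h3 h4))⟩

theorem reebMk_right_eq (H : P.IsHoled S T a b c d l r l' r')
    {x y : ℝ} (hp : (x, y) ∈ P.carrier) (h : c < y → y < d → r' y ≤ x) :
    P.reebMk (r y, y) = P.reebMk (x, y) := by
  have hp' := (mem_carrier_iff_of_hole H).1 hp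
  symm
  refine P.reebMk_eq_of_horizontal rfl (fun x' h1 h2 => ?_) hp'.1.2.2
  dsimp only at h1 h2 ⊢
  rw [mem_carrier_iff_of_hole H]
  exact ⟨⟨hp'.1.1, hp'.1.2.1.trans h1, h2⟩, fun h3 h4 => Or.inr ((h h3 h4).trans h1)⟩

theorem left_mem_carrier (H : P.IsHoled S T a b c d l r l' r')
    {y : ℝ} (h1 : a ≤ y) (h2 : y ≤ b) : (l y, y) ∈ P.carrier := by
  rw [mem_carrier_iff_of_hole H]
  exact ⟨⟨⟨h1, h2⟩, le_rfl, H.outer.le h1 h2⟩,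
    fun h3 h4 => Or.inl (H.outer.hole_bounds H.inner H.sub ⟨h3.le, h4.le⟩).2.1.le⟩

theorem right_mem_carrier (H : P.IsHoled S T a b c d l r l' r')
    {y : ℝ} (h1 : a ≤ y) (h2 : y ≤ b) : (r y, y) ∈ P.carrier := by
  rw [mem_carrier_iff_of_hole H]
  exact ⟨⟨⟨h1, h2⟩, H.outer.le h1 h2, le_rfl⟩,
    fun h3 h4 => Or.inr (H.outer.hole_bounds H.inner H.sub ⟨h3.le, h4.le⟩).2.2.le⟩

/-- The fiber joining the two outer boundary points would contain the middle of the section of the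
hole. -/
theorem left_ne_right (H : P.IsHoled S T a b c d l r l' r') {y : ℝ} (h1 : c < y) (h2 : y < d) :
    P.reebMk (l y, y) ≠ P.reebMk (r y, y) := by
  intro h
  have hb := H.outer.hole_bounds H.inner H.sub ⟨h1.le, h2.le⟩
  have hlt := H.inner.left_lt_right y ⟨h1, h2⟩
  have hm := P.mem_of_reebMk_eq (left_mem_carrier H hb.1.1.le hb.1.2.le)
    (right_mem_carrier H hb.1.1.le hb.1.2.le) h ((l' y + r' y) / 2)
    (by dsimp only; linarith) (by dsimp only; linarith)
  have := ((mem_carrier_iff_of_hole H).1 hm).2 h1 h2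
  rcases this with h | h <;> linarith

theorem hole_heights (H : P.IsHoled S T a b c d l r l' r') : a < c ∧ c < d ∧ d < b :=
  ⟨(H.outer.hole_bounds H.inner H.sub ⟨le_rfl, H.inner.lt.le⟩).1.1, H.inner.lt,
    (H.outer.hole_bounds H.inner H.sub ⟨H.inner.lt.le, le_rfl⟩).1.2⟩

theorem arcX_mem (H : P.IsHoled S T a b c d l r l' r')
    {j : Fin 4} {y : ℝ} (hy : y ∈ Icc (arcLo a c d j) (arcHi b c d j)) :
    (arcX l r j y, y) ∈ P.carrier := by
  obtain ⟨h1, h2, h3⟩ := hole_heights H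
  fin_cases j <;> simp only [arcLo, arcHi] at hy
  · exact left_mem_carrier H hy.1 (hy.2.trans (by simp; linarith))
  · exact left_mem_carrier H (le_trans (by simp; linarith) hy.1)
      (hy.2.trans (by simp; linarith))
  · exact right_mem_carrier H (le_trans (by simp; linarith) hy.1)
      (hy.2.trans (by simp; linarith))
  · exact left_mem_carrier H (le_trans (by simp; linarith) hy.1) hy.2

/-- Below and above the hole the section of the polygon is one segment, represented by its left end.
Beside the hole there are two segments, represented by the left and the right outer boundary point.
-/
theorem arcSystem_hole (H : P.IsHoled S T a b c d l r l' r') :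
    ArcSystem P.reebHeight (P.holeArc l r) (arcLo a c d) (arcHi b c d) := by
  obtain ⟨h1, h2, h3⟩ := hole_heights H
  constructor
  · intro j
    fin_cases j
    exacts [h1, h2, h2, h3]
  · intro j
    refine P.continuousOn_reebMk.comp (ContinuousOn.prodMk ?_ continuousOn_id) fun y hy =>
      arcX_mem H hy
    fin_cases j
    exacts [H.outer.continuous_left.continuousOn, H.outer.continuous_left.continuousOn,
      H.outer.continuous_right.continuousOn, H.outer.continuous_left.continuousOn]
  · exact fun j y hy => P.reebHeight_reebMk (arcX_mem H hy)
  · intro q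
    obtain ⟨⟨x, y⟩, hp, rfl⟩ := P.exists_reebMk q
    have hp' := (mem_carrier_iff_of_hole H).1 hp
    rcases le_or_gt y c with h4 | h4
    · exact ⟨0, y, ⟨hp'.1.1.1, h4⟩,
        reebMk_left_eq H hp fun h5 => absurd h5 (not_lt.2 h4)⟩
    rcases le_or_gt d y with h5 | h5
    · exact ⟨3, y, ⟨h5, hp'.1.1.2⟩,
        reebMk_left_eq H hp fun _ h6 => absurd h6 (not_lt.2 h5)⟩
    rcases hp'.2 h4 h5 with h6 | h6
    · exact ⟨1, y, ⟨h4.le, h5.le⟩, reebMk_left_eq H hp fun _ _ => h6⟩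
    · exact ⟨2, y, ⟨h4.le, h5.le⟩, reebMk_right_eq H hp fun _ _ => h6⟩
  · intro j k hjk y hy hy'
    have e1 : ∀ h : c < y ∧ y < d, P.holeArc l r 1 y ≠ P.holeArc l r 2 y := fun h =>
      left_ne_right H h.1 h.2
    fin_cases j <;> fin_cases k <;> simp [arcLo, arcHi] at hy hy' hjk
    all_goals first
      | (exfalso; linarith [hy.1, hy.2, hy'.1, hy'.2])
      | exact e1 hy
      | exact (e1 hy).symm

/-- The arcs through the fiber of a point. -/
theorem on_hole_iff (H : P.IsHoled S T a b c d l r l' r')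
    {x y : ℝ} (hp : (x, y) ∈ P.carrier) (j : Fin 4) :
    ArcSystem.On P.reebHeight (P.holeArc l r) (arcLo a c d) (arcHi b c d) j (P.reebMk (x, y)) ↔
      (arcLo a c d j ≤ y ∧ y ≤ arcHi b c d j) ∧
        (c < y → y < d → (j = 1 → x ≤ l' y) ∧ (j = 2 → r' y ≤ x)) := by
  unfold ArcSystem.On
  rw [P.reebHeight_reebMk hp]
  refine and_congr_right fun hy => ?_
  dsimp only at hy ⊢
  have hp' := (mem_carrier_iff_of_hole H).1 hp
  obtain ⟨h1, h2, h3⟩ := hole_heights H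
  constructor
  · intro heq h4 h5
    have hlt := H.inner.left_lt_right y ⟨h4, h5⟩
    have hne := left_ne_right H h4 h5
    constructor
    · rintro rfl
      refine (hp'.2 h4 h5).resolve_right fun h6 => hne ?_
      rw [reebMk_right_eq H hp fun _ _ => h6]
      exact heq
    · rintro rfl
      refine (hp'.2 h4 h5).resolve_left fun h6 => hne ?_
      rw [reebMk_left_eq H hp fun _ _ => h6]
      exact heq.symm
  · intro h
    by_cases hcase : c < y ∧ y < d
    · have h' := h hcase.1 hcase.2
      fin_cases j
      · exact absurd hy.2 (not_le.2 hcase.1)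
      · exact reebMk_left_eq H hp fun _ _ => h'.1 rfl
      · exact reebMk_right_eq H hp fun _ _ => h'.2 rfl
      · exact absurd hy.1 (not_le.2 hcase.2)
    · have hl := reebMk_left_eq H hp fun h4 h5 => absurd ⟨h4, h5⟩ hcase
      have hr := reebMk_right_eq H hp fun h4 h5 => absurd ⟨h4, h5⟩ hcase
      fin_cases j
      exacts [hl, hl, hr, hl]

end

end PlanarPolygon

/-! ### Combinatorial models -/

/-- Heights of the vertices `A`, `B`, `C`, `D`, `E`, `F` in the model in which `k` of the vertices
`D`, `E`, `F` are below `B`. -/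
def modelHeight (k : Fin 4) : Fin 6 → ℕ := ![10, 2 * k + 3, 0, 8, 6, 4]

/-- The arcs through the vertices of the model: below (0), on the left (1), on the right (2) of
the hole, above (3). -/
def modelOn (k : Fin 4) (b e : Bool) (j : Fin 4) : Fin 6 → Bool :=
  ![j = 3, if k = 0 then j = 0 else if k = 3 then j = 3 else j = if b then 2 else 1,
    j = 0, j ≠ 0, j = if e then 2 else 1, j ≠ 3]

/-- Two vertices of the model are consecutive on an arc. -/
def modelAdj (k : Fin 4) (b e : Bool) (u v : Fin 6) (j : Fin 4) : Bool :=
  modelOn k b e j u && modelOn k b e j v && decide (modelHeight k u < modelHeight k v) &&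
    decide (∀ w, modelOn k b e j w → modelHeight k u < modelHeight k w →
      modelHeight k v ≤ modelHeight k w)

/-- The model of the Reeb graph of a triangle with a hole. -/
def model (k : Fin 4) (b e : Bool) : MarkedGraph where
  V := Fin 6
  Edge u v := {j : Fin 4 // modelAdj k b e u v j = true}
  -- The two conventions are opposite: if `B` is on the right, the polygon is on its left, so the
  -- vertex is right; if `E` is on the right of the hole, the polygon is on the right of it, so the
  -- vertex is left.
  isLeft v := v = 1 ∧ b = false ∨ v = 4 ∧ e = true

/-- The number of edges at a vertex of the model. -/
def modelDegree (k : Fin 4) (b e : Bool) (v : Fin 6) : ℕ :=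
  (Finset.univ.filter fun p : Fin 6 × Fin 4 => modelAdj k b e p.1 v p.2).card +
    (Finset.univ.filter fun p : Fin 6 × Fin 4 => modelAdj k b e v p.1 p.2).card

theorem degree_model (k : Fin 4) (b e : Bool) (v : Fin 6) :
    (model k b e).degree v = modelDegree k b e v := by
  have key : ∀ f : Fin 6 → Fin 4 → Bool, Nat.card (Σ u, {j : Fin 4 // f u j = true}) =
      (Finset.univ.filter fun p : Fin 6 × Fin 4 => f p.1 p.2).card := by
    intro f
    have e1 : (Σ u, {j : Fin 4 // f u j = true}) ≃ {p : Fin 6 × Fin 4 // f p.1 p.2 = true} :=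
      { toFun := fun x => ⟨(x.1, x.2.1), x.2.2⟩
        invFun := fun p => ⟨p.1.1, p.1.2, p.2⟩
        left_inv := fun _ => rfl
        right_inv := fun _ => rfl }
    rw [Nat.card_congr e1, Nat.card_eq_fintype_card, Fintype.card_subtype]
  exact congrArg₂ (· + ·) (key fun u j => modelAdj k b e u v j)
    (key fun u j => modelAdj k b e v u j)

theorem modelDegree_eq_two (k : Fin 4) (b e : Bool) (v : Fin 6) :
    modelDegree k b e v = 2 ↔ v = 1 ∨ v = 4 := by
  decide +revert

theorem model_isLeft (k : Fin 4) (b e : Bool) (v : Fin 6) :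
    (model k b e).isLeft v ↔ v = 1 ∧ b = false ∨ v = 4 ∧ e = true := Iff.rfl

/-- A reflection in a vertical line exchanges the arcs on the two sides of the hole. -/
theorem modelAdj_mirror (k : Fin 4) (b e : Bool) (u v : Fin 6) (j : Fin 4) :
    modelAdj k b e u v j = modelAdj k (!b) (!e) u v (Equiv.swap 1 2 j) := by
  decide +revert

/-- A reflection in a horizontal line exchanges `A` with `C`, `D` with `F` and the lowest arc with
the highest one; vertices of the hole below `B` become vertices above it. -/
theorem modelAdj_reverse (k : Fin 4) (b e : Bool) (u v : Fin 6) (j : Fin 4) :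
    modelAdj k b e v u j = modelAdj (3 - k) b e (Equiv.swap 0 2 (Equiv.swap 3 5 u))
      (Equiv.swap 0 2 (Equiv.swap 3 5 v)) (Equiv.swap 0 3 j) := by
  decide +revert

/-- An isomorphism of models is given by permutations of the vertices and of the arcs. -/
theorem model_edge_equiv {k k' : Fin 4} {b e b' e' : Bool} {u v u' v' : Fin 6}
    (τ : Equiv.Perm (Fin 4)) (h : ∀ j, modelAdj k b e u v j = modelAdj k' b' e' u' v' (τ j)) :
    Nonempty ((model k b e).Edge u v ≃ (model k' b' e').Edge u' v') :=
  ⟨τ.subtypeEquiv fun j => by rw [h j]⟩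

theorem degree_model_eq_two (k : Fin 4) (b e : Bool) (v : Fin 6) :
    (model k b e).degree v = 2 ↔ v = 1 ∨ v = 4 := by
  rw [degree_model, modelDegree_eq_two]

theorem model_mirror_iso (k : Fin 4) (b e : Bool) :
    (model k b e).mirror.Iso (model k (!b) (!e)) := by
  refine ⟨(Equiv.refl (Fin 6)), fun u v => model_edge_equiv _ (modelAdj_mirror k b e u v),
    fun (v : Fin 6) hv => ?_⟩
  have hv' : v = (1 : Fin 6) ∨ v = (4 : Fin 6) := (degree_model_eq_two k b e v).1 hv
  change ¬ (v = (1 : Fin 6) ∧ b = false ∨ v = (4 : Fin 6) ∧ e = true) ↔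
    (v = (1 : Fin 6) ∧ (!b) = false ∨ v = (4 : Fin 6) ∧ (!e) = true)
  rcases hv' with rfl | rfl <;> simp

theorem model_reverse_iso (k : Fin 4) (b e : Bool) :
    (model k b e).reverse.Iso (model (3 - k) b e) := by
  refine ⟨((Equiv.swap 3 5).trans (Equiv.swap 0 2) : Equiv.Perm (Fin 6)),
    fun u v => model_edge_equiv _ (modelAdj_reverse k b e u v), fun (v : Fin 6) hv => ?_⟩
  have hv' : v = (1 : Fin 6) ∨ v = (4 : Fin 6) :=
    (degree_model_eq_two k b e v).1 (((model k b e).degree_reverse v).symm.trans hv)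
  have hs : ∀ w : Fin 6, w = 1 ∨ w = 4 → Equiv.swap 0 2 (Equiv.swap 3 5 w) = w := by decide
  change (v = (1 : Fin 6) ∧ b = false ∨ v = (4 : Fin 6) ∧ e = true) ↔
    (Equiv.swap 0 2 (Equiv.swap 3 5 v) = (1 : Fin 6) ∧ b = false ∨
      Equiv.swap 0 2 (Equiv.swap 3 5 v) = (4 : Fin 6) ∧ e = true)
  rw [hs v hv']

/-- Every model is similar to one in which `B` is on the right and at least two vertices of the
hole are below `B`. -/
theorem exists_similar_model (k : Fin 4) (b e : Bool) : ∃ k' : Fin 4, (k' = 2 ∨ k' = 3) ∧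
    ∃ e' : Bool, (model k b e).Similar (model k' true e') := by
  have h3 : ∀ k : Fin 4, (k = 2 ∨ k = 3) ∨ (3 - k = 2 ∨ 3 - k = 3) := by decide
  have h1 : ∃ e', (model k b e).Similar (model k true e') := by
    cases b
    · exact ⟨!e, Or.inr (Or.inr (Or.inl (model_mirror_iso k false e)))⟩
    · exact ⟨e, Or.inl (MarkedGraph.Iso.refl _)⟩
  obtain ⟨e', h1⟩ := h1
  have h2 : (model k true e').Similar (model (3 - k) true e') :=
    Or.inr (Or.inl (model_reverse_iso k true e'))
  rcases h3 k with h3 | h3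
  · exact ⟨k, h3, e', h1⟩
  · exact ⟨3 - k, h3, e', h1.trans h2⟩

/-! ### Invariants -/

/-- There is an edge parallel to a path of two edges. -/
def OrientedGraph.HasShortcut (G : OrientedGraph) : Prop :=
  ∃ u v w, Nonempty (G.Edge u v) ∧ Nonempty (G.Edge v w) ∧ Nonempty (G.Edge u w)

/-- There are two paths of two edges with the same ends and different middle vertices. -/
def OrientedGraph.HasSquare (G : OrientedGraph) : Prop :=
  ∃ u v v' w, v ≠ v' ∧ Nonempty (G.Edge u v) ∧ Nonempty (G.Edge v w) ∧ Nonempty (G.Edge u v') ∧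
    Nonempty (G.Edge v' w)

/-- There is an edge from a source to a branching vertex. -/
def OrientedGraph.HasBranchAtSource (G : OrientedGraph) : Prop :=
  ∃ u v w w', (∀ x, IsEmpty (G.Edge x u)) ∧ Nonempty (G.Edge u v) ∧ w ≠ w' ∧
    Nonempty (G.Edge v w) ∧ Nonempty (G.Edge v w')

theorem OrientedGraph.Iso.hasShortcut {G H : OrientedGraph} (h : G.Iso H) (hG : G.HasShortcut) :
    H.HasShortcut := by
  obtain ⟨σ, hσ⟩ := h
  obtain ⟨u, v, w, h1, h2, h3⟩ := hG
  exact ⟨σ u, σ v, σ w, h1.map (hσ _ _).some, h2.map (hσ _ _).some, h3.map (hσ _ _).some⟩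

theorem OrientedGraph.Iso.hasSquare {G H : OrientedGraph} (h : G.Iso H) (hG : G.HasSquare) :
    H.HasSquare := by
  obtain ⟨σ, hσ⟩ := h
  obtain ⟨u, v, v', w, hne, h1, h2, h3, h4⟩ := hG
  exact ⟨σ u, σ v, σ v', σ w, fun h => hne (σ.injective h), h1.map (hσ _ _).some,
    h2.map (hσ _ _).some, h3.map (hσ _ _).some, h4.map (hσ _ _).some⟩

theorem OrientedGraph.Iso.hasBranchAtSource {G H : OrientedGraph} (h : G.Iso H)
    (hG : G.HasBranchAtSource) : H.HasBranchAtSource := by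
  obtain ⟨σ, hσ⟩ := h
  obtain ⟨u, v, w, w', h0, h1, hne, h2, h3⟩ := hG
  refine ⟨σ u, σ v, σ w, σ w', fun x => ?_, h1.map (hσ _ _).some, fun h => hne (σ.injective h),
    h2.map (hσ _ _).some, h3.map (hσ _ _).some⟩
  have := (hσ (σ.symm x) u).some.symm
  rw [σ.apply_symm_apply] at this
  have h4 := h0 (σ.symm x)
  exact this.isEmpty

theorem nonempty_model_edge {k : Fin 4} {b e : Bool} {u v : Fin 6} :
    Nonempty ((model k b e).Edge u v) ↔ ∃ j, modelAdj k b e u v j = true :=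
  ⟨fun ⟨j⟩ => ⟨j.1, j.2⟩, fun ⟨j, hj⟩ => ⟨⟨j, hj⟩⟩⟩

/-- The pairs of adjacent vertices of some models. -/
def modelEdges : Fin 4 → Bool → List (Fin 6 × Fin 6)
  | 0, _ => [(2, 1), (1, 5), (5, 3), (5, 4), (4, 3), (3, 0)]
  | 2, true => [(2, 5), (5, 3), (5, 4), (4, 1), (1, 3), (3, 0)]
  | 2, false => [(2, 5), (5, 4), (4, 3), (5, 1), (1, 3), (3, 0)]
  | _, _ => [(2, 5), (5, 3), (5, 4), (4, 3), (3, 1), (1, 0)]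

/-- The value `1` is excluded because it falls under the default line of the table, which is meant
for `3`. The table ignores multiplicities, which the invariants do not use. -/
theorem exists_modelAdj_iff (k : Fin 4) (hk : k ≠ 1) (e : Bool) (u v : Fin 6) :
    (∃ j, modelAdj k true e u v j = true) ↔ (u, v) ∈ modelEdges k e := by
  decide +revert

theorem nonempty_model_edge_iff {k : Fin 4} (hk : k ≠ 1) {e : Bool} {u v : Fin 6} :
    Nonempty ((model k true e).Edge u v) ↔ (u, v) ∈ modelEdges k e :=
  nonempty_model_edge.trans (exists_modelAdj_iff k hk e u v)

/-- If `B` is below or above the hole, only `E` subdivides the cycle, and one edge is opposite to a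
path of two. For `k = 2` the vertices `B` and `E` cut the two sides of the cycle into one and three
or into two and two edges. -/
theorem model_hasShortcut (k : Fin 4) (hk : k ≠ 1) (e : Bool) :
    (model k true e).HasShortcut ↔ k ≠ 2 := by
  have key : ∀ (k : Fin 4) (e : Bool), (∃ x ∈ modelEdges k e, ∃ y ∈ modelEdges k e,
      x.2 = y.1 ∧ (x.1, y.2) ∈ modelEdges k e) ↔ k ≠ 2 := by decide
  rw [← key k e]
  constructor
  · rintro ⟨u, v, w, h1, h2, h3⟩
    exact ⟨(u, v), (nonempty_model_edge_iff hk).1 h1, (v, w), (nonempty_model_edge_iff hk).1 h2,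
      rfl, (nonempty_model_edge_iff hk).1 h3⟩
  · rintro ⟨⟨u, v⟩, h1, ⟨v', w⟩, h2, h, h3⟩
    obtain rfl : v = v' := h
    exact ⟨u, v, w, (nonempty_model_edge_iff hk).2 h1, (nonempty_model_edge_iff hk).2 h2,
      (nonempty_model_edge_iff hk).2 h3⟩

/-- Both ways around the hole have two edges exactly if `B` and `E` are on different sides. -/
theorem model_hasSquare (e : Bool) : (model 2 true e).HasSquare ↔ e = false := by
  have key : ∀ e : Bool, (∃ x ∈ modelEdges 2 e, ∃ y ∈ modelEdges 2 e, x.2 = y.1 ∧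
      ∃ z ∈ modelEdges 2 e, z.1 = x.1 ∧ z.2 ≠ x.2 ∧ (z.2, y.2) ∈ modelEdges 2 e) ↔
        e = false := by decide
  have hk : (2 : Fin 4) ≠ 1 := by decide
  rw [← key e]
  constructor
  · rintro ⟨u, v, v', w, hne, h1, h2, h3, h4⟩
    exact ⟨(u, v), (nonempty_model_edge_iff hk).1 h1, (v, w), (nonempty_model_edge_iff hk).1 h2,
      rfl, (u, v'), (nonempty_model_edge_iff hk).1 h3, rfl, hne.symm,
      (nonempty_model_edge_iff hk).1 h4⟩
  · rintro ⟨⟨u, v⟩, h1, ⟨v₁, w⟩, h2, h, ⟨u₁, v'⟩, h3, h', hne, h4⟩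
    obtain rfl : v = v₁ := h
    obtain rfl : u₁ = u := h'
    exact ⟨u₁, v, v', w, hne.symm, (nonempty_model_edge_iff hk).2 h1,
      (nonempty_model_edge_iff hk).2 h2, (nonempty_model_edge_iff hk).2 h3,
      (nonempty_model_edge_iff hk).2 h4⟩

/-- The lowest vertex `C` is joined directly to the branching vertex `F` unless `B` lies between
them. -/
theorem model_hasBranchAtSource (k : Fin 4) (hk : k ≠ 1) (e : Bool) :
    (model k true e).HasBranchAtSource ↔ k ≠ 0 := by
  have key : ∀ (k : Fin 4) (e : Bool), (∃ x ∈ modelEdges k e,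
      (∀ y ∈ modelEdges k e, y.2 ≠ x.1) ∧ ∃ y ∈ modelEdges k e, ∃ z ∈ modelEdges k e,
        y.1 = x.2 ∧ z.1 = x.2 ∧ y.2 ≠ z.2) ↔ k ≠ 0 := by decide
  rw [← key k e]
  constructor
  · rintro ⟨u, v, w, w', h0, h1, hne, h2, h3⟩
    refine ⟨(u, v), (nonempty_model_edge_iff hk).1 h1, ?_, (v, w),
      (nonempty_model_edge_iff hk).1 h2, (v, w'), (nonempty_model_edge_iff hk).1 h3, rfl, rfl, hne⟩
    rintro ⟨x, u'⟩ h4 h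
    obtain rfl : u' = u := h
    exact not_nonempty_iff.2 (h0 x) ((nonempty_model_edge_iff hk).2 h4)
  · rintro ⟨⟨u, v⟩, h1, h0, ⟨v₁, w⟩, h2, ⟨v₂, w'⟩, h3, h, h', hne⟩
    obtain rfl : v₁ = v := h
    obtain rfl : v₂ = v₁ := h'
    exact ⟨u, v₂, w, w', fun x => not_nonempty_iff.1 fun h4 =>
      h0 _ ((nonempty_model_edge_iff hk).1 h4) rfl, (nonempty_model_edge_iff hk).2 h1, hne,
      (nonempty_model_edge_iff hk).2 h2, (nonempty_model_edge_iff hk).2 h3⟩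

/-- All vertices of degree two are on the same side. -/
def MarkedGraph.IsOneSided (G : MarkedGraph) : Prop :=
  ∀ u v, G.degree u = 2 → G.degree v = 2 → (G.isLeft u ↔ G.isLeft v)

theorem MarkedGraph.Iso.toOriented {G H : MarkedGraph} (h : G.Iso H) :
    G.toOrientedGraph.Iso H.toOrientedGraph := by
  obtain ⟨σ, hσ, -⟩ := h
  exact ⟨σ, hσ⟩

theorem MarkedGraph.Iso.isOneSided {G H : MarkedGraph} (h : G.Iso H) (hH : H.IsOneSided) :
    G.IsOneSided := by
  obtain ⟨σ, hσ, hm⟩ := h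
  intro u v hu hv
  rw [hm u hu, hm v hv]
  exact hH _ _ ((OrientedGraph.degree_eq σ hσ u).trans hu)
    ((OrientedGraph.degree_eq σ hσ v).trans hv)

theorem MarkedGraph.isOneSided_reverse {G : MarkedGraph} : G.reverse.IsOneSided ↔ G.IsOneSided := by
  constructor <;> intro h u v hu hv
  · exact h u v ((degree_reverse G u).trans hu) ((degree_reverse G v).trans hv)
  · exact h u v ((degree_reverse G u).symm.trans hu) ((degree_reverse G v).symm.trans hv)

theorem MarkedGraph.isOneSided_mirror {G : MarkedGraph} : G.mirror.IsOneSided ↔ G.IsOneSided :=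
  forall₂_congr fun _ _ => forall₂_congr fun _ _ => not_iff_not

theorem MarkedGraph.hasShortcut_reverse {G : MarkedGraph} (h : G.HasShortcut) :
    G.reverse.HasShortcut := by
  obtain ⟨u, v, w, h1, h2, h3⟩ := h
  exact ⟨w, v, u, h2, h1, h3⟩

theorem MarkedGraph.Similar.isOneSided {G H : MarkedGraph} (h : G.Similar H) (hH : H.IsOneSided) :
    G.IsOneSided := by
  rcases h with h | h | h | h
  · exact h.isOneSided hH
  · exact isOneSided_reverse.1 (h.isOneSided hH)
  · exact isOneSided_mirror.1 (h.isOneSided hH)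
  · exact isOneSided_reverse.1 (isOneSided_mirror.1 (h.isOneSided hH))

theorem MarkedGraph.Similar.hasShortcut {G H : MarkedGraph} (h : G.Similar H) (hG : G.HasShortcut) :
    H.HasShortcut := by
  rcases h with h | h | h | h
  · exact h.toOriented.hasShortcut hG
  · exact h.toOriented.hasShortcut (hasShortcut_reverse hG)
  · exact h.toOriented.hasShortcut hG
  · exact h.toOriented.hasShortcut (hasShortcut_reverse hG)

theorem model_isOneSided (k : Fin 4) (b e : Bool) : (model k b e).IsOneSided ↔ b ≠ e := by
  unfold MarkedGraph.IsOneSided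
  have h1 := degree_model_eq_two k b e
  have l1 : (model k b e).isLeft (1 : Fin 6) ↔ b = false := by
    rw [model_isLeft]; simp
  have l2 : (model k b e).isLeft (4 : Fin 6) ↔ e = true := by
    rw [model_isLeft]; simp
  constructor
  · intro h
    have := h (1 : Fin 6) (4 : Fin 6) ((h1 _).2 (Or.inl rfl)) ((h1 _).2 (Or.inr rfl))
    rw [l1, l2] at this
    cases b <;> cases e <;> simp_all
  · intro h (u : Fin 6) (v : Fin 6) hu hv
    have : b = false ↔ e = true := by cases b <;> cases e <;> simp_all
    rcases (h1 u).1 hu with rfl | rfl <;> rcases (h1 v).1 hv with rfl | rfl <;>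
      simp only [l1, l2, this]

/-- Both invariants survive the two reflections: shortcuts distinguish the values of `k`,
one-sidedness distinguishes the sides. -/
theorem similar_model_iff {k k' : Fin 4} (hk : k = 2 ∨ k = 3) (hk' : k' = 2 ∨ k' = 3)
    {s s' : Bool} : (model k true s).Similar (model k' true s') ↔ k = k' ∧ s = s' := by
  constructor
  · intro h
    constructor
    · have h1 := h.hasShortcut
      have h2 := h.symm.hasShortcut
      have h3 : ∀ k : Fin 4, k = 2 ∨ k = 3 → k ≠ 1 := by decide
      rw [model_hasShortcut _ (h3 k hk), model_hasShortcut _ (h3 k' hk')] at h1 h2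
      rcases hk with rfl | rfl <;> rcases hk' with rfl | rfl <;> simp_all
    · have h1 := h.isOneSided
      have h2 := h.symm.isOneSided
      rw [model_isOneSided, model_isOneSided] at h1 h2
      cases s <;> cases s' <;> simp_all
  · rintro ⟨rfl, rfl⟩
    exact MarkedGraph.similarSetoid.iseqv.refl _

/-! ### The oriented classes -/

/-- Representatives of the oriented models. -/
def orientedModel : Fin 4 → OrientedGraph :=
  ![(model 0 true true).toOrientedGraph, (model 2 true false).toOrientedGraph,
    (model 2 true true).toOrientedGraph, (model 3 true true).toOrientedGraph]

/-- Below the hole there is only one arc, so the oriented graph does not see the side of `B`; the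
same holds above the hole. -/
theorem modelAdj_zero_not (b e : Bool) (u v : Fin 6) (j : Fin 4) :
    modelAdj 0 b e u v j = modelAdj 0 (!b) e u v j := by
  decide +revert

theorem modelAdj_three_not (b e : Bool) (u v : Fin 6) (j : Fin 4) :
    modelAdj 3 b e u v j = modelAdj 3 (!b) e u v j := by
  decide +revert

/-- When `B` and `E` are on the same side of the hole, the cases `k = 1` and `k = 2` differ by the
order of these two vertices on one arc, so exchanging their names suffices. -/
theorem modelAdj_one_two (b : Bool) (u v : Fin 6) (j : Fin 4) :
    modelAdj 1 b b u v j = modelAdj 2 b b (Equiv.swap 1 4 u) (Equiv.swap 1 4 v) j := by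
  decide +revert

/-- On different sides of the hole the relative height of `B` and `E` is irrelevant. -/
theorem modelAdj_one_two' (b : Bool) (u v : Fin 6) (j : Fin 4) :
    modelAdj 1 b (!b) u v j = modelAdj 2 b (!b) u v j := by
  decide +revert

theorem model_iso_not_not (k : Fin 4) {b e b' e' : Bool} (hb : (!b) = b') (he : (!e) = e') :
    (model k b e).toOrientedGraph.Iso (model k b' e').toOrientedGraph := by
  subst hb he
  exact ⟨Equiv.refl (Fin 6), fun u v => model_edge_equiv _ (modelAdj_mirror k b e u v)⟩

theorem model_iso_not_left {k : Fin 4} (hk : k = 0 ∨ k = 3) {b b' : Bool} (hb : (!b) = b')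
    (e : Bool) : (model k b e).toOrientedGraph.Iso (model k b' e).toOrientedGraph := by
  subst hb
  refine ⟨Equiv.refl (Fin 6), fun u v => model_edge_equiv (Equiv.refl _) fun j => ?_⟩
  rcases hk with rfl | rfl
  exacts [modelAdj_zero_not b e u v j, modelAdj_three_not b e u v j]

theorem model_iso_true_true {k : Fin 4} (hk : k = 0 ∨ k = 3) (b e : Bool) :
    (model k b e).toOrientedGraph.Iso (model k true true).toOrientedGraph := by
  cases b <;> cases e
  · exact model_iso_not_not k rfl rfl
  · exact model_iso_not_left hk rfl true
  · exact (model_iso_not_left hk (b' := false) rfl false).trans (model_iso_not_not k rfl rfl)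
  · exact OrientedGraph.Iso.refl _

theorem model_one_iso_two (b e : Bool) :
    (model 1 b e).toOrientedGraph.Iso (model 2 b e).toOrientedGraph := by
  by_cases hbe : e = b
  · subst hbe
    exact ⟨(Equiv.swap 1 4 : Equiv.Perm (Fin 6)), fun u v =>
      model_edge_equiv (Equiv.refl _) (modelAdj_one_two e u v)⟩
  · obtain rfl : e = !b := by cases b <;> cases e <;> simp_all
    exact ⟨Equiv.refl (Fin 6), fun u v =>
      model_edge_equiv (Equiv.refl _) (modelAdj_one_two' b u v)⟩

theorem model_two_iso (b e : Bool) :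
    (model 2 b e).toOrientedGraph.Iso (model 2 true false).toOrientedGraph ∨
      (model 2 b e).toOrientedGraph.Iso (model 2 true true).toOrientedGraph := by
  cases b <;> cases e
  · exact Or.inr (model_iso_not_not 2 rfl rfl)
  · exact Or.inl (model_iso_not_not 2 rfl rfl)
  · exact Or.inl (OrientedGraph.Iso.refl _)
  · exact Or.inr (OrientedGraph.Iso.refl _)

theorem orientedModel_zero : orientedModel 0 = (model 0 true true).toOrientedGraph := rfl

theorem orientedModel_one : orientedModel 1 = (model 2 true false).toOrientedGraph := rfl

theorem orientedModel_two : orientedModel 2 = (model 2 true true).toOrientedGraph := rfl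

theorem orientedModel_three : orientedModel 3 = (model 3 true true).toOrientedGraph := rfl

theorem exists_iso_orientedModel (k : Fin 4) (b e : Bool) :
    ∃ i, (model k b e).toOrientedGraph.Iso (orientedModel i) := by
  have hk : ∀ k : Fin 4, k = 0 ∨ k = 1 ∨ k = 2 ∨ k = 3 := by decide
  have h2 : ∃ i, (model 2 b e).toOrientedGraph.Iso (orientedModel i) := by
    rcases model_two_iso b e with h | h
    · exact ⟨1, orientedModel_one ▸ h⟩
    · exact ⟨2, orientedModel_two ▸ h⟩
  rcases hk k with rfl | rfl | rfl | rfl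
  · exact ⟨0, orientedModel_zero ▸ model_iso_true_true (Or.inl rfl) b e⟩
  · obtain ⟨i, hi⟩ := h2
    exact ⟨i, (model_one_iso_two b e).trans hi⟩
  · exact h2
  · exact ⟨3, orientedModel_three ▸ model_iso_true_true (Or.inr rfl) b e⟩

/-- Shortcuts separate the representatives `0` and `3` from `1` and `2`; a square tells `1` from
`2`, and a branching vertex next to a source tells `3` from `0`. -/
theorem orientedModel_iso_iff {i j : Fin 4} : (orientedModel i).Iso (orientedModel j) ↔ i = j := by
  constructor
  · intro h
    by_contra hij
    wlog hlt : i < j generalizing i j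
    · exact this h.symm (Ne.symm hij) (lt_of_le_of_ne (not_lt.1 hlt) (Ne.symm hij))
    have s0 := (model_hasShortcut 0 (by decide) true).2 (by decide)
    have s3 := (model_hasShortcut 3 (by decide) true).2 (by decide)
    have s1 : ¬ (model 2 true false).HasShortcut := fun h =>
      (model_hasShortcut 2 (by decide) false).1 h rfl
    have s2 : ¬ (model 2 true true).HasShortcut := fun h =>
      (model_hasShortcut 2 (by decide) true).1 h rfl
    have q1 := (model_hasSquare false).2 rfl
    have q2 : ¬ (model 2 true true).HasSquare := fun h =>
      absurd ((model_hasSquare true).1 h) (by decide)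
    have b0 : ¬ (model 0 true true).HasBranchAtSource := fun h =>
      (model_hasBranchAtSource 0 (by decide) true).1 h rfl
    have b3 := (model_hasBranchAtSource 3 (by decide) true).2 (by decide)
    fin_cases i <;> fin_cases j <;> first | (exact absurd hlt (by decide)) | skip
    · exact s1 (h.hasShortcut s0)
    · exact s2 (h.hasShortcut s0)
    · exact b0 (h.symm.hasBranchAtSource b3)
    · exact q2 (h.hasSquare q1)
    · exact s1 (h.symm.hasShortcut s3)
    · exact s2 (h.symm.hasShortcut s3)
  · rintro rfl
    exact OrientedGraph.Iso.refl _

/-! ### Identification of the Reeb graph of a triangle with a hole -/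

section Triangle

variable {A B C : ℝ × ℝ}

theorem triRight_middle (hAB : B.2 < A.2) (hBC : C.2 < B.2) (h : 0 < triOffset A B C) :
    triRight A B C B.2 = B.1 := by
  rw [triRight, triBroken_middle hAB hBC, max_eq_right]
  exact (sub_pos.1 h).le

theorem triLeft_middle (hAB : B.2 < A.2) (hBC : C.2 < B.2) (h : triOffset A B C < 0) :
    triLeft A B C B.2 = B.1 := by
  rw [triLeft, triBroken_middle hAB hBC, min_eq_right]
  exact (sub_neg.1 h).le

end Triangle

namespace PlanarPolygon

section Holed

variable {P : PlanarPolygon} {S T : Set (ℝ × ℝ)} {a b c d x y : ℝ} {l r l' r' : ℝ → ℝ}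

theorem on_below_hole_iff (H : P.IsHoled S T a b c d l r l' r') (hp : (x, y) ∈ P.carrier)
    (hy : y < c) (j : Fin 4) :
    ArcSystem.On P.reebHeight (P.holeArc l r) (arcLo a c d) (arcHi b c d) j (P.reebMk (x, y)) ↔
      j = 0 := by
  obtain ⟨⟨⟨h4, h5⟩, -⟩, -⟩ := (mem_carrier_iff_of_hole H).1 hp
  obtain ⟨h1, h2, h3⟩ := hole_heights H
  rw [on_hole_iff H hp]
  fin_cases j <;> simp [arcLo, arcHi] <;> intros <;>
    first | linarith | exact ⟨by linarith, by linarith⟩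

theorem on_above_hole_iff (H : P.IsHoled S T a b c d l r l' r') (hp : (x, y) ∈ P.carrier)
    (hy : d < y) (j : Fin 4) :
    ArcSystem.On P.reebHeight (P.holeArc l r) (arcLo a c d) (arcHi b c d) j (P.reebMk (x, y)) ↔
      j = 3 := by
  obtain ⟨⟨⟨h4, h5⟩, -⟩, -⟩ := (mem_carrier_iff_of_hole H).1 hp
  obtain ⟨h1, h2, h3⟩ := hole_heights H
  rw [on_hole_iff H hp]
  fin_cases j <;> simp [arcLo, arcHi] <;> intros <;>
    first | linarith | exact ⟨by linarith, by linarith⟩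

theorem on_hole_bottom_iff (H : P.IsHoled S T a b c d l r l' r') (hp : (x, c) ∈ P.carrier)
    (j : Fin 4) :
    ArcSystem.On P.reebHeight (P.holeArc l r) (arcLo a c d) (arcHi b c d) j (P.reebMk (x, c)) ↔
      j ≠ 3 := by
  obtain ⟨h1, h2, h3⟩ := hole_heights H
  rw [on_hole_iff H hp]
  fin_cases j <;> simp [arcLo, arcHi] <;> intros <;> linarith

theorem on_hole_top_iff (H : P.IsHoled S T a b c d l r l' r') (hp : (x, d) ∈ P.carrier)
    (j : Fin 4) :
    ArcSystem.On P.reebHeight (P.holeArc l r) (arcLo a c d) (arcHi b c d) j (P.reebMk (x, d)) ↔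
      j ≠ 0 := by
  obtain ⟨h1, h2, h3⟩ := hole_heights H
  rw [on_hole_iff H hp]
  fin_cases j <;> simp [arcLo, arcHi] <;> intros <;> linarith

theorem on_beside_hole_iff (H : P.IsHoled S T a b c d l r l' r') (hp : (x, y) ∈ P.carrier)
    (h1 : c < y) (h2 : y < d) (j : Fin 4) :
    ArcSystem.On P.reebHeight (P.holeArc l r) (arcLo a c d) (arcHi b c d) j (P.reebMk (x, y)) ↔
      j = if r' y ≤ x then 2 else 1 := by
  have hp' := ((mem_carrier_iff_of_hole H).1 hp).2 h1 h2
  have hlr := H.inner.left_lt_right y ⟨h1, h2⟩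
  rw [on_hole_iff H hp]
  split_ifs with h <;> fin_cases j <;> simp [arcLo, arcHi, h1, h2, h1.le, h2.le, h] <;>
    first | linarith | skip
  exact hp'.resolve_right h

theorem eventually_left_ray (H : P.IsHoled S T a b c d l r l' r') (h1 : a < y) (h2 : y < b) :
    ∀ᶠ t in 𝓝[>] (0 : ℝ), (l y + t, y) ∈ P.carrier := by
  have hlr := H.outer.left_lt_right y ⟨h1, h2⟩
  obtain ⟨δ, hδ, hδ1, hδ2⟩ : ∃ δ > 0, δ ≤ r y - l y ∧ (c < y → y < d → δ ≤ l' y - l y) := by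
    by_cases hy : c < y ∧ y < d
    · have hb := (H.outer.hole_bounds H.inner H.sub ⟨hy.1.le, hy.2.le⟩).2.1
      exact ⟨min (r y - l y) (l' y - l y), lt_min (sub_pos.2 hlr) (sub_pos.2 hb),
        min_le_left _ _, fun _ _ => min_le_right _ _⟩
    · exact ⟨r y - l y, sub_pos.2 hlr, le_rfl, fun h h' => absurd ⟨h, h'⟩ hy⟩
  filter_upwards [Ioo_mem_nhdsGT hδ] with t ht
  rw [mem_carrier_iff_of_hole H]
  refine ⟨⟨⟨h1.le, h2.le⟩, by linarith [ht.1], by linarith [ht.2]⟩, fun h h' => Or.inl ?_⟩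
  linarith [hδ2 h h', ht.2]

theorem not_eventually_right_ray (H : P.IsHoled S T a b c d l r l' r') :
    ¬ ∀ᶠ t in 𝓝[>] (0 : ℝ), (r y + t, y) ∈ P.carrier := by
  intro h
  obtain ⟨t, ht, ht0⟩ := (h.and self_mem_nhdsWithin).exists
  have := ((mem_carrier_iff_of_hole H).1 ht).1.2.2
  have ht0' : 0 < t := ht0
  linarith

theorem eventually_hole_right_ray (H : P.IsHoled S T a b c d l r l' r') (h1 : c < y) (h2 : y < d) :
    ∀ᶠ t in 𝓝[>] (0 : ℝ), (r' y + t, y) ∈ P.carrier := by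
  have hlr := H.inner.left_lt_right y ⟨h1, h2⟩
  obtain ⟨⟨ha, hb⟩, hl, hr⟩ := H.outer.hole_bounds H.inner H.sub ⟨h1.le, h2.le⟩
  filter_upwards [Ioo_mem_nhdsGT (sub_pos.2 hr)] with t ht
  rw [mem_carrier_iff_of_hole H]
  exact ⟨⟨⟨ha.le, hb.le⟩, by linarith [ht.1], by linarith [ht.2]⟩,
    fun _ _ => Or.inr (by linarith [ht.1])⟩

theorem not_eventually_hole_left_ray (H : P.IsHoled S T a b c d l r l' r') (h1 : c < y)
    (h2 : y < d) : ¬ ∀ᶠ t in 𝓝[>] (0 : ℝ), (l' y + t, y) ∈ P.carrier := by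
  have hlr := H.inner.left_lt_right y ⟨h1, h2⟩
  intro h
  obtain ⟨t, ht, ht0⟩ := (h.and (Ioo_mem_nhdsGT (sub_pos.2 hlr))).exists
  rcases ((mem_carrier_iff_of_hole H).1 ht).2 h1 h2 with h | h <;> linarith [ht0.1, ht0.2]

end Holed

/-- The mark refers to some vertex of the polygon over `u`, and there is only one. -/
theorem markedReebGraph_isLeft_iff {P : PlanarPolygon} {u : P.markedReebGraph.V} {z : ℝ × ℝ}
    (hz : z ∈ P.vertices) (hu : P.reebMk z = u.1) :
    P.markedReebGraph.isLeft u ↔ ∀ᶠ t in 𝓝[>] (0 : ℝ), (z.1 + t, z.2) ∈ P.carrier := by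
  have hzc := P.vertex_mem_carrier ⟨z, hz⟩
  constructor
  · rintro ⟨w, hw, hwu, h⟩
    rw [← hu, ← P.reebMk_of_mem w.2] at hwu
    have := P.reebMk_vertex_injective (a₁ := ⟨w.1, hw⟩) (a₂ := ⟨z, hz⟩) hwu
    rw [Subtype.mk.injEq] at this
    rwa [this] at h
  · intro h
    exact ⟨⟨z, hzc⟩, hz, (P.reebMk_of_mem hzc).symm.trans hu, h⟩

variable {P : PlanarPolygon} {A B C D E F : ℝ × ℝ}

theorem IsTriangleWithHole.isHoled (h : P.IsTriangleWithHole A B C D E F) :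
    P.IsHoled (convexHull ℝ {A, B, C}) (convexHull ℝ {D, E, F}) C.2 A.2 F.2 D.2
      (triLeft A B C) (triRight A B C) (triLeft D E F) (triRight D E F) :=
  ⟨h.outer, h.inner, h.2.2.2.1, h.2.2.2.2⟩

theorem IsTriangleWithHole.mem_vertices (h : P.IsTriangleWithHole A B C D E F) {z : ℝ × ℝ} :
    z ∈ P.vertices ↔ z = A ∨ z = B ∨ z = C ∨ z = D ∨ z = E ∨ z = F := by
  rw [← Finset.mem_coe, h.1]
  simp only [Set.mem_insert_iff, Set.mem_singleton_iff]

/-- `B` is on the frontier of the outer triangle and the vertices of the hole are in its interior,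
so they are different vertices, and general position applies. -/
theorem IsTriangleWithHole.middle_ne (h : P.IsTriangleWithHole A B C D E F) :
    B.2 ≠ D.2 ∧ B.2 ≠ E.2 ∧ B.2 ≠ F.2 := by
  have hB : B ∉ interior (convexHull ℝ {A, B, C}) := fun hi =>
    (vertices_mem_frontier_triangle h.2.1.1 h.2.1.2 h.offset_ne (by simp : B ∈ _)).2 hi
  have key : ∀ X ∈ ({D, E, F} : Set (ℝ × ℝ)), B.2 ≠ X.2 := by
    intro X hX heq
    have : B = X := P.height_injOn B (by rw [h.mem_vertices]; simp) X
      (by rw [h.mem_vertices]; rcases hX with rfl | rfl | rfl <;> simp) heq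
    exact hB (this ▸ h.2.2.2.1 (subset_convexHull ℝ _ hX))
  exact ⟨key D (by simp), key E (by simp), key F (by simp)⟩

/-- The parameter `k` of the model describes the position of the outer middle vertex. -/
def IsMiddlePosition (B D E F : ℝ × ℝ) (k : Fin 4) : Prop :=
  k = 0 ∧ B.2 < F.2 ∨ k = 1 ∧ F.2 < B.2 ∧ B.2 < E.2 ∨ k = 2 ∧ E.2 < B.2 ∧ B.2 < D.2 ∨
    k = 3 ∧ D.2 < B.2

theorem IsTriangleWithHole.exists_isMiddlePosition (h : P.IsTriangleWithHole A B C D E F) :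
    ∃ k, IsMiddlePosition B D E F k := by
  obtain ⟨h1, h2, h3⟩ := h.middle_ne
  rcases lt_or_gt_of_ne h3 with h3 | h3
  · exact ⟨0, Or.inl ⟨rfl, h3⟩⟩
  rcases lt_or_gt_of_ne h2 with h2 | h2
  · exact ⟨1, Or.inr (Or.inl ⟨rfl, h3, h2⟩)⟩
  rcases lt_or_gt_of_ne h1 with h1 | h1
  · exact ⟨2, Or.inr (Or.inr (Or.inl ⟨rfl, h2, h1⟩))⟩
  · exact ⟨3, Or.inr (Or.inr (Or.inr ⟨rfl, h1⟩))⟩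

theorem IsTriangleWithHole.modelHeight_lt_iff (h : P.IsTriangleWithHole A B C D E F) {k : Fin 4}
    (hk : IsMiddlePosition B D E F k) (i j : Fin 6) :
    modelHeight k i < modelHeight k j ↔
      (![A, B, C, D, E, F] i : ℝ × ℝ).2 < (![A, B, C, D, E, F] j : ℝ × ℝ).2 := by
  have hinj : ∀ (k : Fin 4) (i j : Fin 6), modelHeight k i = modelHeight k j → i = j := by decide
  obtain ⟨h1, h2, h3⟩ := hole_heights h.isHoled
  obtain ⟨h4, h5⟩ := h.2.1
  obtain ⟨h6, h7⟩ := h.2.2.1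
  have key : ∀ i j : Fin 6, modelHeight k i < modelHeight k j →
      (![A, B, C, D, E, F] i : ℝ × ℝ).2 < (![A, B, C, D, E, F] j : ℝ × ℝ).2 := by
    rcases hk with ⟨rfl, hk⟩ | ⟨rfl, hk, hk'⟩ | ⟨rfl, hk, hk'⟩ | ⟨rfl, hk⟩ <;> intro i j hij <;>
      fin_cases i <;> fin_cases j <;> first | (exact absurd hij (by decide)) | skip
    all_goals
      simp only [Fin.zero_eta, Fin.mk_one, Fin.reduceFinMk, Matrix.cons_val]
      linarith
  refine ⟨key i j, fun hlt => ?_⟩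
  by_contra hcon
  rcases (not_lt.1 hcon).lt_or_eq with h' | h'
  · exact absurd (key j i h') hlt.not_gt
  · rw [hinj k j i h'] at hlt
    exact lt_irrefl _ hlt

theorem IsTriangleWithHole.vertex_mem (h : P.IsTriangleWithHole A B C D E F) (i : Fin 6) :
    ![A, B, C, D, E, F] i ∈ P.vertices := by
  rw [h.mem_vertices]
  fin_cases i <;> simp

/-- The height of a vertex relative to the hole decides which arcs contain it. Only for `B` and `E`
strictly beside the hole does the side matter, and there the sign of the offset decides it. -/
theorem IsTriangleWithHole.on_iff (h : P.IsTriangleWithHole A B C D E F) {k : Fin 4}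
    (hk : IsMiddlePosition B D E F k) {b e : Bool} (hb : b = true ↔ MiddleOnRight A B C)
    (he : e = true ↔ MiddleOnRight D E F) (i : Fin 6) (j : Fin 4) :
    ArcSystem.On P.reebHeight (P.holeArc (triLeft A B C) (triRight A B C)) (arcLo C.2 F.2 D.2)
      (arcHi A.2 F.2 D.2) j (P.reebMk (![A, B, C, D, E, F] i)) ↔ modelOn k b e j i = true := by
  have H := h.isHoled
  have hm : ∀ i, ![A, B, C, D, E, F] i ∈ P.carrier := fun i =>
    P.vertex_mem_carrier ⟨_, h.vertex_mem i⟩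
  obtain ⟨h1, h2, h3⟩ := hole_heights h.isHoled
  obtain ⟨h4, h5⟩ := h.2.1
  obtain ⟨h6, h7⟩ := h.2.2.1
  rw [middleOnRight_iff (h5.trans h4)] at hb
  rw [middleOnRight_iff (h7.trans h6)] at he
  -- `B` is an end of the section of the outer triangle, so it is beyond the hole, on the side given
  -- by its offset.
  have hB : F.2 < B.2 → B.2 < D.2 → (triRight D E F B.2 ≤ B.1 ↔ b = true) := by
    intro h8 h9
    have hl := H.inner.left_lt_right B.2 ⟨h8, h9⟩
    obtain ⟨-, hb1, hb2⟩ := H.outer.hole_bounds H.inner H.sub ⟨h8.le, h9.le⟩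
    rcases lt_or_gt_of_ne h.offset_ne with h0 | h0
    · rw [hb, ← triLeft_middle h4 h5 h0]
      exact iff_of_false (by linarith) h0.not_gt
    · rw [hb, ← triRight_middle h4 h5 h0]
      exact iff_of_true hb2.le h0
  have hE : triRight D E F E.2 ≤ E.1 ↔ e = true := by
    have hl := H.inner.left_lt_right E.2 ⟨h7, h6⟩
    rcases lt_or_gt_of_ne h.offset_ne' with h0 | h0
    · rw [he]
      refine iff_of_false ?_ h0.not_gt
      rw [triLeft_middle h6 h7 h0] at hl
      exact hl.not_ge
    · rw [he]
      exact iff_of_true (triRight_middle h6 h7 h0).le h0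
  have hOB := fun h8 h9 => on_beside_hole_iff H (hm 1) h8 h9 j
  have hOE := on_beside_hole_iff H (hm 4) h7 h6 j
  fin_cases i
  · rw [show modelOn k b e j ⟨0, _⟩ = decide (j = 3) from rfl, decide_eq_true_iff]
    exact on_above_hole_iff H (hm 0) h3 j
  · rcases hk with ⟨rfl, hk⟩ | ⟨rfl, hk, hk'⟩ | ⟨rfl, hk, hk'⟩ | ⟨rfl, hk⟩
    · rw [show modelOn 0 b e j ⟨1, _⟩ = decide (j = 0) from rfl, decide_eq_true_iff]
      exact on_below_hole_iff H (hm 1) hk j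
    · rw [show modelOn 1 b e j ⟨1, _⟩ = decide (j = if b then 2 else 1) from rfl,
        decide_eq_true_iff]
      refine (hOB hk (hk'.trans h6)).trans ?_
      simp only [hB hk (hk'.trans h6)]
    · rw [show modelOn 2 b e j ⟨1, _⟩ = decide (j = if b then 2 else 1) from rfl,
        decide_eq_true_iff]
      refine (hOB (h7.trans hk) hk').trans ?_
      simp only [hB (h7.trans hk) hk']
    · rw [show modelOn 3 b e j ⟨1, _⟩ = decide (j = 3) from rfl, decide_eq_true_iff]
      exact on_above_hole_iff H (hm 1) hk j
  · rw [show modelOn k b e j ⟨2, _⟩ = decide (j = 0) from rfl, decide_eq_true_iff]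
    exact on_below_hole_iff H (hm 2) h1 j
  · rw [show modelOn k b e j ⟨3, _⟩ = decide (j ≠ 0) from rfl, decide_eq_true_iff]
    exact on_hole_top_iff H (hm 3) j
  · rw [show modelOn k b e j ⟨4, _⟩ = decide (j = if e then 2 else 1) from rfl, decide_eq_true_iff]
    refine hOE.trans ?_
    simp only [hE]
  · rw [show modelOn k b e j ⟨5, _⟩ = decide (j ≠ 3) from rfl, decide_eq_true_iff]
    exact on_hole_bottom_iff H (hm 5) j

/-- The vertices of the Reeb graph of a triangle with a hole. -/
noncomputable def IsTriangleWithHole.vertexEquiv (h : P.IsTriangleWithHole A B C D E F) :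
    Fin 6 ≃ P.reebGraph.V :=
  Equiv.ofBijective (fun i => ⟨P.reebMk (![A, B, C, D, E, F] i),
    P.mem_reebVertices_iff.2 ⟨⟨_, h.vertex_mem i⟩, rfl⟩⟩) (by
  constructor
  · intro i j hij
    obtain ⟨k, hk⟩ := h.exists_isMiddlePosition
    have hinj : ∀ (k : Fin 4) (i j : Fin 6), ¬ modelHeight k i < modelHeight k j →
        ¬ modelHeight k j < modelHeight k i → i = j := by decide
    have := congrArg P.reebHeight (congrArg Subtype.val hij)
    dsimp only at this
    rw [P.reebHeight_reebMk (P.vertex_mem_carrier ⟨_, h.vertex_mem i⟩),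
      P.reebHeight_reebMk (P.vertex_mem_carrier ⟨_, h.vertex_mem j⟩)] at this
    refine hinj k i j ?_ ?_ <;> rw [h.modelHeight_lt_iff hk, this] <;> exact lt_irrefl _
  · rintro ⟨q, hq⟩
    obtain ⟨⟨v, hv⟩, rfl⟩ := P.mem_reebVertices_iff.1 hq
    rcases h.mem_vertices.1 hv with rfl | rfl | rfl | rfl | rfl | rfl
    exacts [⟨0, rfl⟩, ⟨1, rfl⟩, ⟨2, rfl⟩, ⟨3, rfl⟩, ⟨4, rfl⟩, ⟨5, rfl⟩])

theorem IsTriangleWithHole.vertexEquiv_val (h : P.IsTriangleWithHole A B C D E F) (i : Fin 6) :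
    (h.vertexEquiv i).1 = P.reebMk (![A, B, C, D, E, F] i) := rfl

theorem modelAdj_iff {k : Fin 4} {b e : Bool} {u v : Fin 6} {j : Fin 4} :
    modelAdj k b e u v j = true ↔ modelOn k b e j u = true ∧ modelOn k b e j v = true ∧
      modelHeight k u < modelHeight k v ∧ ∀ w, modelOn k b e j w = true →
        modelHeight k u < modelHeight k w → modelHeight k v ≤ modelHeight k w := by
  simp only [modelAdj, Bool.and_eq_true, decide_eq_true_iff, and_assoc]

/-- Edges of the model and of the Reeb graph are both counted by the arcs on which the two vertices
are consecutive. The ends of the four arcs are the images of `C`, `F`, `D` and `A`, as the general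
result on arc systems requires. -/
theorem IsTriangleWithHole.nonempty_edge_equiv (h : P.IsTriangleWithHole A B C D E F) {k : Fin 4}
    (hk : IsMiddlePosition B D E F k) {b e : Bool} (hb : b = true ↔ MiddleOnRight A B C)
    (he : e = true ↔ MiddleOnRight D E F) (u v : Fin 6) :
    Nonempty ((model k b e).Edge u v ≃ P.reebGraph.Edge (h.vertexEquiv u) (h.vertexEquiv v)) := by
  have H := h.isHoled
  have hht : ∀ i, P.reebHeight (h.vertexEquiv i).1 = (![A, B, C, D, E, F] i : ℝ × ℝ).2 := fun i =>
    P.reebHeight_reebMk (P.vertex_mem_carrier ⟨_, h.vertex_mem i⟩)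
  have hlt : ∀ i j, modelHeight k i < modelHeight k j ↔
      P.reebHeight (h.vertexEquiv i).1 < P.reebHeight (h.vertexEquiv j).1 := fun i j => by
    rw [hht, hht]; exact h.modelHeight_lt_iff hk i j
  have hon := h.on_iff hk hb he
  have harc := arcSystem_hole H
  have hle : ∀ i j, modelHeight k i ≤ modelHeight k j ↔
      P.reebHeight (h.vertexEquiv i).1 ≤ P.reebHeight (h.vertexEquiv j).1 := fun i j => by
    rw [← not_lt, ← not_lt, hlt]
  have hend : ∀ (j : Fin 4) (i : Fin 6) (y : ℝ), (![A, B, C, D, E, F] i : ℝ × ℝ).2 = y →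
      modelOn k b e j i = true →
      P.holeArc (triLeft A B C) (triRight A B C) j y ∈ P.reebVertices := by
    rintro j i y rfl hj
    have h2 := ((hon i j).2 hj).2
    rw [← h.vertexEquiv_val, hht] at h2
    rw [h2]
    exact (h.vertexEquiv i).2
  have hlo : ∀ j, P.holeArc (triLeft A B C) (triRight A B C) j (arcLo C.2 F.2 D.2 j) ∈
      P.reebVertices := by
    intro j
    fin_cases j
    exacts [hend 0 2 _ rfl rfl, hend 1 5 _ rfl rfl, hend 2 5 _ rfl rfl, hend 3 3 _ rfl rfl]
  have hhi : ∀ j, P.holeArc (triLeft A B C) (triRight A B C) j (arcHi A.2 F.2 D.2 j) ∈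
      P.reebVertices := by
    intro j
    fin_cases j
    exacts [hend 0 5 _ rfl rfl, hend 1 3 _ rfl rfl, hend 2 3 _ rfl rfl, hend 3 0 _ rfl rfl]
  have hfin : P.reebVertices.Finite := Set.finite_coe_iff.1 (Finite.of_equiv _ h.vertexEquiv)
  obtain ⟨eq⟩ := harc.nonempty_edgeEquiv hfin hlo hhi (h.vertexEquiv u).2 (h.vertexEquiv v).2
  refine ⟨(Equiv.subtypeEquivRight fun j => ?_).trans eq.symm⟩
  rw [modelAdj_iff, ← hon, ← hon, hlt]
  refine and_congr_right fun _ => and_congr_right fun _ => and_congr_right fun _ => ?_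
  constructor
  · intro hw q hq hj hq'
    obtain ⟨i, hi⟩ := h.vertexEquiv.surjective ⟨q, hq⟩
    have hi' : (h.vertexEquiv i).1 = q := congrArg Subtype.val hi
    subst hi'
    exact (hle v i).1 (hw i ((hon i j).1 hj) ((hlt u i).2 hq'))
  · intro hw i hj hi
    exact (hle v i).2 (hw _ (h.vertexEquiv i).2 ((hon i j).2 hj) ((hlt u i).1 hi))

/-- The marked Reeb graph of a triangle with a hole is the corresponding model. -/
theorem IsTriangleWithHole.model_iso (h : P.IsTriangleWithHole A B C D E F) {k : Fin 4}
    (hk : IsMiddlePosition B D E F k) {b e : Bool} (hb : b = true ↔ MiddleOnRight A B C)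
    (he : e = true ↔ MiddleOnRight D E F) : (model k b e).Iso P.markedReebGraph := by
  refine ⟨h.vertexEquiv, h.nonempty_edge_equiv hk hb he, fun (v : Fin 6) hv => ?_⟩
  have H := h.isHoled
  obtain ⟨h1, h2, h3⟩ := hole_heights h.isHoled
  obtain ⟨h4, h5⟩ := h.2.1
  obtain ⟨h6, h7⟩ := h.2.2.1
  rw [middleOnRight_iff (h5.trans h4)] at hb
  rw [middleOnRight_iff (h7.trans h6)] at he
  have hL := markedReebGraph_isLeft_iff (h.vertex_mem v) (u := h.vertexEquiv v) rfl
  refine Iff.trans ?_ hL.symm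
  rcases (degree_model_eq_two k b e v).1 hv with rfl | rfl
  · have hm : (model k b e).isLeft (1 : Fin 6) ↔ b = false := by rw [model_isLeft]; simp
    refine hm.trans ?_
    change b = false ↔ ∀ᶠ t in 𝓝[>] (0 : ℝ), (B.1 + t, B.2) ∈ P.carrier
    rw [← Bool.not_eq_true, hb]
    rcases lt_or_gt_of_ne h.offset_ne with h0 | h0
    · rw [← triLeft_middle h4 h5 h0]
      exact iff_of_true h0.not_gt (eventually_left_ray H h5 h4)
    · rw [← triRight_middle h4 h5 h0]
      exact iff_of_false (not_not.2 h0) (not_eventually_right_ray H)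
  · have hm : (model k b e).isLeft (4 : Fin 6) ↔ e = true := by rw [model_isLeft]; simp
    refine hm.trans ?_
    change e = true ↔ ∀ᶠ t in 𝓝[>] (0 : ℝ), (E.1 + t, E.2) ∈ P.carrier
    rw [he]
    rcases lt_or_gt_of_ne h.offset_ne' with h0 | h0
    · rw [← triLeft_middle h6 h7 h0]
      exact iff_of_false h0.not_gt (not_eventually_hole_left_ray H h7 h6)
    · rw [← triRight_middle h6 h7 h0]
      exact iff_of_true h0 (eventually_hole_right_ray H h7 h6)

theorem IsTriangleWithHole.exists_model_iso (h : P.IsTriangleWithHole A B C D E F) :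
    ∃ k b e, (model k b e).Iso P.markedReebGraph := by
  classical
  obtain ⟨k, hk⟩ := h.exists_isMiddlePosition
  exact ⟨k, decide (MiddleOnRight A B C), decide (MiddleOnRight D E F),
    h.model_iso hk decide_eq_true_iff decide_eq_true_iff⟩

theorem ncard_below_eq {k : Fin 4} (hDE : E.2 < D.2) (hEF : F.2 < E.2)
    (hk : IsMiddlePosition B D E F k) :
    {X : ℝ × ℝ | X ∈ ({D, E, F} : Set (ℝ × ℝ)) ∧ X.2 < B.2}.ncard = k := by
  have hne : D ≠ E ∧ D ≠ F ∧ E ≠ F := by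
    refine ⟨?_, ?_, ?_⟩ <;> rintro rfl <;> linarith
  have key : ∀ T : Set (ℝ × ℝ), (∀ X, X ∈ T ↔ (X = D ∨ X = E ∨ X = F) ∧ X.2 < B.2) →
      {X : ℝ × ℝ | X ∈ ({D, E, F} : Set (ℝ × ℝ)) ∧ X.2 < B.2} = T := by
    intro T hT
    ext X
    rw [hT]
    rfl
  rcases hk with ⟨rfl, hk⟩ | ⟨rfl, hk, hk'⟩ | ⟨rfl, hk, hk'⟩ | ⟨rfl, hk⟩
  · rw [key ∅]
    · simp
    · intro X
      refine iff_of_false (fun h => h) ?_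
      rintro ⟨rfl | rfl | rfl, h⟩ <;> linarith
  · rw [key {F}]
    · simp
    · intro X
      constructor
      · rintro rfl
        exact ⟨Or.inr (Or.inr rfl), hk⟩
      · rintro ⟨rfl | rfl | rfl, h⟩
        exacts [absurd h (by linarith), absurd h (by linarith), rfl]
  · rw [key {E, F}]
    · rw [Set.ncard_pair hne.2.2]; rfl
    · intro X
      constructor
      · rintro (rfl | rfl)
        exacts [⟨Or.inr (Or.inl rfl), hk⟩, ⟨Or.inr (Or.inr rfl), by linarith⟩]
      · rintro ⟨rfl | rfl | rfl, h⟩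
        exacts [absurd h (by linarith), Or.inl rfl, Or.inr rfl]
  · rw [key {D, E, F}]
    · rw [Set.ncard_eq_three.2 ⟨D, E, F, hne.1, hne.2.1, hne.2.2, rfl⟩]; rfl
    · intro X
      constructor
      · rintro (rfl | rfl | rfl)
        exacts [⟨Or.inl rfl, hk⟩, ⟨Or.inr (Or.inl rfl), by linarith⟩,
          ⟨Or.inr (Or.inr rfl), by linarith⟩]
      · exact fun h => h.1

theorem HasCase.exists_model_iso {k : ℕ} {s : Bool} (h : P.HasCase k s) :
    ∃ i : Fin 4, (i : ℕ) = k ∧ (model i true s).Iso P.markedReebGraph := by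
  obtain ⟨A, B, C, D, E, F, h, hB, hcard, hs⟩ := h
  obtain ⟨i, hi⟩ := h.exists_isMiddlePosition
  exact ⟨i, (ncard_below_eq h.2.2.1.1 h.2.2.1.2 hi).symm.trans hcard,
    h.model_iso hi (iff_of_true rfl hB) hs⟩

end PlanarPolygon

/-! ### Counting the classes -/

namespace PlanarPolygon

variable {P : PlanarPolygon}

theorem isNConnected_two_and_isOptimal_iff : (P.IsNConnected 2 ∧ P.IsOptimal) ↔
    ∃ A B C D E F : ℝ × ℝ, P.IsTriangleWithHole A B C D E F := by
  constructor
  · rintro ⟨h, hopt⟩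
    -- Any member of the family of examples serves as the competitor with six vertices.
    obtain ⟨Q, hQ⟩ := exists_example (b := 1) (x := 11) (by norm_num) (by norm_num) (by norm_num)
      (by norm_num)
    exact h.exists_isTriangleWithHole hopt hQ.isNConnected hQ.card_le
  · rintro ⟨A, B, C, D, E, F, h⟩
    exact ⟨h.isNConnected, h.isOptimal⟩

theorem middleOnRight_example {x : ℝ} : MiddleOnRight (10, 3) (x, 0) (10, -3) ↔ 10 < x := by
  rw [middleOnRight_iff (by norm_num)]
  simp [triOffset, lineX]

theorem middleOnRight_example' {b : ℝ} : MiddleOnRight (0, 100) (100, b) (0, -100) := by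
  rw [middleOnRight_iff (by norm_num)]
  simp [triOffset, lineX]

theorem exists_model_iso (k : Fin 4) (s : Bool) : ∃ P : PlanarPolygon,
    (P.IsNConnected 2 ∧ P.IsOptimal) ∧ P.HasCase k s ∧ (model k true s).Iso P.markedReebGraph := by
  -- The vertices of the hole have heights `3`, `0`, `-3`, and `b` is put into the gap prescribed by
  -- `k`. Below, `x` is chosen on one side of the abscissa `10` of the long side of the hole.
  obtain ⟨b, hb, hb', hk⟩ : ∃ b : ℝ, (-5 < b ∧ b < 5) ∧ (b ≠ 3 ∧ b ≠ 0 ∧ b ≠ -3) ∧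
      ∀ x : ℝ, IsMiddlePosition (100, b) (10, 3) (x, 0) (10, -3) k := by
    have hk : ∀ k : Fin 4, k = 0 ∨ k = 1 ∨ k = 2 ∨ k = 3 := by decide
    rcases hk k with rfl | rfl | rfl | rfl
    · exact ⟨-4, by norm_num, by norm_num, fun x => Or.inl (by norm_num)⟩
    · exact ⟨-1, by norm_num, by norm_num, fun x => Or.inr (Or.inl (by norm_num))⟩
    · exact ⟨1, by norm_num, by norm_num, fun x => Or.inr (Or.inr (Or.inl (by norm_num)))⟩
    · exact ⟨4, by norm_num, by norm_num, fun x => Or.inr (Or.inr (Or.inr (by norm_num)))⟩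
  obtain ⟨x, hx, hx', hs⟩ : ∃ x : ℝ, (0 < x ∧ x < 20) ∧ x ≠ 10 ∧ (s = true ↔ 10 < x) := by
    cases s
    · exact ⟨9, by norm_num, by norm_num, by norm_num⟩
    · exact ⟨11, by norm_num, by norm_num, by norm_num⟩
  rw [← middleOnRight_example] at hs
  obtain ⟨P, h⟩ := exists_example hb hb' hx hx'
  exact ⟨P, ⟨h.isNConnected, h.isOptimal⟩,
    ⟨_, _, _, _, _, _, h, middleOnRight_example', ncard_below_eq h.2.2.1.1 h.2.2.1.2 (hk x), hs⟩,
    h.model_iso (hk x) (iff_of_true rfl middleOnRight_example') hs⟩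

theorem image_reebGraph_eq :
    (fun P : PlanarPolygon => Quotient.mk OrientedGraph.isoSetoid P.reebGraph) ''
      {P | P.IsNConnected 2 ∧ P.IsOptimal} =
        Set.range fun i => Quotient.mk OrientedGraph.isoSetoid (orientedModel i) := by
  apply Set.Subset.antisymm
  · rintro _ ⟨P, hP, rfl⟩
    obtain ⟨A, B, C, D, E, F, h⟩ := isNConnected_two_and_isOptimal_iff.1 hP
    obtain ⟨k, b, e, he⟩ := h.exists_model_iso
    obtain ⟨i, hi⟩ := exists_iso_orientedModel k b e
    exact ⟨i, Quotient.sound (hi.symm.trans he.toOriented)⟩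
  · have key : ∀ k s, Quotient.mk OrientedGraph.isoSetoid (model k true s).toOrientedGraph ∈
        (fun P : PlanarPolygon => Quotient.mk OrientedGraph.isoSetoid P.reebGraph) ''
          {P | P.IsNConnected 2 ∧ P.IsOptimal} := by
      intro k s
      obtain ⟨P, hP, -, hi⟩ := PlanarPolygon.exists_model_iso k s
      exact ⟨P, hP, Quotient.sound hi.toOriented.symm⟩
    rintro _ ⟨i, rfl⟩
    fin_cases i
    exacts [key 0 true, key 2 false, key 2 true, key 3 true]

theorem ncard_image_reebGraph :
    ((fun P : PlanarPolygon => Quotient.mk OrientedGraph.isoSetoid P.reebGraph) ''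
      {P | P.IsNConnected 2 ∧ P.IsOptimal}).ncard = 4 := by
  rw [image_reebGraph_eq, ← Set.image_univ, Set.ncard_image_of_injective _ fun i j h =>
    orientedModel_iso_iff.1 (Quotient.exact h), Set.ncard_univ, Nat.card_eq_fintype_card,
    Fintype.card_fin]

/-- The parameter `k` of the two positions that have to be distinguished. -/
def modelIndex (t : Bool) : Fin 4 := if t then 3 else 2

theorem modelIndex_eq (t : Bool) : modelIndex t = 2 ∨ modelIndex t = 3 := by
  decide +revert

theorem exists_modelIndex_eq {k : Fin 4} (hk : k = 2 ∨ k = 3) : ∃ t, modelIndex t = k := by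
  decide +revert

theorem modelIndex_injective : Function.Injective modelIndex := by
  decide

theorem image_markedReebGraph_eq :
    (fun P : PlanarPolygon => Quotient.mk MarkedGraph.similarSetoid P.markedReebGraph) ''
      {P | P.IsNConnected 2 ∧ P.IsOptimal} = Set.range fun p : Bool × Bool =>
        Quotient.mk MarkedGraph.similarSetoid (model (modelIndex p.1) true p.2) := by
  apply Set.Subset.antisymm
  · rintro _ ⟨P, hP, rfl⟩
    obtain ⟨A, B, C, D, E, F, h⟩ := isNConnected_two_and_isOptimal_iff.1 hP
    obtain ⟨k, b, e, he⟩ := h.exists_model_iso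
    obtain ⟨k', hk', e', hs⟩ := exists_similar_model k b e
    obtain ⟨t, rfl⟩ := exists_modelIndex_eq hk'
    exact ⟨(t, e'), Quotient.sound (hs.symm.trans (Or.inl he))⟩
  · rintro _ ⟨p, rfl⟩
    obtain ⟨P, hP, -, hi⟩ := PlanarPolygon.exists_model_iso (modelIndex p.1) p.2
    exact ⟨P, hP, Quotient.sound (Or.inl hi.symm)⟩

theorem ncard_image_markedReebGraph :
    ((fun P : PlanarPolygon => Quotient.mk MarkedGraph.similarSetoid P.markedReebGraph) ''
      {P | P.IsNConnected 2 ∧ P.IsOptimal}).ncard = 4 := by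
  rw [image_markedReebGraph_eq, ← Set.image_univ, Set.ncard_image_of_injective, Set.ncard_univ,
    Nat.card_eq_fintype_card, Fintype.card_prod, Fintype.card_bool]
  intro p q h
  obtain ⟨h1, h2⟩ := (similar_model_iff (modelIndex_eq _) (modelIndex_eq _)).1 (Quotient.exact h)
  exact Prod.ext (modelIndex_injective h1) h2

theorem exists_similar_hasCase (h : P.IsNConnected 2) (hopt : P.IsOptimal) :
    ∃ Q : PlanarPolygon, ∃ k ∈ ({2, 3} : Set ℕ), ∃ s : Bool,
      Q.HasCase k s ∧ P.markedReebGraph.Similar Q.markedReebGraph := by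
  obtain ⟨A, B, C, D, E, F, h⟩ := isNConnected_two_and_isOptimal_iff.1 ⟨h, hopt⟩
  obtain ⟨k, b, e, he⟩ := h.exists_model_iso
  obtain ⟨k', hk', e', hs⟩ := exists_similar_model k b e
  obtain ⟨Q, -, hQ, hi⟩ := PlanarPolygon.exists_model_iso k' e'
  refine ⟨Q, k', ?_, e', hQ,
    (MarkedGraph.Similar.trans (Or.inl he.symm) hs).trans (Or.inl hi)⟩
  rcases hk' with rfl | rfl
  exacts [Or.inl rfl, Or.inr rfl]

theorem HasCase.similar_iff {Q : PlanarPolygon} {k k' : ℕ} (hk : k ∈ ({2, 3} : Set ℕ))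
    (hk' : k' ∈ ({2, 3} : Set ℕ)) {s s' : Bool} (h : P.HasCase k s) (h' : Q.HasCase k' s') :
    P.markedReebGraph.Similar Q.markedReebGraph ↔ k = k' ∧ s = s' := by
  obtain ⟨i, rfl, hi⟩ := h.exists_model_iso
  obtain ⟨j, rfl, hj⟩ := h'.exists_model_iso
  have key : ∀ i : Fin 4, (i : ℕ) ∈ ({2, 3} : Set ℕ) → i = 2 ∨ i = 3 := by
    intro i hi
    rcases hi with hi | hi
    exacts [Or.inl (Fin.ext hi), Or.inr (Fin.ext hi)]
  rw [← Fin.ext_iff, ← similar_model_iff (key i hk) (key j hk')]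
  constructor
  · intro hs
    exact (MarkedGraph.Similar.trans (Or.inl hi) hs).trans (Or.inl hj.symm)
  · intro hs
    exact (MarkedGraph.Similar.trans (Or.inl hi.symm) hs).trans (Or.inl hj)

end PlanarPolygon
end Development

theorem theorem3 :
    -- the polygons in question are exactly the triangles with one triangular hole
    (∀ P : PlanarPolygon, (P.IsNConnected 2 ∧ P.IsOptimal) ↔
      ∃ A B C D E F : ℝ × ℝ, P.IsTriangleWithHole A B C D E F) ∧
    -- up to isomorphism of oriented graphs there are exactly four Reeb graphs
    ((fun P : PlanarPolygon => Quotient.mk OrientedGraph.isoSetoid P.reebGraph) ''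
      {P | P.IsNConnected 2 ∧ P.IsOptimal}).ncard = 4 ∧
    -- with left and right vertices distinguished, and up to the two reflections, also four
    ((fun P : PlanarPolygon => Quotient.mk MarkedGraph.similarSetoid P.markedReebGraph) ''
      {P | P.IsNConnected 2 ∧ P.IsOptimal}).ncard = 4 ∧
    -- these four are given by the four cases
    (∀ P : PlanarPolygon, P.IsNConnected 2 → P.IsOptimal →
      ∃ Q : PlanarPolygon, ∃ k ∈ ({2, 3} : Set ℕ), ∃ s : Bool,
        Q.HasCase k s ∧ P.markedReebGraph.Similar Q.markedReebGraph) ∧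
    (∀ k ∈ ({2, 3} : Set ℕ), ∀ s : Bool, ∃ Q : PlanarPolygon, Q.HasCase k s) ∧
    (∀ Q Q' : PlanarPolygon, ∀ k ∈ ({2, 3} : Set ℕ), ∀ k' ∈ ({2, 3} : Set ℕ), ∀ s s' : Bool,
      Q.HasCase k s → Q'.HasCase k' s' →
        (Q.markedReebGraph.Similar Q'.markedReebGraph ↔ k = k' ∧ s = s')) := by
  refine ⟨fun P => PlanarPolygon.isNConnected_two_and_isOptimal_iff,
    PlanarPolygon.ncard_image_reebGraph, PlanarPolygon.ncard_image_markedReebGraph,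
    fun P => PlanarPolygon.exists_similar_hasCase, fun k hk s => ?_,
    fun Q Q' k hk k' hk' s s' => PlanarPolygon.HasCase.similar_iff hk hk'⟩
  rcases hk with rfl | rfl
  · obtain ⟨Q, -, hQ, -⟩ := PlanarPolygon.exists_model_iso 2 s
    exact ⟨Q, hQ⟩
  · obtain ⟨Q, -, hQ, -⟩ := PlanarPolygon.exists_model_iso 3 s
    exact ⟨Q, hQ⟩
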